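/- **Setting.** Let $p\ge 4$ be an integer, let $N\in\{p+1,p+2,\dots\}\cup\{\infty\}$, let $\hat\mu\in\mathbb R$, and let $(f_{1,\varepsilon})_{\varepsilon\in\mathbb R}$ be functions in $C^{N}(\mathbb R)$ with $\lim_{s\to0}f_{1,\varepsilon}(s)/|s|^p=0$ for each $\varepsilon$, whose derivatives of order $p+1$ are bounded on bounded sets uniformly in $\varepsilon$ (for instance a single function $f_1$ independent of $\varepsilon$). Consider $$f=f_\varepsilon:\quad f(u)=u^2+\hat\mu|\varepsilon|^{\frac1{p-2}}u^3+\varepsilon u^p+|\varepsilon|^{1+\frac1{p-2}}f_{1,\varepsilon}(u)\quad(m=2),$$ $$f(u)=u^3+\varepsilon u^p+|\varepsilon|^{1+\frac1{p-3}}f_{1,\varepsilon}(u)\quad(m=3).$$ Let $\mathcal Y$ be the set of $g\in C^N(\mathbb R)$ such that for every integer $0\le j\le N$ there are $K_j$ and $r_j>0$ with $|g^{(j)}(x)|\le K_j(1+|x|)^{r_j}e^{-|x|}$ for all $x$ (for $N=\infty$: the $C^\infty$ functions with such bounds for all $j$), and let $\mathcal Y'$ be the same class with $N-1$ in place of $N$.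 Let $Q=Q_\varepsilon$ denote the positive even $H^1(\mathbb R)$ solution of $Q''+f(Q)=Q$, and put $\varphi=-Q'/Q$, $\mathcal Lw=-w''+w-f'(Q)w$. For functions $F,G$, a triple $(A,B,a)$ with $a\in\mathbb R$ solves the system with source $(F,G)$ if $$(\mathcal LA)'+a(3Q-2f(Q))'=F,\qquad(\mathcal LB)'+3aQ''-3A''-f'(Q)A=G .$$ It has limits $(\gamma,b)$ if $A$ is even, $B$ is odd, $A-\gamma\in\mathcal Y$, $B-b\varphi\in\mathcal Y$, $\lim_{+\infty}A=\gamma$ and $\lim_{+\infty}B=b$. Let $(A_{1,0},B_{1,0},a_{1,0})$ be the solution with source $F_{1,0}=(f'(Q))'$, $G_{1,0}=f'(Q)$, with limits $(0,b_{1,0})$ and with $\int_{\mathbb R}Q'B_{1,0}=0$. The system $(\Omega_{2,0})$ is the system with the following source, where $A=A_{1,0}$, $B=B_{1,0}$, $a=a_{1,0}$. For $m=2$: $$F_{2,0}=-(3A'+3B''+f'(Q)B)+\tfrac12\big(f''(Q)(2A+A^2)\big)'-a\big(3A''-Q+f'(Q)(1+A)\big)'+3a^2Q^{(3)}+\tfrac12(f''(Q)-2)',$$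 $$G_{2,0}=\tfrac12(f''(Q)-2)-(A+3B')+\tfrac12f''(Q)(2A+A^2)+\tfrac32a^2Q''-\tfrac12a\big(9A'+3B''+f'(Q)B\big)'+\tfrac12\big(f''(Q)(B+AB)\big)'.$$ For $m=3$: $$F_{2,0}=\big(\tfrac12f''(Q)(1+A)^2\big)'+3a^2Q^{(3)}-a\big(f'(Q)+3A''+f'(Q)A\big)',$$ $$G_{2,0}=\tfrac12f''(Q)(1+A)^2+\tfrac32a^2Q''-\tfrac12a\big(9A'+3B''+f'(Q)B\big)'+\tfrac12\big(f''(Q)(1+A)B\big)'.$$ **Proposition (resolution of $(\Omega_{2,0})$; nonzero defect).** For each of $m=2$ and $m=3$ there is $\varepsilon_0>0$ such that for all $0<|\varepsilon|<\varepsilon_0$ the soliton $Q_\varepsilon$ and the normalized first order solution $(A_{1,0},B_{1,0},a_{1,0})$, with limits $(0,b_{1,0})$, exist, and $(\Omega_{2,0})$ has a solution $(A_{2,0},B_{2,0},a_{2,0})$ with limits $(\gamma_{2,0},b_{2,0})$, where $\gamma_{2,0}=-\frac12b_{1,0}^2$ if $m=2$ and $\gamma_{2,0}=0$ if $m=3$,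 and with $A_{2,0}',B_{2,0}'\in\mathcal Y'$. For these solutions the defect $$d(\varepsilon)=b_{2,0}+\tfrac16b_{1,0}^3\quad(m=2),\qquad d(\varepsilon)=b_{2,0}\quad(m=3)$$ satisfies $d(\varepsilon)=c_{m,p}\,\varepsilon+o(\varepsilon)$ as $\varepsilon\to0$, where $$c_{2,p}=-\frac{(p-3)(2p-1)(24-23p+3p^2+2p^3)}{36(p^2-1)(p-2)}\int_{\mathbb R}\Big[\frac{3}{2\cosh^2(x/2)}\Big]^p dx,$$ $$c_{3,p}=-\frac{(p-1)(p-3)(p^2-3p+8)}{8(p-2)(p+1)}\int_{\mathbb R}\Big[\frac{\sqrt2}{\cosh x}\Big]^p dx .$$ Both constants are nonzero for every $p\ge4$, and $d(\varepsilon)\ne0$ for $0<|\varepsilon|<\varepsilon_0$. -/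

import Mathlib

open MeasureTheory Filter Topology Asymptotics

noncomputable section

namespace GKdV

/-- The class `𝒴` of localized functions at regularity `N`: functions of class `C^N` all of whose
derivatives of order `j ≤ N` are bounded by `K_j (1 + |x|)^{r_j} e^{-|x|}`.
For `N = ⊤` these are the `C^∞` functions with such bounds on every derivative. -/
def MemY (N : ℕ∞) (g : ℝ → ℝ) : Prop :=
  ContDiff ℝ N g ∧
    ∀ j : ℕ, (j : ℕ∞) ≤ N → ∃ K r : ℝ, 0 < r ∧
      ∀ x : ℝ, |iteratedDeriv j g x| ≤ K * (1 + |x|) ^ r * Real.exp (-|x|)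

/-- The `ε`-dependent nonlinearity with quadratic leading term (`m = 2`):
`f(u) = u² + μ(ε) u³ + ε u^p + |ε|^{1 + 1/(p-2)} f₁(u)`, with `μ(ε) = μ |ε|^{1/(p-2)}`. -/
def nonlin2 (p : ℕ) (μ : ℝ) (f₁ : ℝ → ℝ → ℝ) (ε : ℝ) (u : ℝ) : ℝ :=
  u ^ 2 + μ * |ε| ^ (1 / ((p : ℝ) - 2)) * u ^ 3 + ε * u ^ p
    + |ε| ^ (1 + 1 / ((p : ℝ) - 2)) * f₁ ε u

/-- The `ε`-dependent nonlinearity with cubic leading term (`m = 3`):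
`f(u) = u³ + ε u^p + |ε|^{1 + 1/(p-3)} f₁(u)`. -/
def nonlin3 (p : ℕ) (f₁ : ℝ → ℝ → ℝ) (ε : ℝ) (u : ℝ) : ℝ :=
  u ^ 3 + ε * u ^ p + |ε| ^ (1 + 1 / ((p : ℝ) - 3)) * f₁ ε u

/-- `Q` is the soliton profile of speed `1`: the positive even solution of `Q'' + f(Q) = Q`
in `H¹(ℝ)`. -/
structure IsSoliton (f Q : ℝ → ℝ) : Prop where
  contDiff : ContDiff ℝ 2 Q
  pos : ∀ x, 0 < Q x
  even : ∀ x, Q (-x) = Q x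
  memLp : MemLp Q 2 volume
  memLp_deriv : MemLp (deriv Q) 2 volume
  eq : ∀ x, iteratedDeriv 2 Q x + f (Q x) = Q x

/-- The linearized operator `ℒ w = -w'' + w - f'(Q) w`. -/
def linOp (f Q w : ℝ → ℝ) (x : ℝ) : ℝ :=
  -iteratedDeriv 2 w x + w x - deriv f (Q x) * w x

/-- The resonance function `φ = -Q'/Q`. -/
def resonance (Q : ℝ → ℝ) (x : ℝ) : ℝ := -deriv Q x / Q x

/-- The linear system
`(ℒ A)' + a (3 Q - 2 f(Q))' = F`, `(ℒ B)' + 3 a Q'' - 3 A'' - f'(Q) A = G`. -/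
def SolvesOmega (f Q F G A B : ℝ → ℝ) (a : ℝ) : Prop :=
  (∀ x, deriv (linOp f Q A) x + a * deriv (fun y => 3 * Q y - 2 * f (Q y)) x = F x) ∧
  (∀ x, deriv (linOp f Q B) x + 3 * a * iteratedDeriv 2 Q x - 3 * iteratedDeriv 2 A x
      - deriv f (Q x) * A x = G x)

/-- Parity and limit form of a solution: `A` is even, `B` is odd, `A - γ ∈ 𝒴`, `B - b φ ∈ 𝒴`,
`A → γ` and `B → b` at `+∞`. -/
structure HasLimitForm (N : ℕ∞) (Q A B : ℝ → ℝ) (γ b : ℝ) : Prop where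
  even : ∀ x, A (-x) = A x
  odd : ∀ x, B (-x) = -B x
  memY_A : MemY N (fun x => A x - γ)
  memY_B : MemY N (fun x => B x - b * resonance Q x)
  tendsto_A : Tendsto A atTop (𝓝 γ)
  tendsto_B : Tendsto B atTop (𝓝 b)

/-- The property (IP): every derivative (of order at least one) of `A` and of `B` is localized. -/
def HasIP (N : ℕ∞) (A B : ℝ → ℝ) : Prop :=
  MemY (N - 1) (deriv A) ∧ MemY (N - 1) (deriv B)

/-- The normalized solution `(A, B, a)` of the first order system `(Ω_{1,0})`, whose source terms
are `F = (f'(Q))'` and `G = f'(Q)`: `A ∈ 𝒴` (that is, `γ = 0`) and `∫ Q' B = 0`. -/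
structure IsFirstOrder (N : ℕ∞) (f Q A B : ℝ → ℝ) (a b : ℝ) : Prop where
  solves : SolvesOmega f Q (deriv fun y => deriv f (Q y)) (fun y => deriv f (Q y)) A B a
  form : HasLimitForm N Q A B 0 b
  orthogonal : ∫ x, deriv Q x * B x = 0

/-- The function `9 A' + 3 B'' + f'(Q) B`, common to both second order source terms `G`. -/
def innerG (f Q A B : ℝ → ℝ) (x : ℝ) : ℝ :=
  9 * deriv A x + 3 * iteratedDeriv 2 B x + deriv f (Q x) * B x

/-- The source term `F_{2,0}` for `m = 2`, in terms of `(A, B, a) = (A_{1,0}, B_{1,0}, a_{1,0})`. -/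
def sourceF2 (f Q A B : ℝ → ℝ) (a : ℝ) (x : ℝ) : ℝ :=
  -(3 * deriv A x + 3 * iteratedDeriv 2 B x + deriv f (Q x) * B x)
    + 1 / 2 * deriv (fun y => iteratedDeriv 2 f (Q y) * (2 * A y + A y ^ 2)) x
    - a * deriv (fun y => 3 * iteratedDeriv 2 A y - Q y + deriv f (Q y) * (1 + A y)) x
    + 3 * a ^ 2 * iteratedDeriv 3 Q x
    + 1 / 2 * deriv (fun y => iteratedDeriv 2 f (Q y) - 2) x

/-- The source term `G_{2,0}` for `m = 2`. -/
def sourceG2 (f Q A B : ℝ → ℝ) (a : ℝ) (x : ℝ) : ℝ :=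
  1 / 2 * (iteratedDeriv 2 f (Q x) - 2) - (A x + 3 * deriv B x)
    + 1 / 2 * iteratedDeriv 2 f (Q x) * (2 * A x + A x ^ 2)
    + 3 / 2 * a ^ 2 * iteratedDeriv 2 Q x
    - 1 / 2 * a * deriv (innerG f Q A B) x
    + 1 / 2 * deriv (fun y => iteratedDeriv 2 f (Q y) * (B y + A y * B y)) x

/-- The source term `F_{2,0}` for `m = 3`. -/
def sourceF3 (f Q A : ℝ → ℝ) (a : ℝ) (x : ℝ) : ℝ :=
  deriv (fun y => 1 / 2 * iteratedDeriv 2 f (Q y) * (1 + A y) ^ 2) x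
    + 3 * a ^ 2 * iteratedDeriv 3 Q x
    - a * deriv (fun y => deriv f (Q y) + 3 * iteratedDeriv 2 A y + deriv f (Q y) * A y) x

/-- The source term `G_{2,0}` for `m = 3`. -/
def sourceG3 (f Q A B : ℝ → ℝ) (a : ℝ) (x : ℝ) : ℝ :=
  1 / 2 * iteratedDeriv 2 f (Q x) * (1 + A x) ^ 2
    + 3 / 2 * a ^ 2 * iteratedDeriv 2 Q x
    - 1 / 2 * a * deriv (innerG f Q A B) x
    + 1 / 2 * deriv (fun y => iteratedDeriv 2 f (Q y) * (1 + A y) * B y) x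

/-- The constant `c_{2,p}`. -/
def c2 (p : ℕ) : ℝ :=
  -(((p : ℝ) - 3) * (2 * p - 1) * (24 - 23 * p + 3 * (p : ℝ) ^ 2 + 2 * (p : ℝ) ^ 3)
      / (36 * ((p : ℝ) ^ 2 - 1) * (p - 2)))
    * ∫ x : ℝ, (3 / (2 * Real.cosh (x / 2) ^ 2)) ^ p

/-- The constant `c_{3,p}`. -/
def c3 (p : ℕ) : ℝ :=
  -(((p : ℝ) - 1) * (p - 3) * ((p : ℝ) ^ 2 - 3 * p + 8) / (8 * ((p : ℝ) - 2) * (p + 1)))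
    * ∫ x : ℝ, (√2 / Real.cosh x) ^ p

end GKdV

end

/-! Everything about the soliton is read off φ = -Q'/Q, which satisfies φ' = φ² - 1 + f(Q)/Q and the
energy identity 1 - φ² = 2F(Q)/Q², where F' = f and F(0) = 0. All bounds on a soliton go through one
constant C (`Profile`), so they are uniform in ε as soon as C is.

Resolution. The kernel of ℒ among localized functions is spanned by the odd function Q', so ℒ w = h
is solvable for even localized h, and for odd localized h orthogonal to Q'
(`Profile.exists_solution`). Integrating both equations of the system once gives ℒA = H + γ - a(3Q -
2f(Q)) and an equation for ℒB. Orthogonality of the right-hand side of the latter to Q' is one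
scalar linear equation for a. Its leading coefficient is ∫ (Q² + Q'² + W(3Q - 2f(Q))) with ℒW = -(3Q
- 2f(Q)), which is bounded below for small ε because W is nearly a combination of Q and xQ'
(`Family.exists_solvability`, `Profile.exists_omegaSol`).

Limit of the second order solution. Testing the second order system against the first order solution
eliminates every second order unknown except b₂. After further integrations by parts, 2(b₂ - e b₁) +
e b₁³, where f''(0) = 2e, is the integral of an expression in the first order data only
(`hasInt_of_omega`, `hasInt_reduction`, `Profile.exists_second`). The cases m = 2 and m = 3 are e =
1 and e = 0.

Expansion. Write f = κu² + νu³ + εg with g close to u^p. For ε = 0 one has A = -(4/3)κQ - νQ² and a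
= 2κ/3, and the defect is zero because its integrand is an exact derivative up to known integrals.
At order ε three devices leave a multiple of ∫ Q^p: terms linear in the correction w of A are
removed by self-adjointness of ℒ against an explicit K whose image ℒK is their coefficient; the
integrals of Q^(p-2) Q^k are reduced to ∫ Q^p by derivatives of φ Q^(p-2) Q^k; and the orthogonality
relation of the first order solution is subtracted. The bookkeeping is `cubic_identity` and
`quadratic_identity`; the rest is O(|ε|(|ε| + |ν| + |δ|)).

Finally ∫ Q^p is compared with the moment of the explicit hyperbolic soliton through recurrences
satisfied by both, so that convergence of the solitons themselves is never needed. The constants are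
nonzero since their polynomial factors are positive for p ≥ 4. -/

namespace GKdV

/-! ### Localized and bounded functions -/

/-- Continuous functions bounded by a polynomial times `e^{-|x|}`. -/
@[fun_prop]
def Dec (g : ℝ → ℝ) : Prop :=
  Continuous g ∧ ∃ (K : ℝ) (n : ℕ), ∀ x, |g x| ≤ K * ((1 + |x|) ^ n * Real.exp (-|x|))

/-- Bounded continuous functions. -/
@[fun_prop]
def Bdd (g : ℝ → ℝ) : Prop := Continuous g ∧ ∃ K : ℝ, ∀ x, |g x| ≤ K

theorem weight_pos (n : ℕ) (x : ℝ) : 0 < (1 + |x|) ^ n * Real.exp (-|x|) := by positivity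

theorem weight_mono {m n : ℕ} (h : m ≤ n) (x : ℝ) :
    (1 + |x|) ^ m * Real.exp (-|x|) ≤ (1 + |x|) ^ n * Real.exp (-|x|) := by
  gcongr
  linarith [abs_nonneg x]

@[fun_prop]
theorem Dec.add {f g : ℝ → ℝ} (hf : Dec f) (hg : Dec g) : Dec fun x => f x + g x := by
  obtain ⟨cf, K, m, hK⟩ := hf
  obtain ⟨cg, L, n, hL⟩ := hg
  have hK0 : 0 ≤ K := by
    have := (abs_nonneg _).trans (hK 0); simpa using this
  have hL0 : 0 ≤ L := by
    have := (abs_nonneg _).trans (hL 0); simpa using this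
  refine ⟨cf.add cg, K + L, max m n, fun x => (abs_add_le _ _).trans ?_⟩
  have h1 := mul_le_mul_of_nonneg_left (weight_mono (le_max_left m n) x) hK0
  have h2 := mul_le_mul_of_nonneg_left (weight_mono (le_max_right m n) x) hL0
  linarith [hK x, hL x]

@[fun_prop]
theorem Dec.mul_bdd {f g : ℝ → ℝ} (hf : Dec f) (hg : Bdd g) : Dec fun x => f x * g x := by
  obtain ⟨cf, K, m, hK⟩ := hf
  obtain ⟨cg, L, hL⟩ := hg
  refine ⟨cf.mul cg, K * L, m, fun x => ?_⟩
  rw [abs_mul]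
  calc |f x| * |g x| ≤ (K * ((1 + |x|) ^ m * Real.exp (-|x|))) * L :=
        mul_le_mul (hK x) (hL x) (abs_nonneg _) ((abs_nonneg _).trans (hK x))
    _ = _ := by ring

@[fun_prop]
theorem Dec.bdd_mul {f g : ℝ → ℝ} (hf : Bdd f) (hg : Dec g) : Dec fun x => f x * g x := by
  simpa [mul_comm] using hg.mul_bdd hf

@[fun_prop]
theorem Bdd.const (c : ℝ) : Bdd fun _ => c := ⟨continuous_const, |c|, fun _ => le_rfl⟩

@[fun_prop]
theorem Bdd.add {f g : ℝ → ℝ} (hf : Bdd f) (hg : Bdd g) : Bdd fun x => f x + g x := by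
  obtain ⟨cf, K, hK⟩ := hf
  obtain ⟨cg, L, hL⟩ := hg
  exact ⟨cf.add cg, K + L, fun x => (abs_add_le _ _).trans (add_le_add (hK x) (hL x))⟩

@[fun_prop]
theorem Bdd.mul {f g : ℝ → ℝ} (hf : Bdd f) (hg : Bdd g) : Bdd fun x => f x * g x := by
  obtain ⟨cf, K, hK⟩ := hf
  obtain ⟨cg, L, hL⟩ := hg
  refine ⟨cf.mul cg, K * L, fun x => ?_⟩
  rw [abs_mul]
  exact mul_le_mul (hK x) (hL x) (abs_nonneg _) ((abs_nonneg _).trans (hK x))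

@[fun_prop]
theorem Bdd.neg {f : ℝ → ℝ} (hf : Bdd f) : Bdd fun x => -f x := by
  simpa using (Bdd.const (-1)).mul hf

@[fun_prop]
theorem Dec.neg {f : ℝ → ℝ} (hf : Dec f) : Dec fun x => -f x := by
  simpa using Dec.bdd_mul (Bdd.const (-1)) hf

@[fun_prop]
theorem Bdd.sub {f g : ℝ → ℝ} (hf : Bdd f) (hg : Bdd g) : Bdd fun x => f x - g x := by
  simpa [sub_eq_add_neg] using hf.add hg.neg

@[fun_prop]
theorem Dec.sub {f g : ℝ → ℝ} (hf : Dec f) (hg : Dec g) : Dec fun x => f x - g x := by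
  simpa [sub_eq_add_neg] using hf.add hg.neg

theorem exp_neg_weight_le (n : ℕ) : ∃ c : ℝ, ∀ x : ℝ, (1 + |x|) ^ n * Real.exp (-|x|) ≤ c := by
  refine ⟨n.factorial * Real.exp 1, fun x => ?_⟩
  have h := Real.pow_div_factorial_le_exp (1 + |x|) (by positivity) n
  rw [div_le_iff₀ (by positivity)] at h
  calc (1 + |x|) ^ n * Real.exp (-|x|) ≤ Real.exp (1 + |x|) * n.factorial * Real.exp (-|x|) := by
        gcongr
    _ = n.factorial * (Real.exp (1 + |x|) * Real.exp (-|x|)) := by ring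
    _ = _ := by rw [← Real.exp_add]; ring_nf

@[fun_prop]
theorem Dec.bdd {f : ℝ → ℝ} (hf : Dec f) : Bdd f := by
  obtain ⟨cf, K, n, hK⟩ := hf
  obtain ⟨c, hc⟩ := exp_neg_weight_le n
  have hK0 : 0 ≤ K := by
    have := (abs_nonneg _).trans (hK 0); simpa using this
  exact ⟨cf, K * c, fun x => (hK x).trans (mul_le_mul_of_nonneg_left (hc x) hK0)⟩

@[fun_prop]
theorem Bdd.pow {f : ℝ → ℝ} (hf : Bdd f) (n : ℕ) : Bdd fun x => f x ^ n := by
  induction n with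
  | zero => simpa using Bdd.const 1
  | succ n ih => simpa [pow_succ] using ih.mul hf

theorem Dec.pow {f : ℝ → ℝ} (hf : Dec f) {n : ℕ} (hn : n ≠ 0) : Dec fun x => f x ^ n := by
  obtain ⟨m, rfl⟩ := Nat.exists_eq_succ_of_ne_zero hn
  simpa [pow_succ] using Dec.bdd_mul (hf.bdd.pow m) hf

@[fun_prop]
theorem Dec.pow_two {f : ℝ → ℝ} (hf : Dec f) : Dec fun x => f x ^ 2 := hf.pow two_ne_zero

@[fun_prop]
theorem Dec.pow_succ {f : ℝ → ℝ} (hf : Dec f) (n : ℕ) : Dec fun x => f x ^ (n + 1) :=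
  hf.pow n.succ_ne_zero

theorem Dec.continuous {f : ℝ → ℝ} (hf : Dec f) : Continuous f := hf.1

theorem Bdd.continuous {f : ℝ → ℝ} (hf : Bdd f) : Continuous f := hf.1

theorem integrable_weight (n : ℕ) : Integrable fun x : ℝ => (1 + |x|) ^ n * Real.exp (-|x|) := by
  have hcont : Continuous fun x : ℝ => (1 + |x|) ^ n * Real.exp (-|x|) := by fun_prop
  have hb : Integrable fun x : ℝ => (1 + ‖x‖) ^ (-(2 : ℝ)) :=
    integrable_one_add_norm (by simp)
  -- Two spare powers of 1 + |x| leave the integrable majorant (1 + |x|)^(-2).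
  obtain ⟨c, hc⟩ := exp_neg_weight_le (n + 2)
  refine (hb.const_mul c).mono' hcont.aestronglyMeasurable (ae_of_all _ fun x => ?_)
  have h1 : (0 : ℝ) < 1 + |x| := by positivity
  rw [Real.norm_eq_abs, abs_of_pos (weight_pos n x), Real.norm_eq_abs,
    Real.rpow_neg h1.le, Real.rpow_two, ← div_eq_mul_inv, le_div_iff₀ (by positivity)]
  refine le_trans (le_of_eq ?_) (hc x)
  ring

theorem Dec.integrable {f : ℝ → ℝ} (hf : Dec f) : Integrable f := by
  obtain ⟨cf, K, n, hK⟩ := hf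
  exact ((integrable_weight n).const_mul K).mono' cf.aestronglyMeasurable (ae_of_all _ hK)

theorem tendsto_weight (n : ℕ) :
    Tendsto (fun x : ℝ => (1 + |x|) ^ n * Real.exp (-|x|)) (cocompact ℝ) (𝓝 0) := by
  obtain ⟨c, hc⟩ := exp_neg_weight_le (n + 1)
  have h1 : Tendsto (fun x : ℝ => 1 + |x|) (cocompact ℝ) atTop :=
    tendsto_atTop_add_const_left _ _ tendsto_norm_cocompact_atTop
  have h2 : Tendsto (fun x : ℝ => c / (1 + |x|)) (cocompact ℝ) (𝓝 0) :=
    tendsto_const_nhds.div_atTop h1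
  refine squeeze_zero (fun x => (weight_pos n x).le) (fun x => ?_) h2
  rw [le_div_iff₀ (by positivity)]
  refine le_trans (le_of_eq ?_) (hc x)
  ring

theorem Dec.tendsto_cocompact {f : ℝ → ℝ} (hf : Dec f) : Tendsto f (cocompact ℝ) (𝓝 0) := by
  obtain ⟨cf, K, n, hK⟩ := hf
  have := (tendsto_weight n).const_mul K
  rw [mul_zero] at this
  exact squeeze_zero_norm hK this

theorem Dec.tendsto_atTop {f : ℝ → ℝ} (hf : Dec f) : Tendsto f atTop (𝓝 0) :=
  hf.tendsto_cocompact.mono_left atTop_le_cocompact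

theorem Dec.tendsto_atBot {f : ℝ → ℝ} (hf : Dec f) : Tendsto f atBot (𝓝 0) :=
  hf.tendsto_cocompact.mono_left atBot_le_cocompact

theorem Dec.integral_deriv_eq_zero {T T' : ℝ → ℝ} (hT : Dec T) (hT' : Dec T')
    (h : ∀ x, HasDerivAt T (T' x) x) : ∫ x, T' x = 0 := by
  simpa using integral_of_hasDerivAt_of_tendsto h hT'.integrable hT.tendsto_atBot hT.tendsto_atTop

/-- Oddness makes the limit at -∞ equal to -b. This is how the limits b of odd solutions become
integrals, and hence computable. -/
theorem integral_deriv_of_odd {T T' : ℝ → ℝ} {b : ℝ} (hT : ∀ x, T (-x) = -T x) (hT' : Dec T')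
    (hb : Tendsto T atTop (𝓝 b)) (h : ∀ x, HasDerivAt T (T' x) x) : ∫ x, T' x = 2 * b := by
  have hb' : Tendsto T atBot (𝓝 (-b)) := by
    have := (hb.comp tendsto_neg_atBot_atTop).neg
    refine this.congr fun x => ?_
    simp [hT]
  rw [integral_of_hasDerivAt_of_tendsto h hT'.integrable hb' hb]
  ring

/-! ### Tail estimates and primitives -/

/-- A polynomially bounded solution `p` of `p' - p = -(1 + t)^n`. -/
theorem exists_tail_poly (n : ℕ) : ∃ (p p' : ℝ → ℝ) (c : ℝ), 0 ≤ c ∧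
    (∀ t, HasDerivAt p (p' t) t) ∧ (∀ t, p' t - p t = -(1 + t) ^ n) ∧
    ∀ t, 0 ≤ t → 0 ≤ p t ∧ p t ≤ c * (1 + t) ^ n := by
  induction n with
  | zero => exact ⟨fun _ => 1, fun _ => 0, 1, by simp, fun t => hasDerivAt_const _ _, by simp,
      fun t _ => by simp⟩
  | succ n ih =>
    obtain ⟨p, p', c, hc, hd, he, hb⟩ := ih
    -- The function p(t)e^{-t} is the tail integral of (1 + u)^n e^{-u} over u > t; the recursion is
    -- one integration by parts.
    refine ⟨fun t => (1 + t) ^ (n + 1) + (n + 1) * p t,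
      fun t => (n + 1) * (1 + t) ^ n + (n + 1) * p' t, 1 + (n + 1) * c, by positivity,
      fun t => ?_, fun t => ?_, fun t ht => ⟨?_, ?_⟩⟩
    · have h1 : HasDerivAt (fun t : ℝ => (1 + t) ^ (n + 1)) ((n + 1) * (1 + t) ^ n) t := by
        simpa using ((hasDerivAt_id t).const_add 1).fun_pow (n + 1)
      exact h1.add ((hd t).const_mul _)
    · have := he t
      have e : p' t = p t - (1 + t) ^ n := by linarith
      beta_reduce
      rw [e, pow_succ]
      ring
    · have := (hb t ht).1
      positivity
    · have h1 := (hb t ht).2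
      have h2 : (1 + t) ^ n ≤ (1 + t) ^ (n + 1) := pow_le_pow_right₀ (by linarith) n.le_succ
      have h3 : (n + 1) * p t ≤ (n + 1) * (c * (1 + t) ^ (n + 1)) := by
        gcongr
        exact h1.trans (mul_le_mul_of_nonneg_left h2 hc)
      have : (1 + (n + 1) * c) * (1 + t) ^ (n + 1)
          = (1 + t) ^ (n + 1) + (n + 1) * (c * (1 + t) ^ (n + 1)) := by ring
      linarith

/-- Tail estimate: a function tending to `0` is bounded like its derivative. -/
theorem exists_tail_bound (n : ℕ) : ∃ c : ℝ, 0 ≤ c ∧ ∀ (l : ℝ), 1 ≤ l → ∀ (G g : ℝ → ℝ) (K : ℝ),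
    (∀ x, 0 ≤ x → HasDerivAt G (g x) x) →
    (∀ x, 0 ≤ x → |g x| ≤ K * ((1 + x) ^ n * Real.exp (-(l * x)))) →
    Tendsto G atTop (𝓝 0) →
    ∀ x, 0 ≤ x → |G x| ≤ c * K * ((1 + x) ^ n * Real.exp (-(l * x))) := by
  obtain ⟨p, p', c, hc, hd, he, hb⟩ := exists_tail_poly n
  refine ⟨c, hc, fun l hl => ?_⟩
  have hexp : ∀ t, HasDerivAt (fun t => Real.exp (-(l * t))) (Real.exp (-(l * t)) * -l) t := by
    intro t
    have : HasDerivAt (fun t => -(l * t)) (-l) t := by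
      simpa using ((hasDerivAt_id t).const_mul l).fun_neg
    exact this.exp
  have hlim : Tendsto (fun t => p t * Real.exp (-(l * t))) atTop (𝓝 0) := by
    have h0 := ((tendsto_weight n).mono_left atTop_le_cocompact).const_mul c
    rw [mul_zero] at h0
    refine squeeze_zero' ?_ ?_ h0
    · filter_upwards [eventually_ge_atTop 0] with t ht
      have := (hb t ht).1
      positivity
    · filter_upwards [eventually_ge_atTop 0] with t ht
      rw [abs_of_nonneg ht, ← mul_assoc]
      have h1 : Real.exp (-(l * t)) ≤ Real.exp (-t) := by
        apply Real.exp_le_exp.2; nlinarith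
      exact mul_le_mul (hb t ht).2 h1 (Real.exp_pos _).le (by positivity)
  have key : ∀ (G g : ℝ → ℝ) (K : ℝ), (∀ x, 0 ≤ x → HasDerivAt G (g x) x) →
      (∀ x, 0 ≤ x → |g x| ≤ K * ((1 + x) ^ n * Real.exp (-(l * x)))) →
      Tendsto G atTop (𝓝 0) →
      ∀ x, 0 ≤ x → -(c * K * ((1 + x) ^ n * Real.exp (-(l * x)))) ≤ G x := by
    intro G g K hG hg hG0 x hx
    have hK : 0 ≤ K := by
      have := (abs_nonneg _).trans (hg 0 le_rfl); simpa using this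
    -- The derivative is g + K(p' - l p)e^{-lt}, and p' - l p ≤ -(1 + t)^n because l ≥ 1 and p ≥ 0.
    -- Since the sum tends to 0, it is nonnegative.
    have hanti : AntitoneOn (fun t => G t + K * (p t * Real.exp (-(l * t)))) (Set.Ici 0) := by
      have hD : ∀ t, 0 ≤ t → HasDerivAt (fun t => G t + K * (p t * Real.exp (-(l * t))))
          (g t + K * (p' t * Real.exp (-(l * t)) + p t * (Real.exp (-(l * t)) * -l))) t :=
        fun t ht => (hG t ht).add (((hd t).mul (hexp t)).const_mul K)
      refine antitoneOn_of_deriv_nonpos (convex_Ici 0)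
        (fun t ht => (hD t ht).continuousAt.continuousWithinAt)
        (fun t ht => (hD t (by simpa using le_of_lt (by simpa using ht))).differentiableAt.differentiableWithinAt) ?_
      intro t ht
      have ht' : 0 ≤ t := le_of_lt (by simpa using ht)
      rw [(hD t ht').deriv]
      have e : p' t = p t - (1 + t) ^ n := by linarith [he t]
      have h1 := (abs_le.1 (hg t ht')).2
      have h2 : 0 ≤ p t * Real.exp (-(l * t)) * (l - 1) :=
        mul_nonneg (mul_nonneg (hb t ht').1 (Real.exp_pos _).le) (by linarith)
      have h3 := mul_nonneg hK h2
      rw [e]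
      nlinarith
    have hlim' : Tendsto (fun t => G t + K * (p t * Real.exp (-(l * t)))) atTop (𝓝 0) := by
      simpa using hG0.add (hlim.const_mul K)
    have h0 : 0 ≤ G x + K * (p x * Real.exp (-(l * x))) := by
      refine le_of_tendsto hlim' ?_
      filter_upwards [eventually_ge_atTop x] with t ht
      exact hanti hx (hx.trans ht) ht
    have h1 : K * (p x * Real.exp (-(l * x))) ≤ K * (c * (1 + x) ^ n * Real.exp (-(l * x))) := by
      gcongr
      exact (hb x hx).2
    nlinarith
  intro G g K hG hg hG0 x hx
  refine abs_le.2 ⟨key G g K hG hg hG0 x hx, ?_⟩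
  have := key (fun x => -G x) (fun x => -g x) K (fun x hx => (hG x hx).neg)
    (fun x hx => by simpa using hg x hx) (by simpa using hG0.neg) x hx
  linarith

theorem Dec.of_abs_bound_nonneg {G : ℝ → ℝ} (hc : Continuous G) (habs : ∀ x, |G (-x)| = |G x|)
    (K : ℝ) (n : ℕ) (h : ∀ x, 0 ≤ x → |G x| ≤ K * ((1 + x) ^ n * Real.exp (-x))) : Dec G := by
  refine ⟨hc, K, n, fun x => ?_⟩
  rcases le_total 0 x with hx | hx
  · simpa [abs_of_nonneg hx] using h x hx
  · rw [← habs, abs_of_nonpos hx]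
    exact h (-x) (by linarith)

/-- An even or odd function with localized derivative which tends to `0` is localized. -/
theorem Dec.of_deriv {G g : ℝ → ℝ} (habs : ∀ x, |G (-x)| = |G x|)
    (hG : ∀ x, HasDerivAt G (g x) x) (hg : Dec g) (h0 : Tendsto G atTop (𝓝 0)) : Dec G := by
  obtain ⟨-, K, n, hK⟩ := hg
  obtain ⟨c, hc, H⟩ := exists_tail_bound n
  refine Dec.of_abs_bound_nonneg (continuous_iff_continuousAt.2 fun x => (hG x).continuousAt) habs
    (c * K) n fun x hx => ?_
  have := H 1 le_rfl G g K (fun x _ => hG x) (fun x hx => ?_) h0 x hx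
  · simpa using this
  · simpa [abs_of_nonneg hx] using hK x

theorem hasDerivAt_integral {g : ℝ → ℝ} (hg : Continuous g) (x : ℝ) :
    HasDerivAt (fun x => ∫ t in (0 : ℝ)..x, g t) (g x) x :=
  intervalIntegral.integral_hasDerivAt_right (hg.intervalIntegrable _ _)
    (hg.stronglyMeasurableAtFilter _ _) hg.continuousAt

theorem integral_comp_neg_zero (g : ℝ → ℝ) (x : ℝ) :
    ∫ t in (0 : ℝ)..(-x), g t = -∫ t in (0 : ℝ)..x, g (-t) := by
  rw [intervalIntegral.integral_comp_neg, neg_zero, intervalIntegral.integral_symm]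

theorem integral_odd_of_even {g : ℝ → ℝ} (hg : ∀ x, g (-x) = g x) (x : ℝ) :
    ∫ t in (0 : ℝ)..(-x), g t = -∫ t in (0 : ℝ)..x, g t := by
  simp [integral_comp_neg_zero, hg]

theorem integral_even_of_odd {g : ℝ → ℝ} (hg : ∀ x, g (-x) = -g x) (x : ℝ) :
    ∫ t in (0 : ℝ)..(-x), g t = ∫ t in (0 : ℝ)..x, g t := by
  simp [integral_comp_neg_zero, hg]

theorem Dec.tendsto_integral {g : ℝ → ℝ} (hg : Dec g) :
    Tendsto (fun x => ∫ t in (0 : ℝ)..x, g t) atTop (𝓝 (∫ t in Set.Ioi 0, g t)) :=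
  intervalIntegral_tendsto_integral_Ioi 0 hg.integrable.integrableOn tendsto_id

/-- The localized primitive of an odd localized function. -/
theorem Dec.exists_primitive {g : ℝ → ℝ} (hg : Dec g) (hodd : ∀ x, g (-x) = -g x) :
    ∃ G : ℝ → ℝ, (∀ x, HasDerivAt G (g x) x) ∧ (∀ x, G (-x) = G x) ∧ Dec G := by
  have hd : ∀ x, HasDerivAt (fun x => (∫ t in (0 : ℝ)..x, g t) - ∫ t in Set.Ioi 0, g t) (g x) x :=
    fun x => (hasDerivAt_integral hg.continuous x).sub_const _
  have hev : ∀ x, (fun x => (∫ t in (0 : ℝ)..x, g t) - ∫ t in Set.Ioi 0, g t) (-x)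
      = (fun x => (∫ t in (0 : ℝ)..x, g t) - ∫ t in Set.Ioi 0, g t) x := fun x => by
    simp [integral_even_of_odd hodd]
  refine ⟨_, hd, hev, Dec.of_deriv (fun x => congrArg _ (hev x)) hd hg ?_⟩
  simpa using hg.tendsto_integral.sub_const (∫ t in Set.Ioi 0, g t)

theorem continuous_of_hasDerivAt {G g : ℝ → ℝ} (h : ∀ x, HasDerivAt G (g x) x) : Continuous G :=
  continuous_iff_continuousAt.2 fun x => (h x).continuousAt

/-- The odd primitive of an even localized function. -/
theorem Dec.exists_odd_primitive {g : ℝ → ℝ} (hg : Dec g) (heven : ∀ x, g (-x) = g x) :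
    ∃ (G : ℝ → ℝ) (b : ℝ), (∀ x, HasDerivAt G (g x) x) ∧ (∀ x, G (-x) = -G x) ∧ Bdd G ∧
      Tendsto G atTop (𝓝 b) := by
  have hd := hasDerivAt_integral hg.continuous
  refine ⟨_, _, hd, integral_odd_of_even heven, ⟨continuous_of_hasDerivAt hd, ∫ t, |g t|, fun x => ?_⟩,
    hg.tendsto_integral⟩
  have h1 : |∫ t in (0 : ℝ)..x, g t| ≤ ∫ t in Set.uIoc 0 x, |g t| := by
    simpa only [Real.norm_eq_abs] using
      intervalIntegral.norm_integral_le_integral_norm_uIoc (f := g) (a := 0) (b := x) (μ := volume)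
  exact h1.trans (setIntegral_le_integral hg.integrable.abs (ae_of_all _ fun _ => abs_nonneg _))

/-! ### Classes with finitely many controlled derivatives -/

/-- Functions whose derivatives of order at most `k` satisfy `P`. -/
def Reg (P : (ℝ → ℝ) → Prop) : ℕ → (ℝ → ℝ) → Prop
  | 0, g => P g
  | k + 1, g => P g ∧ Differentiable ℝ g ∧ Reg P k (deriv g)

theorem Reg.zero {P : (ℝ → ℝ) → Prop} {k : ℕ} {g : ℝ → ℝ} (h : Reg P k g) : P g := by
  cases k with
  | zero => exact h
  | succ k => exact h.1

theorem Reg.mono_left {P S : (ℝ → ℝ) → Prop} (hPS : ∀ g, P g → S g) {k : ℕ} {g : ℝ → ℝ}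
    (h : Reg P k g) : Reg S k g := by
  induction k generalizing g with
  | zero => exact hPS g h
  | succ k ih => exact ⟨hPS g h.1, h.2.1, ih h.2.2⟩

theorem Reg.pred {P : (ℝ → ℝ) → Prop} {k : ℕ} {g : ℝ → ℝ} (h : Reg P (k + 1) g) : Reg P k g := by
  induction k generalizing g with
  | zero => exact h.1
  | succ k ih => exact ⟨h.1, h.2.1, ih h.2.2⟩

theorem Reg.mono {P : (ℝ → ℝ) → Prop} {k l : ℕ} (hkl : k ≤ l) {g : ℝ → ℝ} (h : Reg P l g) :
    Reg P k g := by
  induction hkl with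
  | refl => exact h
  | step _ ih => exact ih h.pred

theorem Reg.succ_of {P : (ℝ → ℝ) → Prop} {k : ℕ} {g g' : ℝ → ℝ} (h0 : P g)
    (hd : ∀ x, HasDerivAt g (g' x) x) (h : Reg P k g') : Reg P (k + 1) g := by
  have : deriv g = g' := funext fun x => (hd x).deriv
  exact ⟨h0, fun x => (hd x).differentiableAt, this ▸ h⟩

theorem Reg.hasDerivAt {P : (ℝ → ℝ) → Prop} {k : ℕ} {g : ℝ → ℝ} (h : Reg P (k + 1) g) (x : ℝ) :
    HasDerivAt g (_root_.deriv g x) x := (h.2.1 x).hasDerivAt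

theorem Reg.add {P : (ℝ → ℝ) → Prop} (hP : ∀ f g, P f → P g → P fun x => f x + g x) {k : ℕ}
    {f g : ℝ → ℝ} (hf : Reg P k f) (hg : Reg P k g) : Reg P k fun x => f x + g x := by
  induction k generalizing f g with
  | zero => exact hP f g hf hg
  | succ k ih =>
    exact Reg.succ_of (hP _ _ hf.1 hg.1) (fun x => (hf.hasDerivAt x).fun_add (hg.hasDerivAt x))
      (ih hf.2.2 hg.2.2)

/-- Two properties are allowed so that one induction on the Leibniz rule covers both bounded times
bounded and localized times bounded. -/
theorem Reg.mul {P S : (ℝ → ℝ) → Prop} (hP : ∀ f g, P f → P g → P fun x => f x + g x)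
    (hPS : ∀ f g, P f → S g → P fun x => f x * g x) {k : ℕ}
    {f g : ℝ → ℝ} (hf : Reg P k f) (hg : Reg S k g) : Reg P k fun x => f x * g x := by
  induction k generalizing f g with
  | zero => exact hPS f g hf hg
  | succ k ih =>
    refine Reg.succ_of (hPS _ _ hf.1 hg.1) (fun x => (hf.hasDerivAt x).fun_mul (hg.hasDerivAt x)) ?_
    exact Reg.add hP (ih hf.2.2 hg.pred) (ih hf.pred hg.2.2)

/-- Localized functions with `k` localized derivatives. -/
@[fun_prop]
def DecN (k : ℕ) (g : ℝ → ℝ) : Prop := Reg Dec k g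

/-- Bounded functions with `k` bounded derivatives. -/
@[fun_prop]
def BddN (k : ℕ) (g : ℝ → ℝ) : Prop := Reg Bdd k g

section
variable {k : ℕ} {f g : ℝ → ℝ}

@[fun_prop]
theorem DecN.add (hf : DecN k f) (hg : DecN k g) : DecN k fun x => f x + g x :=
  Reg.add (fun _ _ => Dec.add) hf hg

@[fun_prop]
theorem BddN.add (hf : BddN k f) (hg : BddN k g) : BddN k fun x => f x + g x :=
  Reg.add (fun _ _ => Bdd.add) hf hg

@[fun_prop]
theorem BddN.mul (hf : BddN k f) (hg : BddN k g) : BddN k fun x => f x * g x :=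
  Reg.mul (fun _ _ => Bdd.add) (fun _ _ => Bdd.mul) hf hg

@[fun_prop]
theorem DecN.mul_bdd (hf : DecN k f) (hg : BddN k g) : DecN k fun x => f x * g x :=
  Reg.mul (fun _ _ => Dec.add) (fun _ _ => Dec.mul_bdd) hf hg

@[fun_prop]
theorem DecN.bdd_mul (hf : BddN k f) (hg : DecN k g) : DecN k fun x => f x * g x := by
  simpa [mul_comm] using hg.mul_bdd hf

@[fun_prop]
theorem DecN.bdd (hf : DecN k f) : BddN k f := hf.mono_left fun _ => Dec.bdd

@[fun_prop]
theorem BddN.const (c : ℝ) : BddN k fun _ => c := by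
  induction k generalizing c with
  | zero => exact Bdd.const c
  | succ k ih => exact Reg.succ_of (Bdd.const c) (fun x => hasDerivAt_const x c) (ih 0)

@[fun_prop]
theorem DecN.neg (hf : DecN k f) : DecN k fun x => -f x := by
  simpa using DecN.bdd_mul (BddN.const (-1)) hf

@[fun_prop]
theorem BddN.neg (hf : BddN k f) : BddN k fun x => -f x := by
  simpa using BddN.mul (BddN.const (-1)) hf

@[fun_prop]
theorem DecN.sub (hf : DecN k f) (hg : DecN k g) : DecN k fun x => f x - g x := by
  simpa [sub_eq_add_neg] using hf.add hg.neg

@[fun_prop]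
theorem BddN.sub (hf : BddN k f) (hg : BddN k g) : BddN k fun x => f x - g x := by
  simpa [sub_eq_add_neg] using hf.add hg.neg

@[fun_prop]
theorem BddN.pow (hf : BddN k f) (n : ℕ) : BddN k fun x => f x ^ n := by
  induction n with
  | zero => simpa using BddN.const 1
  | succ n ih => simpa [pow_succ] using BddN.mul ih hf

end

theorem Reg.contDiff {P : (ℝ → ℝ) → Prop} (hP : ∀ g, P g → Continuous g) {k : ℕ} {g : ℝ → ℝ}
    (h : Reg P k g) : ContDiff ℝ k g := by
  induction k generalizing g with
  | zero => exact contDiff_zero.2 (hP g h)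
  | succ k ih =>
    have := (contDiff_succ_iff_deriv (n := (k : WithTop ℕ∞)) (𝕜 := ℝ) (f := g)).2
      ⟨h.2.1, by simp, ih h.2.2⟩
    exact_mod_cast this

theorem Reg.iteratedDeriv {P : (ℝ → ℝ) → Prop} {k j : ℕ} (hjk : j ≤ k) {g : ℝ → ℝ}
    (h : Reg P k g) : P (iteratedDeriv j g) := by
  induction k generalizing g j with
  | zero =>
    obtain rfl : j = 0 := by omega
    simpa using Reg.zero h
  | succ k ih =>
    cases j with
    | zero => simpa using h.1
    | succ j =>
      rw [iteratedDeriv_succ']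
      exact ih (by omega) h.2.2

theorem memY_of_decN {N : ℕ∞} {g : ℝ → ℝ} (h : ∀ k : ℕ, (k : ℕ∞) ≤ N → DecN k g) : MemY N g := by
  constructor
  · refine contDiff_iff_forall_nat_le.2 fun m hm => (h m hm).contDiff fun _ => Dec.continuous
  · intro j hj
    obtain ⟨-, K, n, hK⟩ := (h j hj).iteratedDeriv le_rfl
    have hK0 : 0 ≤ K := by
      have := (abs_nonneg _).trans (hK 0); simpa using this
    -- The exponent is raised by one because `MemY` requires r > 0.
    refine ⟨K, (n + 1 : ℕ), by positivity, fun x => (hK x).trans ?_⟩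
    rw [Real.rpow_natCast, mul_assoc]
    exact mul_le_mul_of_nonneg_left (weight_mono n.le_succ x) hK0

end GKdV

/-! ### Construction of the soliton profile -/

namespace GKdV

theorem hasDerivAt_tanh (x : ℝ) : HasDerivAt Real.tanh (1 - Real.tanh x ^ 2) x := by
  have hc : Real.cosh x ≠ 0 := (Real.cosh_pos x).ne'
  have h := (Real.hasDerivAt_sinh x).fun_div (Real.hasDerivAt_cosh x) hc
  have e : (fun y => Real.sinh y / Real.cosh y) = Real.tanh :=
    funext fun y => (Real.tanh_eq_sinh_div_cosh y).symm
  rw [e] at h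
  refine h.congr_deriv ?_
  rw [Real.tanh_eq_sinh_div_cosh]
  field_simp

theorem exists_continuous_inverse {F : ℝ → ℝ} (hc : Continuous F) (hm : StrictMono F)
    (ht : Tendsto F atTop atTop) (hb : Tendsto F atBot atBot) :
    ∃ G : ℝ → ℝ, Continuous G ∧ StrictMono G ∧ (∀ y, F (G y) = y) ∧ ∀ x, G (F x) = x := by
  let e := StrictMono.orderIsoOfSurjective F hm (hc.surjective ht hb)
  refine ⟨e.symm, e.symm.continuous, e.symm.strictMono, fun y => ?_, fun x => ?_⟩
  · exact e.apply_symm_apply y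
  · exact e.symm_apply_apply x

/-- A scalar autonomous equation with even right-hand side bounded above and below. -/
theorem exists_autonomous_solution {v : ℝ → ℝ} (hv : Continuous v) {C : ℝ} (hC : 0 < C)
    (hlow : ∀ t, 1 / C ≤ v t) (hup : ∀ t, v t ≤ C) (heven : ∀ t, v (-t) = v t) :
    ∃ g : ℝ → ℝ, (∀ x, HasDerivAt g (v (g x)) x) ∧ ∀ x, g (-x) = -g x := by
  have hpos : ∀ t, 0 < v t := fun t => (by positivity : 0 < 1 / C).trans_le (hlow t)
  have hvi : Continuous fun t => (v t)⁻¹ := hv.inv₀ fun t => (hpos t).ne'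
  have hX := hasDerivAt_integral hvi
  -- Separation of variables: g is the inverse of the time function X. The upper bound on v makes X
  -- grow at least linearly, hence onto, so g is global; evenness of v makes X and g odd.
  set X : ℝ → ℝ := fun x => ∫ t in (0 : ℝ)..x, (v t)⁻¹ with hXdef
  have hXodd : ∀ x, X (-x) = -X x := integral_odd_of_even fun t => by rw [heven]
  have hXm : StrictMono X := strictMono_of_deriv_pos fun x => by
    rw [(hX x).deriv]; exact inv_pos.2 (hpos x)
  have hXlow : Monotone fun x => X x - x / C := by
    refine monotone_of_deriv_nonneg (fun x => ((hX x).sub ((hasDerivAt_id x).div_const C)).differentiableAt)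
      fun x => ?_
    have h1 := ((hX x).fun_sub ((hasDerivAt_id x).div_const C)).deriv
    simp only [id] at h1
    rw [h1, sub_nonneg, one_div]
    exact inv_anti₀ (hpos x) (hup x)
  have hX0 : X 0 = 0 := by simp [hXdef]
  have ht : Tendsto X atTop atTop := by
    refine tendsto_atTop_mono' _ ?_ (tendsto_id.atTop_div_const hC)
    filter_upwards [eventually_ge_atTop 0] with x hx
    have := hXlow hx
    simp only [hX0, zero_div, sub_zero, id] at this ⊢
    linarith
  have hb : Tendsto X atBot atBot := by
    have := tendsto_neg_atTop_atBot.comp (ht.comp tendsto_neg_atBot_atTop)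
    refine this.congr fun x => ?_
    simp [hXodd]
  obtain ⟨g, hgc, -, hXg, hgX⟩ := exists_continuous_inverse (continuous_of_hasDerivAt hX) hXm ht hb
  refine ⟨g, fun x => ?_, fun x => ?_⟩
  · have := HasDerivAt.of_local_left_inverse (a := x) hgc.continuousAt (hX (g x))
      (inv_ne_zero (hpos _).ne') (Eventually.of_forall hXg)
    simpa using this
  · rw [← hgX (-g x), hXodd, hXg]

/-- Inverse of an increasing function on an interval. -/
theorem exists_inverse_on {s : ℝ → ℝ} {q₁ : ℝ} (hq₁ : 0 < q₁) (hs : ContinuousOn s (Set.Icc 0 q₁))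
    (hm : StrictMonoOn s (Set.Icc 0 q₁)) (h0 : s 0 = 0) :
    ∃ S : ℝ → ℝ, Continuous S ∧ (∀ y, 0 < y → y < s q₁ → 0 < S y ∧ S y < q₁ ∧ s (S y) = y) := by
  -- Clamping to [0, q₁] and adding q - c(q) extends s to an increasing homeomorphism of ℝ, so the
  -- global inverse function lemma applies.
  set c : ℝ → ℝ := fun q => max 0 (min q q₁) with hc
  have hcm : ∀ q, c q ∈ Set.Icc 0 q₁ := fun q =>
    ⟨le_max_left _ _, max_le hq₁.le (min_le_right _ _)⟩
  have hcmono : Monotone c := fun a b hab => max_le_max le_rfl (min_le_min hab le_rfl)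
  have hcid : ∀ q ∈ Set.Icc 0 q₁, c q = q := fun q hq => by
    simp [hc, min_eq_left hq.2, hq.1]
  have hcc : Continuous c := by fun_prop
  have hlip : Monotone fun q => q - c q := by
    intro a b hab
    simp only [hc]
    rcases le_total a q₁ with h1 | h1 <;> rcases le_total b q₁ with h2 | h2 <;>
      rcases le_total 0 a with h3 | h3 <;> rcases le_total 0 b with h4 | h4 <;>
      simp [h1, h2, h3, h4, hq₁.le] <;> linarith
  set F : ℝ → ℝ := fun q => s (c q) + (q - c q) with hF
  have hFc : Continuous F := (hs.comp_continuous hcc hcm).add (continuous_id.sub hcc)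
  have hFm : StrictMono F := by
    intro a b hab
    have h1 := hlip hab.le
    simp only at h1
    rcases (hcmono hab.le).lt_or_eq with h | h
    · have := hm (hcm a) (hcm b) h
      simp only [hF]; linarith
    · simp only [hF, h]; linarith
  have hsnn : ∀ q ∈ Set.Icc 0 q₁, 0 ≤ s q := fun q hq => by
    rw [← h0]; exact hm.monotoneOn ⟨le_rfl, hq₁.le⟩ hq hq.1
  have ht : Tendsto F atTop atTop := by
    refine tendsto_atTop_mono (fun q => ?_) (tendsto_atTop_add_const_right _ (-q₁) tendsto_id)
    have h1 := hsnn _ (hcm q)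
    have h2 := (hcm q).2
    simp only [hF, id]; linarith
  have hb : Tendsto F atBot atBot := by
    refine tendsto_atBot_mono' _ ?_ tendsto_id
    filter_upwards [eventually_le_atBot 0] with q hq
    have : c q = 0 := by simp [hc, min_eq_left (hq.trans hq₁.le), hq]
    simp [hF, this, h0]
  obtain ⟨G, hGc, hGm, hFG, hGF⟩ := exists_continuous_inverse hFc hFm ht hb
  have e0 : G 0 = 0 := by
    have : F 0 = 0 := by simp [hF, hcid 0 ⟨le_rfl, hq₁.le⟩, h0]
    rw [← this, hGF, this]
  have e1 : G (s q₁) = q₁ := by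
    have : F q₁ = s q₁ := by simp [hF, hcid q₁ ⟨hq₁.le, le_rfl⟩]
    rw [← this, hGF]
  refine ⟨G, hGc, fun y hy hy1 => ?_⟩
  have a1 : 0 < G y := e0 ▸ hGm hy
  have a2 : G y < q₁ := by
    have := hGm hy1
    rwa [e1] at this
  refine ⟨a1, a2, ?_⟩
  have := hFG y
  simpa [hF, hcid (G y) ⟨a1.le, a2.le⟩] using this

/-- The positive even solution `Q` of `Q'' + f(Q) = Q`, presented through `φ = -Q'/Q`, together with
quantitative bounds in terms of one constant `C`. -/
structure Profile (f Q φ : ℝ → ℝ) (C : ℝ) : Prop where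
  one_le : 1 ≤ C
  hasDerivAt_Q : ∀ x, HasDerivAt Q (-(φ x * Q x)) x
  hasDerivAt_φ : ∀ x, HasDerivAt φ (φ x ^ 2 - 1 + f (Q x) / Q x) x
  pos : ∀ x, 0 < Q x
  even : ∀ x, Q (-x) = Q x
  odd : ∀ x, φ (-x) = -φ x
  φ_nonneg : ∀ x, 0 ≤ x → 0 ≤ φ x
  φ_sq_lt : ∀ x, φ x ^ 2 < 1
  sub_le : ∀ x, 1 - φ x ^ 2 ≤ C * (φ x ^ 2 - 1 + f (Q x) / Q x)
  kappa_le : ∀ x, |deriv f (Q x) - (1 - φ x ^ 2) - 3 * (φ x ^ 2 - 1 + f (Q x) / Q x)|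
    ≤ C * (φ x ^ 2 - 1 + f (Q x) / Q x)
  le_exp : ∀ x, Q x ≤ C * Real.exp (-|x|)
  exp_le : ∀ x, Real.exp (-|x|) ≤ C * Q x
  f_le : ∀ x, |f (Q x)| ≤ C * Q x ^ 2
  deriv_le : ∀ x, |deriv f (Q x)| ≤ C * Q x
  contDiff : ContDiff ℝ 3 f

/-- Here s plays the role of 2F(q)/q², as its differential equation says. The energy identity s(Q) =
1 - φ² recovers Q from φ. With φ = tanh g the profile equation becomes g' = v(g) with v bounded
between 1/C and C; unlike Q' = -Q√(1 - s(Q)), this equation does not degenerate at the maximum of Q.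
-/
theorem exists_profile {f s : ℝ → ℝ} {q₁ C : ℝ} (hC : 1 ≤ C) (hq₁ : 0 < q₁) (hq₁C : q₁ ≤ C)
    (hf : ContDiff ℝ 3 f) (hs : ContinuousOn s (Set.Icc 0 q₁)) (hs0 : s 0 = 0) (hs1 : 1 < s q₁)
    (hd : ∀ q ∈ Set.Ioo 0 q₁, HasDerivAt s (2 * (f q / q - s q) / q) q)
    (hlow : ∀ q ∈ Set.Ioo 0 q₁, s q ≤ C * (f q / q - s q))
    (hup : ∀ q ∈ Set.Ioo 0 q₁, f q / q - s q ≤ C * s q)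
    (hpos : ∀ q ∈ Set.Ioo 0 q₁, 0 < f q / q - s q)
    (hle : ∀ q ∈ Set.Ioo 0 q₁, s q ≤ C * q)
    (hkap : ∀ q ∈ Set.Ioo 0 q₁, |deriv f q - s q - 3 * (f q / q - s q)| ≤ C * (f q / q - s q))
    (hfl : ∀ q ∈ Set.Ioo 0 q₁, |f q| ≤ C * q ^ 2)
    (hfl' : ∀ q ∈ Set.Ioo 0 q₁, |deriv f q| ≤ C * q) :
    ∃ Q φ : ℝ → ℝ, Profile f Q φ (C * Real.exp C) ∧ (∀ x, Q x < q₁) ∧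
      ∀ x, φ x ^ 2 = 1 - s (Q x) := by
  have hC0 : 0 < C := by linarith
  have hm : StrictMonoOn s (Set.Icc 0 q₁) := by
    refine strictMonoOn_of_deriv_pos (convex_Icc _ _) hs fun q hq => ?_
    rw [interior_Icc] at hq
    rw [(hd q hq).deriv]
    have := hpos q hq
    have := hq.1
    positivity
  obtain ⟨S, hSc, hS⟩ := exists_inverse_on hq₁ hs hm hs0
  have hth : ∀ t, 0 < 1 - Real.tanh t ^ 2 := fun t => by linarith [Real.tanh_sq_lt_one t]
  have htanhc : Continuous Real.tanh := continuous_of_hasDerivAt hasDerivAt_tanh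
  set q : ℝ → ℝ := fun t => S (1 - Real.tanh t ^ 2) with hq
  have hqS : ∀ t, 0 < q t ∧ q t < q₁ ∧ s (q t) = 1 - Real.tanh t ^ 2 := fun t =>
    hS _ (hth t) (by nlinarith [sq_nonneg (Real.tanh t)])
  have hqI : ∀ t, q t ∈ Set.Ioo 0 q₁ := fun t => ⟨(hqS t).1, (hqS t).2.1⟩
  have hqc : Continuous q := hSc.comp (continuous_const.sub (htanhc.pow 2))
  -- From φ' = (1 - tanh² g) g' and φ' = f(Q)/Q - s(Q). The hypotheses `hlow` and `hup` are exactly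
  -- the two bounds on v.
  set v : ℝ → ℝ := fun t => (f (q t) / q t - s (q t)) / (1 - Real.tanh t ^ 2) with hv
  have hvc : Continuous v := by
    refine ((hf.continuous.comp hqc).div hqc (fun t => (hqS t).1.ne') |>.sub
      (hs.comp_continuous hqc fun t => ⟨(hqS t).1.le, (hqS t).2.1.le⟩)).div
      (continuous_const.sub (htanhc.pow 2)) fun t => (hth t).ne'
  obtain ⟨g, hg, hgodd⟩ := exists_autonomous_solution hvc hC0
    (fun t => by
      rw [hv, div_le_div_iff₀ hC0 (hth t), one_mul, ← (hqS t).2.2, mul_comm]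
      exact hlow _ (hqI t))
    (fun t => by
      rw [hv, div_le_iff₀ (hth t), ← (hqS t).2.2]
      exact hup _ (hqI t))
    (fun t => by simp [hv, hq, Real.tanh_neg])
  set φ : ℝ → ℝ := fun x => Real.tanh (g x) with hφ
  set Q : ℝ → ℝ := fun x => q (g x) with hQ
  have hsQ : ∀ x, s (Q x) = 1 - φ x ^ 2 := fun x => (hqS (g x)).2.2
  have hQI : ∀ x, Q x ∈ Set.Ioo 0 q₁ := fun x => hqI (g x)
  have hQpos : ∀ x, 0 < Q x := fun x => (hQI x).1
  have hφd : ∀ x, HasDerivAt φ (φ x ^ 2 - 1 + f (Q x) / Q x) x := by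
    intro x
    have := (hasDerivAt_tanh (g x)).comp x (hg x)
    refine this.congr_deriv ?_
    simp only [hv]
    rw [mul_div_cancel₀ _ (hth _).ne', (hqS (g x)).2.2]
    simp only [hφ, hQ]
    ring
  have hΓ : ∀ x, φ x ^ 2 - 1 + f (Q x) / Q x = f (Q x) / Q x - s (Q x) := fun x => by
    rw [hsQ]; ring
  have hSd : ∀ y, 0 < y → y < s q₁ →
      HasDerivAt S (2 * (f (S y) / S y - s (S y)) / S y)⁻¹ y := by
    intro y hy hy1
    have h1 := hS y hy hy1
    have hI : S y ∈ Set.Ioo 0 q₁ := ⟨h1.1, h1.2.1⟩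
    refine HasDerivAt.of_local_left_inverse hSc.continuousAt (hd _ hI) ?_ ?_
    · have := hpos _ hI
      have := h1.1
      positivity
    · filter_upwards [Ioo_mem_nhds hy hy1] with z hz
      exact (hS z hz.1 hz.2).2.2
  have hQd : ∀ x, HasDerivAt Q (-(φ x * Q x)) x := by
    intro x
    have h1 : HasDerivAt (fun x => 1 - φ x ^ 2) (-(2 * φ x * (φ x ^ 2 - 1 + f (Q x) / Q x))) x := by
      have := ((hφd x).fun_pow 2).const_sub 1
      simpa [mul_assoc] using this
    have hlt : 1 - φ x ^ 2 < s q₁ := by nlinarith [sq_nonneg (φ x)]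
    have h2 := (hSd _ (hth (g x)) hlt).comp x h1
    refine h2.congr_deriv ?_
    have e : S (1 - Real.tanh (g x) ^ 2) = Q x := rfl
    rw [e, hΓ]
    have h3 := hpos _ (hQI x)
    have h4 := hQpos x
    generalize f (Q x) / Q x - s (Q x) = G at h3 ⊢
    rw [inv_div]
    field_simp
  have hφnn : ∀ x, 0 ≤ x → 0 ≤ φ x := by
    have hmono : Monotone φ := monotone_of_deriv_nonneg (fun x => (hφd x).differentiableAt)
      fun x => by rw [(hφd x).deriv, hΓ]; exact (hpos _ (hQI x)).le
    intro x hx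
    have h0 : φ 0 = 0 := by
      have := hgodd 0
      have h : g 0 = 0 := by rw [neg_zero] at this; linarith
      simp [hφ, h]
    rw [← h0]; exact hmono hx
  have hlog : ∀ x, HasDerivAt (fun x => Real.log (Q x) + x) (1 - φ x) x := by
    intro x
    refine (((hQd x).log (hQpos x).ne').fun_add (hasDerivAt_id x)).congr_deriv ?_
    have := (hQpos x).ne'
    field_simp
    ring
  have hφlt : ∀ x, φ x < 1 := fun x => Real.tanh_lt_one _
  have hsub : ∀ x, 1 - φ x ^ 2 ≤ C * (φ x ^ 2 - 1 + f (Q x) / Q x) := fun x => by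
    rw [hΓ, ← hsQ]; exact hlow _ (hQI x)
  have heven : ∀ x, Q (-x) = Q x := fun x => by simp [hQ, hq, hgodd, Real.tanh_neg]
  have hodd : ∀ x, φ (-x) = -φ x := fun x => by simp [hφ, hgodd, Real.tanh_neg]
  have hs00 : φ 0 = 0 := by
    have := hodd 0
    rw [neg_zero] at this; linarith
  -- At the origin φ vanishes, so s(Q 0) = 1, and s(q) ≤ C q bounds the height of the soliton from
  -- below.
  have hQ0 : 1 ≤ C * Q 0 := by
    have h1 := hle _ (hQI 0)
    rw [hsQ, hs00] at h1
    linarith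
  have hup' : ∀ x, 0 ≤ x → Q x ≤ C * Real.exp C * Real.exp (-x) := by
    intro x hx
    -- Its derivative is (1 - φ) - Cφ', which is nonpositive for x ≥ 0 because 1 - φ ≤ 1 - φ² ≤ Cφ'.
    -- As φ < 1, this costs the factor e^C in the upper exponential bound.
    have hanti : AntitoneOn (fun x => Real.log (Q x) + x - C * φ x) (Set.Ici 0) := by
      have hD := fun x => (hlog x).fun_sub ((hφd x).const_mul C)
      refine antitoneOn_of_deriv_nonpos (convex_Ici 0)
        (fun t _ => (hD t).continuousAt.continuousWithinAt)
        (fun t _ => (hD t).differentiableAt.differentiableWithinAt) fun t ht => ?_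
      have ht' : 0 ≤ t := le_of_lt (by simpa using ht)
      rw [(hD t).deriv]
      have h1 := hsub t
      have h2 := hφnn t ht'
      have h3 := hφlt t
      nlinarith
    have h1 := hanti (Set.mem_Ici.2 le_rfl) (Set.mem_Ici.2 hx) hx
    simp only [hs00] at h1
    have h2 : Real.log (Q x) ≤ Real.log C + C + -x := by
      have : Real.log (Q 0) ≤ Real.log C :=
        Real.log_le_log (hQpos 0) ((hQI 0).2.le.trans hq₁C)
      nlinarith [hφlt x]
    rw [Real.log_le_iff_le_exp (hQpos x), Real.exp_add, Real.exp_add, Real.exp_log hC0] at h2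
    exact h2
  have hlow' : ∀ x, 0 ≤ x → Real.exp (-x) ≤ C * Q x := by
    intro x hx
    have hmono : MonotoneOn (fun x => Real.log (Q x) + x) (Set.Ici 0) := by
      refine monotoneOn_of_deriv_nonneg (convex_Ici 0)
        (fun t _ => (hlog t).continuousAt.continuousWithinAt)
        (fun t _ => (hlog t).differentiableAt.differentiableWithinAt) fun t ht => ?_
      rw [(hlog t).deriv]
      linarith [hφlt t]
    have h1 := hmono (Set.mem_Ici.2 le_rfl) (Set.mem_Ici.2 hx) hx
    simp only [add_zero] at h1
    have h2 : Real.log (Q 0) + -x ≤ Real.log (Q x) := by linarith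
    have h3 := Real.exp_le_exp.2 h2
    rw [Real.exp_add, Real.exp_log (hQpos 0), Real.exp_log (hQpos x)] at h3
    have := Real.exp_pos (-x)
    nlinarith
  have hCe : C ≤ C * Real.exp C := le_mul_of_one_le_right hC0.le (Real.one_le_exp hC0.le)
  have hΓpos : ∀ x, 0 < φ x ^ 2 - 1 + f (Q x) / Q x := fun x => by
    rw [hΓ]; exact hpos _ (hQI x)
  refine ⟨Q, φ, ⟨hC.trans hCe, hQd, hφd, hQpos, heven, hodd, hφnn, fun x => Real.tanh_sq_lt_one _,
    fun x => (hsub x).trans (mul_le_mul_of_nonneg_right hCe (hΓpos x).le), fun x => ?_, fun x => ?_,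
    fun x => ?_, fun x => (hfl _ (hQI x)).trans (by gcongr),
    fun x => (hfl' _ (hQI x)).trans (mul_le_mul_of_nonneg_right hCe (hQpos x).le), hf⟩,
    fun x => (hQI x).2, fun x => by rw [hsQ]; ring⟩
  · have := hkap _ (hQI x)
    rw [hΓ, ← hsQ]
    exact this.trans (mul_le_mul_of_nonneg_right hCe (hpos _ (hQI x)).le)
  · rcases le_total 0 x with hx | hx
    · rw [abs_of_nonneg hx]; exact hup' x hx
    · rw [abs_of_nonpos hx, ← heven]; exact hup' (-x) (by linarith)
  · refine le_trans ?_ (mul_le_mul_of_nonneg_right hCe (hQpos x).le)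
    rcases le_total 0 x with hx | hx
    · rw [abs_of_nonneg hx]; exact hlow' x hx
    · rw [abs_of_nonpos hx, ← heven]; exact hlow' (-x) (by linarith)

end GKdV

/-! ### Properties of the profile and the second homogeneous solution -/

namespace GKdV

namespace Profile

variable {f Q φ : ℝ → ℝ} {C : ℝ}

theorem C_pos (h : Profile f Q φ C) : 0 < C := by linarith [h.one_le]

theorem hasDerivAt_f (h : Profile f Q φ C) (u : ℝ) : HasDerivAt f (deriv f u) u :=
  (h.contDiff.differentiable (by norm_num) u).hasDerivAt

theorem gamma_pos (h : Profile f Q φ C) (x : ℝ) : 0 < φ x ^ 2 - 1 + f (Q x) / Q x := by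
  have h1 := h.sub_le x
  have h2 := h.φ_sq_lt x
  by_contra hneg
  nlinarith [h.C_pos]

theorem abs_φ_lt (h : Profile f Q φ C) (x : ℝ) : |φ x| < 1 := by
  rw [← sq_lt_one_iff_abs_lt_one]; exact h.φ_sq_lt x

theorem continuous_Q (h : Profile f Q φ C) : Continuous Q := continuous_of_hasDerivAt h.hasDerivAt_Q

theorem continuous_φ (h : Profile f Q φ C) : Continuous φ := continuous_of_hasDerivAt h.hasDerivAt_φ

theorem continuous_deriv_f (h : Profile f Q φ C) : Continuous (deriv f) :=
  h.contDiff.continuous_deriv (by norm_num)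

theorem hasDerivAt_fQ (h : Profile f Q φ C) (x : ℝ) :
    HasDerivAt (fun x => f (Q x)) (deriv f (Q x) * -(φ x * Q x)) x :=
  (h.hasDerivAt_f (Q x)).comp x (h.hasDerivAt_Q x)

/-- The derivative of `Q'`. -/
theorem hasDerivAt_Q' (h : Profile f Q φ C) (x : ℝ) :
    HasDerivAt (fun x => -(φ x * Q x)) (Q x - f (Q x)) x := by
  refine (((h.hasDerivAt_φ x).fun_mul (h.hasDerivAt_Q x)).fun_neg).congr_deriv ?_
  have := (h.pos x).ne'
  field_simp
  ring

/-- The derivative of `Q''`. -/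
theorem hasDerivAt_Q'' (h : Profile f Q φ C) (x : ℝ) :
    HasDerivAt (fun x => Q x - f (Q x)) ((1 - deriv f (Q x)) * -(φ x * Q x)) x := by
  refine ((h.hasDerivAt_Q x).fun_sub (h.hasDerivAt_fQ x)).congr_deriv ?_
  ring

theorem dec_Q (h : Profile f Q φ C) : Dec Q :=
  ⟨h.continuous_Q, C, 0, fun x => by
    rw [abs_of_pos (h.pos x), pow_zero, one_mul]; exact h.le_exp x⟩

theorem bdd_φ (h : Profile f Q φ C) : Bdd φ := ⟨h.continuous_φ, 1, fun x => (h.abs_φ_lt x).le⟩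

theorem Q_le (h : Profile f Q φ C) (x : ℝ) : Q x ≤ C :=
  (h.le_exp x).trans (mul_le_of_le_one_right h.C_pos.le (Real.exp_le_one_iff.2 (by simp)))

theorem continuous_σ (h : Profile f Q φ C) : Continuous fun x => f (Q x) / Q x :=
  (h.contDiff.continuous.comp h.continuous_Q).div h.continuous_Q fun x => (h.pos x).ne'

theorem σ_le (h : Profile f Q φ C) (x : ℝ) : |f (Q x) / Q x| ≤ C * Q x := by
  rw [abs_div, abs_of_pos (h.pos x), div_le_iff₀ (h.pos x)]
  exact (h.f_le x).trans (le_of_eq (by ring))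

theorem dec_of_le (h : Profile f Q φ C) {g : ℝ → ℝ} (hg : Continuous g) {K : ℝ}
    (hK : ∀ x, |g x| ≤ K * Q x) : Dec g := by
  have hK0 : 0 ≤ K := by
    have := (abs_nonneg _).trans (hK 0)
    exact nonneg_of_mul_nonneg_left this (h.pos 0)
  refine ⟨hg, K * C, 0, fun x => (hK x).trans ?_⟩
  rw [pow_zero, one_mul, mul_assoc]
  exact mul_le_mul_of_nonneg_left (h.le_exp x) hK0

theorem dec_σ (h : Profile f Q φ C) : Dec fun x => f (Q x) / Q x :=
  h.dec_of_le h.continuous_σ h.σ_le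

theorem dec_f' (h : Profile f Q φ C) : Dec fun x => deriv f (Q x) :=
  h.dec_of_le (h.continuous_deriv_f.comp h.continuous_Q) h.deriv_le

theorem dec_f (h : Profile f Q φ C) : Dec fun x => f (Q x) := by
  have := h.dec_σ.mul_bdd h.dec_Q.bdd
  have e : (fun x => f (Q x)) = fun x => f (Q x) / Q x * Q x :=
    funext fun x => (div_mul_cancel₀ _ (h.pos x).ne').symm
  rwa [e]

theorem sub_le_Q (h : Profile f Q φ C) (x : ℝ) : 1 - φ x ^ 2 ≤ C ^ 2 * Q x := by
  have h1 := h.sub_le x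
  have h2 := (abs_le.1 (h.σ_le x)).2
  have h3 := h.φ_sq_lt x
  have h4 := h.C_pos
  nlinarith

theorem dec_θ (h : Profile f Q φ C) : Dec fun x => φ x ^ 2 - 1 := by
  refine h.dec_of_le (by have := h.continuous_φ; fun_prop) (K := C ^ 2) fun x => ?_
  rw [abs_sub_comm, abs_of_pos (by linarith [h.φ_sq_lt x])]
  exact h.sub_le_Q x

theorem gamma_le (h : Profile f Q φ C) (x : ℝ) : φ x ^ 2 - 1 + f (Q x) / Q x ≤ C * Q x := by
  have h2 := (abs_le.1 (h.σ_le x)).2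
  have h3 := h.φ_sq_lt x
  linarith

theorem tendsto_φ (h : Profile f Q φ C) : Tendsto φ atTop (𝓝 1) := by
  have h0 := h.dec_θ.tendsto_atTop
  have : Tendsto (fun x => φ x - 1) atTop (𝓝 0) := by
    refine squeeze_zero_norm' ?_ (by simpa using h0.abs)
    filter_upwards [eventually_ge_atTop 0] with x hx
    have h1 := h.φ_nonneg x hx
    have e : φ x ^ 2 - 1 = (φ x - 1) * (φ x + 1) := by ring
    rw [e, abs_mul, Real.norm_eq_abs]
    refine le_mul_of_one_le_right (abs_nonneg _) ?_
    rw [abs_of_nonneg (by linarith)]; linarith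
  simpa using this.add_const 1

theorem hasDerivAt_σ (h : Profile f Q φ C) (x : ℝ) :
    HasDerivAt (fun x => f (Q x) / Q x) (φ x * (f (Q x) / Q x - deriv f (Q x))) x := by
  refine ((h.hasDerivAt_fQ x).fun_div (h.hasDerivAt_Q x) (h.pos x).ne').congr_deriv ?_
  have := (h.pos x).ne'
  field_simp
  ring

theorem hasDerivAt_θ (h : Profile f Q φ C) (x : ℝ) :
    HasDerivAt (fun x => φ x ^ 2 - 1) (2 * (φ x * (φ x ^ 2 - 1 + f (Q x) / Q x))) x := by
  refine (((h.hasDerivAt_φ x).fun_pow 2).sub_const 1).congr_deriv ?_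
  simp [mul_assoc]

/-- The even second solution of the linearized equation, normalized by its Wronskian with `Q'`. -/
theorem exists_second_solution (C : ℝ) : ∃ K : ℝ, ∀ {f Q φ : ℝ → ℝ}, Profile f Q φ C →
    ∃ Y Y' : ℝ → ℝ, (∀ x, HasDerivAt Y (Y' x) x) ∧
      (∀ x, HasDerivAt Y' ((1 - deriv f (Q x)) * Y x) x) ∧
      (∀ x, -(φ x * Q x) * Y' x - (Q x - f (Q x)) * Y x = -1) ∧
      (∀ x, Y (-x) = Y x) ∧ (∀ x, Y' (-x) = -Y' x) ∧
      (∀ x, |Y x| ≤ K * Real.exp |x|) ∧ ∀ x, |Y' x| ≤ K * Real.exp |x| := by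
  -- Only the dependence on C matters: every later estimate inherits its uniformity in ε from this
  -- constant.
  refine ⟨C ^ 2 + (1 + C) * C + C ^ 2 * (1 + C * C) * ((2 * C + C * C + 1) * C ^ 2), ?_⟩
  intro f Q φ h
  have hC := h.C_pos
  set Γ : ℝ → ℝ := fun x => φ x ^ 2 - 1 + f (Q x) / Q x with hΓdef
  have hΓ : ∀ x, 0 < Γ x := h.gamma_pos
  have hΓd : ∀ x, HasDerivAt Γ (2 * (φ x * Γ x) + φ x * (f (Q x) / Q x - deriv f (Q x))) x :=
    fun x => (h.hasDerivAt_θ x).fun_add (h.hasDerivAt_σ x)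
  have hΓc : Continuous Γ := continuous_of_hasDerivAt hΓd
  -- Reduction of order calls for a primitive of -1/Q'², which has a pole at the origin. Since
  -- (ρ/(φQ²))' = R - 1/Q'² with the regular R below, the primitive can be taken as ρ/(φQ²) - ∫R,
  -- and multiplying by Q' = -φQ cancels the remaining pole. The bound on κ is what controls ρ' and
  -- R.
  set ρ : ℝ → ℝ := fun x => (1 - φ x ^ 2) / Γ x with hρdef
  set κ : ℝ → ℝ := fun x => (deriv f (Q x) - (1 - φ x ^ 2) - 3 * Γ x) / Γ x with hκdef
  have hQc := h.continuous_Q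
  have hφc := h.continuous_φ
  have hρc : Continuous ρ := Continuous.div (by fun_prop) hΓc fun x => (hΓ x).ne'
  have hκc : Continuous κ := by
    have := h.continuous_deriv_f.comp hQc
    refine Continuous.div ?_ hΓc fun x => (hΓ x).ne'
    exact (this.sub (by fun_prop)).sub (by fun_prop)
  have hρ0 : ∀ x, 0 ≤ ρ x := fun x =>
    div_nonneg (by linarith [h.φ_sq_lt x]) (hΓ x).le
  have hρ1 : ∀ x, ρ x ≤ C := fun x => by
    rw [hρdef, div_le_iff₀ (hΓ x)]; exact h.sub_le x
  have hκ1 : ∀ x, |κ x| ≤ C := fun x => by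
    rw [hκdef, abs_div, abs_of_pos (hΓ x), div_le_iff₀ (hΓ x)]; exact h.kappa_le x
  have hs : ∀ x, 1 - φ x ^ 2 = ρ x * Γ x := fun x => by
    rw [hρdef, div_mul_cancel₀ _ (hΓ x).ne']
  have hfp : ∀ x, deriv f (Q x) = κ x * Γ x + ρ x * Γ x + 3 * Γ x := fun x => by
    rw [hκdef, div_mul_cancel₀ _ (hΓ x).ne', ← hs]; ring
  have hσ : ∀ x, f (Q x) / Q x = Γ x + ρ x * Γ x := fun x => by rw [← hs, hΓdef]; ring
  have hfQ : ∀ x, f (Q x) = Q x * (Γ x + ρ x * Γ x) := fun x => by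
    rw [← hσ, mul_div_cancel₀ _ (h.pos x).ne']
  set R : ℝ → ℝ := fun x => (2 * ρ x + ρ x * κ x - 1) / Q x ^ 2 with hRdef
  have hRc : Continuous R := Continuous.div (by fun_prop) (by fun_prop) fun x => by
    have := h.pos x; positivity
  have hI := hasDerivAt_integral hRc
  set I : ℝ → ℝ := fun x => ∫ t in (0 : ℝ)..x, R t with hIdef
  have hρd : ∀ x, HasDerivAt ρ (φ x * (-2 + ρ x * κ x)) x := by
    intro x
    have h1 : HasDerivAt (fun x => 1 - φ x ^ 2) (-(2 * (φ x * Γ x))) x := by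
      refine (h.hasDerivAt_θ x).fun_neg.congr_of_eventuallyEq (Eventually.of_forall fun y => ?_)
      ring
    refine (h1.fun_div (hΓd x) (hΓ x).ne').congr_deriv ?_
    have := (hΓ x).ne'
    rw [hs, hσ, hfp]
    field_simp
    ring
  have hsφ : ∀ x, φ x ^ 2 = 1 - ρ x * Γ x := fun x => by linarith [hs x]
  have hΓeven : ∀ x, Γ (-x) = Γ x := fun x => by simp [hΓdef, h.odd, h.even]
  have hρeven : ∀ x, ρ (-x) = ρ x := fun x => by simp [hρdef, h.odd, hΓeven]
  have hκeven : ∀ x, κ (-x) = κ x := fun x => by simp [hκdef, h.odd, h.even, hΓeven]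
  have hReven : ∀ x, R (-x) = R x := fun x => by simp [hRdef, hρeven, hκeven, h.even]
  have hIodd : ∀ x, I (-x) = -I x := integral_odd_of_even hReven
  have hexp : ∀ x, 1 / Q x ≤ C * Real.exp |x| := fun x => by
    rw [div_le_iff₀ (h.pos x)]
    have := h.exp_le x
    rw [Real.exp_neg, inv_le_iff_one_le_mul₀ (Real.exp_pos _)] at this
    linarith
  have hRb : ∀ x, |R x| ≤ (2 * C + C * C + 1) * C ^ 2 * Real.exp (2 * |x|) := by
    intro x
    have h1 : |2 * ρ x + ρ x * κ x - 1| ≤ 2 * C + C * C + 1 := by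
      have hab := abs_le.1 (hκ1 x)
      have h2 : |ρ x * κ x| ≤ C * C := by
        rw [abs_mul, abs_of_nonneg (hρ0 x)]
        exact mul_le_mul (hρ1 x) (hκ1 x) (abs_nonneg _) hC.le
      have h3 := abs_le.1 h2
      rw [abs_le]
      constructor <;> linarith [hρ0 x, hρ1 x]
    have h2 : (1 / Q x) ^ 2 ≤ (C * Real.exp |x|) ^ 2 :=
      pow_le_pow_left₀ (by have := h.pos x; positivity) (hexp x) 2
    rw [hRdef, abs_div, abs_of_pos (by have := h.pos x; positivity : 0 < Q x ^ 2), div_eq_mul_one_div]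
    calc |2 * ρ x + ρ x * κ x - 1| * (1 / Q x ^ 2)
        ≤ (2 * C + C * C + 1) * (C * Real.exp |x|) ^ 2 := by
          refine mul_le_mul h1 (by simpa using h2) (by positivity) (by positivity)
      _ = (2 * C + C * C + 1) * C ^ 2 * (Real.exp |x|) ^ 2 := by ring
      _ = _ := by rw [← Real.exp_nat_mul]; norm_num
  have hIb : ∀ x, |I x| ≤ (2 * C + C * C + 1) * C ^ 2 * Real.exp (2 * |x|) := by
    have hpos : ∀ x, 0 ≤ x → |I x| ≤ (2 * C + C * C + 1) * C ^ 2 * Real.exp (2 * x) := by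
      intro x hx
      have hK : 0 ≤ (2 * C + C * C + 1) * C ^ 2 := by positivity
      have hg : ∀ t, HasDerivAt (fun t => (2 * C + C * C + 1) * C ^ 2 * (Real.exp (2 * t) / 2))
          ((2 * C + C * C + 1) * C ^ 2 * Real.exp (2 * t)) t := fun t => by
        have h1 : HasDerivAt (fun t : ℝ => 2 * t) 2 t := by
          simpa using (hasDerivAt_id t).const_mul (2 : ℝ)
        refine ((h1.exp.div_const 2).const_mul _).congr_deriv ?_
        ring
      have h1 := intervalIntegral.norm_integral_le_of_norm_le hx
        (f := R) (g := fun t => (2 * C + C * C + 1) * C ^ 2 * Real.exp (2 * t)) (μ := volume)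
        (Eventually.of_forall fun t ht => by
          have := hRb t
          rwa [abs_of_pos ht.1] at this)
        (Continuous.intervalIntegrable (by fun_prop) _ _)
      rw [intervalIntegral.integral_eq_sub_of_hasDerivAt (fun t _ => hg t)
        (Continuous.intervalIntegrable (by fun_prop) _ _)] at h1
      have h2 := Real.exp_pos (2 * x)
      simp only [mul_zero, Real.exp_zero] at h1
      refine h1.trans ?_
      nlinarith
    intro x
    rcases le_total 0 x with hx | hx
    · rw [abs_of_nonneg hx]; exact hpos x hx
    · have := hpos (-x) (by linarith)
      rwa [hIodd, abs_neg, ← abs_of_nonpos hx] at this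
  have hQI : ∀ x, Q x * |I x| ≤ C * ((2 * C + C * C + 1) * C ^ 2) * Real.exp |x| := by
    intro x
    calc Q x * |I x| ≤ (C * Real.exp (-|x|)) * ((2 * C + C * C + 1) * C ^ 2 * Real.exp (2 * |x|)) :=
          mul_le_mul (h.le_exp x) (hIb x) (abs_nonneg _) (by positivity)
      _ = C * ((2 * C + C * C + 1) * C ^ 2) * (Real.exp (-|x|) * Real.exp (2 * |x|)) := by ring
      _ = _ := by rw [← Real.exp_add]; ring_nf
  have hE := fun x : ℝ => Real.exp_pos |x|
  have hΓb : ∀ x, |Γ x - φ x ^ 2| ≤ 1 + C * C := by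
    intro x
    have h1 := (h.gamma_le x).trans (mul_le_mul_of_nonneg_left (h.Q_le x) hC.le)
    have h2 := h.φ_sq_lt x
    have h3 := hΓ x
    rw [abs_le]
    constructor <;> nlinarith [sq_nonneg (φ x)]
  have hφ1 := fun x => (h.abs_φ_lt x).le
  refine ⟨fun x => -(ρ x / Q x) + Q x * φ x * I x,
    fun x => φ x * (1 + ρ x) / Q x + Q x * (Γ x - φ x ^ 2) * I x, fun x => ?_, fun x => ?_,
    fun x => ?_, fun x => ?_, fun x => ?_, fun x => ?_, fun x => ?_⟩
  · have hq := (h.pos x).ne'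
    refine (((hρd x).fun_div (h.hasDerivAt_Q x) hq).fun_neg.fun_add
      (((h.hasDerivAt_Q x).fun_mul (h.hasDerivAt_φ x)).fun_mul (hI x))).congr_deriv ?_
    change _ + ((_ + Q x * Γ x) * I x + _) = _
    simp only [hRdef]
    field_simp
    ring
  · have hq := (h.pos x).ne'
    refine ((((h.hasDerivAt_φ x).fun_mul ((hρd x).const_add 1)).fun_div (h.hasDerivAt_Q x) hq).fun_add
      (((h.hasDerivAt_Q x).fun_mul ((hΓd x).fun_sub ((h.hasDerivAt_φ x).fun_pow 2))).fun_mul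
        (hI x))).congr_deriv ?_
    change ((Γ x * (1 + ρ x) + _) * _ - _) / _ + ((_ * _ + Q x * (_ - _ * Γ x)) * I x + _) = _
    simp only [hRdef]
    rw [hσ, hfp]
    field_simp
    simp only [Nat.cast_ofNat]
    linear_combination (-ρ x + φ x * Q x ^ 2 * I x) * hsφ x
  · have hq := (h.pos x).ne'
    rw [hfQ]
    field_simp
    linear_combination (-(1 + ρ x) + φ x * Q x ^ 2 * I x) * hsφ x
  · simp only [hρeven, h.even, h.odd, hIodd]; ring
  · simp only [hρeven, h.even, h.odd, hIodd, hΓeven]; ring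
  · refine (abs_add_le _ _).trans ?_
    have h1 : |-(ρ x / Q x)| ≤ C * (C * Real.exp |x|) := by
      rw [abs_neg, abs_of_nonneg (div_nonneg (hρ0 x) (h.pos x).le), div_eq_mul_one_div]
      exact mul_le_mul (hρ1 x) (hexp x) (by have := h.pos x; positivity) hC.le
    have h2 : |Q x * φ x * I x| ≤ C * ((2 * C + C * C + 1) * C ^ 2) * Real.exp |x| := by
      rw [abs_mul, abs_mul, abs_of_pos (h.pos x)]
      refine le_trans ?_ (hQI x)
      have := mul_nonneg (h.pos x).le (abs_nonneg (I x))
      nlinarith [hφ1 x]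
    have h3 : 0 ≤ (1 + C) * C * Real.exp |x| := by have := hE x; positivity
    have h4 : C * ((2 * C + C * C + 1) * C ^ 2) * Real.exp |x|
        ≤ C ^ 2 * (1 + C * C) * ((2 * C + C * C + 1) * C ^ 2) * Real.exp |x| := by
      have : C ≤ C ^ 2 * (1 + C * C) := by nlinarith [h.one_le, mul_pos hC hC]
      gcongr
    nlinarith
  · refine (abs_add_le _ _).trans ?_
    have h1 : |φ x * (1 + ρ x) / Q x| ≤ (1 + C) * (C * Real.exp |x|) := by
      rw [div_eq_mul_one_div, abs_mul, abs_of_pos (by have := h.pos x; positivity : 0 < 1 / Q x)]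
      refine mul_le_mul ?_ (hexp x) (by have := h.pos x; positivity) (by linarith)
      rw [abs_mul, abs_of_nonneg (by linarith [hρ0 x] : 0 ≤ 1 + ρ x)]
      nlinarith [hφ1 x, hρ1 x, hρ0 x, abs_nonneg (φ x)]
    have h2 : |Q x * (Γ x - φ x ^ 2) * I x|
        ≤ (1 + C * C) * (C * ((2 * C + C * C + 1) * C ^ 2) * Real.exp |x|) := by
      rw [abs_mul, abs_mul, abs_of_pos (h.pos x)]
      calc Q x * |Γ x - φ x ^ 2| * |I x| = |Γ x - φ x ^ 2| * (Q x * |I x|) := by ring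
        _ ≤ _ := mul_le_mul (hΓb x) (hQI x) (by have := h.pos x; positivity) (by positivity)
    have h3 : 0 ≤ C ^ 2 * Real.exp |x| := by have := hE x; positivity
    have h4 : (1 + C * C) * (C * ((2 * C + C * C + 1) * C ^ 2) * Real.exp |x|)
        ≤ C ^ 2 * (1 + C * C) * ((2 * C + C * C + 1) * C ^ 2) * Real.exp |x| := by
      have : C ≤ C ^ 2 := by nlinarith [h.one_le]
      calc _ = C * (1 + C * C) * ((2 * C + C * C + 1) * C ^ 2) * Real.exp |x| := by ring
        _ ≤ _ := by gcongr
    nlinarith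

end Profile

end GKdV

/-! ### Inversion of the linearized operator on localized functions -/

namespace GKdV

namespace Profile

variable {f Q φ : ℝ → ℝ} {C : ℝ}

theorem abs_Q'_le (h : Profile f Q φ C) (x : ℝ) : |φ x * Q x| ≤ Q x := by
  rw [abs_mul, abs_of_pos (h.pos x)]
  exact mul_le_of_le_one_left (h.pos x).le (h.abs_φ_lt x).le

theorem abs_Q''_le (h : Profile f Q φ C) (x : ℝ) : |Q x - f (Q x)| ≤ (1 + C ^ 2) * Q x := by
  have h1 := abs_le.1 (h.f_le x)
  have h2 := h.Q_le x
  have h3 := h.pos x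
  have h4 : C * Q x ^ 2 ≤ C ^ 2 * Q x := by
    have := mul_le_mul_of_nonneg_left h2 (mul_nonneg h.C_pos.le h3.le)
    nlinarith
  rw [abs_le]
  constructor <;> nlinarith

/-- Solvability of `ℒ w = h` in the class of localized functions, with a uniform estimate. -/
theorem exists_solution (C : ℝ) (n : ℕ) : ∃ K : ℝ, 0 ≤ K ∧ ∀ {f Q φ : ℝ → ℝ}, Profile f Q φ C →
    ∀ (σ : ℝ) (h : ℝ → ℝ) (M : ℝ), Continuous h →
    (∀ x, |h x| ≤ M * ((1 + |x|) ^ n * Real.exp (-|x|))) → (∀ x, h (-x) = σ * h x) →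
    (σ = 1 ∨ σ = -1 ∧ ∫ x, φ x * Q x * h x = 0) →
    ∃ w w' : ℝ → ℝ, (∀ x, HasDerivAt w (w' x) x) ∧
      (∀ x, HasDerivAt w' ((1 - deriv f (Q x)) * w x - h x) x) ∧
      (∀ x, w (-x) = σ * w x) ∧ (∀ x, w' (-x) = -(σ * w' x)) ∧
      (∀ x, |w x| ≤ K * M * ((1 + |x|) ^ (n + 1) * Real.exp (-|x|))) ∧
      ∀ x, |w' x| ≤ K * M * ((1 + |x|) ^ (n + 1) * Real.exp (-|x|)) := by
  obtain ⟨K, hK⟩ := exists_second_solution C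
  obtain ⟨c, hc, hcb⟩ := exists_tail_bound n
  -- When C is not positive or K is negative there is no profile with that constant, so the claim is
  -- empty and 0 will do.
  by_cases hCpos : 0 < C
  swap
  · exact ⟨0, le_rfl, fun h => absurd h.C_pos hCpos⟩
  by_cases hKpos : 0 ≤ K
  swap
  · refine ⟨0, le_rfl, fun h => ?_⟩
    obtain ⟨Y, Y', -, -, -, -, -, hY, -⟩ := hK h
    have := (abs_nonneg _).trans (hY 0)
    simp only [abs_zero, Real.exp_zero, mul_one] at this
    exact absurd this hKpos
  refine ⟨(1 + C ^ 2) * C * K + K * (c * C), by positivity, ?_⟩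
  intro f Q φ hp σ h M hh hM hpar hσ
  obtain ⟨Y, Y', hY, hY', hW, hYe, hY'o, hYb, hY'b⟩ := hK hp
  have hM0 : 0 ≤ M := by
    have := (abs_nonneg _).trans (hM 0); simpa using this
  have hσ2 : σ * σ = 1 := by rcases hσ with rfl | ⟨rfl, -⟩ <;> norm_num
  have hYc : Continuous Y := continuous_of_hasDerivAt hY
  have hQc := hp.continuous_Q
  have hφc := hp.continuous_φ
  have hdech : Dec h := ⟨hh, M, n, hM⟩
  have hg2c : Continuous fun x => -(φ x * Q x) * h x := by fun_prop
  have hg2d : Dec fun x => -(φ x * Q x) * h x :=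
    Dec.bdd_mul ⟨by fun_prop, C, fun x => by
      rw [abs_neg]; exact (hp.abs_Q'_le x).trans (hp.Q_le x)⟩ hdech
  have hI1 := hasDerivAt_integral (hYc.mul hh)
  have hI2 := hasDerivAt_integral hg2c
  -- Variation of parameters: w = -Q' ∫₀ˣ Yh - Y ∫ₓ^∞ Q'h. The first integral grows polynomially,
  -- with one extra power, and is damped by Q'; the tail decays like e^{-2x} and beats the growth
  -- e^x of Y.
  set I1 : ℝ → ℝ := fun x => ∫ t in (0 : ℝ)..x, (Y * h) t with hI1def
  set I2 : ℝ → ℝ := fun x => ∫ t in (0 : ℝ)..x, -(φ t * Q t) * h t with hI2def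
  set e : ℝ := ∫ t in Set.Ioi 0, -(φ t * Q t) * h t with hedef
  have hlim : Tendsto I2 atTop (𝓝 e) := hg2d.tendsto_integral
  have hI1par : ∀ x, I1 (-x) = -(σ * I1 x) := by
    intro x
    simp only [hI1def, integral_comp_neg_zero, Pi.mul_apply, hYe, hpar]
    rw [← intervalIntegral.integral_const_mul]
    congr 1
    exact intervalIntegral.integral_congr fun t _ => by ring
  have hI2par : ∀ x, I2 (-x) = σ * I2 x := by
    intro x
    simp only [hI2def, integral_comp_neg_zero, hp.odd, hp.even, hpar]
    rw [← intervalIntegral.integral_const_mul, ← intervalIntegral.integral_neg]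
    exact intervalIntegral.integral_congr fun t _ => by ring
  -- In the odd case orthogonality to Q' gives e = 0. This relation makes w have the parity σ, so
  -- decay at +∞ yields decay at -∞.
  have he : e = σ * e := by
    rcases hσ with rfl | ⟨rfl, h0⟩
    · ring
    · have := integral_deriv_of_odd (fun x => by rw [hI2par]; ring) hg2d hlim hI2
      have h1 : ∫ x, -(φ x * Q x) * h x = 0 := by
        simp only [neg_mul, integral_neg, h0, neg_zero]
      rw [h1] at this
      linarith
  have hE0 : Tendsto (fun x => I2 x - e) atTop (𝓝 0) := by simpa using hlim.sub_const e
  have hEb := hcb 2 (by norm_num) (fun x => I2 x - e) _ (C * M) (fun x _ => (hI2 x).sub_const e)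
    (fun x hx => by
      rw [abs_mul, abs_neg]
      have h1 := (hp.abs_Q'_le x).trans (hp.le_exp x)
      have h2 := hM x
      rw [abs_of_nonneg hx] at h1 h2
      calc _ ≤ (C * Real.exp (-x)) * (M * ((1 + x) ^ n * Real.exp (-x))) :=
            mul_le_mul h1 h2 (abs_nonneg _) (by positivity)
        _ = C * M * ((1 + x) ^ n * (Real.exp (-x) * Real.exp (-x))) := by ring
        _ = _ := by rw [← Real.exp_add]; ring_nf) hE0
  have hI1b : ∀ x, 0 ≤ x → |I1 x| ≤ K * M * (1 + x) ^ (n + 1) := by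
    intro x hx
    have h1 := intervalIntegral.norm_integral_le_of_norm_le_const (a := 0) (b := x)
      (f := fun t => (Y * h) t) (C := K * M * (1 + x) ^ n) (fun t ht => by
        rw [Set.uIoc_of_le hx] at ht
        rw [Pi.mul_apply, Real.norm_eq_abs, abs_mul]
        have h1 := hYb t
        have h2 := hM t
        rw [abs_of_pos ht.1] at h1 h2
        calc |Y t| * |h t| ≤ (K * Real.exp t) * (M * ((1 + t) ^ n * Real.exp (-t))) :=
              mul_le_mul h1 h2 (abs_nonneg _) (by positivity)
          _ = K * M * (1 + t) ^ n * (Real.exp t * Real.exp (-t)) := by ring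
          _ = K * M * (1 + t) ^ n := by rw [← Real.exp_add]; simp
          _ ≤ _ := by
            have := ht.1.le
            have := ht.2
            gcongr)
    rw [sub_zero, abs_of_nonneg hx] at h1
    refine h1.trans ?_
    have h3 : x ≤ 1 + x := by linarith
    calc K * M * (1 + x) ^ n * x ≤ K * M * (1 + x) ^ n * (1 + x) := by gcongr
      _ = _ := by ring
  have hw1 : ∀ x, HasDerivAt (fun x => φ x * Q x * I1 x + Y x * (I2 x - e))
      (-(Q x - f (Q x)) * I1 x + Y' x * (I2 x - e)) x := by
    intro x
    refine (((hp.hasDerivAt_Q' x).fun_neg.congr_of_eventuallyEq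
      (f₁ := fun x => φ x * Q x) (Eventually.of_forall fun y => (neg_neg _).symm)).fun_mul
        (hI1 x)).fun_add ((hY x).fun_mul ((hI2 x).sub_const e)) |>.congr_deriv ?_
    simp only [Pi.mul_apply]
    ring
  have hw2 : ∀ x, HasDerivAt (fun x => -(Q x - f (Q x)) * I1 x + Y' x * (I2 x - e))
      ((1 - deriv f (Q x)) * (φ x * Q x * I1 x + Y x * (I2 x - e)) - h x) x := by
    intro x
    refine (((hp.hasDerivAt_Q'' x).fun_neg.fun_mul (hI1 x)).fun_add
      ((hY' x).fun_mul ((hI2 x).sub_const e))).congr_deriv ?_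
    simp only [Pi.mul_apply]
    linear_combination h x * hW x
  have hbd : ∀ (A B : ℝ → ℝ), (∀ x, |A (-x) * I1 (-x) + B (-x) * (I2 (-x) - e)|
        = |A x * I1 x + B x * (I2 x - e)|) →
      (∀ x, |A x| ≤ (1 + C ^ 2) * Q x) → (∀ x, |B x| ≤ K * Real.exp |x|) →
      ∀ x, |A x * I1 x + B x * (I2 x - e)| ≤
        ((1 + C ^ 2) * C * K + K * (c * C)) * M * ((1 + |x|) ^ (n + 1) * Real.exp (-|x|)) := by
    intro A B hAB hA hB x
    wlog hx : 0 ≤ x generalizing x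
    · have := this (-x) (by linarith)
      rwa [hAB, abs_neg] at this
    have h1 := hA x
    have h2 := hB x
    have h3 := hp.le_exp x
    rw [abs_of_nonneg hx] at h2 h3 ⊢
    have a1 : |A x * I1 x| ≤ (1 + C ^ 2) * (C * Real.exp (-x)) * (K * M * (1 + x) ^ (n + 1)) := by
      rw [abs_mul]
      exact mul_le_mul (h1.trans (by gcongr)) (hI1b x hx) (abs_nonneg _) (by positivity)
    have a2 : |B x * (I2 x - e)| ≤ (K * Real.exp x) *
        (c * (C * M) * ((1 + x) ^ n * Real.exp (-(2 * x)))) := by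
      rw [abs_mul]
      exact mul_le_mul h2 (hEb x hx) (abs_nonneg _) (by positivity)
    have a3 : (K * Real.exp x) * (c * (C * M) * ((1 + x) ^ n * Real.exp (-(2 * x))))
        ≤ K * (c * C) * M * ((1 + x) ^ (n + 1) * Real.exp (-x)) := by
      have e1 : Real.exp x * Real.exp (-(2 * x)) = Real.exp (-x) := by
        rw [← Real.exp_add]; ring_nf
      calc _ = K * (c * C) * M * ((1 + x) ^ n * (Real.exp x * Real.exp (-(2 * x)))) := by ring
        _ ≤ _ := by
          rw [e1]
          gcongr
          · linarith
          · exact n.le_succ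
    refine (abs_add_le _ _).trans ((add_le_add a1 (a2.trans a3)).trans (le_of_eq (by ring)))
  have hpe : ∀ x, φ (-x) * Q (-x) * I1 (-x) + Y (-x) * (I2 (-x) - e)
      = σ * (φ x * Q x * I1 x + Y x * (I2 x - e)) := fun x => by
    rw [hp.odd, hp.even, hI1par, hYe, hI2par]
    linear_combination -(Y x) * he
  have hpo : ∀ x, -(Q (-x) - f (Q (-x))) * I1 (-x) + Y' (-x) * (I2 (-x) - e)
      = -(σ * (-(Q x - f (Q x)) * I1 x + Y' x * (I2 x - e))) := fun x => by
    rw [hp.even, hI1par, hY'o, hI2par]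
    linear_combination (Y' x) * he
  have hσabs : |σ| = 1 := by rcases hσ with rfl | ⟨rfl, -⟩ <;> norm_num
  refine ⟨_, _, hw1, hw2, hpe, hpo, ?_, ?_⟩
  · refine hbd _ _ (fun x => by rw [hpe, abs_mul, hσabs, one_mul]) (fun x => ?_) hYb
    refine (hp.abs_Q'_le x).trans (le_mul_of_one_le_left (hp.pos x).le ?_)
    nlinarith [sq_nonneg C]
  · refine hbd _ _ (fun x => by rw [hpo, abs_neg, abs_mul, hσabs, one_mul]) (fun x => ?_) hY'b
    rw [abs_neg]
    exact hp.abs_Q''_le x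

theorem const_of_hasDerivAt_zero {g : ℝ → ℝ} (h : ∀ x, HasDerivAt g 0 x) (x y : ℝ) : g x = g y :=
  is_const_of_deriv_eq_zero (fun x => (h x).differentiableAt) (fun x => (h x).deriv) x y

/-- Localized solutions of the homogeneous equation are multiples of `Q'`. -/
theorem exists_eq_mul_of_homogeneous (h : Profile f Q φ C) {w w' : ℝ → ℝ} (hw : Dec w)
    (hw' : Dec w') (hd : ∀ x, HasDerivAt w (w' x) x)
    (hd' : ∀ x, HasDerivAt w' ((1 - deriv f (Q x)) * w x) x) :
    ∃ c : ℝ, (∀ x, w x = c * -(φ x * Q x)) ∧ (∀ x, w' x = c * (Q x - f (Q x))) ∧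
      (w' 0 = 0 → c = 0) := by
  obtain ⟨K, hK⟩ := exists_second_solution C
  obtain ⟨Y, Y', hY, hY', hW, hYe, hY'o, -, -⟩ := hK h
  -- The Wronskian of w with Q' is constant and decays, hence is zero. The Wronskian with Y is
  -- constant and is the proportionality factor.
  have hW1 : ∀ x, -(φ x * Q x) * w' x - (Q x - f (Q x)) * w x = 0 := by
    have hz : ∀ x, HasDerivAt (fun x => -(φ x * Q x) * w' x - (Q x - f (Q x)) * w x) 0 x := fun x => by
      refine (((h.hasDerivAt_Q' x).fun_mul (hd' x)).fun_sub
        ((h.hasDerivAt_Q'' x).fun_mul (hd x))).congr_deriv ?_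
      ring
    have hdec : Dec fun x => -(φ x * Q x) * w' x - (Q x - f (Q x)) * w x := by
      have := h.dec_Q
      have := h.bdd_φ
      have key : ∀ F : ℝ → ℝ, Dec F → Dec fun x => -(φ x * Q x) * w' x - (Q x - F x) * w x :=
        fun F hF => by fun_prop
      exact key _ h.dec_f
    intro x
    refine tendsto_nhds_unique (f := fun _ : ℝ => -(φ x * Q x) * w' x - (Q x - f (Q x)) * w x)
      tendsto_const_nhds (hdec.tendsto_atTop.congr fun y => ?_)
    exact const_of_hasDerivAt_zero hz y x
  have hW2 : ∀ x, Y x * w' x - Y' x * w x = Y 0 * w' 0 - Y' 0 * w 0 := by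
    have hz : ∀ x, HasDerivAt (fun x => Y x * w' x - Y' x * w x) 0 x := fun x => by
      refine (((hY x).fun_mul (hd' x)).fun_sub ((hY' x).fun_mul (hd x))).congr_deriv ?_
      ring
    exact fun x => const_of_hasDerivAt_zero hz x 0
  have hY'0 : Y' 0 = 0 := by
    have := hY'o 0
    rw [neg_zero] at this; linarith
  refine ⟨Y 0 * w' 0 - Y' 0 * w 0, fun x => ?_, fun x => ?_, fun h0 => by rw [h0, hY'0]; ring⟩
  · linear_combination w x * hW x - Y x * hW1 x + (-(φ x * Q x)) * hW2 x
  · linear_combination w' x * hW x - Y' x * hW1 x + (Q x - f (Q x)) * hW2 x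

/-- A priori estimate for even localized solutions of `ℒ w = h`. -/
theorem estimate_even (C : ℝ) (n : ℕ) : ∃ K : ℝ, 0 ≤ K ∧ ∀ {f Q φ : ℝ → ℝ}, Profile f Q φ C →
    ∀ (h w w' : ℝ → ℝ) (M : ℝ), Continuous h →
    (∀ x, |h x| ≤ M * ((1 + |x|) ^ n * Real.exp (-|x|))) → (∀ x, h (-x) = h x) →
    Dec w → Dec w' → (∀ x, w (-x) = w x) → (∀ x, HasDerivAt w (w' x) x) →
    (∀ x, HasDerivAt w' ((1 - deriv f (Q x)) * w x - h x) x) →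
      (∀ x, |w x| ≤ K * M * ((1 + |x|) ^ (n + 1) * Real.exp (-|x|))) ∧
      ∀ x, |w' x| ≤ K * M * ((1 + |x|) ^ (n + 1) * Real.exp (-|x|)) := by
  obtain ⟨K, hK0, hK⟩ := exists_solution C n
  refine ⟨K, hK0, fun {f Q φ} hp h w w' M hh hM he hw hw' hwe hd hd' => ?_⟩
  obtain ⟨v, v', hv, hv', hve, hvo, hb, hb'⟩ := hK hp 1 h M hh hM (by simpa using he) (Or.inl rfl)
  have hvd : Dec v := ⟨continuous_of_hasDerivAt hv, _, _, hb⟩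
  have hvd' : Dec v' := ⟨continuous_of_hasDerivAt hv', _, _, hb'⟩
  -- Two even solutions differ by a multiple of the odd function Q', and comparing derivatives at
  -- the origin makes the multiple zero; the bounds for the constructed solution therefore hold for
  -- any even localized one.
  obtain ⟨c, h1, h2, h3⟩ := hp.exists_eq_mul_of_homogeneous (hw.sub hvd) (hw'.sub hvd')
    (fun x => (hd x).fun_sub (hv x)) (fun x => ((hd' x).fun_sub (hv' x)).congr_deriv (by ring))
  have hw0 : w' 0 = 0 := by
    have h4 := (hd 0).unique (((hd (-0)).comp 0 (hasDerivAt_neg 0)).congr_of_eventuallyEq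
      (Eventually.of_forall fun x => (hwe x).symm))
    simp at h4
    linarith
  have hv0 : v' 0 = 0 := by
    have := hvo 0
    rw [neg_zero] at this; linarith
  have hc := h3 (by rw [hw0, hv0, sub_zero])
  have e1 : ∀ x, w x = v x := fun x => by have := h1 x; rw [hc] at this; linarith
  have e2 : ∀ x, w' x = v' x := fun x => by have := h2 x; rw [hc] at this; linarith
  exact ⟨fun x => by rw [e1]; exact hb x, fun x => by rw [e2]; exact hb' x⟩

/-- Bootstrap: the equation expresses w'' through w, p and h, so j localized derivatives of these
give j + 2 of w. -/
theorem decN_of_eq (k : ℕ) {p w w' h : ℝ → ℝ} (hp : DecN k p) (hw : Dec w) (hw' : Dec w')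
    (hd : ∀ x, HasDerivAt w (w' x) x) (hd' : ∀ x, HasDerivAt w' ((1 - p x) * w x - h x) x)
    (hh : DecN k h) : DecN (k + 2) w := by
  have key : ∀ j, j ≤ k + 1 → DecN (j + 1) w := by
    intro j hj
    induction j with
    | zero => exact Reg.succ_of hw hd hw'
    | succ j ih =>
      have hj' : j ≤ k := by omega
      have h1 : DecN j w := (ih (by omega)).pred
      have h2 : DecN j h := hh.mono hj'
      have h3 : DecN j p := hp.mono hj'
      exact Reg.succ_of hw hd (Reg.succ_of (g' := fun x => (1 - p x) * w x - h x) hw' hd' (by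
        change DecN j _
        fun_prop))
  exact key (k + 1) le_rfl

/-- The functions Q, φ, φ² - 1 and f(Q)/Q have derivatives that are polynomials in one another and
in f'(Q), so they gain derivatives together. Composition with f' costs one derivative of f, hence
the separate last clause. -/
theorem regularity (h : Profile f Q φ C) {k : ℕ} (hf : ContDiff ℝ k f) (m : ℕ) (hm : m ≤ k) :
    DecN m Q ∧ BddN m φ ∧ DecN m (fun x => φ x ^ 2 - 1) ∧ DecN m (fun x => f (Q x) / Q x) ∧
      (∀ j, j + m ≤ k → BddN m fun x => iteratedDeriv j f (Q x)) ∧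
      (m + 1 ≤ k → DecN m fun x => deriv f (Q x)) := by
  have hbdd : ∀ j, j ≤ k → Bdd fun x => iteratedDeriv j f (Q x) := by
    intro j hj
    have hc : Continuous (iteratedDeriv j f) := hf.continuous_iteratedDeriv j (by exact_mod_cast hj)
    obtain ⟨K, hK⟩ := (isCompact_Icc (a := (0 : ℝ)) (b := C)).exists_bound_of_continuousOn hc.continuousOn
    exact ⟨hc.comp h.continuous_Q, K, fun x => hK _ ⟨(h.pos x).le, h.Q_le x⟩⟩
  induction m with
  | zero => exact ⟨h.dec_Q, h.bdd_φ, h.dec_θ, h.dec_σ, fun j hj => hbdd j hj, fun _ => h.dec_f'⟩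
  | succ m ih =>
    obtain ⟨h1, h2, h3, h4, h5, h6⟩ := ih (by omega)
    have h6 := h6 hm
    have hd : ∀ j, j + 1 ≤ k → ∀ x, HasDerivAt (fun x => iteratedDeriv j f (Q x))
        (iteratedDeriv (j + 1) f (Q x) * -(φ x * Q x)) x := by
      intro j hj x
      have hdf : DifferentiableAt ℝ (iteratedDeriv j f) (Q x) :=
        (hf.differentiable_iteratedDeriv j (by exact_mod_cast hj)) _
      have := hdf.hasDerivAt
      rw [← iteratedDeriv_succ] at this
      exact this.comp x (h.hasDerivAt_Q x)
    refine ⟨Reg.succ_of h.dec_Q h.hasDerivAt_Q ?_, Reg.succ_of h.bdd_φ h.hasDerivAt_φ ?_,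
      Reg.succ_of h.dec_θ h.hasDerivAt_θ ?_, Reg.succ_of h.dec_σ h.hasDerivAt_σ ?_,
      fun j hj => Reg.succ_of (hbdd j (by omega)) (hd j (by omega)) ?_, fun hk => ?_⟩
    · change DecN m _; fun_prop
    · exact (h3.add h4).bdd
    · exact DecN.bdd_mul (BddN.const 2) (DecN.bdd_mul h2 (h3.add h4))
    · exact DecN.bdd_mul h2 (h4.sub h6)
    · exact BddN.mul (h5 (j + 1) (by omega)) (BddN.neg (h2.mul h1.bdd))
    · refine Reg.succ_of (g' := fun x => iteratedDeriv 2 f (Q x) * -(φ x * Q x)) h.dec_f' (fun x => ?_) ?_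
      · have := hd 1 (by omega) x
        simpa [iteratedDeriv_one] using this
      · exact DecN.bdd_mul (h5 2 (by omega)) (DecN.neg (DecN.bdd_mul h2 h1))

end Profile

end GKdV

/-! ### Exact integrals and solvability of the linear systems -/

namespace GKdV

/-- The function `g` is integrable with integral `v`. -/
def HasInt (g : ℝ → ℝ) (v : ℝ) : Prop := Integrable g ∧ ∫ x, g x = v

namespace HasInt
variable {f g : ℝ → ℝ} {u v : ℝ}

theorem of_dec (h : Dec f) : HasInt f (∫ x, f x) := ⟨h.integrable, rfl⟩

theorem add (hf : HasInt f u) (hg : HasInt g v) : HasInt (fun x => f x + g x) (u + v) :=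
  ⟨hf.1.add hg.1, by rw [integral_add hf.1 hg.1, hf.2, hg.2]⟩

theorem sub (hf : HasInt f u) (hg : HasInt g v) : HasInt (fun x => f x - g x) (u - v) :=
  ⟨hf.1.sub hg.1, by rw [integral_sub hf.1 hg.1, hf.2, hg.2]⟩

theorem const_mul (c : ℝ) (hf : HasInt f u) : HasInt (fun x => c * f x) (c * u) :=
  ⟨hf.1.const_mul c, by rw [integral_const_mul, hf.2]⟩

theorem congr (hf : HasInt f u) (hfg : ∀ x, g x = f x) (huv : v = u) : HasInt g v := by
  have : g = f := funext hfg
  rw [this, huv]; exact hf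

theorem unique (hf : HasInt f u) (hf' : HasInt f v) : u = v := hf.2.symm.trans hf'.2

theorem of_deriv {T T' : ℝ → ℝ} (hT : Dec T) (hT' : Dec T') (h : ∀ x, HasDerivAt T (T' x) x) :
    HasInt T' 0 := ⟨hT'.integrable, hT.integral_deriv_eq_zero hT' h⟩

theorem of_deriv_odd {T T' : ℝ → ℝ} {b : ℝ} (hT : ∀ x, T (-x) = -T x) (hT' : Dec T')
    (hb : Tendsto T atTop (𝓝 b)) (h : ∀ x, HasDerivAt T (T' x) x) : HasInt T' (2 * b) :=
  ⟨hT'.integrable, integral_deriv_of_odd hT hT' hb h⟩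

end HasInt

theorem odd_of_hasDerivAt_even {w w' : ℝ → ℝ} (hd : ∀ x, HasDerivAt w (w' x) x)
    (he : ∀ x, w (-x) = w x) (x : ℝ) : w' (-x) = -w' x := by
  have h1 := ((hd (-x)).comp x (hasDerivAt_neg x)).congr_of_eventuallyEq
    (f₁ := w) (Eventually.of_forall fun y => (he y).symm)
  have := h1.unique (hd x)
  linarith

theorem even_of_hasDerivAt_odd {w w' : ℝ → ℝ} (hd : ∀ x, HasDerivAt w (w' x) x)
    (ho : ∀ x, w (-x) = -w x) (x : ℝ) : w' (-x) = w' x := by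
  have h1 := ((hd (-x)).comp x (hasDerivAt_neg x)).fun_neg.congr_of_eventuallyEq
    (f₁ := w) (Eventually.of_forall fun y => by simp [ho])
  have := h1.unique (hd x)
  linarith

/-- The class of functions which are localized together with their derivatives of order at most
`N - m`. -/
def Loc (N : ℕ∞) (m : ℕ) (g : ℝ → ℝ) : Prop := ∀ k : ℕ, ((k + m : ℕ) : ℕ∞) ≤ N → DecN k g

/-- The class of functions which are bounded together with their derivatives of order at most
`N - m`. -/
def Bdl (N : ℕ∞) (m : ℕ) (g : ℝ → ℝ) : Prop := ∀ k : ℕ, ((k + m : ℕ) : ℕ∞) ≤ N → BddN k g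

section
variable {N : ℕ∞} {m : ℕ} {g g' : ℝ → ℝ}

theorem Loc.mono (h : Loc N m g) {l : ℕ} (hml : m ≤ l) : Loc N l g := fun k hk =>
  h k (le_trans (by exact_mod_cast (by omega : k + m ≤ k + l)) hk)

theorem Bdl.mono (h : Bdl N m g) {l : ℕ} (hml : m ≤ l) : Bdl N l g := fun k hk =>
  h k (le_trans (by exact_mod_cast (by omega : k + m ≤ k + l)) hk)

theorem Loc.dec (h : Loc N m g) (hm : (m : ℕ∞) ≤ N) : Dec g := by
  have := h 0 (by simpa using hm)
  exact this

theorem Loc.of_deriv (h0 : Dec g) (hd : ∀ x, HasDerivAt g (g' x) x) (h : Loc N (m + 1) g') :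
    Loc N m g := by
  intro k hk
  cases k with
  | zero => exact h0
  | succ k => exact Reg.succ_of h0 hd (h k (by convert hk using 2; omega))

theorem Loc.deriv (h : Loc N m g) (hd : ∀ x, HasDerivAt g (g' x) x) : Loc N (m + 1) g' := by
  intro k hk
  have h1 : DecN (k + 1) g := h (k + 1) (by convert hk using 2; omega)
  have h2 : DecN k (_root_.deriv g) := h1.2.2
  have : _root_.deriv g = g' := funext fun x => (hd x).deriv
  rwa [this] at h2

theorem Loc.memY (h : Loc N 0 g) : MemY N g := memY_of_decN fun k hk => h k (by simpa using hk)

theorem Loc.memY_pred (h : Loc N 1 g) (hN : 1 ≤ N) : MemY (N - 1) g := by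
  refine memY_of_decN fun k hk => h k ?_
  have : ((k : ℕ∞) + 1) ≤ N - 1 + 1 := by gcongr
  rw [tsub_add_cancel_of_le hN] at this
  exact_mod_cast this

end

/-- Solutions of the linear systems with source `F = H'`, `G = G° + g₁'`. -/
structure OmegaSol (N : ℕ∞) (f Q φ H G g₁ : ℝ → ℝ) (γ β : ℝ) (A A' J B B' : ℝ → ℝ) (a b : ℝ) :
    Prop where
  hasDerivAt_A : ∀ x, HasDerivAt A (A' x) x
  hasDerivAt_A' : ∀ x, HasDerivAt A'
    ((1 - deriv f (Q x)) * A x - (H x + γ - a * (3 * Q x - 2 * f (Q x)))) x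
  hasDerivAt_J : ∀ x, HasDerivAt J (G x + deriv f (Q x) * A x) x
  hasDerivAt_B : ∀ x, HasDerivAt B (B' x) x
  hasDerivAt_B' : ∀ x, HasDerivAt B'
    ((1 - deriv f (Q x)) * B x - (J x + g₁ x + 3 * a * (φ x * Q x) + 3 * A' x)) x
  even : ∀ x, A (-x) = A x
  odd : ∀ x, B (-x) = -B x
  odd_J : ∀ x, J (-x) = -J x
  loc_A : Loc N 0 fun x => A x - γ
  loc_B : Loc N 0 fun x => B x - b * φ x
  tendsto_J : Tendsto J atTop (𝓝 (b - β))

namespace Profile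

variable {f Q φ : ℝ → ℝ} {C : ℝ} {N : ℕ∞}

theorem loc_Q (h : Profile f Q φ C) (hf : ContDiff ℝ N f) : Loc N 0 Q := fun k hk =>
  (h.regularity (hf.of_le (by exact_mod_cast (by simpa using hk : (k : ℕ∞) ≤ N))) k le_rfl).1

theorem bdl_φ (h : Profile f Q φ C) (hf : ContDiff ℝ N f) : Bdl N 0 φ := fun k hk =>
  (h.regularity (hf.of_le (by exact_mod_cast (by simpa using hk : (k : ℕ∞) ≤ N))) k le_rfl).2.1

theorem loc_θ (h : Profile f Q φ C) (hf : ContDiff ℝ N f) : Loc N 0 fun x => φ x ^ 2 - 1 := fun k hk =>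
  (h.regularity (hf.of_le (by exact_mod_cast (by simpa using hk : (k : ℕ∞) ≤ N))) k le_rfl).2.2.1

theorem loc_σ (h : Profile f Q φ C) (hf : ContDiff ℝ N f) : Loc N 0 fun x => f (Q x) / Q x := fun k hk =>
  (h.regularity (hf.of_le (by exact_mod_cast (by simpa using hk : (k : ℕ∞) ≤ N))) k le_rfl).2.2.2.1

theorem bdl_iteratedDeriv (h : Profile f Q φ C) (hf : ContDiff ℝ N f) (j : ℕ) :
    Bdl N j fun x => iteratedDeriv j f (Q x) := fun k hk =>
  (h.regularity (k := k + j) (hf.of_le (by exact_mod_cast hk)) k (by omega)).2.2.2.2.1 j (by omega)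

theorem loc_f' (h : Profile f Q φ C) (hf : ContDiff ℝ N f) : Loc N 1 fun x => deriv f (Q x) :=
  fun k hk =>
  (h.regularity (k := k + 1) (hf.of_le (by exact_mod_cast hk)) k (by omega)).2.2.2.2.2 (by omega)

theorem loc_φ' (h : Profile f Q φ C) (hf : ContDiff ℝ N f) :
    Loc N 0 fun x => φ x ^ 2 - 1 + f (Q x) / Q x := fun k hk =>
  (h.loc_θ hf k hk).add (h.loc_σ hf k hk)

theorem loc_f (h : Profile f Q φ C) (hf : ContDiff ℝ N f) : Loc N 0 fun x => f (Q x) := by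
  have e : (fun x => f (Q x)) = fun x => f (Q x) / Q x * Q x :=
    funext fun x => (div_mul_cancel₀ _ (h.pos x).ne').symm
  rw [e]
  exact fun k hk => (h.loc_σ hf k hk).mul_bdd (h.loc_Q hf k hk).bdd

/-- The second derivative of `φ`. -/
theorem hasDerivAt_φ' (h : Profile f Q φ C) (x : ℝ) :
    HasDerivAt (fun x => φ x ^ 2 - 1 + f (Q x) / Q x)
      (2 * (φ x * (φ x ^ 2 - 1 + f (Q x) / Q x)) + φ x * (f (Q x) / Q x - deriv f (Q x))) x :=
  (h.hasDerivAt_θ x).fun_add (h.hasDerivAt_σ x)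

theorem loc_Q'' (h : Profile f Q φ C) (hf : ContDiff ℝ N f) :
    Loc N 0 fun x => 3 * Q x - 2 * f (Q x) := fun k hk =>
  (DecN.bdd_mul (BddN.const 3) (h.loc_Q hf k hk)).sub (DecN.bdd_mul (BddN.const 2) (h.loc_f hf k hk))

/-- An odd function with localized derivative is a multiple of `φ` up to a localized function. -/
theorem loc_sub_φ (h : Profile f Q φ C) (hf : ContDiff ℝ N f) {J g : ℝ → ℝ} {b : ℝ} {m : ℕ}
    (hJ : ∀ x, HasDerivAt J (g x) x) (ho : ∀ x, J (-x) = -J x) (hb : Tendsto J atTop (𝓝 b))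
    (hg : Loc N (m + 1) g) (hm : ((m + 1 : ℕ) : ℕ∞) ≤ N) : Loc N m fun x => J x - b * φ x := by
  have hd := fun x => (hJ x).fun_sub ((h.hasDerivAt_φ x).const_mul b)
  have hl : Loc N (m + 1) fun x => g x - b * (φ x ^ 2 - 1 + f (Q x) / Q x) := fun k hk =>
    (hg k hk).sub (DecN.bdd_mul (BddN.const b) (((h.loc_φ' hf).mono (Nat.zero_le _)) k hk))
  refine Loc.of_deriv (Dec.of_deriv (fun x => ?_) hd (hl.dec hm) ?_) hd hl
  · rw [ho, h.odd, ← abs_neg]; congr 1; ring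
  · simpa using hb.sub (h.tendsto_φ.const_mul b)

theorem exists_even_loc (h : Profile f Q φ C) (hf : ContDiff ℝ N f) (hN : 2 ≤ N) {H : ℝ → ℝ}
    (hH : Loc N 2 H) (hHe : ∀ x, H (-x) = H x) :
    ∃ w w' : ℝ → ℝ, (∀ x, HasDerivAt w (w' x) x) ∧
      (∀ x, HasDerivAt w' ((1 - deriv f (Q x)) * w x - H x) x) ∧ (∀ x, w (-x) = w x) ∧
      Loc N 0 w ∧ Dec w' := by
  obtain ⟨hc, M, n, hM⟩ := hH.dec hN
  obtain ⟨K, -, hK⟩ := exists_solution C n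
  obtain ⟨w, w', hw, hw', hwe, -, hb, hb'⟩ := hK h 1 H M hc hM (by simpa using hHe) (Or.inl rfl)
  have hdw : Dec w := ⟨continuous_of_hasDerivAt hw, _, _, hb⟩
  have hdw' : Dec w' := ⟨continuous_of_hasDerivAt hw', _, _, hb'⟩
  refine ⟨w, w', hw, hw', by simpa using hwe, fun k hk => ?_, hdw'⟩
  match k with
  | 0 => exact hdw
  | 1 => exact Reg.succ_of hdw hw hdw'
  | k + 2 =>
    exact decN_of_eq k (h.loc_f' hf k (le_trans (by exact_mod_cast (by omega)) hk)) hdw hdw' hw hw'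
      (hH k (by simpa using hk))

theorem exists_odd_loc (h : Profile f Q φ C) (hf : ContDiff ℝ N f) (hN : 2 ≤ N) {H : ℝ → ℝ}
    (hH : Loc N 2 H) (hHe : ∀ x, H (-x) = -H x) (h0 : ∫ x, φ x * Q x * H x = 0) :
    ∃ w w' : ℝ → ℝ, (∀ x, HasDerivAt w (w' x) x) ∧
      (∀ x, HasDerivAt w' ((1 - deriv f (Q x)) * w x - H x) x) ∧ (∀ x, w (-x) = -w x) ∧
      Loc N 0 w ∧ Dec w' := by
  obtain ⟨hc, M, n, hM⟩ := hH.dec hN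
  obtain ⟨K, -, hK⟩ := exists_solution C n
  obtain ⟨w, w', hw, hw', hwe, -, hb, hb'⟩ := hK h (-1) H M hc hM (by simpa using hHe)
    (Or.inr ⟨rfl, h0⟩)
  have hdw : Dec w := ⟨continuous_of_hasDerivAt hw, _, _, hb⟩
  have hdw' : Dec w' := ⟨continuous_of_hasDerivAt hw', _, _, hb'⟩
  refine ⟨w, w', hw, hw', by simpa using hwe, fun k hk => ?_, hdw'⟩
  match k with
  | 0 => exact hdw
  | 1 => exact Reg.succ_of hdw hw hdw'
  | k + 2 =>
    exact decN_of_eq k (h.loc_f' hf k (le_trans (by exact_mod_cast (by omega)) hk)) hdw hdw' hw hw'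
      (hH k (by simpa using hk))

/-- The linear system is solvable as soon as the scalar solvability constant does not vanish. -/
theorem exists_omegaSol (h : Profile f Q φ C) (hf : ContDiff ℝ N f) (hN : 2 ≤ N)
    {W W' : ℝ → ℝ} (hW : ∀ x, HasDerivAt W (W' x) x)
    (hW' : ∀ x, HasDerivAt W' ((1 - deriv f (Q x)) * W x + (3 * Q x - 2 * f (Q x))) x)
    (hWe : ∀ x, W (-x) = W x) (hWl : Loc N 0 W) (hWd' : Dec W')
    (hc : ∫ x, (Q x ^ 2 + (φ x * Q x) ^ 2 + W x * (3 * Q x - 2 * f (Q x))) ≠ 0)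
    {H G g₁ : ℝ → ℝ} {γ β : ℝ} (hH : Loc N 2 H) (hHe : ∀ x, H (-x) = H x) (hG : Loc N 2 G)
    (hGe : ∀ x, G (-x) = G x) (hg₁ : Loc N 2 fun x => g₁ x - β * φ x) (hg₁o : ∀ x, g₁ (-x) = -g₁ x) :
    ∃ (A A' J B B' : ℝ → ℝ) (a b : ℝ), OmegaSol N f Q φ H G g₁ γ β A A' J B B' a b := by
  have hN0 : ((2 : ℕ) : ℕ∞) ≤ N := by exact_mod_cast hN
  have dQ := h.dec_Q
  have bφ := h.bdd_φ
  have df := h.dec_f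
  have df' := h.dec_f'
  have hHγ : Loc N 2 fun x => H x + γ * deriv f (Q x) := fun k hk =>
    (hH k hk).add (DecN.bdd_mul (BddN.const γ) ((h.loc_f' hf).mono (by omega : 1 ≤ 2) k hk))
  -- Since ℒγ = γ - γ f'(Q), the function γ + V solves ℒ(γ + V) = H + γ.
  obtain ⟨V, V', hV, hV', hVe, hVl, hVd'⟩ := h.exists_even_loc hf hN hHγ
    (fun x => by rw [hHe, h.even])
  have dV : Dec V := hVl.dec (by simp)
  have dW : Dec W := hWl.dec (by simp)
  have dG : Dec G := hG.dec hN0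
  have dg : Dec fun x => g₁ x - β * φ x := hg₁.dec hN0
  have bg : Bdd g₁ := by
    have := dg.bdd.add ((Bdd.const β).mul bφ)
    simpa using this
  set c₀ := ∫ x, (Q x ^ 2 + (φ x * Q x) ^ 2 + W x * (3 * Q x - 2 * f (Q x))) with hc₀
  set I₀ := ∫ x, (-(Q x * (G x + deriv f (Q x) * (γ + V x))) - φ x * Q x * g₁ x
    - 3 * (φ x * Q x * V' x)) with hI₀
  -- The source of the B equation is affine in a, and its integral against φQ equals a c₀ - I₀; this
  -- value of a makes it zero.
  set a := I₀ / c₀ with ha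
  set A : ℝ → ℝ := fun x => γ + V x + a * W x with hA
  set A' : ℝ → ℝ := fun x => V' x + a * W' x with hA'
  have hAd : ∀ x, HasDerivAt A (A' x) x := fun x =>
    ((hV x).const_add γ).fun_add ((hW x).const_mul a)
  have hAd' : ∀ x, HasDerivAt A'
      ((1 - deriv f (Q x)) * A x - (H x + γ - a * (3 * Q x - 2 * f (Q x)))) x := fun x =>
    ((hV' x).fun_add ((hW' x).const_mul a)).congr_deriv (by simp only [hA]; ring)
  have hAe : ∀ x, A (-x) = A x := fun x => by simp [hA, hVe, hWe]
  have hA'o := odd_of_hasDerivAt_even hAd hAe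
  have hAl : Loc N 0 fun x => A x - γ := by
    intro k hk
    have h1 := hVl k hk
    have h2 := hWl k hk
    have e : (fun x => A x - γ) = fun x => V x + a * W x := funext fun x => by simp only [hA]; ring
    rw [e]
    fun_prop
  have dA' : Dec A' := by fun_prop
  have bA : Bdd A := by fun_prop
  have hGl : Loc N 2 fun x => G x + deriv f (Q x) * A x := by
    intro k hk
    have h1 := hG k hk
    have h2 := (h.loc_f' hf).mono (by omega : 1 ≤ 2) k hk
    have h3 : BddN k A := by
      have := ((hAl.mono (by omega : 0 ≤ 2)) k hk).bdd.add (BddN.const γ)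
      simpa using this
    exact h1.add (h2.mul_bdd h3)
  have dGl := hGl.dec hN0
  obtain ⟨J, b', hJ, hJo, bJ, hJb⟩ := dGl.exists_odd_primitive (fun x => by
    rw [hGe, h.even, hAe])
  have hJl := h.loc_sub_φ hf hJ hJo hJb (m := 1) hGl hN0
  set b := b' + β with hb
  set φ'' : ℝ → ℝ := fun x =>
    2 * (φ x * (φ x ^ 2 - 1 + f (Q x) / Q x)) + φ x * (f (Q x) / Q x - deriv f (Q x)) with hφ''
  have hφ''l : Loc N 1 φ'' := (h.loc_φ' hf).deriv h.hasDerivAt_φ'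
  -- The source for w = B - bφ, that is, the source of B minus bℒφ. The limits b' of J and β of g₁
  -- are subtracted separately, so each bracket is localized; b = b' + β because ℒB tends to the
  -- limit of B.
  set S : ℝ → ℝ := fun x => (J x - b' * φ x) + (g₁ x - β * φ x) + 3 * a * (φ x * Q x) + 3 * A' x
    + b * (deriv f (Q x) * φ x + φ'' x) with hS
  have hSl : Loc N 2 S := by
    intro k hk
    have h1 := hJl.mono (by omega : 1 ≤ 2) k hk
    have h2 := hg₁ k hk
    have h3 := (h.loc_Q hf).mono (by omega : 0 ≤ 2) k hk
    have h4 := (h.bdl_φ hf).mono (by omega : 0 ≤ 2) k hk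
    have h5 : DecN k A' := (hAl.deriv fun x => (hAd x).sub_const γ).mono (by omega : 1 ≤ 2) k hk
    have h6 := (h.loc_f' hf).mono (by omega : 1 ≤ 2) k hk
    have h7 := hφ''l.mono (by omega : 1 ≤ 2) k hk
    have key : ∀ u v p : ℝ → ℝ, DecN k u → DecN k v → DecN k p → DecN k fun x =>
        u x + v x + 3 * a * (φ x * Q x) + 3 * A' x + b * (p x * φ x + φ'' x) := by
      intro u v p hu hv hp
      fun_prop
    exact key _ _ _ h1 h2 h6
  have hSo : ∀ x, S (-x) = -S x := by
    intro x
    simp only [hS, hφ'', hJo, hg₁o, h.odd, h.even, hA'o]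
    ring
  have dS := hSl.dec hN0
  have e1 : ∫ x, φ x * Q x * S x = 0 := by
    -- the solvability condition, reduced to the definition of `a` by exact derivatives
    have t1 : HasInt (fun x => φ'' x * (φ x * Q x) + (1 - deriv f (Q x)) * -(φ x * Q x) * φ x) 0 := by
      refine HasInt.of_deriv
        (T := fun x => (φ x ^ 2 - 1 + f (Q x) / Q x) * (φ x * Q x) + (Q x - f (Q x)) * φ x) ?_ ?_ ?_
      · exact ((h.dec_θ.add h.dec_σ).mul_bdd (bφ.mul dQ.bdd)).add ((dQ.sub df).mul_bdd bφ)
      · have d1 : Dec φ'' := hφ''l.dec (le_trans (by norm_num) hN)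
        exact (d1.mul_bdd (bφ.mul dQ.bdd)).add
          ((Dec.bdd_mul ((Bdd.const 1).sub df'.bdd) (Dec.bdd_mul bφ dQ).neg).mul_bdd bφ)
      · intro x
        refine (((h.hasDerivAt_φ' x).fun_mul ((h.hasDerivAt_φ x).fun_mul (h.hasDerivAt_Q x))).fun_add
          ((h.hasDerivAt_Q'' x).fun_mul (h.hasDerivAt_φ x))).congr_deriv ?_
        have hq := (h.pos x).ne'
        simp only [hφ'']
        field_simp
        ring
    have t2 : HasInt (fun x => -(φ x * Q x) * J x + Q x * (G x + deriv f (Q x) * A x)) 0 :=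
      HasInt.of_deriv (T := fun x => Q x * J x) (dQ.mul_bdd bJ)
        (((Dec.bdd_mul bφ dQ).neg.mul_bdd bJ).add (dQ.mul_bdd dGl.bdd))
        (fun x => ((h.hasDerivAt_Q x).fun_mul (hJ x)))
    -- Turns the coefficient of a in ∫ φQS, namely the integral of Qf'(Q)W + 3(φQ)² + 3φQW', into
    -- c₀.
    have t3 : HasInt (fun x => -(Q x * (deriv f (Q x) * W x)) - 3 * (φ x * Q x) ^ 2
        - 3 * (φ x * Q x * W' x) + (Q x ^ 2 + (φ x * Q x) ^ 2 + W x * (3 * Q x - 2 * f (Q x)))) 0 := by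
      refine HasInt.of_deriv
        (T := fun x => Q x * W' x + 2 * (-(φ x * Q x) * W x) - 2 * (Q x * -(φ x * Q x)))
        (by fun_prop) ?_ ?_
      · have key : ∀ p F : ℝ → ℝ, Dec p → Dec F → Dec fun x => (-(Q x * (p x * W x))
            - 3 * (φ x * Q x) ^ 2 - 3 * (φ x * Q x * W' x)
            + (Q x ^ 2 + (φ x * Q x) ^ 2 + W x * (3 * Q x - 2 * F x))) := by
          intro p F hp hF
          fun_prop
        exact key _ _ df' df
      · intro x
        refine ((((h.hasDerivAt_Q x).fun_mul (hW' x)).fun_add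
          (((h.hasDerivAt_Q' x).fun_mul (hW x)).const_mul 2)).fun_sub
          (((h.hasDerivAt_Q x).fun_mul (h.hasDerivAt_Q' x)).const_mul 2)).congr_deriv ?_
        ring
    have i1 := HasInt.of_dec (f := fun x => Q x ^ 2 + (φ x * Q x) ^ 2
        + W x * (3 * Q x - 2 * f (Q x))) (by
      have key : ∀ F : ℝ → ℝ, Dec F → Dec fun x =>
          Q x ^ 2 + (φ x * Q x) ^ 2 + W x * (3 * Q x - 2 * F x) := fun F hF => by fun_prop
      exact key _ df)
    have i2 := HasInt.of_dec (f := fun x => -(Q x * (G x + deriv f (Q x) * (γ + V x)))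
        - φ x * Q x * g₁ x - 3 * (φ x * Q x * V' x)) (by
      have key : ∀ p : ℝ → ℝ, Dec p → Dec fun x => -(Q x * (G x + p x * (γ + V x)))
        - φ x * Q x * g₁ x - 3 * (φ x * Q x * V' x) := fun F hF => by fun_prop
      exact key _ df')
    rw [← hc₀] at i1
    rw [← hI₀] at i2
    exact ((((((t1.const_mul b).sub t2).sub i2).add (i1.const_mul a)).sub (t3.const_mul a)).congr
      (fun x => by simp only [hS, hA, hA', hb]; ring) (by
        rw [ha, div_mul_cancel₀ _ hc]; ring : (0 : ℝ) = _)).2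
  obtain ⟨w, w', hw, hw', hwo, hwl, hwd'⟩ := h.exists_odd_loc hf hN hSl hSo e1
  refine ⟨A, A', J, fun x => w x + b * φ x, fun x => w' x + b * (φ x ^ 2 - 1 + f (Q x) / Q x), a, b,
    hAd, hAd', hJ, fun x => (hw x).fun_add ((h.hasDerivAt_φ x).const_mul b), fun x => ?_, hAe,
    fun x => ?_, hJo, hAl, ?_, ?_⟩
  · refine ((hw' x).fun_add ((h.hasDerivAt_φ' x).const_mul b)).congr_deriv ?_
    simp only [hS, hφ'', hb]
    ring
  · rw [hwo, h.odd]; ring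
  · simpa using hwl
  · simpa [hb] using hJb

end Profile

end GKdV

/-! ### The normalized first order solution -/

namespace GKdV

/-- The normalized first order solution, with `J' = A + a Q` the odd primitive which enters the
equation `ℒ B = J + 2 A' - a Q'`. -/
structure FirstSol (N : ℕ∞) (f Q φ A A' J B B' : ℝ → ℝ) (a b : ℝ) : Prop where
  hasDerivAt_A : ∀ x, HasDerivAt A (A' x) x
  hasDerivAt_A' : ∀ x, HasDerivAt A'
    ((1 - deriv f (Q x)) * A x - (deriv f (Q x) - a * (3 * Q x - 2 * f (Q x)))) x
  hasDerivAt_J : ∀ x, HasDerivAt J (A x + a * Q x) x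
  hasDerivAt_B : ∀ x, HasDerivAt B (B' x) x
  hasDerivAt_B' : ∀ x, HasDerivAt B'
    ((1 - deriv f (Q x)) * B x - (J x + 2 * A' x + a * (φ x * Q x))) x
  even : ∀ x, A (-x) = A x
  odd : ∀ x, B (-x) = -B x
  odd_J : ∀ x, J (-x) = -J x
  loc_A : Loc N 0 A
  loc_B : Loc N 0 fun x => B x - b * φ x
  tendsto_J : Tendsto J atTop (𝓝 b)
  orth : HasInt (fun x => a * (Q x ^ 2 + (φ x * Q x) ^ 2) + A x * (3 * Q x - 2 * f (Q x))) 0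
  normalized : ∫ x, φ x * Q x * B x = 0

namespace Profile

variable {f Q φ : ℝ → ℝ} {C : ℝ} {N : ℕ∞}

theorem loc_Q' (h : Profile f Q φ C) (hf : ContDiff ℝ N f) : Loc N 0 fun x => φ x * Q x :=
  fun k hk => DecN.bdd_mul (h.bdl_φ hf k hk) (h.loc_Q hf k hk)

/-- Exact integral of `Q' ℒ w`. -/
theorem hasInt_Q'_mul (h : Profile f Q φ C) {w w' g : ℝ → ℝ} (hw : Bdd w) (hw' : Bdd w') (hg : Bdd g)
    (hd : ∀ x, HasDerivAt w (w' x) x)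
    (hd' : ∀ x, HasDerivAt w' ((1 - deriv f (Q x)) * w x - g x) x) :
    HasInt (fun x => φ x * Q x * g x) 0 := by
  have dQ := h.dec_Q
  have bφ := h.bdd_φ
  refine HasInt.of_deriv (T := fun x => -(φ x * Q x) * w' x - (Q x - f (Q x)) * w x) ?_ (by fun_prop)
    fun x => ?_
  · have key : ∀ F : ℝ → ℝ, Dec F → Dec fun x => -(φ x * Q x) * w' x - (Q x - F x) * w x :=
      fun F hF => by fun_prop
    exact key _ h.dec_f
  · refine (((h.hasDerivAt_Q' x).fun_mul (hd' x)).fun_sub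
      ((h.hasDerivAt_Q'' x).fun_mul (hd x))).congr_deriv ?_
    ring

theorem exists_firstSol (h : Profile f Q φ C) (hf : ContDiff ℝ N f) (hN : 3 ≤ N)
    {W W' : ℝ → ℝ} (hW : ∀ x, HasDerivAt W (W' x) x)
    (hW' : ∀ x, HasDerivAt W' ((1 - deriv f (Q x)) * W x + (3 * Q x - 2 * f (Q x))) x)
    (hWe : ∀ x, W (-x) = W x) (hWl : Loc N 0 W) (hWd' : Dec W')
    (hc : ∫ x, (Q x ^ 2 + (φ x * Q x) ^ 2 + W x * (3 * Q x - 2 * f (Q x))) ≠ 0) :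
    ∃ (A A' J B B' : ℝ → ℝ) (a b : ℝ), FirstSol N f Q φ A A' J B B' a b := by
  have hN2 : (2 : ℕ∞) ≤ N := le_trans (by norm_num) hN
  have hN1 : ((1 : ℕ) : ℕ∞) ≤ N := le_trans (by norm_num) hN
  have hN0 : ((0 : ℕ) : ℕ∞) ≤ N := by simp
  have dQ := h.dec_Q
  have bφ := h.bdd_φ
  have df := h.dec_f
  have df' := h.dec_f'
  obtain ⟨A, A', J, B, B', a, b, S⟩ := h.exists_omegaSol hf hN2 hW hW' hWe hWl hWd' hc
    (H := fun x => deriv f (Q x)) (G := fun x => deriv f (Q x)) (g₁ := fun _ => 0) (γ := 0) (β := 0)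
    ((h.loc_f' hf).mono (by omega)) (fun x => by rw [h.even]) ((h.loc_f' hf).mono (by omega))
    (fun x => by rw [h.even])
    (fun k _ => by simpa using DecN.bdd_mul (BddN.const 0) (h.loc_Q hf 0 hN0 |> fun _ =>
      ((h.loc_Q hf).mono (by omega : 0 ≤ 2)) k (by assumption)))
    (fun x => by simp)
  have lA : Loc N 0 A := by simpa using S.loc_A
  have lA' : Loc N 1 A' := lA.deriv S.hasDerivAt_A
  have dA : Dec A := lA.dec hN0
  have dA' : Dec A' := lA'.dec hN1
  have hA'o := odd_of_hasDerivAt_even S.hasDerivAt_A S.even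
  have dBφ := S.loc_B.dec hN0
  have bB : Bdd B := by
    have := dBφ.bdd.add ((Bdd.const b).mul bφ)
    simpa using this
  have dφ' : Dec fun x => φ x ^ 2 - 1 + f (Q x) / Q x := h.dec_θ.add h.dec_σ
  have dB' : Dec B' := by
    have h1 := (S.loc_B.deriv fun x => (S.hasDerivAt_B x).fun_sub ((h.hasDerivAt_φ x).const_mul b)).dec hN1
    have := h1.add (Dec.bdd_mul (Bdd.const b) dφ')
    simpa using this
  -- Adding A' - 2aQ' absorbs f'(Q)(1 + A): by the equations of A and Q the derivative collapses to
  -- A + aQ. Both added terms decay, so the limit is still b.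
  set J₁ : ℝ → ℝ := fun x => J x + A' x + 2 * a * (φ x * Q x) with hJ₁
  have hJ₁d : ∀ x, HasDerivAt J₁ (A x + a * Q x) x := by
    intro x
    refine (((S.hasDerivAt_J x).fun_add (S.hasDerivAt_A' x)).fun_add
      (((h.hasDerivAt_Q' x).fun_neg).const_mul (2 * a))).congr_of_eventuallyEq
      (Eventually.of_forall fun y => by simp [hJ₁]) |>.congr_deriv ?_
    ring
  have hJ₁t : Tendsto J₁ atTop (𝓝 b) := by
    have h1 := (S.tendsto_J.add dA'.tendsto_atTop).add
      ((h.bdd_φ |> fun hb => Dec.bdd_mul hb dQ).tendsto_atTop.const_mul (2 * a))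
    simpa using h1
  have hJ₁o : ∀ x, J₁ (-x) = -J₁ x := fun x => by
    simp only [hJ₁, S.odd_J, hA'o, h.odd, h.even]; ring
  have dJ₁' : Dec fun x => A x + a * Q x := by fun_prop
  have bJ₁ : Bdd J₁ := by
    have h1 : Loc N 0 fun x => J₁ x - b * φ x := h.loc_sub_φ hf hJ₁d hJ₁o hJ₁t (m := 0)
      (fun k hk => (lA.mono (by omega : 0 ≤ 1) k hk).add
        (DecN.bdd_mul (BddN.const a) ((h.loc_Q hf).mono (by omega : 0 ≤ 1) k hk))) hN1
    have := (h1.dec hN0).bdd.add ((Bdd.const b).mul bφ)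
    simpa using this
  have hB1 : ∀ x, HasDerivAt B'
      ((1 - deriv f (Q x)) * B x - (J₁ x + 2 * A' x + a * (φ x * Q x))) x := fun x =>
    (S.hasDerivAt_B' x).congr_deriv (by simp only [hJ₁]; ring)
  -- The solvability condition of the B equation, freed of B and J: ∫ Q'ℒB = 0, then J and A' are
  -- integrated by parts.
  have horth : HasInt (fun x => a * (Q x ^ 2 + (φ x * Q x) ^ 2) + A x * (3 * Q x - 2 * f (Q x))) 0 := by
    have t1 := h.hasInt_Q'_mul bB dB'.bdd (by fun_prop) S.hasDerivAt_B hB1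
    have t2 : HasInt (fun x => -(φ x * Q x) * J₁ x + Q x * (A x + a * Q x)) 0 :=
      HasInt.of_deriv (dQ.mul_bdd bJ₁) (by fun_prop)
        (fun x => ((h.hasDerivAt_Q x).fun_mul (hJ₁d x)))
    have t3 : HasInt (fun x => (A' x * -(φ x * Q x)) + A x * (Q x - f (Q x))) 0 := by
      refine HasInt.of_deriv (T := fun x => A x * -(φ x * Q x)) (by fun_prop) ?_
        (fun x => ((S.hasDerivAt_A x).fun_mul (h.hasDerivAt_Q' x)))
      have key : ∀ F : ℝ → ℝ, Dec F → Dec fun x => (A' x * -(φ x * Q x)) + A x * (Q x - F x) :=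
        fun F hF => by fun_prop
      exact key _ df
    exact ((t1.add t2).add (t3.const_mul 2)).congr (fun x => by ring) (by ring)
  set I := ∫ x, (φ x * Q x) ^ 2 with hI
  have dI : Dec fun x => (φ x * Q x) ^ 2 := by fun_prop
  have hIpos : 0 < I := by
    refine lt_of_le_of_ne (integral_nonneg fun x => sq_nonneg _) fun h0 => ?_
    have h1 := (integral_eq_zero_iff_of_nonneg (fun x => sq_nonneg (φ x * Q x)) dI.integrable).1 h0.symm
    have h2 := Continuous.ae_eq_iff_eq volume dI.continuous continuous_const |>.1 h1
    have h3 : ∀ x, φ x = 0 := fun x => by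
      have h6 : (φ x * Q x) ^ 2 = 0 := congrFun h2 x
      exact (mul_eq_zero.1 (pow_eq_zero_iff two_ne_zero |>.1 h6)).resolve_right (h.pos x).ne'
    have h4 := (h.hasDerivAt_φ 0).congr_of_eventuallyEq (f₁ := fun _ => 0)
      (Eventually.of_forall fun x => (h3 x).symm)
    have h5 := h4.unique (hasDerivAt_const (0 : ℝ) (0 : ℝ))
    linarith [h.gamma_pos 0]
  have iB := HasInt.of_dec (f := fun x => φ x * Q x * B x) (by fun_prop)
  -- B may be changed by any multiple of Q' without affecting the equations or the limit; this
  -- multiple is the projection onto Q', which is not identically zero because φ' > 0.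
  set κ := (∫ x, φ x * Q x * B x) / I with hκ
  refine ⟨A, A', J₁, fun x => B x - κ * (φ x * Q x), fun x => B' x + κ * (Q x - f (Q x)), a, b,
    S.hasDerivAt_A, fun x => (S.hasDerivAt_A' x).congr_deriv (by ring), hJ₁d, fun x => ?_, fun x => ?_,
    S.even, fun x => by rw [S.odd, h.odd, h.even]; ring, hJ₁o, lA, fun k hk => ?_, hJ₁t, horth, ?_⟩
  · refine ((S.hasDerivAt_B x).fun_add ((h.hasDerivAt_Q' x).const_mul κ)).congr_of_eventuallyEq
      (Eventually.of_forall fun y => by ring)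
  · refine ((hB1 x).fun_add ((h.hasDerivAt_Q'' x).const_mul κ)).congr_deriv ?_
    ring
  · have := (S.loc_B k hk).sub (DecN.bdd_mul (BddN.const κ) (h.loc_Q' hf k hk))
    have e : (fun x => B x - κ * (φ x * Q x) - b * φ x) =
        fun x => (B x - b * φ x) - κ * (φ x * Q x) := funext fun x => by ring
    rw [e]; exact this
  · have i2 := HasInt.of_dec dI
    rw [← hI] at i2
    exact ((iB.sub (i2.const_mul κ)).congr (fun x => by ring)
      (by rw [hκ, div_mul_cancel₀ _ hIpos.ne', sub_self] : (0 : ℝ) = _)).2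

end Profile

theorem OmegaSol.solvesOmega {N : ℕ∞} {f Q φ H G g₁ F g₁' A A' J B B' : ℝ → ℝ} {C γ β a b : ℝ}
    (h : Profile f Q φ C) (S : OmegaSol N f Q φ H G g₁ γ β A A' J B B' a b)
    (hH : ∀ x, HasDerivAt H (F x) x) (hg : ∀ x, HasDerivAt g₁ (g₁' x) x) :
    SolvesOmega f Q F (fun x => G x + g₁' x) A B a := by
  have eQ : deriv Q = fun x => -(φ x * Q x) := funext fun x => (h.hasDerivAt_Q x).deriv
  have eA : deriv A = A' := funext fun x => (S.hasDerivAt_A x).deriv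
  have eB : deriv B = B' := funext fun x => (S.hasDerivAt_B x).deriv
  have eQ2 : iteratedDeriv 2 Q = fun x => Q x - f (Q x) := by
    rw [iteratedDeriv_succ, iteratedDeriv_one, eQ]
    exact funext fun x => (h.hasDerivAt_Q' x).deriv
  have eA2 : iteratedDeriv 2 A = fun x =>
      (1 - deriv f (Q x)) * A x - (H x + γ - a * (3 * Q x - 2 * f (Q x))) := by
    rw [iteratedDeriv_succ, iteratedDeriv_one, eA]
    exact funext fun x => (S.hasDerivAt_A' x).deriv
  have eB2 : iteratedDeriv 2 B = fun x =>
      (1 - deriv f (Q x)) * B x - (J x + g₁ x + 3 * a * (φ x * Q x) + 3 * A' x) := by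
    rw [iteratedDeriv_succ, iteratedDeriv_one, eB]
    exact funext fun x => (S.hasDerivAt_B' x).deriv
  have lA : linOp f Q A = fun x => H x + γ - a * (3 * Q x - 2 * f (Q x)) := by
    funext x; rw [linOp, eA2]; ring
  have lB : linOp f Q B = fun x => J x + g₁ x - 3 * a * -(φ x * Q x) + 3 * A' x := by
    funext x; rw [linOp, eB2]; ring
  have hq : ∀ x, HasDerivAt (fun y => 3 * Q y - 2 * f (Q y))
      (3 * -(φ x * Q x) - 2 * (deriv f (Q x) * -(φ x * Q x))) x := fun x =>
    ((h.hasDerivAt_Q x).const_mul 3).fun_sub ((h.hasDerivAt_fQ x).const_mul 2)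
  refine ⟨fun x => ?_, fun x => ?_⟩
  · rw [lA, (((hH x).add_const γ).fun_sub ((hq x).const_mul a)).deriv, (hq x).deriv]
    ring
  · rw [lB, ((((S.hasDerivAt_J x).fun_add (hg x)).fun_sub ((h.hasDerivAt_Q' x).const_mul (3 * a))).fun_add
      ((S.hasDerivAt_A' x).const_mul 3)).deriv, eQ2, eA2]
    ring

theorem Profile.resonance_eq {f Q φ : ℝ → ℝ} {C : ℝ} (h : Profile f Q φ C) : resonance Q = φ := by
  funext x
  have := (h.pos x).ne'
  rw [resonance, (h.hasDerivAt_Q x).deriv]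
  field_simp

theorem Profile.isSoliton {f Q φ : ℝ → ℝ} {C : ℝ} (h : Profile f Q φ C) : IsSoliton f Q := by
  have eQ : deriv Q = fun x => -(φ x * Q x) := funext fun x => (h.hasDerivAt_Q x).deriv
  have dQ := h.dec_Q
  have bφ := h.bdd_φ
  have hmem : ∀ g : ℝ → ℝ, Dec g → MemLp g 2 volume := fun g hg => by
    rw [memLp_two_iff_integrable_sq hg.continuous.aestronglyMeasurable]
    exact hg.pow_two.integrable
  have eQ2 : iteratedDeriv 2 Q = fun x => Q x - f (Q x) := by
    rw [iteratedDeriv_succ, iteratedDeriv_one, eQ]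
    exact funext fun x => (h.hasDerivAt_Q' x).deriv
  refine ⟨?_, h.pos, h.even, hmem Q dQ, ?_, fun x => by rw [eQ2]; ring⟩
  · have : DecN 2 Q := by
      refine Reg.succ_of dQ h.hasDerivAt_Q (Reg.succ_of ?_ h.hasDerivAt_Q' ?_)
      · fun_prop
      · exact dQ.sub h.dec_f
    exact_mod_cast this.contDiff fun _ => Dec.continuous
  · rw [eQ]; exact hmem _ (by fun_prop)

theorem OmegaSol.hasLimitForm {N : ℕ∞} {f Q φ H G g₁ A A' J B B' : ℝ → ℝ} {C γ β a b : ℝ}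
    (h : Profile f Q φ C) (S : OmegaSol N f Q φ H G g₁ γ β A A' J B B' a b) :
    HasLimitForm N Q A B γ b := by
  refine ⟨S.even, S.odd, S.loc_A.memY, by rw [h.resonance_eq]; exact S.loc_B.memY, ?_, ?_⟩
  · simpa using (S.loc_A.dec (by simp)).tendsto_atTop.add_const γ
  · simpa using (S.loc_B.dec (by simp)).tendsto_atTop.add (h.tendsto_φ.const_mul b)

theorem OmegaSol.hasIP {N : ℕ∞} {f Q φ H G g₁ A A' J B B' : ℝ → ℝ} {C γ β a b : ℝ}
    (h : Profile f Q φ C) (hf : ContDiff ℝ N f) (hN : 1 ≤ N)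
    (S : OmegaSol N f Q φ H G g₁ γ β A A' J B B' a b) : HasIP N A B := by
  have eA : deriv A = A' := funext fun x => (S.hasDerivAt_A x).deriv
  have eB : deriv B = B' := funext fun x => (S.hasDerivAt_B x).deriv
  rw [HasIP, eA, eB]
  refine ⟨(S.loc_A.deriv fun x => (S.hasDerivAt_A x).sub_const γ).memY_pred hN, Loc.memY_pred ?_ hN⟩
  intro k hk
  have h1 := (S.loc_B.deriv fun x => (S.hasDerivAt_B x).fun_sub ((h.hasDerivAt_φ x).const_mul b)) k hk
  have h2 := h1.add (DecN.bdd_mul (BddN.const b) ((h.loc_φ' hf).mono (by omega : 0 ≤ 1) k hk))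
  simpa using h2

theorem FirstSol.isFirstOrder {N : ℕ∞} {f Q φ A A' J B B' : ℝ → ℝ} {C a b : ℝ}
    (h : Profile f Q φ C) (S : FirstSol N f Q φ A A' J B B' a b) :
    IsFirstOrder N f Q A B a b := by
  have eQ : deriv Q = fun x => -(φ x * Q x) := funext fun x => (h.hasDerivAt_Q x).deriv
  have eA : deriv A = A' := funext fun x => (S.hasDerivAt_A x).deriv
  have eB : deriv B = B' := funext fun x => (S.hasDerivAt_B x).deriv
  have eQ2 : iteratedDeriv 2 Q = fun x => Q x - f (Q x) := by
    rw [iteratedDeriv_succ, iteratedDeriv_one, eQ]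
    exact funext fun x => (h.hasDerivAt_Q' x).deriv
  have eA2 : iteratedDeriv 2 A = fun x =>
      (1 - deriv f (Q x)) * A x - (deriv f (Q x) - a * (3 * Q x - 2 * f (Q x))) := by
    rw [iteratedDeriv_succ, iteratedDeriv_one, eA]
    exact funext fun x => (S.hasDerivAt_A' x).deriv
  have eB2 : iteratedDeriv 2 B = fun x =>
      (1 - deriv f (Q x)) * B x - (J x + 2 * A' x + a * (φ x * Q x)) := by
    rw [iteratedDeriv_succ, iteratedDeriv_one, eB]
    exact funext fun x => (S.hasDerivAt_B' x).deriv
  have lA : linOp f Q A = fun x => deriv f (Q x) - a * (3 * Q x - 2 * f (Q x)) := by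
    funext x; rw [linOp, eA2]; ring
  have lB : linOp f Q B = fun x => J x + 2 * A' x - a * -(φ x * Q x) := by
    funext x; rw [linOp, eB2]; ring
  have hq : ∀ x, HasDerivAt (fun y => 3 * Q y - 2 * f (Q y))
      (3 * -(φ x * Q x) - 2 * (deriv f (Q x) * -(φ x * Q x))) x := fun x =>
    ((h.hasDerivAt_Q x).const_mul 3).fun_sub ((h.hasDerivAt_fQ x).const_mul 2)
  have hp : ∀ x, DifferentiableAt ℝ (fun y => deriv f (Q y)) x := fun x => by
    have h1 : DifferentiableAt ℝ (deriv f) (Q x) :=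
      ((h.contDiff.iterate_deriv' 2 1).differentiable (by norm_num)) _
    exact h1.comp x (h.hasDerivAt_Q x).differentiableAt
  refine ⟨⟨fun x => ?_, fun x => ?_⟩, ⟨S.even, S.odd, by simpa using S.loc_A.memY,
    by rw [h.resonance_eq]; exact S.loc_B.memY, (S.loc_A.dec (by simp)).tendsto_atTop, ?_⟩, ?_⟩
  · rw [lA, ((hp x).hasDerivAt.fun_sub ((hq x).const_mul a)).deriv, (hq x).deriv]
    ring
  · rw [lB, (((S.hasDerivAt_J x).fun_add ((S.hasDerivAt_A' x).const_mul 2)).fun_sub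
      ((h.hasDerivAt_Q' x).const_mul a)).deriv, eQ2, eA2]
    ring
  · simpa using (S.loc_B.dec (by simp)).tendsto_atTop.add (h.tendsto_φ.const_mul b)
  · rw [eQ]
    simp only [neg_mul, integral_neg, S.normalized, neg_zero]

end GKdV

/-! ### The second order limit as an integral of first order data -/

namespace GKdV

/-- The limit of the second order solution, in terms of the source terms. -/
theorem hasInt_of_omega {Q φ F p A A' J A₂ A₂' V J₂ B₂ B₂' H G g₁ : ℝ → ℝ} {a b γ a₂ v : ℝ}
    (dQ : Dec Q) (bφ : Bdd φ) (dF : Dec F) (dp : Dec p) (dA : Dec A) (dA' : Dec A')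
    (dV : Dec V) (dA₂' : Dec A₂') (bJ₂ : Bdd J₂) (bB₂ : Bdd B₂) (bB₂' : Bdd B₂')
    (dH : Dec H) (dG : Dec G) (bg₁ : Bdd g₁)
    (hQ : ∀ x, HasDerivAt Q (-(φ x * Q x)) x)
    (hQ' : ∀ x, HasDerivAt (fun x => -(φ x * Q x)) (Q x - F x) x)
    (hQ'' : ∀ x, HasDerivAt (fun x => Q x - F x) ((1 - p x) * -(φ x * Q x)) x)
    (hA : ∀ x, HasDerivAt A (A' x) x)
    (hA' : ∀ x, HasDerivAt A' ((1 - p x) * A x - (p x - a * (3 * Q x - 2 * F x))) x)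
    (hJ : ∀ x, HasDerivAt J (A x + a * Q x) x) (oJ : ∀ x, J (-x) = -J x)
    (tJ : Tendsto J atTop (𝓝 b))
    (horth : HasInt (fun x => a * (Q x ^ 2 + (φ x * Q x) ^ 2) + A x * (3 * Q x - 2 * F x)) 0)
    (eV : ∀ x, V x = A₂ x - γ) (hA₂ : ∀ x, HasDerivAt A₂ (A₂' x) x)
    (hA₂' : ∀ x, HasDerivAt A₂' ((1 - p x) * A₂ x - (H x + γ - a₂ * (3 * Q x - 2 * F x))) x)
    (hJ₂ : ∀ x, HasDerivAt J₂ (G x + p x * A₂ x) x) (oJ₂ : ∀ x, J₂ (-x) = -J₂ x)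
    (tJ₂ : Tendsto J₂ atTop (𝓝 v))
    (hB₂ : ∀ x, HasDerivAt B₂ (B₂' x) x)
    (hB₂' : ∀ x, HasDerivAt B₂'
      ((1 - p x) * B₂ x - (J₂ x + g₁ x + 3 * a₂ * (φ x * Q x) + 3 * A₂' x)) x) :
    HasInt (fun x => G x * (1 - a * Q x) + a * g₁ x * -(φ x * Q x) + H x * (A x + a * Q x))
      (2 * v - 2 * γ * b) := by
  have eA₂ : A₂ = fun x => V x + γ := funext fun x => by rw [eV]; ring
  have hV : ∀ x, HasDerivAt V (A₂' x) x := fun x =>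
    ((hA₂ x).sub_const γ).congr_of_eventuallyEq (Eventually.of_forall eV)
  subst eA₂
  have s1 : HasInt (fun x => G x + p x * (V x + γ)) (2 * v) :=
    HasInt.of_deriv_odd oJ₂ (by fun_prop) tJ₂ hJ₂
  have s2 : HasInt (fun x => φ x * Q x * (J₂ x + g₁ x + 3 * a₂ * (φ x * Q x) + 3 * A₂' x)) 0 := by
    refine HasInt.of_deriv (T := fun x => -(φ x * Q x) * B₂' x - (Q x - F x) * B₂ x)
      (by fun_prop) (by fun_prop) fun x => ?_
    refine (((hQ' x).fun_mul (hB₂' x)).fun_sub ((hQ'' x).fun_mul (hB₂ x))).congr_deriv ?_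
    ring
  have s3 : HasInt (fun x => -(φ x * Q x) * J₂ x + Q x * (G x + p x * (V x + γ))) 0 :=
    HasInt.of_deriv (T := fun x => Q x * J₂ x) (by fun_prop) (by fun_prop)
      fun x => (hQ x).fun_mul (hJ₂ x)
  -- Mainly the Wronskian of A + aQ with A₂ - γ: self-adjointness of ℒ replaces the integral of
  -- f'(Q)A₂ by integrals of the known source H.
  have s4 := HasInt.of_deriv
    (T := fun x => (A' x + a * -(φ x * Q x)) * V x - (A x + a * Q x) * A₂' x
      - 3 * a * (-(φ x * Q x) * V x) + γ * (A' x - 2 * a * -(φ x * Q x))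
      + 2 * a * a₂ * (Q x * -(φ x * Q x))) (by fun_prop) ?_
    fun x => ((((((hA' x).fun_add ((hQ' x).const_mul a)).fun_mul (hV x)).fun_sub
      (((hA x).fun_add ((hQ x).const_mul a)).fun_mul (hA₂' x))).fun_sub
      (((hQ' x).fun_mul (hV x)).const_mul (3 * a))).fun_add
      (((hA' x).fun_sub ((hQ' x).const_mul (2 * a))).const_mul γ)).fun_add
      (((hQ x).fun_mul (hQ' x)).const_mul (2 * a * a₂))
  · have s5 : HasInt (fun x => A x + a * Q x) (2 * b) :=
      HasInt.of_deriv_odd oJ (by fun_prop) tJ hJ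
    -- The coefficient of a₂ is exactly the orthogonality integrand of the first order solution, so
    -- a₂ drops out; ∫ (A + aQ) = 2b accounts for -2γb.
    refine (((((s1.sub (s2.const_mul a)).sub (s3.const_mul a)).add s4).add
      (horth.const_mul a₂)).sub (s5.const_mul γ)).congr (fun x => ?_) (by ring)
    ring
  · fun_prop

/-- Reduction of the integrand of the second order limit. -/
theorem hasInt_reduction {Q φ F p r A A' J B B' Z : ℝ → ℝ} {a e : ℝ}
    (dQ : Dec Q) (bφ : Bdd φ) (dF : Dec F) (dp : Dec p) (dr : Dec r) (dA : Dec A) (dA' : Dec A')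
    (bJ : Bdd J) (bB : Bdd B) (dB' : Dec B') (dBJ : Dec fun x => B x - J x) (dZ : Dec Z)
    (hQ : ∀ x, HasDerivAt Q (-(φ x * Q x)) x)
    (hQ' : ∀ x, HasDerivAt (fun x => -(φ x * Q x)) (Q x - F x) x)
    (hF : ∀ x, HasDerivAt F (p x * -(φ x * Q x)) x)
    (hp : ∀ x, HasDerivAt p ((2 * e + r x) * -(φ x * Q x)) x)
    (hA : ∀ x, HasDerivAt A (A' x) x)
    (hA' : ∀ x, HasDerivAt A' ((1 - p x) * A x - (p x - a * (3 * Q x - 2 * F x))) x)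
    (hJ : ∀ x, HasDerivAt J (A x + a * Q x) x)
    (hB : ∀ x, HasDerivAt B (B' x) x)
    (hB' : ∀ x, HasDerivAt B' ((1 - p x) * B x - (J x + 2 * A' x + a * (φ x * Q x))) x)
    (hZ : ∀ x, HasDerivAt Z (3 * A' x + 3 * ((1 - p x) * B x - (J x + 2 * A' x + a * (φ x * Q x)))
      + p x * B x) x) :
    HasInt (fun x =>
      ((1 / 2 * ((2 * e + r x) * (1 + A x) ^ 2 - 2 * e) + 3 / 2 * a ^ 2 * (Q x - F x)
          - e * (A x + 3 * B' x)) * (1 - a * Q x)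
        + a * (-(1 / 2) * a * (9 * A' x + 3 * ((1 - p x) * B x - (J x + 2 * A' x + a * (φ x * Q x)))
            + p x * B x) + 1 / 2 * (2 * e + r x) * (1 + A x) * B x) * -(φ x * Q x)
        + (1 / 2 * ((2 * e + r x) * (1 + A x) ^ 2 - 2 * e)
          - a * (p x * (1 + A x) + 3 * ((1 - p x) * A x - (p x - a * (3 * Q x - 2 * F x))))
          + 3 * a ^ 2 * (Q x - F x) + e * (a * Q x - Z x)) * (A x + a * Q x))
      - (1 / 2 * ((2 * e + r x) * (1 + A x) ^ 2 - 2 * e) * (1 + A x)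
        + a * (-(3 / 2) * A x ^ 2 + 3 * A' x ^ 2)
        + a ^ 2 * (4 * A x * (Q x - F x) - 5 / 2 * (A x * Q x))
        + a ^ 3 * (-(1 / 2) * (Q x * (Q x - F x)) - Q x ^ 2)
        + e * (-4 * A x - 3 * a * Q x - a * (A x * Q x) + a ^ 2 * Q x ^ 2 - 3 * A x ^ 2
          + B x * (3 * A' x + p x * J x)))) 0 := by
  have bJ' : Bdd fun x => B x - J x := dBJ.bdd
  -- The derivatives `s1` and `s2` carry powers of a and serve both nonlinearities; `s3` and `s4`
  -- are weighted by e and matter only in the quadratic case.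
  have s1 := HasInt.of_deriv
    (T := fun x => 1 / 2 * a * (A' x * B' x
        - ((1 - p x) * A x - (p x - a * (3 * Q x - 2 * F x))) * B x)
      + 3 / 2 * a ^ 2 * ((Q x - F x) * B x - -(φ x * Q x) * B' x)) (by fun_prop) ?_
    fun x => (((((hA' x).fun_mul (hB' x)).fun_sub
      (((((hp x).const_sub 1).fun_mul (hA x)).fun_sub ((hp x).fun_sub
        ((((hQ x).const_mul 3).fun_sub ((hF x).const_mul 2)).const_mul a))).fun_mul (hB x))).const_mul
        (1 / 2 * a))).fun_add
      (((((hQ x).fun_sub (hF x)).fun_mul (hB x)).fun_sub ((hQ' x).fun_mul (hB' x))).const_mul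
        (3 / 2 * a ^ 2))
  · have s2 := HasInt.of_deriv
      (T := fun x => 1 / 2 * a * (A x * J x) - 5 * a ^ 2 * (A x * -(φ x * Q x))
        + 3 / 2 * a ^ 2 * -(φ x * Q x) - 2 * a * (A x * A' x)
        - 2 * a ^ 2 * (Q x * A' x - -(φ x * Q x) * A x)) (by fun_prop) (by fun_prop)
      fun x => ((((((hA x).fun_mul (hJ x)).const_mul (1 / 2 * a)).fun_sub
        (((hA x).fun_mul (hQ' x)).const_mul (5 * a ^ 2))).fun_add
        ((hQ' x).const_mul (3 / 2 * a ^ 2))).fun_sub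
        (((hA x).fun_mul (hA' x)).const_mul (2 * a))).fun_sub
        ((((hQ x).fun_mul (hA' x)).fun_sub ((hQ' x).fun_mul (hA x))).const_mul (2 * a ^ 2))
    -- Z is known only through its derivative. Integrating against J, whose derivative A + aQ
    -- multiplies Z in the integrand, eliminates it.
    have s3 := HasInt.of_deriv
      (T := fun x => -(Z x * J x) + 3 * (A x * J x) + 3 * (B' x * J x - B x * (A x + a * Q x))
        + 3 * a * (B x * Q x)) (by fun_prop) ?_
      fun x => ((((hZ x).fun_mul (hJ x)).fun_neg.fun_add
        (((hA x).fun_mul (hJ x)).const_mul 3)).fun_add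
        ((((hB' x).fun_mul (hJ x)).fun_sub
          ((hB x).fun_mul ((hA x).fun_add ((hQ x).const_mul a)))).const_mul 3)).fun_add
        (((hB x).fun_mul (hQ x)).const_mul (3 * a))
    · have s4 := HasInt.of_deriv (T := fun x => B x - J x) dBJ (by fun_prop)
        fun x => (hB x).fun_sub (hJ x)
      refine (((s1.add s2).add (s3.const_mul e)).sub (s4.const_mul (3 * e))).congr (fun x => ?_)
        (by ring)
      ring
    · have e1 : (fun x => 3 * A' x + 3 * ((1 - p x) * B x - (J x + 2 * A' x + a * (φ x * Q x)))
          + p x * B x) = fun x => -3 * A' x + 3 * (B x - J x) - 2 * (p x * B x)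
          - 3 * a * (φ x * Q x) := funext fun x => by ring
      have e2 : (fun x => (1 - p x) * B x - (J x + 2 * A' x + a * (φ x * Q x))) =
          fun x => (B x - J x) - p x * B x - 2 * A' x - a * (φ x * Q x) := funext fun x => by ring
      have d1 : Dec fun x => 3 * A' x + 3 * ((1 - p x) * B x - (J x + 2 * A' x + a * (φ x * Q x)))
          + p x * B x := by rw [e1]; fun_prop
      have d2 : Dec fun x => (1 - p x) * B x - (J x + 2 * A' x + a * (φ x * Q x)) := by
        rw [e2]; fun_prop
      have key : ∀ X Y : ℝ → ℝ, Dec X → Dec Y → Dec fun x =>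
          -(X x * J x + Z x * (A x + a * Q x)) + 3 * (A' x * J x + A x * (A x + a * Q x))
          + 3 * (Y x * J x + B' x * (A x + a * Q x)
            - (B' x * (A x + a * Q x) + B x * (A' x + a * -(φ x * Q x))))
          + 3 * a * (B' x * Q x + B x * -(φ x * Q x)) := fun X Y hX hY => by fun_prop
      exact key _ _ d1 d2
  · fun_prop

/-- The linear systems on the background of the profile are uniquely solvable: the even solution
`W` of `ℒ W = -(3 Q - 2 f(Q))` has a nonzero solvability constant. -/
def Solvable (N : ℕ∞) (f Q φ : ℝ → ℝ) : Prop :=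
  ∃ W W' : ℝ → ℝ, (∀ x, HasDerivAt W (W' x) x) ∧
    (∀ x, HasDerivAt W' ((1 - deriv f (Q x)) * W x + (3 * Q x - 2 * f (Q x))) x) ∧
    (∀ x, W (-x) = W x) ∧ Loc N 0 W ∧ Dec W' ∧
    ∫ x, (Q x ^ 2 + (φ x * Q x) ^ 2 + W x * (3 * Q x - 2 * f (Q x))) ≠ 0

namespace FirstSol

variable {N : ℕ∞} {f Q φ A A' J B B' : ℝ → ℝ} {C a b : ℝ}

theorem dec_A (S : FirstSol N f Q φ A A' J B B' a b) : Dec A := S.loc_A.dec (by simp)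

theorem loc_A' (S : FirstSol N f Q φ A A' J B B' a b) : Loc N 1 A' := S.loc_A.deriv S.hasDerivAt_A

theorem loc_J (S : FirstSol N f Q φ A A' J B B' a b) (h : Profile f Q φ C) (hf : ContDiff ℝ N f)
    (hN : 1 ≤ N) : Loc N 0 fun x => J x - b * φ x :=
  h.loc_sub_φ hf S.hasDerivAt_J S.odd_J S.tendsto_J (m := 0)
    (fun k hk => (S.loc_A.mono (by omega : 0 ≤ 1) k hk).add
      (DecN.bdd_mul (BddN.const a) ((h.loc_Q hf).mono (by omega : 0 ≤ 1) k hk))) hN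

theorem bdd_J (S : FirstSol N f Q φ A A' J B B' a b) (h : Profile f Q φ C) (hf : ContDiff ℝ N f)
    (hN : 1 ≤ N) : Bdd J := by
  simpa using ((S.loc_J h hf hN).dec (by simp)).bdd.add ((Bdd.const b).mul h.bdd_φ)

theorem bdl_B (S : FirstSol N f Q φ A A' J B B' a b) (h : Profile f Q φ C) (hf : ContDiff ℝ N f) :
    Bdl N 0 B := fun k hk => by
  simpa using (S.loc_B k hk).bdd.add ((BddN.const b).mul (h.bdl_φ hf k hk))

theorem loc_B' (S : FirstSol N f Q φ A A' J B B' a b) (h : Profile f Q φ C) (hf : ContDiff ℝ N f) :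
    Loc N 1 B' := fun k hk => by
  have h1 := (S.loc_B.deriv fun x => (S.hasDerivAt_B x).fun_sub ((h.hasDerivAt_φ x).const_mul b)) k hk
  simpa using h1.add (DecN.bdd_mul (BddN.const b) ((h.loc_φ' hf).mono (by omega : 0 ≤ 1) k hk))

theorem loc_B'' (S : FirstSol N f Q φ A A' J B B' a b) (h : Profile f Q φ C) (hf : ContDiff ℝ N f) :
    Loc N 2 fun x => (1 - deriv f (Q x)) * B x - (J x + 2 * A' x + a * (φ x * Q x)) :=
  (S.loc_B' h hf).deriv S.hasDerivAt_B'

theorem loc_A'' (S : FirstSol N f Q φ A A' J B B' a b) :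
    Loc N 2 fun x => (1 - deriv f (Q x)) * A x - (deriv f (Q x) - a * (3 * Q x - 2 * f (Q x))) :=
  S.loc_A'.deriv S.hasDerivAt_A'

end FirstSol

theorem Profile.hasDerivAt_p {f Q φ : ℝ → ℝ} {C : ℝ} (h : Profile f Q φ C) (x : ℝ) :
    HasDerivAt (fun x => deriv f (Q x)) (iteratedDeriv 2 f (Q x) * -(φ x * Q x)) x := by
  have h1 : DifferentiableAt ℝ (deriv f) (Q x) :=
    ((h.contDiff.iterate_deriv' 2 1).differentiable (by norm_num)) _
  have h2 := h1.hasDerivAt.comp x (h.hasDerivAt_Q x)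
  rw [iteratedDeriv_succ, iteratedDeriv_one]
  exact h2

theorem Profile.hasDerivAt_p2 {f Q φ : ℝ → ℝ} {C : ℝ} (h : Profile f Q φ C) (x : ℝ) :
    HasDerivAt (fun x => iteratedDeriv 2 f (Q x)) (iteratedDeriv 3 f (Q x) * -(φ x * Q x)) x := by
  have h1 : DifferentiableAt ℝ (iteratedDeriv 2 f) (Q x) :=
    (h.contDiff.differentiable_iteratedDeriv 2 (by norm_num)) _
  have h2 := h1.hasDerivAt.comp x (h.hasDerivAt_Q x)
  rw [iteratedDeriv_succ (n := 2)]
  exact h2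

theorem Profile.dec_p2 {f Q φ : ℝ → ℝ} {C : ℝ} (h : Profile f Q φ C) {e : ℝ}
    (he : iteratedDeriv 2 f 0 = 2 * e) : Dec fun x => iteratedDeriv 2 f (Q x) - 2 * e := by
  have hd : ∀ x, HasDerivAt (iteratedDeriv 2 f) (iteratedDeriv 3 f x) x := fun x => by
    rw [iteratedDeriv_succ (n := 2)]
    exact ((h.contDiff.differentiable_iteratedDeriv 2 (by norm_num)) x).hasDerivAt
  have c3 : Continuous (iteratedDeriv 3 f) := h.contDiff.continuous_iteratedDeriv 3 le_rfl
  obtain ⟨K, hK⟩ := isCompact_Icc.exists_bound_of_continuousOn (s := Set.Icc 0 C) c3.continuousOn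
  refine h.dec_of_le (K := K) ?_ fun x => ?_
  · exact (continuous_of_hasDerivAt h.hasDerivAt_p2).sub continuous_const
  · have h1 := (convex_Icc 0 C).norm_image_sub_le_of_norm_hasDerivWithin_le
      (fun y _ => (hd y).hasDerivWithinAt) hK (x := 0) (y := Q x) ⟨le_rfl, h.C_pos.le⟩
      ⟨(h.pos x).le, h.Q_le x⟩
    simpa [he, abs_of_pos (h.pos x)] using h1

theorem Profile.loc_p2 {f Q φ : ℝ → ℝ} {C : ℝ} {N : ℕ∞} (h : Profile f Q φ C) (hf : ContDiff ℝ N f)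
    {e : ℝ} (he : iteratedDeriv 2 f 0 = 2 * e) :
    Loc N 2 fun x => iteratedDeriv 2 f (Q x) - 2 * e :=
  Loc.of_deriv (h.dec_p2 he) (fun x => (h.hasDerivAt_p2 x).sub_const _) fun k hk =>
    DecN.bdd_mul (h.bdl_iteratedDeriv hf 3 k hk) ((h.loc_Q' hf).mono (by omega : 0 ≤ 3) k hk).neg

/-- Resolution of the second order system, and the exact formula for the limit of the solution. -/
theorem Profile.exists_second {f Q φ A A' J B B' : ℝ → ℝ} {C a b e : ℝ} {N : ℕ∞}
    (h : Profile f Q φ C) (hf : ContDiff ℝ N f) (hN : 3 ≤ N) (hW : Solvable N f Q φ)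
    (S : FirstSol N f Q φ A A' J B B' a b) (he : iteratedDeriv 2 f 0 = 2 * e) :
    ∃ (A₂ B₂ Z : ℝ → ℝ) (a₂ b₂ : ℝ), HasLimitForm N Q A₂ B₂ (-(1 / 2) * e * b ^ 2) b₂ ∧
      HasIP N A₂ B₂ ∧
      (∀ x, HasDerivAt Z (3 * A' x + 3 * ((1 - deriv f (Q x)) * B x
        - (J x + 2 * A' x + a * (φ x * Q x))) + deriv f (Q x) * B x) x) ∧
      (∀ F g₁' : ℝ → ℝ,
        (∀ x, HasDerivAt (fun x => 1 / 2 * (iteratedDeriv 2 f (Q x) * (1 + A x) ^ 2 - 2 * e)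
          - a * (deriv f (Q x) * (1 + A x) + 3 * ((1 - deriv f (Q x)) * A x
            - (deriv f (Q x) - a * (3 * Q x - 2 * f (Q x)))))
          + 3 * a ^ 2 * (Q x - f (Q x)) + e * (a * Q x - Z x)) (F x) x) →
        (∀ x, HasDerivAt (fun x => -(1 / 2) * a * (9 * A' x + 3 * ((1 - deriv f (Q x)) * B x
            - (J x + 2 * A' x + a * (φ x * Q x))) + deriv f (Q x) * B x)
            + 1 / 2 * iteratedDeriv 2 f (Q x) * (1 + A x) * B x) (g₁' x) x) →
        SolvesOmega f Q F (fun x => (1 / 2 * (iteratedDeriv 2 f (Q x) * (1 + A x) ^ 2 - 2 * e)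
          + 3 / 2 * a ^ 2 * (Q x - f (Q x)) - e * (A x + 3 * B' x)) + g₁' x) A₂ B₂ a₂) ∧
      HasInt (fun x => 1 / 2 * (iteratedDeriv 2 f (Q x) * (1 + A x) ^ 2 - 2 * e) * (1 + A x)
        + a * (-(3 / 2) * A x ^ 2 + 3 * A' x ^ 2)
        + a ^ 2 * (4 * A x * (Q x - f (Q x)) - 5 / 2 * (A x * Q x))
        + a ^ 3 * (-(1 / 2) * (Q x * (Q x - f (Q x))) - Q x ^ 2)
        + e * (-4 * A x - 3 * a * Q x - a * (A x * Q x) + a ^ 2 * Q x ^ 2 - 3 * A x ^ 2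
          + B x * (3 * A' x + deriv f (Q x) * J x))) (2 * (b₂ - e * b) + e * b ^ 3) := by
  have hN2 : (2 : ℕ∞) ≤ N := le_trans (by norm_num) hN
  have hN1 : ((1 : ℕ) : ℕ∞) ≤ N := le_trans (by norm_num) hN
  have hN0 : ((0 : ℕ) : ℕ∞) ≤ N := by simp
  obtain ⟨W, W', hW, hW', hWe, hWl, hWd', hc⟩ := hW
  have oA' := odd_of_hasDerivAt_even S.hasDerivAt_A S.even
  have eB' := even_of_hasDerivAt_odd S.hasDerivAt_B S.odd
  have oQ : ∀ x, φ (-x) * Q (-x) = -(φ x * Q x) := fun x => by rw [h.odd, h.even]; ring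
  have oB'' : ∀ x, (1 - deriv f (Q (-x))) * B (-x) - (J (-x) + 2 * A' (-x) + a * (φ (-x) * Q (-x)))
      = -((1 - deriv f (Q x)) * B x - (J x + 2 * A' x + a * (φ x * Q x))) := fun x => by
    rw [oQ, h.even, S.odd, S.odd_J, oA']; ring
  have lp := h.loc_f' hf
  have lp2 := h.loc_p2 hf he
  have lpB : Loc N 1 fun x => deriv f (Q x) * B x := fun k hk =>
    (lp k hk).mul_bdd ((S.bdl_B h hf).mono (by omega : 0 ≤ 1) k hk)
  -- For e ≠ 0 the source F contains 3A' + 3B'' + f'(Q)B undifferentiated. Because f'(Q)B is odd and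
  -- localized, it has an even localized primitive, so F is still the derivative of a localized even
  -- H.
  obtain ⟨Z₀, hZ₀, eZ₀, dZ₀⟩ := (lpB.dec hN1).exists_primitive fun x => by
    rw [h.even, S.odd]; ring
  have lZ₀ : Loc N 0 Z₀ := Loc.of_deriv dZ₀ hZ₀ lpB
  set Z : ℝ → ℝ := fun x => 3 * A x + 3 * B' x + Z₀ x with hZdef
  have hZ : ∀ x, HasDerivAt Z (3 * A' x + 3 * ((1 - deriv f (Q x)) * B x
      - (J x + 2 * A' x + a * (φ x * Q x))) + deriv f (Q x) * B x) x := fun x =>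
    (((S.hasDerivAt_A x).const_mul 3).fun_add ((S.hasDerivAt_B' x).const_mul 3)).fun_add (hZ₀ x)
  have eZ : ∀ x, Z (-x) = Z x := fun x => by simp only [hZdef, S.even, eB', eZ₀]
  have lZ : Loc N 1 Z := fun k hk => ((DecN.bdd_mul (BddN.const 3) (S.loc_A.mono (by omega : 0 ≤ 1) k hk)).add
    (DecN.bdd_mul (BddN.const 3) (S.loc_B' h hf k hk))).add (lZ₀.mono (by omega : 0 ≤ 1) k hk)
  set p2 : ℝ → ℝ := fun x => iteratedDeriv 2 f (Q x) with hp2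
  set r : ℝ → ℝ := fun x => iteratedDeriv 2 f (Q x) - 2 * e with hr
  have ep2 : ∀ x, iteratedDeriv 2 f (Q x) = 2 * e + r x := fun x => by simp [hr]
  have lP : Loc N 2 fun x => 1 / 2 * (iteratedDeriv 2 f (Q x) * (1 + A x) ^ 2 - 2 * e) := fun k hk => by
    have hA := S.loc_A.mono (by omega : 0 ≤ 2) k hk
    have hr := lp2 k hk
    have e1 : (fun x => 1 / 2 * (iteratedDeriv 2 f (Q x) * (1 + A x) ^ 2 - 2 * e)) =
        fun x => 1 / 2 * (r x * (1 + A x) ^ 2) + e * (2 * A x + A x * A x) := by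
      funext x; rw [ep2]; ring
    rw [e1]
    have hA' := hA.bdd
    have h1 := (BddN.const 1 (k := k)).add hA'
    exact (DecN.bdd_mul (BddN.const _) (hr.mul_bdd (h1.pow 2))).add
      (DecN.bdd_mul (BddN.const _) ((DecN.bdd_mul (BddN.const _) hA).add (hA.mul_bdd hA')))
  have lQ := fun k hk => (h.loc_Q hf).mono (by omega : 0 ≤ 2) k hk
  have lF := fun k hk => (h.loc_f hf).mono (by omega : 0 ≤ 2) k hk
  have lQQ : Loc N 2 fun x => Q x - f (Q x) := fun k hk => (lQ k hk).sub (lF k hk)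
  have lA := fun k hk => S.loc_A.mono (by omega : 0 ≤ 2) k hk
  have lp' := fun k hk => lp.mono (by omega : 1 ≤ 2) k hk
  set H : ℝ → ℝ := fun x => 1 / 2 * (iteratedDeriv 2 f (Q x) * (1 + A x) ^ 2 - 2 * e)
          - a * (deriv f (Q x) * (1 + A x) + 3 * ((1 - deriv f (Q x)) * A x
            - (deriv f (Q x) - a * (3 * Q x - 2 * f (Q x)))))
          + 3 * a ^ 2 * (Q x - f (Q x)) + e * (a * Q x - Z x) with hH
  set G : ℝ → ℝ := fun x => 1 / 2 * (iteratedDeriv 2 f (Q x) * (1 + A x) ^ 2 - 2 * e)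
          + 3 / 2 * a ^ 2 * (Q x - f (Q x)) - e * (A x + 3 * B' x) with hG
  set g₁ : ℝ → ℝ := fun x => -(1 / 2) * a * (9 * A' x + 3 * ((1 - deriv f (Q x)) * B x
            - (J x + 2 * A' x + a * (φ x * Q x))) + deriv f (Q x) * B x)
            + 1 / 2 * iteratedDeriv 2 f (Q x) * (1 + A x) * B x with hg₁
  have lH : Loc N 2 H := fun k hk => by
    have h1 := (BddN.const 1 (k := k)).add (lA k hk).bdd
    exact (((lP k hk).sub (DecN.bdd_mul (BddN.const a) (((lp' k hk).mul_bdd h1).add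
      (DecN.bdd_mul (BddN.const 3) (S.loc_A'' k hk))))).add
      (DecN.bdd_mul (BddN.const _) (lQQ k hk))).add
      (DecN.bdd_mul (BddN.const e) ((DecN.bdd_mul (BddN.const a) (lQ k hk)).sub
        (lZ.mono (by omega : 1 ≤ 2) k hk)))
  have lG : Loc N 2 G := fun k hk =>
    ((lP k hk).add (DecN.bdd_mul (BddN.const _) (lQQ k hk))).sub
      (DecN.bdd_mul (BddN.const e) ((lA k hk).add (DecN.bdd_mul (BddN.const 3)
        ((S.loc_B' h hf).mono (by omega : 1 ≤ 2) k hk))))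
  -- f''(Q) tends to 2e and B to b, so g₁ tends to e b; this is the value of β.
  have lg₁ : Loc N 2 fun x => g₁ x - e * b * φ x := fun k hk => by
    have e1 : (fun x => g₁ x - e * b * φ x) = fun x => -(1 / 2) * a * (9 * A' x
        + 3 * ((1 - deriv f (Q x)) * B x
            - (J x + 2 * A' x + a * (φ x * Q x))) + deriv f (Q x) * B x)
        + (1 / 2 * (r x * ((1 + A x) * B x)) + e * (A x * B x) + e * (B x - b * φ x)) := by
      funext x; simp only [hg₁]; rw [ep2]; ring
    rw [e1]
    have h1 := (BddN.const 1 (k := k)).add (lA k hk).bdd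
    have hB := (S.bdl_B h hf).mono (by omega : 0 ≤ 2) k hk
    exact (DecN.bdd_mul (BddN.const _) (((DecN.bdd_mul (BddN.const _)
      (S.loc_A'.mono (by omega : 1 ≤ 2) k hk)).add (DecN.bdd_mul (BddN.const _) (S.loc_B'' h hf k hk))).add
      (lpB.mono (by omega : 1 ≤ 2) k hk))).add
      (((DecN.bdd_mul (BddN.const _) ((lp2 k hk).mul_bdd (h1.mul hB))).add
        (DecN.bdd_mul (BddN.const _) ((lA k hk).mul_bdd hB))).add
        (DecN.bdd_mul (BddN.const _) (S.loc_B.mono (by omega : 0 ≤ 2) k hk)))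
  have eH : ∀ x, H (-x) = H x := fun x => by simp only [hH, h.even, S.even, eZ]
  have eG : ∀ x, G (-x) = G x := fun x => by simp only [hG, h.even, S.even, eB']
  have og₁ : ∀ x, g₁ (-x) = -g₁ x := fun x => by
    simp only [hg₁]; rw [oB'']; simp only [h.even, S.even, S.odd, oA']; ring
  -- The system is solvable for every γ; this choice turns the term -2γb of the limit formula into e
  -- b³.
  obtain ⟨A₂, A₂', J₂, B₂, B₂', a₂, b₂, T⟩ := h.exists_omegaSol hf hN2 hW hW' hWe hWl hWd' hc
    lH eH lG eG lg₁ og₁ (γ := -(1 / 2) * e * b ^ 2)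
  refine ⟨A₂, B₂, Z, a₂, b₂, T.hasLimitForm h, T.hasIP h hf hN1, hZ,
    fun F g₁' hF hg => T.solvesOmega h hF hg, ?_⟩
  have dA := S.dec_A
  have dA' := S.loc_A'.dec hN1
  have bB : Bdd B := (S.bdl_B h hf) 0 (by simp)
  have bB₂ : Bdd B₂ := by
    simpa using (T.loc_B.dec (by simp)).bdd.add ((Bdd.const b₂).mul h.bdd_φ)
  have dV := T.loc_A.dec hN0
  have dV' := (T.loc_A.deriv fun x => (T.hasDerivAt_A x).sub_const _).dec hN1
  have bA₂ : Bdd A₂ := by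
    have h1 := dV.bdd.add (Bdd.const (-(1 / 2) * e * b ^ 2))
    have e1 : (fun x => A₂ x - -(1 / 2) * e * b ^ 2 + -(1 / 2) * e * b ^ 2) = A₂ :=
      funext fun x => by ring
    rwa [e1] at h1
  have dφ' : Dec fun x => φ x ^ 2 - 1 + f (Q x) / Q x := h.dec_θ.add h.dec_σ
  have dB₂' : Dec B₂' := by
    have h1 := (T.loc_B.deriv fun x => (T.hasDerivAt_B x).fun_sub ((h.hasDerivAt_φ x).const_mul b₂)).dec hN1
    simpa using h1.add (Dec.bdd_mul (Bdd.const b₂) dφ')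
  have bJ₂ : Bdd J₂ := by
    have dJ' : Dec fun x => G x + deriv f (Q x) * A₂ x :=
      (lG.dec hN2).add (h.dec_f'.mul_bdd bA₂)
    have h1 := fun x => (T.hasDerivAt_J x).fun_sub ((h.hasDerivAt_φ x).const_mul (b₂ - e * b))
    have h2 : Dec fun x => J₂ x - (b₂ - e * b) * φ x := by
      refine Dec.of_deriv (fun x => ?_) h1 (dJ'.sub (Dec.bdd_mul (Bdd.const _) dφ')) ?_
      · rw [T.odd_J, h.odd, ← abs_neg]; congr 1; ring
      · simpa using T.tendsto_J.sub (h.tendsto_φ.const_mul (b₂ - e * b))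
    simpa using h2.bdd.add ((Bdd.const (b₂ - e * b)).mul h.bdd_φ)
  have bg₁ : Bdd g₁ := by
    simpa using (lg₁.dec hN2).bdd.add ((Bdd.const (e * b)).mul h.bdd_φ)
  have dBJ : Dec fun x => B x - J x := by
    simpa using (S.loc_B.dec hN0).sub ((S.loc_J h hf hN1).dec hN0)
  have i1 := hasInt_of_omega (p := fun x => deriv f (Q x)) (F := fun x => f (Q x))
    h.dec_Q h.bdd_φ h.dec_f h.dec_f' dA dA' dV dV' bJ₂ bB₂ dB₂'.bdd (lH.dec hN2) (lG.dec hN2) bg₁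
    h.hasDerivAt_Q h.hasDerivAt_Q' h.hasDerivAt_Q'' S.hasDerivAt_A S.hasDerivAt_A' S.hasDerivAt_J
    S.odd_J S.tendsto_J S.orth (fun x => rfl) T.hasDerivAt_A T.hasDerivAt_A' T.hasDerivAt_J T.odd_J
    T.tendsto_J T.hasDerivAt_B T.hasDerivAt_B'
  have i2 := hasInt_reduction (p := fun x => deriv f (Q x)) (F := fun x => f (Q x)) (e := e)
    h.dec_Q h.bdd_φ h.dec_f h.dec_f' (lp2.dec hN2) dA dA' (S.bdd_J h hf hN1) bB
    ((S.loc_B' h hf).dec hN1) dBJ (lZ.dec hN1)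
    h.hasDerivAt_Q h.hasDerivAt_Q' h.hasDerivAt_fQ
    (fun x => ep2 x ▸ h.hasDerivAt_p x) S.hasDerivAt_A S.hasDerivAt_A' S.hasDerivAt_J
    S.hasDerivAt_B S.hasDerivAt_B' hZ
  refine (i1.sub i2).congr (fun x => ?_) (by ring)
  simp only [hH, hG, hg₁, ep2]
  ring

/-- The case e = 1. What remains is to recognize the given sources as H' and G + g₁'. -/
theorem Profile.exists_second2 {f Q φ A A' J B B' : ℝ → ℝ} {C a b : ℝ} {N : ℕ∞}
    (h : Profile f Q φ C) (hf : ContDiff ℝ N f) (hN : 3 ≤ N) (hW : Solvable N f Q φ)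
    (S : FirstSol N f Q φ A A' J B B' a b) (he : iteratedDeriv 2 f 0 = 2) :
    ∃ (A₂ B₂ : ℝ → ℝ) (a₂ b₂ : ℝ),
      SolvesOmega f Q (sourceF2 f Q A B a) (sourceG2 f Q A B a) A₂ B₂ a₂ ∧
      HasLimitForm N Q A₂ B₂ (-(1 / 2) * b ^ 2) b₂ ∧ HasIP N A₂ B₂ ∧
      HasInt (fun x => 1 / 2 * (iteratedDeriv 2 f (Q x) * (1 + A x) ^ 2 - 2) * (1 + A x)
        + a * (-(3 / 2) * A x ^ 2 + 3 * A' x ^ 2)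
        + a ^ 2 * (4 * A x * (Q x - f (Q x)) - 5 / 2 * (A x * Q x))
        + a ^ 3 * (-(1 / 2) * (Q x * (Q x - f (Q x))) - Q x ^ 2)
        + (-4 * A x - 3 * a * Q x - a * (A x * Q x) + a ^ 2 * Q x ^ 2 - 3 * A x ^ 2
          + B x * (3 * A' x + deriv f (Q x) * J x))) (2 * (b₂ - b) + b ^ 3) := by
  obtain ⟨A₂, B₂, Z, a₂, b₂, h1, h2, hZ, h3, h4⟩ := h.exists_second hf hN hW S (e := 1) (by simpa)
  refine ⟨A₂, B₂, a₂, b₂, ?_, by simpa using h1, h2, by simpa using h4⟩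
  have eQ : deriv Q = fun x => -(φ x * Q x) := funext fun x => (h.hasDerivAt_Q x).deriv
  have eA : deriv A = A' := funext fun x => (S.hasDerivAt_A x).deriv
  have eB : deriv B = B' := funext fun x => (S.hasDerivAt_B x).deriv
  have eQ2 : iteratedDeriv 2 Q = fun x => Q x - f (Q x) := by
    rw [iteratedDeriv_succ, iteratedDeriv_one, eQ]
    exact funext fun x => (h.hasDerivAt_Q' x).deriv
  have eQ3 : iteratedDeriv 3 Q = fun x => (1 - deriv f (Q x)) * -(φ x * Q x) := by
    rw [iteratedDeriv_succ, eQ2]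
    exact funext fun x => (h.hasDerivAt_Q'' x).deriv
  have eA2 : iteratedDeriv 2 A = fun x =>
      (1 - deriv f (Q x)) * A x - (deriv f (Q x) - a * (3 * Q x - 2 * f (Q x))) := by
    rw [iteratedDeriv_succ, iteratedDeriv_one, eA]
    exact funext fun x => (S.hasDerivAt_A' x).deriv
  have eB2 : iteratedDeriv 2 B = fun x =>
      (1 - deriv f (Q x)) * B x - (J x + 2 * A' x + a * (φ x * Q x)) := by
    rw [iteratedDeriv_succ, iteratedDeriv_one, eB]
    exact funext fun x => (S.hasDerivAt_B' x).deriv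
  have h3' := h3 (sourceF2 f Q A B a)
    (fun x => -(1 / 2) * a * deriv (innerG f Q A B) x
      + 1 / 2 * deriv (fun y => iteratedDeriv 2 f (Q y) * (B y + A y * B y)) x) ?_ ?_
  · convert h3' using 1
    funext x
    simp only [sourceG2, eB, eQ2]
    ring
  · intro x
    have hp2 := h.hasDerivAt_p2 x
    have hp := h.hasDerivAt_p x
    have hA := S.hasDerivAt_A x
    have hA2 := ((hp.const_sub 1).fun_mul hA).fun_sub (hp.fun_sub
        ((((h.hasDerivAt_Q x).const_mul 3).fun_sub ((h.hasDerivAt_fQ x).const_mul 2)).const_mul a))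
    rw [← eA2] at hA2
    have d1 := (hp2.fun_mul ((hA.const_mul 2).fun_add (hA.fun_pow 2)))
    have d2 := ((hA2.const_mul 3).fun_sub (h.hasDerivAt_Q x)).fun_add (hp.fun_mul (hA.const_add 1))
    have d3 := hp2.sub_const 2
    simp only [sourceF2]
    rw [d1.deriv, d2.deriv, d3.deriv]
    have := ((((d1.const_mul (1 / 2)).fun_sub (d2.const_mul a)).fun_add
      ((h.hasDerivAt_Q'' x).const_mul (3 * a ^ 2))).fun_add (d3.const_mul (1 / 2))).fun_sub (hZ x)
    refine (this.congr_of_eventuallyEq (Eventually.of_forall fun y => ?_)).congr_deriv ?_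
    · simp only [eA2]; ring
    · simp only [eA, eB2, eQ3]; ring
  · intro x
    have hp2 := h.hasDerivAt_p2 x
    have hp := h.hasDerivAt_p x
    have hA := S.hasDerivAt_A x
    have hB := S.hasDerivAt_B x
    have e1 : innerG f Q A B = fun x => 9 * A' x + 3 * ((1 - deriv f (Q x)) * B x
            - (J x + 2 * A' x + a * (φ x * Q x))) + deriv f (Q x) * B x := by
      funext x; simp only [innerG, eA, eB2]
    have d1 := ((((S.hasDerivAt_A' x).const_mul 9).fun_add ((((hp.const_sub 1).fun_mul hB).fun_sub
      (((S.hasDerivAt_J x).fun_add ((S.hasDerivAt_A' x).const_mul 2)).fun_add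
        ((((h.hasDerivAt_Q' x).fun_neg).congr_of_eventuallyEq (f₁ := fun x => φ x * Q x)
          (Eventually.of_forall fun y => (neg_neg _).symm)).const_mul a))).const_mul 3)).fun_add
          (hp.fun_mul hB))
    have d2 := hp2.fun_mul (hB.fun_add (hA.fun_mul hB))
    rw [e1, d1.deriv, d2.deriv]
    refine (((d1.const_mul (-(1 / 2) * a)).fun_add (d2.const_mul (1 / 2))).congr_of_eventuallyEq
      (Eventually.of_forall fun y => ?_))
    ring

/-- The case e = 0, in which the terms in Z and the product B(3A' + f'(Q)J) disappear from the limit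
formula. -/
theorem Profile.exists_second3 {f Q φ A A' J B B' : ℝ → ℝ} {C a b : ℝ} {N : ℕ∞}
    (h : Profile f Q φ C) (hf : ContDiff ℝ N f) (hN : 3 ≤ N) (hW : Solvable N f Q φ)
    (S : FirstSol N f Q φ A A' J B B' a b) (he : iteratedDeriv 2 f 0 = 0) :
    ∃ (A₂ B₂ : ℝ → ℝ) (a₂ b₂ : ℝ),
      SolvesOmega f Q (sourceF3 f Q A a) (sourceG3 f Q A B a) A₂ B₂ a₂ ∧
      HasLimitForm N Q A₂ B₂ 0 b₂ ∧ HasIP N A₂ B₂ ∧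
      HasInt (fun x => 1 / 2 * iteratedDeriv 2 f (Q x) * (1 + A x) ^ 3
        + a * (-(3 / 2) * A x ^ 2 + 3 * A' x ^ 2)
        + a ^ 2 * (4 * A x * (Q x - f (Q x)) - 5 / 2 * (A x * Q x))
        + a ^ 3 * (-(1 / 2) * (Q x * (Q x - f (Q x))) - Q x ^ 2)) (2 * b₂) := by
  obtain ⟨A₂, B₂, Z, a₂, b₂, h1, h2, hZ, h3, h4⟩ := h.exists_second hf hN hW S (e := 0) (by simpa)
  refine ⟨A₂, B₂, a₂, b₂, ?_, by simpa using h1, h2, h4.congr (fun x => by ring) (by ring)⟩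
  have eQ : deriv Q = fun x => -(φ x * Q x) := funext fun x => (h.hasDerivAt_Q x).deriv
  have eA : deriv A = A' := funext fun x => (S.hasDerivAt_A x).deriv
  have eB : deriv B = B' := funext fun x => (S.hasDerivAt_B x).deriv
  have eQ2 : iteratedDeriv 2 Q = fun x => Q x - f (Q x) := by
    rw [iteratedDeriv_succ, iteratedDeriv_one, eQ]
    exact funext fun x => (h.hasDerivAt_Q' x).deriv
  have eQ3 : iteratedDeriv 3 Q = fun x => (1 - deriv f (Q x)) * -(φ x * Q x) := by
    rw [iteratedDeriv_succ, eQ2]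
    exact funext fun x => (h.hasDerivAt_Q'' x).deriv
  have eA2 : iteratedDeriv 2 A = fun x =>
      (1 - deriv f (Q x)) * A x - (deriv f (Q x) - a * (3 * Q x - 2 * f (Q x))) := by
    rw [iteratedDeriv_succ, iteratedDeriv_one, eA]
    exact funext fun x => (S.hasDerivAt_A' x).deriv
  have eB2 : iteratedDeriv 2 B = fun x =>
      (1 - deriv f (Q x)) * B x - (J x + 2 * A' x + a * (φ x * Q x)) := by
    rw [iteratedDeriv_succ, iteratedDeriv_one, eB]
    exact funext fun x => (S.hasDerivAt_B' x).deriv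
  have h3' := h3 (sourceF3 f Q A a)
    (fun x => -(1 / 2) * a * deriv (innerG f Q A B) x
      + 1 / 2 * deriv (fun y => iteratedDeriv 2 f (Q y) * (1 + A y) * B y) x) ?_ ?_
  · convert h3' using 1
    funext x
    simp only [sourceG3, eQ2]
    ring
  · intro x
    have hp2 := h.hasDerivAt_p2 x
    have hp := h.hasDerivAt_p x
    have hA := S.hasDerivAt_A x
    have hA2 := ((hp.const_sub 1).fun_mul hA).fun_sub (hp.fun_sub
        ((((h.hasDerivAt_Q x).const_mul 3).fun_sub ((h.hasDerivAt_fQ x).const_mul 2)).const_mul a))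
    rw [← eA2] at hA2
    have d1 := ((hp2.const_mul (1 / 2)).fun_mul ((hA.const_add 1).fun_pow 2))
    have d2 := (hp.fun_add (hA2.const_mul 3)).fun_add (hp.fun_mul hA)
    simp only [sourceF3]
    rw [d1.deriv, d2.deriv]
    have := (d1.fun_sub (d2.const_mul a)).fun_add ((h.hasDerivAt_Q'' x).const_mul (3 * a ^ 2))
    refine (this.congr_of_eventuallyEq (Eventually.of_forall fun y => ?_)).congr_deriv ?_
    · simp only [eA2]; ring
    · simp only [eQ3]; ring
  · intro x
    have hp2 := h.hasDerivAt_p2 x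
    have hp := h.hasDerivAt_p x
    have hA := S.hasDerivAt_A x
    have hB := S.hasDerivAt_B x
    have e1 : innerG f Q A B = fun x => 9 * A' x + 3 * ((1 - deriv f (Q x)) * B x
            - (J x + 2 * A' x + a * (φ x * Q x))) + deriv f (Q x) * B x := by
      funext x; simp only [innerG, eA, eB2]
    have d1 := ((((S.hasDerivAt_A' x).const_mul 9).fun_add ((((hp.const_sub 1).fun_mul hB).fun_sub
      (((S.hasDerivAt_J x).fun_add ((S.hasDerivAt_A' x).const_mul 2)).fun_add
        ((((h.hasDerivAt_Q' x).fun_neg).congr_of_eventuallyEq (f₁ := fun x => φ x * Q x)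
          (Eventually.of_forall fun y => (neg_neg _).symm)).const_mul a))).const_mul 3)).fun_add
          (hp.fun_mul hB))
    have d2 := (hp2.fun_mul (hA.const_add 1)).fun_mul hB
    rw [e1, d1.deriv, d2.deriv]
    refine (((d1.const_mul (-(1 / 2) * a)).fun_add (d2.const_mul (1 / 2))).congr_of_eventuallyEq
      (Eventually.of_forall fun y => ?_))
    ring

end GKdV

/-! ### Families uniform in the parameter and the perturbed first order solution -/

namespace GKdV

section Families

variable {ι : Type*}

/-- Families of continuous functions which are bounded uniformly in the parameter. -/
@[fun_prop]
def UBdd (g : ι × ℝ → ℝ) : Prop := (∀ i, Continuous fun x => g (i, x)) ∧ ∃ K : ℝ, ∀ z, |g z| ≤ K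

/-- Families of continuous functions which are localized uniformly in the parameter. -/
@[fun_prop]
def UDec (g : ι × ℝ → ℝ) : Prop := (∀ i, Continuous fun x => g (i, x)) ∧
  ∃ (K : ℝ) (n : ℕ), ∀ z, |g z| ≤ K * ((1 + |z.2|) ^ n * Real.exp (-|z.2|))

variable {f g : ι × ℝ → ℝ}

theorem UBdd.bdd (h : UBdd g) (i : ι) : Bdd fun x => g (i, x) :=
  ⟨h.1 i, h.2.imp fun _ hK x => hK (i, x)⟩

theorem UDec.dec (h : UDec g) (i : ι) : Dec fun x => g (i, x) := by
  obtain ⟨hc, K, n, hK⟩ := h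
  exact ⟨hc i, K, n, fun x => hK (i, x)⟩

@[fun_prop]
theorem UBdd.const (c : ℝ) : UBdd fun _ : ι × ℝ => c :=
  ⟨fun _ => continuous_const, |c|, fun _ => le_rfl⟩

@[fun_prop]
theorem UBdd.add (hf : UBdd f) (hg : UBdd g) : UBdd fun z => f z + g z := by
  obtain ⟨cf, K, hK⟩ := hf
  obtain ⟨cg, L, hL⟩ := hg
  exact ⟨fun i => (cf i).add (cg i), K + L, fun z => (abs_add_le _ _).trans (add_le_add (hK z) (hL z))⟩

@[fun_prop]
theorem UBdd.mul (hf : UBdd f) (hg : UBdd g) : UBdd fun z => f z * g z := by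
  obtain ⟨cf, K, hK⟩ := hf
  obtain ⟨cg, L, hL⟩ := hg
  refine ⟨fun i => (cf i).mul (cg i), K * L, fun z => ?_⟩
  rw [abs_mul]
  exact mul_le_mul (hK z) (hL z) (abs_nonneg _) ((abs_nonneg _).trans (hK z))

@[fun_prop]
theorem UBdd.neg (hf : UBdd f) : UBdd fun z => -f z :=
  ⟨fun i => (hf.1 i).neg, by simpa using hf.2⟩

@[fun_prop]
theorem UBdd.sub (hf : UBdd f) (hg : UBdd g) : UBdd fun z => f z - g z := by
  simpa only [sub_eq_add_neg] using hf.add hg.neg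

@[fun_prop]
theorem UBdd.pow (hf : UBdd f) (n : ℕ) : UBdd fun z => f z ^ n := by
  induction n with
  | zero => simpa using UBdd.const 1
  | succ n ih => simpa only [_root_.pow_succ] using ih.mul hf

@[fun_prop]
theorem UDec.add (hf : UDec f) (hg : UDec g) : UDec fun z => f z + g z := by
  obtain ⟨cf, K, m, hK⟩ := hf
  obtain ⟨cg, L, n, hL⟩ := hg
  refine ⟨fun i => (cf i).add (cg i), |K| + |L|, max m n, fun z => (abs_add_le _ _).trans ?_⟩
  rw [add_mul]
  refine add_le_add ((hK z).trans ?_) ((hL z).trans ?_)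
  · exact mul_le_mul (le_abs_self _) (weight_mono (le_max_left _ _) _) (weight_pos _ _).le (abs_nonneg _)
  · exact mul_le_mul (le_abs_self _) (weight_mono (le_max_right _ _) _) (weight_pos _ _).le (abs_nonneg _)

@[fun_prop]
theorem UDec.mul_bdd (hf : UDec f) (hg : UBdd g) : UDec fun z => f z * g z := by
  obtain ⟨cf, K, m, hK⟩ := hf
  obtain ⟨cg, L, hL⟩ := hg
  refine ⟨fun i => (cf i).mul (cg i), K * L, m, fun z => ?_⟩
  rw [abs_mul, mul_right_comm]
  exact mul_le_mul (hK z) (hL z) (abs_nonneg _) ((abs_nonneg _).trans (hK z))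

@[fun_prop]
theorem UDec.bdd_mul (hf : UBdd f) (hg : UDec g) : UDec fun z => f z * g z := by
  simpa only [mul_comm] using hg.mul_bdd hf

@[fun_prop]
theorem UDec.neg (hf : UDec f) : UDec fun z => -f z := by
  obtain ⟨cf, K, m, hK⟩ := hf
  exact ⟨fun i => (cf i).neg, K, m, fun z => by simpa using hK z⟩

@[fun_prop]
theorem UDec.sub (hf : UDec f) (hg : UDec g) : UDec fun z => f z - g z := by
  simpa only [sub_eq_add_neg] using hf.add hg.neg

@[fun_prop]
theorem UDec.bdd (hf : UDec f) : UBdd f := by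
  obtain ⟨cf, K, n, hK⟩ := hf
  obtain ⟨c, hc⟩ := exp_neg_weight_le n
  refine ⟨cf, |K| * c, fun z => (hK z).trans ?_⟩
  exact mul_le_mul (le_abs_self _) (hc _) (weight_pos _ _).le (abs_nonneg _)

@[fun_prop]
theorem UDec.pow_two (hf : UDec f) : UDec fun z => f z ^ 2 := by
  simpa only [sq] using hf.mul_bdd hf.bdd

@[fun_prop]
theorem UDec.pow_succ (hf : UDec f) (n : ℕ) : UDec fun z => f z ^ (n + 1) := by
  simpa only [_root_.pow_succ] using UDec.bdd_mul (hf.bdd.pow n) hf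

@[fun_prop]
theorem UDec.pow_three (hf : UDec f) : UDec fun z => f z ^ 3 := hf.pow_succ 2

@[fun_prop]
theorem UDec.pow_four (hf : UDec f) : UDec fun z => f z ^ 4 := hf.pow_succ 3

@[fun_prop]
theorem UDec.id_mul (hf : UDec f) : UDec fun z => z.2 * f z := by
  obtain ⟨cf, K, n, hK⟩ := hf
  refine ⟨fun i => continuous_id.mul (cf i), K, n + 1, fun z => ?_⟩
  rw [abs_mul]
  have h1 : |z.2| ≤ 1 + |z.2| := by linarith
  calc |z.2| * |f z| ≤ (1 + |z.2|) * (K * ((1 + |z.2|) ^ n * Real.exp (-|z.2|))) :=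
        mul_le_mul h1 (hK z) (abs_nonneg _) (by positivity)
    _ = _ := by ring

/-- A common integrable majorant: every O-estimate of the expansion comes from this. -/
theorem UDec.exists_integral_le (hf : UDec f) : ∃ K : ℝ, ∀ i, |∫ x, f (i, x)| ≤ K := by
  obtain ⟨-, K, n, hK⟩ := hf
  refine ⟨∫ x : ℝ, K * ((1 + |x|) ^ n * Real.exp (-|x|)), fun i => ?_⟩
  refine norm_integral_le_of_norm_le (f := fun x => f (i, x)) ((integrable_weight n).const_mul K) (ae_of_all _ fun x => ?_)
  exact hK (i, x)

/-- A parameter, seen as a family of constant functions. -/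
def par (ε : ι → ℝ) (z : ι × ℝ) : ℝ := ε z.1

theorem UBdd.of_par {ε : ι → ℝ} {K : ℝ} (h : ∀ i, |ε i| ≤ K) : UBdd (par ε) :=
  ⟨fun _ => by simpa only [par] using continuous_const, K, fun z => h z.1⟩

theorem UBdd.exists_par {ε : ι → ℝ} (h : UBdd (par ε)) : ∃ K : ℝ, ∀ i, |ε i| ≤ K :=
  h.2.imp fun _ hK i => hK (i, 0)

/-- The constant of the even a priori estimate depends on f only through C, so uniform localization
passes from the source to the solution. -/
theorem UDec.of_even_solution {f : ι → ℝ → ℝ} {Q φ h w w' : ι × ℝ → ℝ} {C : ℝ}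
    (hp : ∀ i, Profile (f i) (fun x => Q (i, x)) (fun x => φ (i, x)) C) (hh : UDec h)
    (he : ∀ i x, h (i, -x) = h (i, x)) (hw : ∀ i, Dec fun x => w (i, x))
    (hw' : ∀ i, Dec fun x => w' (i, x)) (hwe : ∀ i x, w (i, -x) = w (i, x))
    (hd : ∀ i x, HasDerivAt (fun x => w (i, x)) (w' (i, x)) x)
    (hd' : ∀ i x, HasDerivAt (fun x => w' (i, x))
      ((1 - deriv (f i) (Q (i, x))) * w (i, x) - h (i, x)) x) : UDec w ∧ UDec w' := by
  obtain ⟨hc, M, n, hM⟩ := hh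
  obtain ⟨K, -, hK⟩ := Profile.estimate_even C n
  have key := fun i => hK (hp i) (fun x => h (i, x)) (fun x => w (i, x)) (fun x => w' (i, x)) M (hc i)
    (fun x => hM (i, x)) (he i) (hw i) (hw' i) (hwe i) (hd i) (hd' i)
  exact ⟨⟨fun i => (hw i).continuous, _, _, fun z => (key z.1).1 z.2⟩,
    ⟨fun i => (hw' i).continuous, _, _, fun z => (key z.1).2 z.2⟩⟩

theorem UDec.exists_solution {f : ι → ℝ → ℝ} {Q φ h : ι × ℝ → ℝ} {C σ : ℝ}
    (hp : ∀ i, Profile (f i) (fun x => Q (i, x)) (fun x => φ (i, x)) C) (hh : UDec h)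
    (he : ∀ i x, h (i, -x) = σ * h (i, x))
    (hσ : σ = 1 ∨ σ = -1 ∧ ∀ i, ∫ x, φ (i, x) * Q (i, x) * h (i, x) = 0) :
    ∃ w w' : ι × ℝ → ℝ, UDec w ∧ UDec w' ∧ (∀ i x, w (i, -x) = σ * w (i, x)) ∧
      (∀ i x, w' (i, -x) = -(σ * w' (i, x))) ∧
      (∀ i x, HasDerivAt (fun x => w (i, x)) (w' (i, x)) x) ∧
      (∀ i x, HasDerivAt (fun x => w' (i, x))
        ((1 - deriv (f i) (Q (i, x))) * w (i, x) - h (i, x)) x) := by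
  obtain ⟨hc, M, n, hM⟩ := hh
  obtain ⟨K, -, hK⟩ := Profile.exists_solution C n
  have key := fun i => hK (hp i) σ (fun x => h (i, x)) M (hc i) (fun x => hM (i, x)) (he i)
    (hσ.imp_right fun h => ⟨h.1, h.2 i⟩)
  choose w w' h1 h2 h3 h4 h5 h6 using key
  exact ⟨fun z => w z.1 z.2, fun z => w' z.1 z.2,
    ⟨fun i => continuous_of_hasDerivAt (h1 i), _, _, fun z => h5 z.1 z.2⟩,
    ⟨fun i => continuous_of_hasDerivAt (h2 i), _, _, fun z => h6 z.1 z.2⟩, h3, h4, h1, h2⟩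

/-- Families of nonlinearities `f = κ u² + ν u³ + ε g` with `g` close to `u^P`, together with their
solitons, in terms of `y = Q^(P-2)`: `g(Q) = y Q² + δ e Q`, `g'(Q) = P y Q + δ g₁`,
`g''(Q) = P (P - 1) y + δ g₂`, and `y Q / (P + 1) + δ G` is the primitive of `g` over `Q²`. -/
structure Family (κ P : ℝ) (ν ε δ : ι → ℝ) (f : ι → ℝ → ℝ) (Q φ y e g₁ g₂ G : ι × ℝ → ℝ) (C : ℝ) :
    Prop where
  profile : ∀ i, Profile (f i) (fun x => Q (i, x)) (fun x => φ (i, x)) C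
  four_le : 4 ≤ P
  ν_bdd : UBdd (par ν)
  ε_bdd : UBdd (par ε)
  δ_bdd : UBdd (par δ)
  ε_ne : ∀ i, ε i ≠ 0
  dec_y : UDec y
  dec_e : UDec e
  dec_g₁ : UDec g₁
  dec_g₂ : UDec g₂
  dec_G : UDec G
  even_y : ∀ i x, y (i, -x) = y (i, x)
  even_e : ∀ i x, e (i, -x) = e (i, x)
  even_g₁ : ∀ i x, g₁ (i, -x) = g₁ (i, x)
  even_G : ∀ i x, G (i, -x) = G (i, x)
  f_eq : ∀ z : ι × ℝ, f z.1 (Q z) = κ * Q z ^ 2 + par ν z * Q z ^ 3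
    + par ε z * (y z * Q z ^ 2 + par δ z * (e z * Q z))
  deriv_eq : ∀ z : ι × ℝ, deriv (f z.1) (Q z) = 2 * κ * Q z + 3 * par ν z * Q z ^ 2
    + par ε z * (P * (y z * Q z) + par δ z * g₁ z)
  deriv2_eq : ∀ z : ι × ℝ, iteratedDeriv 2 (f z.1) (Q z) = 2 * κ + 6 * par ν z * Q z
    + par ε z * (P * (P - 1) * y z + par δ z * g₂ z)
  φ_sq : ∀ z : ι × ℝ, φ z ^ 2 = 1 - (2 / 3 * κ * Q z + 1 / 2 * par ν z * Q z ^ 2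
    + 2 * par ε z * (1 / (P + 1) * (y z * Q z) + par δ z * G z))
  hasDerivAt_y : ∀ i x, HasDerivAt (fun x => y (i, x)) (-((P - 2) * (φ (i, x) * y (i, x)))) x

/-- Uniformly bounded even solutions `W` of `ℒ W = -(3 Q - 2 f(Q))` with a solvability constant
bounded away from zero. -/
structure Solvability (f : ι → ℝ → ℝ) (Q φ W W' : ι × ℝ → ℝ) (c : ℝ) : Prop where
  pos : 0 < c
  dec_W : UDec W
  dec_W' : UDec W'
  even_W : ∀ i x, W (i, -x) = W (i, x)
  hasDerivAt_W : ∀ i x, HasDerivAt (fun x => W (i, x)) (W' (i, x)) x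
  hasDerivAt_W' : ∀ i x, HasDerivAt (fun x => W' (i, x))
    ((1 - deriv (f i) (Q (i, x))) * W (i, x) + (3 * Q (i, x) - 2 * f i (Q (i, x)))) x
  le_integral : ∀ i, c ≤ ∫ x, (Q (i, x) ^ 2 + (φ (i, x) * Q (i, x)) ^ 2
    + W (i, x) * (3 * Q (i, x) - 2 * f i (Q (i, x))))

/-- Self-adjointness of ℒ. The second function need only be bounded, since the multiplier of the
quadratic case contains a constant. -/
theorem hasInt_wronskian {p w w' v v' h k : ℝ → ℝ} (dw : Dec w) (dw' : Dec w') (dv : Bdd v)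
    (dv' : Bdd v') (dh : Dec h) (dk : Bdd k) (hw : ∀ x, HasDerivAt w (w' x) x)
    (hv : ∀ x, HasDerivAt v (v' x) x) (hw' : ∀ x, HasDerivAt w' ((1 - p x) * w x - h x) x)
    (hv' : ∀ x, HasDerivAt v' ((1 - p x) * v x - k x) x) :
    HasInt (fun x => v x * h x - w x * k x) 0 := by
  refine HasInt.of_deriv (T := fun x => w x * v' x - v x * w' x) (by fun_prop) (by fun_prop) fun x => ?_
  refine (((hw x).fun_mul (hv' x)).fun_sub ((hv x).fun_mul (hw' x))).congr_deriv ?_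
  ring

theorem Solvability.solvable {f : ι → ℝ → ℝ} {Q φ W W' : ι × ℝ → ℝ} {c C : ℝ} {N : ℕ∞}
    (h : Solvability f Q φ W W' c)
    (hp : ∀ i, Profile (f i) (fun x => Q (i, x)) (fun x => φ (i, x)) C)
    (hf : ∀ i, ContDiff ℝ N (f i)) (i : ι) :
    Solvable N (f i) (fun x => Q (i, x)) fun x => φ (i, x) := by
  refine ⟨fun x => W (i, x), fun x => W' (i, x), h.hasDerivAt_W i, h.hasDerivAt_W' i, h.even_W i,
    fun k hk => ?_, h.dec_W'.dec i, (h.pos.trans_le (h.le_integral i)).ne'⟩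
  match k with
  | 0 => exact h.dec_W.dec i
  | 1 => exact Reg.succ_of (h.dec_W.dec i) (h.hasDerivAt_W i) (h.dec_W'.dec i)
  | k + 2 =>
    exact Profile.decN_of_eq k ((hp i).loc_f' (hf i) k (le_trans (by exact_mod_cast (by omega)) hk))
      (h.dec_W.dec i) (h.dec_W'.dec i) (h.hasDerivAt_W i)
      (fun x => (h.hasDerivAt_W' i x).congr_deriv (by ring :
        _ = (1 - deriv (f i) (Q (i, x))) * W (i, x) - -(3 * Q (i, x) - 2 * f i (Q (i, x)))))
      (((hp i).loc_Q'' (hf i)).mono (by omega : 0 ≤ 2) k (by simpa using hk)).neg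

namespace Family

variable {κ P C : ℝ} {ν ε δ : ι → ℝ} {f : ι → ℝ → ℝ} {Q φ y e g₁ g₂ G : ι × ℝ → ℝ}

theorem dec_Q (h : Family κ P ν ε δ f Q φ y e g₁ g₂ G C) : UDec Q :=
  ⟨fun i => (h.profile i).continuous_Q, C, 0, fun z => by
    have h1 := (h.profile z.1).le_exp z.2
    have h2 := (h.profile z.1).pos z.2
    simpa [abs_of_pos h2] using h1⟩

theorem bdd_φ (h : Family κ P ν ε δ f Q φ y e g₁ g₂ G C) : UBdd φ :=
  ⟨fun i => (h.profile i).continuous_φ, 1, fun z => ((h.profile z.1).abs_φ_lt z.2).le⟩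

theorem even_Q (h : Family κ P ν ε δ f Q φ y e g₁ g₂ G C) (i : ι) (x : ℝ) : Q (i, -x) = Q (i, x) :=
  (h.profile i).even x

theorem odd_φ (h : Family κ P ν ε δ f Q φ y e g₁ g₂ G C) (i : ι) (x : ℝ) : φ (i, -x) = -φ (i, x) :=
  (h.profile i).odd x

theorem hasDerivAt_Q (h : Family κ P ν ε δ f Q φ y e g₁ g₂ G C) (i : ι) (x : ℝ) :
    HasDerivAt (fun x => Q (i, x)) (-(φ (i, x) * Q (i, x))) x := (h.profile i).hasDerivAt_Q x

theorem hasDerivAt_φ (h : Family κ P ν ε δ f Q φ y e g₁ g₂ G C) (i : ι) (x : ℝ) :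
    HasDerivAt (fun x => φ (i, x)) (φ (i, x) ^ 2 - 1 + (κ * Q (i, x) + ν i * Q (i, x) ^ 2
      + ε i * (y (i, x) * Q (i, x) + δ i * e (i, x)))) x := by
  refine ((h.profile i).hasDerivAt_φ x).congr_deriv ?_
  have h1 := h.f_eq (i, x)
  have h2 := ((h.profile i).pos x).ne'
  simp only [par] at h1
  rw [h1]
  field_simp

/-- The first order solution is a perturbation of an explicit one. -/
theorem exists_first_order (h : Family κ P ν ε δ f Q φ y e g₁ g₂ G C) {W W' : ι × ℝ → ℝ} {c : ℝ}
    (hW : Solvability f Q φ W W' c) {N : ℕ∞} (hN : 1 ≤ N) {A A' J B B' : ι × ℝ → ℝ} {a b : ι → ℝ}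
    (S : ∀ i, FirstSol N (f i) (fun x => Q (i, x)) (fun x => φ (i, x)) (fun x => A (i, x))
      (fun x => A' (i, x)) (fun x => J (i, x)) (fun x => B (i, x)) (fun x => B' (i, x)) (a i) (b i)) :
    ∃ (w w' : ι × ℝ → ℝ) (α : ι → ℝ), UDec w ∧ UDec w' ∧ UBdd (par α) ∧
      (∀ z, A z = -(4 / 3) * κ * Q z - par ν z * Q z ^ 2 + par ε z * w z) ∧
      (∀ z, A' z = φ z * (4 / 3 * κ * Q z + 2 * par ν z * Q z ^ 2) + par ε z * w' z) ∧
      (∀ i, a i = 2 / 3 * κ + ε i * α i) ∧ (∀ i x, w (i, -x) = w (i, x)) ∧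
      (∀ i x, HasDerivAt (fun x => w (i, x)) (w' (i, x)) x) ∧
      (∀ i x, HasDerivAt (fun x => w' (i, x)) ((1 - deriv (f i) (Q (i, x))) * w (i, x)
        - ((P * (y (i, x) * Q (i, x)) + δ i * g₁ (i, x))
          + 4 / 3 * κ * (y (i, x) * Q (i, x) ^ 2 + δ i * (e (i, x) * Q (i, x)))
          + 4 / 3 * κ * (y (i, x) * Q (i, x) ^ 2 + δ i * (e (i, x) * Q (i, x))
            - (P * (y (i, x) * Q (i, x)) + δ i * g₁ (i, x)) * Q (i, x))
          + ν i * (4 * (1 / (P + 1) * (y (i, x) * Q (i, x)) + δ i * G (i, x)) * Q (i, x) ^ 2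
            + 2 * Q (i, x) * (y (i, x) * Q (i, x) ^ 2 + δ i * (e (i, x) * Q (i, x)))
            - (P * (y (i, x) * Q (i, x)) + δ i * g₁ (i, x)) * Q (i, x) ^ 2)
          - α i * (3 * Q (i, x) - 2 * f i (Q (i, x))))) x) := by
  have dQ := h.dec_Q
  have bφ := h.bdd_φ
  have dy := h.dec_y
  have de := h.dec_e
  have dg₁ := h.dec_g₁
  have dG := h.dec_G
  have bν := h.ν_bdd
  have bε := h.ε_bdd
  have bδ := h.δ_bdd
  have dW := hW.dec_W
  have hN1 : ((1 : ℕ) : ℕ∞) ≤ N := by simpa using hN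
  set k : ι × ℝ → ℝ := fun z => (P * (y z * Q z) + par δ z * g₁ z)
    + 4 / 3 * κ * (y z * Q z ^ 2 + par δ z * (e z * Q z))
    + 4 / 3 * κ * (y z * Q z ^ 2 + par δ z * (e z * Q z) - (P * (y z * Q z) + par δ z * g₁ z) * Q z)
    + par ν z * (4 * (1 / (P + 1) * (y z * Q z) + par δ z * G z) * Q z ^ 2
      + 2 * Q z * (y z * Q z ^ 2 + par δ z * (e z * Q z))
      - (P * (y z * Q z) + par δ z * g₁ z) * Q z ^ 2) with hk
  -- What remains of the orthogonality integrand, divided by ε, after its exact part and the terms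
  -- in α and w are taken out.
  set m : ι × ℝ → ℝ := fun z => -(4 / 3) * κ * ((1 / (P + 1) * (y z * Q z) + par δ z * G z) * Q z ^ 2)
    + 2 * (y z * Q z ^ 2 + par δ z * (e z * Q z)) * (4 / 3 * κ * Q z + par ν z * Q z ^ 2)
    - (y z * Q z + par δ z * e z - 2 * (1 / (P + 1) * (y z * Q z) + par δ z * G z))
      * (4 / 3 * κ * Q z ^ 2 + par ν z * Q z ^ 3)
    - 2 * (1 / (P + 1) * (y z * Q z) + par δ z * G z) * (8 / 3 * κ * Q z ^ 2 + 3 * par ν z * Q z ^ 3)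
    with hm
  have dk : UDec k := by fun_prop
  have dm : UDec m := by fun_prop
  -- Difference quotients in ε around the explicit solution of the equation with ε = 0. Each is
  -- localized for fixed parameter; uniformity comes at the end, once α is bounded.
  set w : ι × ℝ → ℝ := fun z => (A z - (-(4 / 3) * κ * Q z - par ν z * Q z ^ 2)) / ε z.1 with hw
  set w' : ι × ℝ → ℝ := fun z =>
    (A' z - φ z * (4 / 3 * κ * Q z + 2 * par ν z * Q z ^ 2)) / ε z.1 with hw'
  set α : ι → ℝ := fun i => (a i - 2 / 3 * κ) / ε i with hα
  have eA : ∀ z, A z = -(4 / 3) * κ * Q z - par ν z * Q z ^ 2 + par ε z * w z := fun z => by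
    have := h.ε_ne z.1
    simp only [hw, par]; field_simp; ring
  have eA' : ∀ z, A' z = φ z * (4 / 3 * κ * Q z + 2 * par ν z * Q z ^ 2) + par ε z * w' z :=
    fun z => by
      have := h.ε_ne z.1
      simp only [hw', par]; field_simp; ring
  have ea : ∀ i, a i = 2 / 3 * κ + ε i * α i := fun i => by
    have := h.ε_ne i
    simp only [hα]; field_simp; ring
  have hwd : ∀ i x, HasDerivAt (fun x => w (i, x)) (w' (i, x)) x := fun i x => by
    refine ((((S i).hasDerivAt_A x).fun_sub (((h.hasDerivAt_Q i x).const_mul (-(4 / 3) * κ)).fun_sub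
      (((h.hasDerivAt_Q i x).fun_pow 2).const_mul (ν i)))).div_const (ε i)).congr_deriv ?_
    simp only [hw', par]
    ring
  have hwd' : ∀ i x, HasDerivAt (fun x => w' (i, x)) ((1 - deriv (f i) (Q (i, x))) * w (i, x)
      - (k (i, x) - α i * (3 * Q (i, x) - 2 * f i (Q (i, x))))) x := fun i x => by
    have h1 := (h.hasDerivAt_φ i x).fun_mul (((h.hasDerivAt_Q i x).const_mul (4 / 3 * κ)).fun_add
      (((h.hasDerivAt_Q i x).fun_pow 2).const_mul (2 * ν i)))
    refine ((((S i).hasDerivAt_A' x).fun_sub h1).div_const (ε i)).congr_deriv ?_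
    have e1 := h.f_eq (i, x)
    have e2 := h.deriv_eq (i, x)
    have e3 := h.φ_sq (i, x)
    have e4 := eA (i, x)
    have e5 := h.ε_ne i
    simp only [par] at e1 e2 e3 e4
    rw [e4, ea i, e1, e2]
    simp only [hk, par]
    rw [div_eq_iff e5]
    linear_combination 2 * ν i * Q (i, x) ^ 2 * e3
  have hwe : ∀ i x, w (i, -x) = w (i, x) := fun i x => by
    simp only [hw, par, (S i).even x, h.even_Q i x]
  have hwDec : ∀ i, Dec fun x => w (i, x) := fun i => by
    have d1 : UDec fun z => -(4 / 3) * κ * Q z - par ν z * Q z ^ 2 := by fun_prop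
    exact ((S i).dec_A.sub (d1.dec i)).mul_bdd (Bdd.const (ε i)⁻¹)
  have hwDec' : ∀ i, Dec fun x => w' (i, x) := fun i => by
    have d1 : UDec fun z => φ z * (4 / 3 * κ * Q z + 2 * par ν z * Q z ^ 2) := by fun_prop
    exact (((S i).loc_A'.dec hN1).sub (d1.dec i)).mul_bdd (Bdd.const (ε i)⁻¹)
  have eF : (fun z : ι × ℝ => 3 * Q z - 2 * f z.1 (Q z)) = fun z => 3 * Q z - 2 * (κ * Q z ^ 2
      + par ν z * Q z ^ 3 + par ε z * (y z * Q z ^ 2 + par δ z * (e z * Q z))) :=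
    funext fun z => by rw [h.f_eq]
  have dD : UDec fun z : ι × ℝ => 3 * Q z - 2 * f z.1 (Q z) := by rw [eF]; fun_prop
  -- Orthogonality gives a relation between α and ∫ w(3Q - 2f(Q)); self-adjointness against W
  -- replaces the latter by known data. The result is α c₀ = ∫ (Wk - m) with c₀ ≥ c > 0.
  have hα_bdd : UBdd (par α) := by
    have d1 : UDec fun z => W z * k z - m z := by fun_prop
    obtain ⟨K, hK⟩ := d1.exists_integral_le
    refine UBdd.of_par (K := K / c) fun i => ?_
    have s1 := hasInt_wronskian (hwDec i) (hwDec' i) (dW.dec i).bdd (hW.dec_W'.dec i).bdd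
      ((dk.dec i).sub (Dec.bdd_mul (Bdd.const (α i)) (dD.dec i))) (dD.dec i).neg.bdd (hwd i)
      (hW.hasDerivAt_W i) (hwd' i) (fun x => (hW.hasDerivAt_W' i x).congr_deriv
        (by ring : _ = (1 - deriv (f i) (Q (i, x))) * W (i, x) - -(3 * Q (i, x) - 2 * f i (Q (i, x)))))
    have dT : UDec fun z => φ z * (4 / 3 * κ * Q z ^ 2 + par ν z * Q z ^ 3) := by fun_prop
    -- At ε = 0 the orthogonality integrand is the derivative of this function; subtracting it makes
    -- the rest divisible by ε.
    have s2 := HasInt.of_deriv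
      (T := fun x => φ (i, x) * (4 / 3 * κ * Q (i, x) ^ 2 + ν i * Q (i, x) ^ 3))
      (dT.dec i) ?_ fun x => ((h.hasDerivAt_φ i x).fun_mul
        ((((h.hasDerivAt_Q i x).fun_pow 2).const_mul (4 / 3 * κ)).fun_add
          (((h.hasDerivAt_Q i x).fun_pow 3).const_mul (ν i))))
    · have dS : UDec fun z : ι × ℝ => Q z ^ 2 + (φ z * Q z) ^ 2 + W z * (3 * Q z - 2 * f z.1 (Q z)) := by
        refine UDec.add ?_ (dW.mul_bdd dD.bdd)
        fun_prop
      have s3 := HasInt.of_dec (d1.dec i)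
      have s4 := HasInt.of_dec (f := fun x => Q (i, x) ^ 2 + (φ (i, x) * Q (i, x)) ^ 2
        + W (i, x) * (3 * Q (i, x) - 2 * f i (Q (i, x)))) (dS.dec i)
      set c₀ := ∫ x, (Q (i, x) ^ 2 + (φ (i, x) * Q (i, x)) ^ 2
        + W (i, x) * (3 * Q (i, x) - 2 * f i (Q (i, x)))) with hc₀
      have h0 : c ≤ c₀ := hW.le_integral i
      have s5 : α i * c₀ = ∫ x, (W (i, x) * k (i, x) - m (i, x)) := by
        have e5 := h.ε_ne i
        refine (s4.const_mul (α i)).unique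
          (((((((S i).orth.sub s2).const_mul (ε i)⁻¹).sub s1).add s3)).congr (fun x => ?_) (by ring))
        have e1 := h.f_eq (i, x)
        have e3 := h.φ_sq (i, x)
        have e4 := eA (i, x)
        simp only [par] at e1 e3 e4
        have e6 : a i * (Q (i, x) ^ 2 + (φ (i, x) * Q (i, x)) ^ 2)
            + A (i, x) * (3 * Q (i, x) - 2 * f i (Q (i, x)))
            - ((φ (i, x) ^ 2 - 1 + (κ * Q (i, x) + ν i * Q (i, x) ^ 2
              + ε i * (y (i, x) * Q (i, x) + δ i * e (i, x))))
              * (4 / 3 * κ * Q (i, x) ^ 2 + ν i * Q (i, x) ^ 3) + φ (i, x) *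
              (4 / 3 * κ * (2 * Q (i, x) * -(φ (i, x) * Q (i, x)))
                + ν i * (3 * Q (i, x) ^ 2 * -(φ (i, x) * Q (i, x)))))
            = ε i * (m (i, x) + α i * (Q (i, x) ^ 2 + (φ (i, x) * Q (i, x)) ^ 2)
              + w (i, x) * (3 * Q (i, x) - 2 * f i (Q (i, x)))) := by
          rw [e4, ea i, e1]
          simp only [hm, par]
          linear_combination (2 / 3 * κ * Q (i, x) ^ 2 + 4 / 3 * κ * Q (i, x) ^ 2
            + 2 * ν i * Q (i, x) ^ 3) * e3
        simp only [Nat.cast_ofNat, Nat.reduceSub, pow_one]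
        rw [e6, inv_mul_cancel_left₀ e5]
        ring
      rw [le_div_iff₀ hW.pos]
      calc |α i| * c ≤ |α i| * c₀ := by gcongr
        _ = |α i * c₀| := by rw [abs_mul, abs_of_pos (hW.pos.trans_le h0)]
        _ ≤ K := by rw [s5]; exact hK i
    · have : UDec fun z : ι × ℝ => (φ z ^ 2 - 1 + (κ * Q z + par ν z * Q z ^ 2
          + par ε z * (y z * Q z + par δ z * e z))) * (4 / 3 * κ * Q z ^ 2 + par ν z * Q z ^ 3)
          + φ z * (4 / 3 * κ * (2 * Q z ^ (2 - 1) * -(φ z * Q z))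
            + par ν z * (3 * Q z ^ (3 - 1) * -(φ z * Q z))) := by fun_prop
      exact_mod_cast this.dec i
  have dh : UDec fun z => k z - par α z * (3 * Q z - 2 * f z.1 (Q z)) := by fun_prop
  have hu := UDec.of_even_solution h.profile dh (fun i x => ?_) hwDec hwDec' hwe hwd hwd'
  · exact ⟨w, w', α, hu.1, hu.2, hα_bdd, eA, eA', ea, hwe, hwd, hwd'⟩
  · simp only [hk, par, h.even_Q, h.even_y, h.even_e, h.even_g₁, h.even_G]

end Family

end Families

end GKdV

/-! ### Expansion of the defect for the cubic nonlinearity -/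

namespace GKdV

/-- The subtracted terms are all integrands with zero integral. Three times the orthogonality
relation removes 9Qw from the terms linear in w, leaving (9Q⁵ - 12Q³)w at leading order; K = 3Q³ -
6Q is chosen so that ℒK is this coefficient. The numbers t₀, t₂, t₄ weight the derivatives of φy,
φyQ², φyQ⁴, and the hypotheses `h₀`, `h₂`, `h₄`, `h₆` are the balances of y, yQ², yQ⁴, yQ⁶: all
vanish except that of yQ², which leaves 2c. The energy identity `hφ` eliminates φ². -/
theorem cubic_identity {P r c t₀ t₂ t₄ ε δ α Q φ y e g₁ g₂ G w w' : ℝ}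
    (hφ : φ ^ 2 = 1 - (1 / 2 * Q ^ 2 + 2 * ε * (r * (y * Q) + δ * G)))
    (h₀ : 1 / 2 * P * (P - 1) + t₀ * (P - 2) = 0)
    (h₂ : -(3 / 2) * P * (P - 1) - 6 * P + 3 * (1 - 2 * r) + 6 * r + t₂ * P - t₀ * (P - 1) / 2 = 2 * c)
    (h₄ : 3 / 2 * P * (P - 1) - 6 + 3 * P - 6 * (4 * r + 2 - P) + (1 - 2 * r) + 6 * r
      + t₄ * (P + 2) - t₂ * (P + 1) / 2 = 0)
    (h₆ : -(1 / 2) * P * (P - 1) + 3 * (4 * r + 2 - P) + (1 - 2 * r) + 10 * r - t₄ * (P + 3) / 2 = 0) :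
    let f := Q ^ 3 + ε * (y * Q ^ 2 + δ * (e * Q))
    let f' := 3 * Q ^ 2 + ε * (P * (y * Q) + δ * g₁)
    let φ' := φ ^ 2 - 1 + (Q ^ 2 + ε * (y * Q + δ * e))
    let H := r * (y * Q) + δ * G
    let g := y * Q ^ 2 + δ * (e * Q)
    let g' := P * (y * Q) + δ * g₁
    let g'' := P * (P - 1) * y + δ * g₂
    let u := 1 - Q ^ 2
    let A := -Q ^ 2 + ε * w
    let A' := φ * (2 * Q ^ 2) + ε * w'
    let K := 3 * Q ^ 3 - 6 * Q
    let Γ := y * Q + δ * e - 2 * (r * (y * Q) + δ * G)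
    (1 / 2 * (6 * Q + ε * g'') * (1 + A) ^ 3
        + (ε * α) * (-(3 / 2) * A ^ 2 + 3 * A' ^ 2)
        + (ε * α) ^ 2 * (4 * A * (Q - f) - 5 / 2 * (A * Q))
        + (ε * α) ^ 3 * (-(1 / 2) * (Q * (Q - f)) - Q ^ 2))
      - 3 * (ε * α * (Q ^ 2 + (φ * Q) ^ 2) + A * (3 * Q - 2 * f))
      - (φ' * (-3 * Q - Q ^ 3 - Q ^ 5) + φ ^ 2 * (3 * Q + 3 * Q ^ 3 + 5 * Q ^ 5))
      + ε * (K * (g' + (4 * H * Q ^ 2 + 2 * Q * g - g' * Q ^ 2) - α * (3 * Q - 2 * f))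
        - w * (3 * (-(6 * φ ^ 2 * Q ^ 3 + 3 * Q ^ 3 - 3 * Q ^ 2 * f) + Q ^ 3 - f' * Q ^ 3)
          - 6 * (f - f' * Q)))
      - ε * α * (-6) * (φ' * Q ^ 2 - 2 * φ ^ 2 * Q ^ 2)
      - ε * (φ' * (y * (t₀ + t₂ * Q ^ 2 + t₄ * Q ^ 4))
        - φ ^ 2 * y * ((P - 2) * t₀ + P * t₂ * Q ^ 2 + (P + 2) * t₄ * Q ^ 4))
    = ε * (2 * c * (y * Q ^ 2)
      + ε * (3 * Q * (3 * u * w ^ 2 + ε * w ^ 3)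
        + 1 / 2 * g'' * (3 * u ^ 2 * w + 3 * ε * u * w ^ 2 + ε ^ 2 * w ^ 3)
        + α * (3 * Q ^ 2 * w - 3 / 2 * ε * w ^ 2 + 12 * φ * Q ^ 2 * w' + 3 * ε * w' ^ 2)
        + α ^ 2 * (4 * A * (Q - f) - 5 / 2 * (A * Q))
        + ε * α ^ 3 * (-(1 / 2) * (Q * (Q - f)) - Q ^ 2)
        + 6 * w * g - 24 * α * H * Q ^ 4 + 6 * α * H * Q ^ 2 + 2 * α * K * g
        - w * (36 * H * Q ^ 3 + 9 * Q ^ 2 * g - 3 * g' * Q ^ 3 - 6 * g + 6 * g' * Q)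
        + 6 * α * (Γ + 4 * H) * Q ^ 2
        - y * (t₀ * (Γ + 2 * (P - 2) * H) + t₂ * (Γ + 2 * P * H) * Q ^ 2
          + t₄ * (Γ + 2 * (P + 2) * H) * Q ^ 4))
      + δ * (1 / 2 * g₂ * u ^ 3 - 6 * Q ^ 3 * e + K * (g₁ + 4 * G * Q ^ 2 + 2 * Q ^ 2 * e - g₁ * Q ^ 2)
        + 3 * e * Q + (e + 4 * G) * Q ^ 3 + (e + 8 * G) * Q ^ 5)) := by
  intro f f' φ' H g g' g'' u A A' K Γ
  simp only [f, f', φ', H, g, g', g'', u, A, A', K, Γ]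
  linear_combination (12 * ε * α * Q ^ 4 - 3 * ε * α * Q ^ 2 - 2 * Q ^ 3 - 4 * Q ^ 5 + 18 * ε * w * Q ^ 3
    - 6 * ε * α * Q ^ 2 - ε * y * ((3 - P) * t₀ + (1 - P) * t₂ * Q ^ 2 + (-1 - P) * t₄ * Q ^ 4)) * hφ
    + ε * y * h₀ + ε * y * Q ^ 2 * h₂ + ε * y * Q ^ 4 * h₄ + ε * y * Q ^ 6 * h₆

/-- Uniform localization bounds the integrals of the remainders independently of the parameter, and
the common factor ε is kept outside. -/
theorem abs_le_of_hasInt {ι : Type*} {R₁ R₂ R₃ Y : ι × ℝ → ℝ} {ε ν δ v : ι → ℝ} {c : ℝ}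
    (h₁ : UDec R₁) (h₂ : UDec R₂) (h₃ : UDec R₃) (hY : UDec Y)
    (h : ∀ i, HasInt (fun x => ε i * (2 * c * Y (i, x) + ε i * R₁ (i, x) + ν i * R₂ (i, x)
      + δ i * R₃ (i, x))) (2 * v i)) :
    ∃ K : ℝ, 0 ≤ K ∧
      ∀ i, |v i - c * ε i * ∫ x, Y (i, x)| ≤ K * (|ε i| * (|ε i| + |ν i| + |δ i|)) := by
  obtain ⟨K₁, hK₁⟩ := h₁.exists_integral_le
  obtain ⟨K₂, hK₂⟩ := h₂.exists_integral_le
  obtain ⟨K₃, hK₃⟩ := h₃.exists_integral_le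
  refine ⟨|K₁| + |K₂| + |K₃|, by positivity, fun i => ?_⟩
  have e := (h i).unique (((((((HasInt.of_dec (hY.dec i)).const_mul (2 * c)).add
    ((HasInt.of_dec (h₁.dec i)).const_mul (ε i))).add
    ((HasInt.of_dec (h₂.dec i)).const_mul (ν i))).add
    ((HasInt.of_dec (h₃.dec i)).const_mul (δ i))).const_mul (ε i)))
  set I₁ := ∫ x, R₁ (i, x)
  set I₂ := ∫ x, R₂ (i, x)
  set I₃ := ∫ x, R₃ (i, x)
  have e2 : v i - c * ε i * ∫ x, Y (i, x) = 1 / 2 * (ε i * (ε i * I₁ + ν i * I₂ + δ i * I₃)) := by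
    linarith
  rw [e2, abs_mul, abs_mul]
  have h1 : |ε i * I₁ + ν i * I₂ + δ i * I₃| ≤ |ε i| * |K₁| + |ν i| * |K₂| + |δ i| * |K₃| := by
    refine (abs_add_three _ _ _).trans (add_le_add_three ?_ ?_ ?_) <;> rw [abs_mul]
    · exact mul_le_mul_of_nonneg_left ((hK₁ i).trans (le_abs_self _)) (abs_nonneg _)
    · exact mul_le_mul_of_nonneg_left ((hK₂ i).trans (le_abs_self _)) (abs_nonneg _)
    · exact mul_le_mul_of_nonneg_left ((hK₃ i).trans (le_abs_self _)) (abs_nonneg _)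
  have h2 : |ε i| * |K₁| + |ν i| * |K₂| + |δ i| * |K₃|
      ≤ (|K₁| + |K₂| + |K₃|) * (|ε i| + |ν i| + |δ i|) := by
    have := mul_nonneg (abs_nonneg (ε i)) (add_nonneg (abs_nonneg K₂) (abs_nonneg K₃))
    have := mul_nonneg (abs_nonneg (ν i)) (add_nonneg (abs_nonneg K₁) (abs_nonneg K₃))
    have := mul_nonneg (abs_nonneg (δ i)) (add_nonneg (abs_nonneg K₁) (abs_nonneg K₂))
    linarith
  have h3 : |(1 / 2 : ℝ)| ≤ 1 := by norm_num [abs_of_pos]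
  calc |(1 / 2 : ℝ)| * (|ε i| * |ε i * I₁ + ν i * I₂ + δ i * I₃|)
      ≤ 1 * (|ε i| * ((|K₁| + |K₂| + |K₃|) * (|ε i| + |ν i| + |δ i|))) := by
        gcongr
        exact h1.trans h2
    _ = _ := by ring

/-- The coefficient of the defect for the cubic nonlinearity. -/
noncomputable def coeff3 (P : ℝ) : ℝ := -((P - 1) * (P - 3) * (P ^ 2 - 3 * P + 8) / (8 * (P - 2) * (P + 1)))

namespace Family

/-- The derivative of φq when q' = -φd. With q a polynomial in Q, possibly times y, these are the
relations among moments used to reduce integrands. -/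
theorem hasInt_φ_mul {ι : Type*} {κ P C : ℝ} {ν ε δ : ι → ℝ} {f : ι → ℝ → ℝ}
    {Q φ y e g₁ g₂ G q d : ι × ℝ → ℝ} (h : Family κ P ν ε δ f Q φ y e g₁ g₂ G C) (dq : UDec q)
    (dd : UDec d) (hd : ∀ i x, HasDerivAt (fun x => q (i, x)) (-(φ (i, x) * d (i, x))) x) (i : ι) :
    HasInt (fun x => (φ (i, x) ^ 2 - 1 + (κ * Q (i, x) + ν i * Q (i, x) ^ 2
      + ε i * (y (i, x) * Q (i, x) + δ i * e (i, x)))) * q (i, x) - φ (i, x) ^ 2 * d (i, x)) 0 := by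
  have dQ := h.dec_Q
  have bφ := h.bdd_φ
  have dy := h.dec_y
  have de := h.dec_e
  have bν := h.ν_bdd
  have bε := h.ε_bdd
  have bδ := h.δ_bdd
  have d1 : UDec fun z => (φ z ^ 2 - 1 + (κ * Q z + par ν z * Q z ^ 2
      + par ε z * (y z * Q z + par δ z * e z))) * q z - φ z ^ 2 * d z := by fun_prop
  refine HasInt.of_deriv (T := fun x => φ (i, x) * q (i, x)) ((UDec.bdd_mul bφ dq).dec i) (d1.dec i)
    fun x => ((h.hasDerivAt_φ i x).fun_mul (hd i x)).congr_deriv ?_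
  ring

variable {ι : Type*} {P C : ℝ} {ε δ : ι → ℝ} {f : ι → ℝ → ℝ} {Q φ y e g₁ g₂ G : ι × ℝ → ℝ}

/-- The integrand of 2b₂ is brought to the form of `cubic_identity` by adding terms of zero
integral; the integral of yQ² = Q^P is left for later. -/
theorem abs_cubic_defect_le (h : Family 0 P (fun _ => 1) ε δ f Q φ y e g₁ g₂ G C) {W W' : ι × ℝ → ℝ}
    {c : ℝ} (hW : Solvability f Q φ W W' c) {N : ℕ∞} (hN : 1 ≤ N) {A A' J B B' : ι × ℝ → ℝ}
    {a b b₂ : ι → ℝ}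
    (S : ∀ i, FirstSol N (f i) (fun x => Q (i, x)) (fun x => φ (i, x)) (fun x => A (i, x))
      (fun x => A' (i, x)) (fun x => J (i, x)) (fun x => B (i, x)) (fun x => B' (i, x)) (a i) (b i))
    (hb : ∀ i, HasInt (fun x => 1 / 2 * iteratedDeriv 2 (f i) (Q (i, x)) * (1 + A (i, x)) ^ 3
        + a i * (-(3 / 2) * A (i, x) ^ 2 + 3 * A' (i, x) ^ 2)
        + a i ^ 2 * (4 * A (i, x) * (Q (i, x) - f i (Q (i, x))) - 5 / 2 * (A (i, x) * Q (i, x)))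
        + a i ^ 3 * (-(1 / 2) * (Q (i, x) * (Q (i, x) - f i (Q (i, x)))) - Q (i, x) ^ 2)) (2 * b₂ i)) :
    ∃ K : ℝ, ∀ i, |b₂ i - coeff3 P * ε i * ∫ x, y (i, x) * Q (i, x) ^ 2|
      ≤ K * (|ε i| * (|ε i| + |δ i|)) := by
  obtain ⟨w, w', α, dw, dw', bα, eA, eA', ea, ew, hw, hw'⟩ := h.exists_first_order hW hN S
  have dQ := h.dec_Q
  have bφ := h.bdd_φ
  have dy := h.dec_y
  have de := h.dec_e
  have dg₁ := h.dec_g₁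
  have dg₂ := h.dec_g₂
  have dG := h.dec_G
  have bε := h.ε_bdd
  have bδ := h.δ_bdd
  have hP := h.four_le
  set r := 1 / (P + 1) with hr
  -- Solved in turn from the balances of y, yQ⁶ and yQ⁴; the remaining balance of yQ² then
  -- determines `coeff3`.
  set t₀ := -(P * (P - 1) / (2 * (P - 2))) with ht₀
  set t₄ := 2 / (P + 3) * (-(1 / 2) * P * (P - 1) + 3 * (4 * r + 2 - P) + (1 - 2 * r) + 10 * r) with ht₄
  set t₂ := 2 / (P + 1) * (3 / 2 * P * (P - 1) - 6 + 3 * P - 6 * (4 * r + 2 - P) + (1 - 2 * r) + 6 * r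
      + t₄ * (P + 2)) with ht₂
  have n1 : P + 1 ≠ 0 := by linarith
  have n2 : P - 2 ≠ 0 := by linarith
  have n3 : P + 3 ≠ 0 := by linarith
  have h₀ : 1 / 2 * P * (P - 1) + t₀ * (P - 2) = 0 := by
    rw [ht₀]; field_simp; ring
  have h₆ : -(1 / 2) * P * (P - 1) + 3 * (4 * r + 2 - P) + (1 - 2 * r) + 10 * r - t₄ * (P + 3) / 2 = 0 := by
    rw [ht₄]; field_simp; ring
  have h₄ : 3 / 2 * P * (P - 1) - 6 + 3 * P - 6 * (4 * r + 2 - P) + (1 - 2 * r) + 6 * r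
      + t₄ * (P + 2) - t₂ * (P + 1) / 2 = 0 := by
    rw [ht₂]; field_simp; ring
  have h₂ : -(3 / 2) * P * (P - 1) - 6 * P + 3 * (1 - 2 * r) + 6 * r + t₂ * P - t₀ * (P - 1) / 2
      = 2 * coeff3 P := by
    rw [ht₂, ht₄, ht₀, hr, coeff3]; field_simp; ring
  have eF : (fun z : ι × ℝ => f z.1 (Q z)) = fun z => Q z ^ 3
      + par ε z * (y z * Q z ^ 2 + par δ z * (e z * Q z)) :=
    funext fun z => by rw [h.f_eq]; simp only [par]; ring
  have ep : (fun z : ι × ℝ => deriv (f z.1) (Q z)) = fun z => 3 * Q z ^ 2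
      + par ε z * (P * (y z * Q z) + par δ z * g₁ z) :=
    funext fun z => by rw [h.deriv_eq]; simp only [par]; ring
  set R₁ : ι × ℝ → ℝ := fun z =>
    3 * Q z * (3 * (1 - Q z ^ 2) * w z ^ 2 + par ε z * w z ^ 3)
    + 1 / 2 * (P * (P - 1) * y z + par δ z * g₂ z) * (3 * (1 - Q z ^ 2) ^ 2 * w z
      + 3 * par ε z * (1 - Q z ^ 2) * w z ^ 2 + par ε z ^ 2 * w z ^ 3)
    + par α z * (3 * Q z ^ 2 * w z - 3 / 2 * par ε z * w z ^ 2 + 12 * φ z * Q z ^ 2 * w' z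
      + 3 * par ε z * w' z ^ 2)
    + par α z ^ 2 * (4 * (-Q z ^ 2 + par ε z * w z) * (Q z - (Q z ^ 3
      + par ε z * (y z * Q z ^ 2 + par δ z * (e z * Q z)))) - 5 / 2 * ((-Q z ^ 2 + par ε z * w z) * Q z))
    + par ε z * par α z ^ 3 * (-(1 / 2) * (Q z * (Q z - (Q z ^ 3
      + par ε z * (y z * Q z ^ 2 + par δ z * (e z * Q z))))) - Q z ^ 2)
    + 6 * w z * (y z * Q z ^ 2 + par δ z * (e z * Q z))
    - 24 * par α z * (r * (y z * Q z) + par δ z * G z) * Q z ^ 4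
    + 6 * par α z * (r * (y z * Q z) + par δ z * G z) * Q z ^ 2
    + 2 * par α z * (3 * Q z ^ 3 - 6 * Q z) * (y z * Q z ^ 2 + par δ z * (e z * Q z))
    - w z * (36 * (r * (y z * Q z) + par δ z * G z) * Q z ^ 3
      + 9 * Q z ^ 2 * (y z * Q z ^ 2 + par δ z * (e z * Q z))
      - 3 * (P * (y z * Q z) + par δ z * g₁ z) * Q z ^ 3 - 6 * (y z * Q z ^ 2 + par δ z * (e z * Q z))
      + 6 * (P * (y z * Q z) + par δ z * g₁ z) * Q z)
    + 6 * par α z * (y z * Q z + par δ z * e z - 2 * (r * (y z * Q z) + par δ z * G z)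
      + 4 * (r * (y z * Q z) + par δ z * G z)) * Q z ^ 2
    - y z * (t₀ * (y z * Q z + par δ z * e z - 2 * (r * (y z * Q z) + par δ z * G z)
        + 2 * (P - 2) * (r * (y z * Q z) + par δ z * G z))
      + t₂ * (y z * Q z + par δ z * e z - 2 * (r * (y z * Q z) + par δ z * G z)
        + 2 * P * (r * (y z * Q z) + par δ z * G z)) * Q z ^ 2
      + t₄ * (y z * Q z + par δ z * e z - 2 * (r * (y z * Q z) + par δ z * G z)
        + 2 * (P + 2) * (r * (y z * Q z) + par δ z * G z)) * Q z ^ 4) with hR₁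
  set R₂ : ι × ℝ → ℝ := fun z => 1 / 2 * g₂ z * (1 - Q z ^ 2) ^ 3 - 6 * Q z ^ 3 * e z
    + (3 * Q z ^ 3 - 6 * Q z) * (g₁ z + 4 * G z * Q z ^ 2 + 2 * Q z ^ 2 * e z - g₁ z * Q z ^ 2)
    + 3 * e z * Q z + (e z + 4 * G z) * Q z ^ 3 + (e z + 8 * G z) * Q z ^ 5 with hR₂
  have dR₁ : UDec R₁ := by fun_prop
  have dR₂ : UDec R₂ := by fun_prop
  suffices H : ∀ i, HasInt (fun x => ε i * (2 * coeff3 P * (y (i, x) * Q (i, x) ^ 2) + ε i * R₁ (i, x)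
      + δ i * R₂ (i, x))) (2 * b₂ i) by
    obtain ⟨K, -, hK⟩ := abs_le_of_hasInt (ν := fun _ => 0) (Y := fun z => y z * Q z ^ 2) dR₁ dR₁ dR₂
      (by fun_prop) fun i => by simpa using H i
    exact ⟨K, fun i => by simpa using hK i⟩
  intro i
  have dK : UDec fun z => 3 * Q z ^ 3 - 6 * Q z := by fun_prop
  have dK' : UDec fun z => -(φ z * (9 * Q z ^ 3 - 6 * Q z)) := by fun_prop
  have dF : UDec fun z => f z.1 (Q z) := by rw [eF]; fun_prop
  have dp : UDec fun z => deriv (f z.1) (Q z) := by rw [ep]; fun_prop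
  have hK : ∀ x, HasDerivAt (fun x => 3 * Q (i, x) ^ 3 - 6 * Q (i, x))
      (-(φ (i, x) * (9 * Q (i, x) ^ 3 - 6 * Q (i, x)))) x := fun x =>
    ((((h.hasDerivAt_Q i x).fun_pow 3).const_mul 3).fun_sub
      ((h.hasDerivAt_Q i x).const_mul 6)).congr_deriv (by push_cast; ring)
  have hK' : ∀ x, HasDerivAt (fun x => -(φ (i, x) * (9 * Q (i, x) ^ 3 - 6 * Q (i, x))))
      ((1 - deriv (f i) (Q (i, x))) * (3 * Q (i, x) ^ 3 - 6 * Q (i, x))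
        - (3 * (-(6 * φ (i, x) ^ 2 * Q (i, x) ^ 3 + 3 * Q (i, x) ^ 3
          - 3 * Q (i, x) ^ 2 * f i (Q (i, x))) + Q (i, x) ^ 3 - deriv (f i) (Q (i, x)) * Q (i, x) ^ 3)
          - 6 * (f i (Q (i, x)) - deriv (f i) (Q (i, x)) * Q (i, x)))) x := fun x => by
    refine ((h.hasDerivAt_φ i x).fun_mul ((((h.hasDerivAt_Q i x).fun_pow 3).const_mul 9).fun_sub
      ((h.hasDerivAt_Q i x).const_mul 6))).fun_neg.congr_deriv ?_
    have e1 := h.f_eq (i, x)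
    simp only [par] at e1
    rw [e1]
    push_cast
    ring
  have dLK : UDec fun z => 3 * (-(6 * φ z ^ 2 * Q z ^ 3 + 3 * Q z ^ 3 - 3 * Q z ^ 2 * f z.1 (Q z))
      + Q z ^ 3 - deriv (f z.1) (Q z) * Q z ^ 3)
      - 6 * (f z.1 (Q z) - deriv (f z.1) (Q z) * Q z) := by
    have key : ∀ F p : ι × ℝ → ℝ, UDec F → UDec p → UDec fun z =>
        3 * (-(6 * φ z ^ 2 * Q z ^ 3 + 3 * Q z ^ 3 - 3 * Q z ^ 2 * F z)
        + Q z ^ 3 - p z * Q z ^ 3) - 6 * (F z - p z * Q z) := fun F p hF hp => by fun_prop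
    exact key _ _ dF dp
  have s2 := h.hasInt_φ_mul (q := fun z => -3 * Q z - Q z ^ 3 - Q z ^ 5)
    (d := fun z => -3 * Q z - 3 * Q z ^ 3 - 5 * Q z ^ 5) (by fun_prop) (by fun_prop)
    (fun i x => ((((h.hasDerivAt_Q i x).const_mul (-3)).fun_sub ((h.hasDerivAt_Q i x).fun_pow 3)).fun_sub
      ((h.hasDerivAt_Q i x).fun_pow 5)).congr_deriv (by push_cast; ring)) i
  have s4 := h.hasInt_φ_mul (q := fun z => Q z ^ 2) (d := fun z => 2 * Q z ^ 2) (by fun_prop)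
    (by fun_prop) (fun i x => ((h.hasDerivAt_Q i x).fun_pow 2).congr_deriv (by push_cast; ring)) i
  have s5 := h.hasInt_φ_mul (q := fun z => y z * (t₀ + t₂ * Q z ^ 2 + t₄ * Q z ^ 4))
    (d := fun z => y z * ((P - 2) * t₀ + P * t₂ * Q z ^ 2 + (P + 2) * t₄ * Q z ^ 4)) (by fun_prop)
    (by fun_prop) (fun i x => ((h.hasDerivAt_y i x).fun_mul
      (((((h.hasDerivAt_Q i x).fun_pow 2).const_mul t₂).const_add t₀).fun_add
        (((h.hasDerivAt_Q i x).fun_pow 4).const_mul t₄))).congr_deriv (by push_cast; ring)) i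
  have dh : UDec fun z => P * (y z * Q z) + par δ z * g₁ z
      + (4 * (r * (y z * Q z) + par δ z * G z) * Q z ^ 2
        + 2 * Q z * (y z * Q z ^ 2 + par δ z * (e z * Q z))
        - (P * (y z * Q z) + par δ z * g₁ z) * Q z ^ 2)
      - par α z * (3 * Q z - 2 * f z.1 (Q z)) := by
    have key : ∀ F : ι × ℝ → ℝ, UDec F → UDec fun z => P * (y z * Q z) + par δ z * g₁ z
      + (4 * (r * (y z * Q z) + par δ z * G z) * Q z ^ 2
        + 2 * Q z * (y z * Q z ^ 2 + par δ z * (e z * Q z))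
        - (P * (y z * Q z) + par δ z * g₁ z) * Q z ^ 2)
      - par α z * (3 * Q z - 2 * F z) := fun F hF => by fun_prop
    exact key _ dF
  have s3 := hasInt_wronskian (dw.dec i) (dw'.dec i) (dK.dec i).bdd (dK'.dec i).bdd (dh.dec i)
    (dLK.dec i).bdd
    (hw i) hK (fun x => (hw' i x).congr_deriv (by simp only [par]; ring)) hK'
  · refine ((((((hb i).sub ((S i).orth.const_mul 3)).sub s2).add (s3.const_mul (ε i))).sub
      (s4.const_mul (ε i * α i * (-6)))).sub (s5.const_mul (ε i))).congr (fun x => ?_) (by ring)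
    have e1 := h.f_eq (i, x)
    have e2 := h.deriv_eq (i, x)
    have e3 := h.φ_sq (i, x)
    have e4 := h.deriv2_eq (i, x)
    have e5 := eA (i, x)
    have e6 := eA' (i, x)
    have e7 := ea i
    simp only [par] at e1 e2 e3 e4 e5 e6
    have key := cubic_identity (P := P) (r := r) (c := coeff3 P) (t₀ := t₀) (t₂ := t₂) (t₄ := t₄)
      (ε := ε i) (δ := δ i) (α := α i) (Q := Q (i, x)) (φ := φ (i, x)) (y := y (i, x)) (e := e (i, x))
      (g₁ := g₁ (i, x)) (g₂ := g₂ (i, x)) (G := G (i, x)) (w := w (i, x)) (w' := w' (i, x))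
      (by rw [e3]; ring) h₀ h₂ h₄ h₆
    rw [e1, e2, e4, e5, e6, e7]
    simp only [hR₁, hR₂, par] at key ⊢
    linear_combination -key

end Family
end GKdV

/-! ### Lower bound for the solvability constant -/

namespace GKdV

namespace Family

variable {ι : Type*} {κ P C : ℝ} {ν ε δ : ι → ℝ} {f : ι → ℝ → ℝ} {Q φ y e g₁ g₂ G : ι × ℝ → ℝ}

theorem dec_f (h : Family κ P ν ε δ f Q φ y e g₁ g₂ G C) : UDec fun z : ι × ℝ => f z.1 (Q z) := by
  have dQ := h.dec_Q
  have dy := h.dec_y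
  have de := h.dec_e
  have bν := h.ν_bdd
  have bε := h.ε_bdd
  have bδ := h.δ_bdd
  have eF : (fun z : ι × ℝ => f z.1 (Q z)) = fun z => κ * Q z ^ 2 + par ν z * Q z ^ 3
      + par ε z * (y z * Q z ^ 2 + par δ z * (e z * Q z)) := funext fun z => h.f_eq z
  rw [eF]; fun_prop

theorem dec_f' (h : Family κ P ν ε δ f Q φ y e g₁ g₂ G C) :
    UDec fun z : ι × ℝ => deriv (f z.1) (Q z) := by
  have dQ := h.dec_Q
  have dy := h.dec_y
  have dg₁ := h.dec_g₁
  have bν := h.ν_bdd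
  have bε := h.ε_bdd
  have bδ := h.δ_bdd
  have ep : (fun z : ι × ℝ => deriv (f z.1) (Q z)) = fun z => 2 * κ * Q z + 3 * par ν z * Q z ^ 2
      + par ε z * (P * (y z * Q z) + par δ z * g₁ z) := funext fun z => h.deriv_eq z
  rw [ep]; fun_prop

/-- Obtained from Q ≥ e^{-|x|}/C and ∫ e^{-2|x|} = 1. -/
theorem le_integral_Q_sq (h : Family κ P ν ε δ f Q φ y e g₁ g₂ G C) (i : ι) :
    1 / C ^ 2 ≤ ∫ x, Q (i, x) ^ 2 := by
  have hC := (h.profile i).C_pos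
  have d1 : UDec fun z => Q z ^ 2 := h.dec_Q.pow_two
  have i1 : ∫ x : ℝ, Real.exp (-2 * |x|) = 1 := by
    have := integral_comp_abs (f := fun x => Real.exp (-2 * x))
    rw [this, integral_exp_mul_Ioi (by norm_num)]
    norm_num
  -- A nonintegrable function would have integral 0 by convention, contradicting the value 1.
  have i2 : Integrable fun x : ℝ => Real.exp (-2 * |x|) := by
    by_contra hn
    rw [integral_undef hn] at i1
    exact zero_ne_one i1
  calc 1 / C ^ 2 = ∫ x : ℝ, 1 / C ^ 2 * Real.exp (-2 * |x|) := by rw [integral_const_mul, i1, mul_one]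
    _ ≤ _ := by
      refine integral_mono (i2.const_mul _) (d1.dec i).integrable fun x => ?_
      have h1 := (h.profile i).exp_le x
      have e1 : Real.exp (-2 * |x|) = Real.exp (-|x|) ^ 2 := by
        rw [← Real.exp_nat_mul]; congr 1; push_cast; ring
      simp only [e1]
      rw [div_mul_eq_mul_div, one_mul, div_le_iff₀ (by positivity), ← mul_pow, mul_comm]
      exact pow_le_pow_left₀ (Real.exp_pos _).le h1 2

/-- The linear systems are solvable for small parameters. -/
theorem exists_solvability (h : Family κ P ν ε δ f Q φ y e g₁ g₂ G C) (hκ : κ = 0 ∨ κ = 1) :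
    ∃ (W W' : ι × ℝ → ℝ) (K : ℝ), UDec W ∧ UDec W' ∧ (∀ i x, W (i, -x) = W (i, x)) ∧
      (∀ i x, HasDerivAt (fun x => W (i, x)) (W' (i, x)) x) ∧
      (∀ i x, HasDerivAt (fun x => W' (i, x))
        ((1 - deriv (f i) (Q (i, x))) * W (i, x) + (3 * Q (i, x) - 2 * f i (Q (i, x)))) x) ∧
      ∀ i, 1 / 4 * (1 / C ^ 2) - K * (|ε i| + |κ * ν i|) ≤ ∫ x, (Q (i, x) ^ 2 + (φ (i, x) * Q (i, x)) ^ 2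
        + W (i, x) * (3 * Q (i, x) - 2 * f i (Q (i, x)))) := by
  have dQ := h.dec_Q
  have bφ := h.bdd_φ
  have dy := h.dec_y
  have de := h.dec_e
  have dg₁ := h.dec_g₁
  have dG := h.dec_G
  have bν := h.ν_bdd
  have bε := h.ε_bdd
  have bδ := h.δ_bdd
  have dF := h.dec_f
  set c₀ := (1 + κ) / 2 with hc₀
  have dD : UDec fun z => 3 * Q z - 2 * f z.1 (Q z) := by
    have key : ∀ F : ι × ℝ → ℝ, UDec F → UDec fun z => 3 * Q z - 2 * F z := fun F hF => by fun_prop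
    exact key _ dF
  obtain ⟨u, u', du, du', ue, uo, hu, hu'⟩ := UDec.exists_solution (σ := 1) (h := fun z => Q z ^ 3)
    h.profile (by fun_prop) (fun i x => by rw [h.even_Q, one_mul]) (Or.inl rfl)
  obtain ⟨v, v', dv, dv', ve, vo, hv, hv'⟩ := UDec.exists_solution (σ := 1)
    (h := fun z => c₀ * ((P * (y z * Q z) + par δ z * g₁ z) * Q z)
      - (1 + c₀) * (y z * Q z ^ 2 + par δ z * (e z * Q z)))
    h.profile (by fun_prop)
    (fun i x => by simp only [par, h.even_Q, h.even_y, h.even_e, h.even_g₁, one_mul]) (Or.inl rfl)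
  -- From ℒQ = f(Q) - f'(Q)Q and ℒ(xQ') = -2Q'', the function c₀Q + (3/2)xQ' is exact when f + c₀(f
  -- - f'Q) = 0, which gives c₀ = 1 for u² and c₀ = 1/2 for u³. The functions v and u correct the
  -- errors of size ε and κν.
  set W : ι × ℝ → ℝ := fun z => c₀ * Q z - 3 / 2 * (z.2 * (φ z * Q z)) + par ε z * v z
    + κ * par ν z * u z with hWdef
  set W' : ι × ℝ → ℝ := fun z => -((c₀ + 3 / 2) * (φ z * Q z)) + 3 / 2 * (z.2 * (Q z - f z.1 (Q z)))
    + par ε z * v' z + κ * par ν z * u' z with hW'def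
  have dW : UDec W := by fun_prop
  have dW' : UDec W' := by
    have key : ∀ F : ι × ℝ → ℝ, UDec F → UDec fun z => -((c₀ + 3 / 2) * (φ z * Q z))
      + 3 / 2 * (z.2 * (Q z - F z)) + par ε z * v' z + κ * par ν z * u' z := fun F hF => by fun_prop
    exact key _ dF
  have d1 : UDec fun z => (1 + 2 * c₀) * (1 / (P + 1) * (y z * Q z) + par δ z * G z) * Q z ^ 2
      - c₀ * (Q z * (y z * Q z ^ 2 + par δ z * (e z * Q z))) + v z * (3 * Q z - 2 * f z.1 (Q z)) := by
    refine UDec.add ?_ (dv.mul_bdd dD.bdd)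
    fun_prop
  have d2 : UDec fun z => -(1 / 4) * Q z ^ 4 + u z * (3 * Q z - 2 * f z.1 (Q z)) := by
    refine UDec.add ?_ (du.mul_bdd dD.bdd)
    fun_prop
  obtain ⟨K₁, hK₁⟩ := d1.exists_integral_le
  obtain ⟨K₂, hK₂⟩ := d2.exists_integral_le
  refine ⟨W, W', |K₁| + |K₂|, dW, dW', fun i x => ?_, fun i x => ?_, fun i x => ?_, fun i => ?_⟩
  · simp only [hWdef, par, h.even_Q, h.odd_φ, ue, ve]; ring
  · have hxQ := (hasDerivAt_id x).fun_mul ((h.profile i).hasDerivAt_Q' x)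
    refine (((((h.hasDerivAt_Q i x).const_mul c₀).fun_add (hxQ.const_mul (3 / 2))).fun_add
      ((hv i x).const_mul (ε i))).fun_add ((hu i x).const_mul (κ * ν i))).congr_of_eventuallyEq
      (Eventually.of_forall fun t => ?_) |>.congr_deriv ?_
    · simp only [hWdef, par, id]; ring
    · simp only [hW'def, par, id]; ring
  · have hxQ := (hasDerivAt_id x).fun_mul ((h.profile i).hasDerivAt_Q'' x)
    refine ((((((h.profile i).hasDerivAt_Q' x).const_mul (c₀ + 3 / 2)).fun_add (hxQ.const_mul (3 / 2))).fun_add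
      ((hv' i x).const_mul (ε i))).fun_add ((hu' i x).const_mul (κ * ν i))).congr_of_eventuallyEq
      (Eventually.of_forall fun t => ?_) |>.congr_deriv ?_
    · simp only [hW'def, par, id]; ring
    · have e1 := h.f_eq (i, x)
      have e2 := h.deriv_eq (i, x)
      simp only [par] at e1 e2
      rw [e1, e2]
      simp only [hWdef, par, id, hc₀]
      rcases hκ with rfl | rfl <;> ring
  · have dS : UDec fun z : ι × ℝ => Q z ^ 2 + (φ z * Q z) ^ 2 + W z * (3 * Q z - 2 * f z.1 (Q z)) := by
      refine UDec.add ?_ (dW.mul_bdd dD.bdd)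
      fun_prop
    have s1 := HasInt.of_dec (dS.dec i)
    have s2 := HasInt.of_dec (d1.dec i)
    have s3 := HasInt.of_dec (d2.dec i)
    have s4 := HasInt.of_dec ((dQ.pow_two).dec i)
    have s5 := h.hasInt_φ_mul (q := fun z => Q z ^ 2) (d := fun z => 2 * Q z ^ 2) (by fun_prop)
      (by fun_prop) (fun i x => ((h.hasDerivAt_Q i x).fun_pow 2).congr_deriv (by push_cast; ring)) i
    -- A virial identity: by Q²(1 - φ²) = 2F(Q), differentiating x times this function produces the
    -- x-weighted part of W(3Q - 2f(Q)) and leaves unweighted terms.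
    have dT : UDec fun z => z.2 * (9 / 4 * Q z ^ 2 - 3 / 2 * (Q z ^ 2 * (1 - φ z ^ 2))) := by fun_prop
    have dT' : UDec fun z => 9 / 4 * Q z ^ 2 - 3 / 2 * (Q z ^ 2 * (1 - φ z ^ 2))
        + z.2 * (-(9 / 2) * (φ z * Q z ^ 2) + 3 * (φ z * Q z * f z.1 (Q z))) := by
      have key : ∀ F : ι × ℝ → ℝ, UDec F → UDec fun z => 9 / 4 * Q z ^ 2
        - 3 / 2 * (Q z ^ 2 * (1 - φ z ^ 2))
        + z.2 * (-(9 / 2) * (φ z * Q z ^ 2) + 3 * (φ z * Q z * F z)) := fun F hF => by fun_prop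
      exact key _ dF
    have s6 := HasInt.of_deriv (dT.dec i) (dT'.dec i) fun x => by
      have hq := (h.hasDerivAt_Q i x).fun_pow 2
      refine ((hasDerivAt_id x).fun_mul ((hq.const_mul (9 / 4)).fun_sub ((hq.fun_mul
        (((h.hasDerivAt_φ i x).fun_pow 2).const_sub 1)).const_mul (3 / 2)))).congr_deriv ?_
      have e1 := h.f_eq (i, x)
      simp only [par] at e1
      rw [e1]
      simp only [id]
      push_cast
      ring
    have e0 := s1.unique ((((((s4.const_mul (c₀ - 1 / 4)).add (s3.const_mul (κ * ν i))).add
      (s2.const_mul (ε i))).add s6).sub (s5.const_mul c₀)).congr (fun x => by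
        have e1 := h.f_eq (i, x)
        have e3 := h.φ_sq (i, x)
        simp only [par] at e1 e3
        rw [e1]
        simp only [hWdef, par, hc₀]
        rcases hκ with rfl | rfl
        · linear_combination (-(Q (i, x) ^ 2)) * e3
        · linear_combination (-(3 / 2) * Q (i, x) ^ 2) * e3) rfl)
    rw [e0]
    have h1 := h.le_integral_Q_sq i
    have h2 : |κ * ν i * ∫ x, (-(1 / 4) * Q (i, x) ^ 4 + u (i, x) * (3 * Q (i, x)
        - 2 * f i (Q (i, x))))| ≤ |κ * ν i| * |K₂| := by
      rw [abs_mul]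
      exact mul_le_mul_of_nonneg_left ((hK₂ i).trans (le_abs_self _)) (abs_nonneg _)
    have h3 := mul_le_mul_of_nonneg_left ((hK₁ i).trans (le_abs_self _)) (abs_nonneg (ε i))
    rw [← abs_mul] at h3
    have h4 := neg_abs_le (κ * ν i * ∫ x, (-(1 / 4) * Q (i, x) ^ 4 + u (i, x) * (3 * Q (i, x)
        - 2 * f i (Q (i, x)))))
    have h5 := neg_le_of_abs_le h3
    have h6 : 1 / 4 * (1 / C ^ 2) ≤ (c₀ - 1 / 4) * ∫ x, Q (i, x) ^ 2 := by
      -- The leading part of the solvability constant is (c₀ - 1/4)∫ Q², with factor 3/4 for κ = 1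
      -- and 1/4 for κ = 0.
      have : (1 : ℝ) / 4 ≤ c₀ - 1 / 4 := by rcases hκ with rfl | rfl <;> norm_num [hc₀]
      have h7 : 0 ≤ 1 / C ^ 2 := by positivity
      exact mul_le_mul this h1 h7 (by linarith)
    have h8 : 0 ≤ |ε i| * |K₂| := by positivity
    have h9 : 0 ≤ |κ * ν i| * |K₁| := by positivity
    simp only at h5 h4 h2 ⊢
    linarith

end Family

end GKdV

/-! ### The algebraic identity for the quadratic nonlinearity -/

namespace GKdV

/-- The part of the quadratic remainder proportional to `ε`. -/
noncomputable def quadRem₁ (P r t₀ t₁ t₂ ε ν δ α Q φ y e g₁ g₂ G w w' j : ℝ) : ℝ :=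
  Q * (Q * (y * (Q * (Q * (w * (P * (ν ^ 2 * (P * (3 / 2) - (3 / 2)))) + Q * α * r * ν ^ 2 * (-(24))
  + α * (ν * (α * ε * 4 + r * (-(32)) + 16 / 3))) + w * (ν * (P * (P * 4 - (4)) + r * (-(16)) -
  (8))) + y * (t₂ * (r * (P * (-(2)) + 2) - (1))) + α * (α * (ε * (α * (ε * (1 / 2)) + 19 / 3)) + r
  * (-(80 / 3)) + 80 / 9)) + w * (w * (P * (ν * (ε * (P * (-(3 / 2)) + 3 / 2)))) + P * (P * (ν *
  (-(3)) + 8 / 3) + ν * 3 + 4 / 3) + α * (ε * (α * ε * (-(4)) - (16 / 3))) - (40 / 3)) + y * (r * (P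
  * (t₁ * (-(2)) - (8)) + t₁ * 4) + t₁ * (-(1))) + G * (t₂ * (δ * (P * (-(2)) + 2))) + e * t₂ * δ *
  (-(1)) + α * (-(1))) + Q * (Q * (Q * α ^ 2 * ν ^ 2 * 4 + w * (g₂ * (ν ^ 2 * (δ * (3 / 2)))) + G *
  α * ν ^ 2 * δ * (-(24)) + α ^ 2 * (ν * (α * (ε * (1 / 2)) + 31 / 3))) + w * (w * ν ^ 2 * (-(9)) +
  g₂ * ν * δ * 4 + α * (ν * (α * ε * (-(4)) - (16 / 3)))) + e * (α * (ν * (δ * (α * ε * 4 + 16 /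
  3)))) + G * α * ν * δ * (-(32)) + α ^ 2 * (α * (ε * (1 / 2)) + ν * (-(3 / 2)) + 19 / 3)) + w * (g₂
  * (w * (ν * (δ * (ε * (-(3 / 2))))) + δ * (ν * (-(3)) + 8 / 3)) + w * ν * (-(15)) + e * ν * δ *
  (-(8)) + G * ν * δ * (-(16)) + α * (α * ε * (-(4)) + ν * 3 - (16 / 3))) + e * (α * (δ * (α * (ε *
  (α * (ε * (1 / 2)) + 19 / 3)) + 80 / 9))) + w' * α * φ * ν * 12 + G * (α * (δ * (-(80 / 3)))) + α
  ^ 2 * (α * (ε * (-(3 / 2))) - (4))) + w * (y * (w * (P * (ε * (P * (-(2)) + 2))) + P * (P * (-(4))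
  - (1)) + r * (-(12)) + 6) + w * (w * ν * ε * 3 + g₂ * δ * ε * (-(2)) + ν * 9 - (4)) + e * (δ * (α
  * (ε * (α * ε * (-(4)) - (16 / 3))) - (40 / 3))) + g₁ * δ * 4 + g₂ * δ * (-(4)) + α * (α * (ε * (3
  / 2)) + 5)) + y * (y * (t₀ * (r * (P * (-(2)) + 6) - (1))) + G * (δ * (P * (t₁ * (-(2)) - (8)) +
  t₁ * 4)) + e * t₁ * δ * (-(1)) + g₁ * r * δ * (-(8)) + j * φ * P * (-(2))) + w' * α * φ * 8 + e *
  α * δ * (-(1))) + w * (w * (y * (w * (P * (ε ^ 2 * (P * (1 / 2) - (1 / 2)))) + P * (ε * (P * (3 /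
  2) - (3 / 2)))) + w * (g₂ * (δ * (ε ^ 2 * (1 / 2))) + ε) + g₂ * (δ * (ε * (3 / 2))) + α * (ε *
  (-(3 / 2))) - (1)) + y * (P * (P * (3 / 2) - (3 / 2))) + e * δ * 6 + g₁ * δ * (-(5)) + g₂ * (δ *
  (3 / 2)) + G * δ * (-(12))) + y * (G * (t₀ * (δ * (P * (-(2)) + 6))) + e * t₀ * δ * (-(1))) + w' ^
  2 * (α * ε * 3 + 2) + g₁ * (G * δ ^ 2 * (-(8)) + j * φ * δ * (-(2)))

/-- The part of the quadratic remainder proportional to `ν`. -/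
noncomputable def quadRem₂ (P r t₀ t₁ t₂ ν δ α Q φ y e g₁ g₂ G w x : ℝ) : ℝ :=
  x * (Q ^ 3 * (Q * (y * (φ * (P * (-(2 / 3)) + r * (8 / 3) + 4 / 3))) + e * (φ * (δ * (4 / 3))) +
  g₁ * (φ * (δ * (-(2 / 3)))) + G * (φ * (δ * (8 / 3))))) + Q * (Q * (Q * (Q * (y * (Q * (Q * (ν ^ 2
  * (P * (P * (-(1 / 2)) + 1 / 2) + r * 8 + 1)) + ν * (P * (P * (-(2)) + 2) + r * 16 + 16 / 3)) + P
  * (P * (ν * (3 / 2) - (8 / 3)) + t₂ * (-(1 / 2)) + ν * (-(3 / 2)) - (4 / 3)) + r * (ν * (-(8)) +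
  40 / 3) + t₂ * (-(1 / 2)) + ν * (-(2)) + 18) + Q * (Q * (g₂ * (ν ^ 2 * (δ * (-(1 / 2)))) + α * ν ^
  2 * (-(6))) + w * ν ^ 2 * 9 + e * ν ^ 2 * δ + g₂ * ν * δ * (-(2)) + G * ν ^ 2 * δ * 8 + α * (ν *
  (-(32 / 3)))) + g₂ * (δ * (ν * (3 / 2) - (8 / 3))) + w * ν * 15 + e * (ν * (δ * (16 / 3))) + G * ν
  * δ * 16 + α * (ν * (21 / 2) - (28 / 9))) + y * (P * (P * 4 + t₁ * (-(1 / 2)) - (1)) + r * (-(44 /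
  3)) - (58 / 3)) + w * (ν * (-(18)) + 28 / 3) + e * (δ * (ν * (-(2)) + 18)) + G * (δ * (ν * (-(8))
  + 40 / 3)) + g₁ * δ * (-(4)) + g₂ * δ * 4 + α * 7) + y * (P * (P * (-(3 / 2)) + t₀ * (-(1 / 2)) +
  3 / 2) + t₀ * (1 / 2) + 3) + w * (-(21)) + e * (δ * (-(58 / 3))) + g₁ * δ * 3 + g₂ * (δ * (-(3 /
  2))) + G * (δ * (-(44 / 3)))) + w * 9 + e * δ * 3)

/-- The part of the quadratic remainder proportional to `δ`. -/
noncomputable def quadRem₃ (Q φ e g₁ g₂ G x : ℝ) : ℝ :=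
  x * (Q * (Q * (e * (φ * (16 / 9)) + g₁ * (φ * (-(8 / 9)))) + g₁ * (φ * (2 / 3)))) + Q * (Q * (g₂ *
  (Q * (-(32 / 27)) + 8 / 3) + e * (152 / 9) + g₁ * (-(16 / 3)) + G * (-(104 / 9))) + e * (-(184 /
  9)) + g₁ * 8 + g₂ * (-(2)) + G * 16) + e * (-(16 / 3)) + g₁ * (-(1)) + g₂ * (1 / 2) + G * (32 / 3)

/-- Same principle as in the cubic case, with two differences. At leading order J = -2φ satisfies
3A' + f'(Q)J = 0, so the product B(3A' + f'(Q)J) is ε times Bρ and only the leading part of B counts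
at first order. The multiplier K, whose image ℒK matches the coefficient of w at ε = ν = 0, now
contains a constant and xQ', so the derivative of x times a localized function is needed to clear
the weights. The four balances are those of y, yQ, yQ² and yQ³, the third leaving 2c; k multiplies
only φQρ, which has zero integral. -/
theorem quadratic_identity {P r c t₀ t₁ t₂ ε ν δ α Q φ y e g₁ g₂ G w w' j u k x : ℝ}
    (hφ : φ ^ 2 = 1 - (2 / 3 * Q + 1 / 2 * ν * Q ^ 2 + 2 * ε * (r * (y * Q) + δ * G)))
    (hr : r * (P + 1) = 1)
    (h₀ : 1 / 2 * P * (P - 1) + t₀ * (P - 2) = 0)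
    (h₁ : P - 2 * P ^ 2 + 32 / 3 * r - 16 / 3 + t₁ * (P - 1) - t₀ * (2 / 3 * P - 1) = 0)
    (h₂ : 16 / 3 * P + 8 / 3 * P ^ 2 + 16 * r - 178 / 9 + t₂ * P - t₁ * (2 / 3 * P - 1 / 3) = 2 * c)
    (h₃ : -(8 / 9) * P * r - 112 / 27 * P - 32 / 27 * P ^ 2 - 88 / 9 * r + 152 / 9
      - t₂ * (2 / 3 * P + 1 / 3) = 0) :
    let f := Q ^ 2 + ν * Q ^ 3 + ε * (y * Q ^ 2 + δ * (e * Q))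
    let f' := 2 * Q + 3 * ν * Q ^ 2 + ε * (P * (y * Q) + δ * g₁)
    let φ' := φ ^ 2 - 1 + (Q + ν * Q ^ 2 + ε * (y * Q + δ * e))
    let H := r * (y * Q) + δ * G
    let g := y * Q ^ 2 + δ * (e * Q)
    let g' := P * (y * Q) + δ * g₁
    let g'' := P * (P - 1) * y + δ * g₂
    let A := -(4 / 3) * Q - ν * Q ^ 2 + ε * w
    let a₁ := 4 / 3 * Q + 2 * ν * Q ^ 2
    let A' := φ * a₁ + ε * w'
    let a := 2 / 3 + ε * α
    let j' := w + α * Q + 2 * (y * Q + δ * e - 2 * H)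
    let ρ := 3 * w' - 2 * φ * g' + f' * j
    let J := -2 * φ + ε * j
    let B := J + ε * (u + k * (φ * Q))
    let K := -5 + 4 * Q + 2 / 3 * (x * (φ * Q))
    let D := 3 * Q - 2 * f
    (1 / 2 * ((2 + 6 * ν * Q + ε * g'') * (1 + A) ^ 2 - 2) * (1 + A)
        + a * (-(3 / 2) * A ^ 2 + 3 * A' ^ 2)
        + a ^ 2 * (4 * A * (Q - f) - 5 / 2 * (A * Q))
        + a ^ 3 * (-(1 / 2) * (Q * (Q - f)) - Q ^ 2)
        + (-4 * A - 3 * a * Q - a * (A * Q) + a ^ 2 * Q ^ 2 - 3 * A ^ 2 + B * (3 * A' + f' * J)))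
      + 16 / 9 * (a * (Q ^ 2 + (φ * Q) ^ 2) + A * D) + 2 / 3 * φ' - 3 * ε * j'
      - (φ' * (-(8 / 9 + 3 * ν) * Q + (28 / 27 + 10 / 3 * ν) * Q ^ 2 + (2 * ν ^ 2 - 14 / 3 * ν) * Q ^ 3
            - 16 / 3 * ν ^ 2 * Q ^ 4 - ν ^ 3 * Q ^ 5)
          - φ ^ 2 * (-(8 / 9 + 3 * ν) * Q + 2 * (28 / 27 + 10 / 3 * ν) * Q ^ 2
            + 3 * (2 * ν ^ 2 - 14 / 3 * ν) * Q ^ 3 - 64 / 3 * ν ^ 2 * Q ^ 4 - 5 * ν ^ 3 * Q ^ 5))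
      + ε * (6 * (φ' * w + φ * w') + φ * (4 * Q + 6 * ν * Q ^ 2) * j - (4 * Q + 3 * ν * Q ^ 2) * j'
          - 4 * ((φ' * a₁ - φ ^ 2 * (4 / 3 * Q + 4 * ν * Q ^ 2)) * w + φ * a₁ * w'))
      + ε * (K * (g' + 4 / 3 * g + 4 / 3 * (g - g' * Q) + ν * (4 * H * Q ^ 2 + 2 * Q * g - g' * Q ^ 2)
            - α * D)
          - w * (-5 + 5 * f' + 4 * (f - f' * Q) + 4 / 3 * (Q - f)))
      + ε * (-(2 / 3) * α * (3 / 2 * Q ^ 2 - Q ^ 2 * (1 - φ ^ 2)) + 2 / 3 * (y * Q ^ 2)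
          + 2 / 3 * (8 / 3 - 4 / 3 * P) * r * (y * Q ^ 3)
          + x * (-(2 / 3) * α * (-3 * (φ * Q ^ 2) + 2 * (φ * Q * f)) - 2 / 3 * P * (φ * (y * Q ^ 2))
            - 2 / 3 * (8 / 3 - 4 / 3 * P) * r * (P + 1) * (φ * (y * Q ^ 3))))
      - ε * α * (φ' * (-9 * Q + 62 / 9 * Q ^ 2) - φ ^ 2 * (-9 * Q + 124 / 9 * Q ^ 2))
      - ε * (φ' * (y * (t₀ + t₁ * Q + t₂ * Q ^ 2))
        - φ ^ 2 * (y * ((P - 2) * t₀ + (P - 1) * t₁ * Q + P * t₂ * Q ^ 2)))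
      - ε ^ 2 * k * (φ * Q * ρ)
    = ε * (2 * c * (y * Q ^ 2)
      + ε * (quadRem₁ P r t₀ t₁ t₂ ε ν δ α Q φ y e g₁ g₂ G w w' j + (j + u) * ρ)
      + ν * quadRem₂ P r t₀ t₁ t₂ ν δ α Q φ y e g₁ g₂ G w x
      + δ * quadRem₃ Q φ e g₁ g₂ G x) := by
  intro f f' φ' H g g' g'' A a₁ A' a j' ρ J B K D
  simp only [f, f', φ', H, g, g', g'', A, a₁, A', a, j', ρ, J, B, K, D, quadRem₁, quadRem₂, quadRem₃]
  linear_combination (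
  Q * (Q * (Q * (Q * (Q * ν ^ 3 * (-(4)) + ν ^ 2 * (α * ε * 12 - (8))) + ν * (α * ε * 16 + ν * 4 + 4
  / 3)) + y * (t₂ * (ε * (P - (1)))) + w * ν * ε * 8 + α * (ε * (40 / 3)) + ν * (10 / 3) + 52 / 9) +
  y * (ε * (P * (t₁ + 4) + t₁ * (-(2))))) + y * (t₀ * (ε * (P - (3)))) + w * ε * 6 + g₁ * δ * ε * 4
  + 2 / 3) * hφ
    + ε * y * h₀ + ε * y * Q * h₁ + ε * y * Q ^ 2 * h₂ + ε * y * Q ^ 3 * h₃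
    + 8 / 9 * (P - 2) * ε * φ * x * y * Q ^ 3 * hr

end GKdV

/-! ### Expansion of the defect for the quadratic nonlinearity -/

namespace GKdV

/-- The coefficient of the defect for the quadratic nonlinearity. -/
noncomputable def coeff2 (P : ℝ) : ℝ :=
  -((P - 3) * (2 * P - 1) * (24 - 23 * P + 3 * P ^ 2 + 2 * P ^ 3) / (36 * (P ^ 2 - 1) * (P - 2)))

section
variable {ι : Type*}

/-- An odd function vanishes at 0, so it is bounded by the integral of the common majorant of its
derivative. -/
theorem UBdd.of_hasDerivAt_odd {g g' : ι × ℝ → ℝ} (hg' : UDec g')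
    (hd : ∀ i x, HasDerivAt (fun x => g (i, x)) (g' (i, x)) x) (ho : ∀ i x, g (i, -x) = -g (i, x)) :
    UBdd g := by
  obtain ⟨hc, K, n, hK⟩ := hg'
  refine ⟨fun i => continuous_of_hasDerivAt (hd i),
    ∫ x : ℝ, K * ((1 + |x|) ^ n * Real.exp (-|x|)), fun z => ?_⟩
  have h0 : g (z.1, 0) = 0 := by have := ho z.1 0; rw [neg_zero] at this; linarith
  have h1 := intervalIntegral.integral_eq_sub_of_hasDerivAt (fun x _ => hd z.1 x)
    ((hc z.1).intervalIntegrable 0 z.2)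
  rw [h0, sub_zero] at h1
  have hI := (integrable_weight n).const_mul K
  have h2 : |g z| = |∫ x in (0)..z.2, g' (z.1, x)| := by rw [h1]
  rw [h2]
  calc |∫ x in (0)..z.2, g' (z.1, x)| ≤ ∫ x in Set.uIoc 0 z.2, |g' (z.1, x)| :=
        intervalIntegral.norm_integral_le_integral_norm_uIoc (f := fun x => g' (z.1, x))
    _ ≤ ∫ x in Set.uIoc 0 z.2, K * ((1 + |x|) ^ n * Real.exp (-|x|)) := by
        refine setIntegral_mono ((hc z.1).abs.integrableOn_uIoc) hI.integrableOn fun x => hK (z.1, x)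
    _ ≤ _ := setIntegral_le_integral hI (ae_of_all _ fun x => (abs_nonneg _).trans (hK (z.1, x)))

variable {P r t₀ t₁ t₂ : ℝ} {ε ν δ α Q φ y e g₁ g₂ G w w' j : ι × ℝ → ℝ}

/-- The polynomial is grouped so that each of its five summands carries a localized factor Q, w, y,
w'² or g₁; the cofactors, where j does not decay, need only be bounded. -/
theorem udec_quadRem₁ (bε : UBdd ε) (bν : UBdd ν) (bδ : UBdd δ) (bα : UBdd α) (dQ : UDec Q)
    (bφ : UBdd φ) (dy : UDec y) (be : UBdd e) (dg₁ : UDec g₁) (bg₂ : UBdd g₂) (bG : UBdd G)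
    (dw : UDec w) (dw' : UDec w') (bj : UBdd j) :
    UDec fun z => quadRem₁ P r t₀ t₁ t₂ (ε z) (ν z) (δ z) (α z) (Q z) (φ z) (y z) (e z) (g₁ z) (g₂ z)
      (G z) (w z) (w' z) (j z) := by
  have bQ := dQ.bdd
  have by' := dy.bdd
  have bg₁ := dg₁.bdd
  have bw := dw.bdd
  have bw' := dw'.bdd
  unfold quadRem₁
  refine UDec.add (UDec.add (UDec.add (UDec.add ?_ ?_) ?_) ?_) ?_
  · refine dQ.mul_bdd ?_
    clear dQ dy dg₁ dw dw'
    fun_prop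
  · refine dw.mul_bdd ?_
    clear dQ dy dg₁ dw dw'
    fun_prop
  · refine dy.mul_bdd ?_
    clear dQ dy dg₁ dw dw'
    fun_prop
  · refine dw'.pow_two.mul_bdd ?_
    clear dQ dy dg₁ dw dw'
    fun_prop
  · refine dg₁.mul_bdd ?_
    clear dQ dy dg₁ dw dw'
    fun_prop

theorem udec_quadRem₂ (bν : UBdd ν) (bδ : UBdd δ) (bα : UBdd α) (dQ : UDec Q)
    (bφ : UBdd φ) (by' : UBdd y) (be : UBdd e) (bg₁ : UBdd g₁) (bg₂ : UBdd g₂) (bG : UBdd G)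
    (bw : UBdd w) :
    UDec fun z => quadRem₂ P r t₀ t₁ t₂ (ν z) (δ z) (α z) (Q z) (φ z) (y z) (e z) (g₁ z) (g₂ z)
      (G z) (w z) z.2 := by
  have bQ := dQ.bdd
  unfold quadRem₂
  refine UDec.add ?_ ?_
  · refine UDec.id_mul (dQ.pow_three.mul_bdd ?_)
    clear dQ
    fun_prop
  · refine dQ.mul_bdd ?_
    clear dQ
    fun_prop

theorem udec_quadRem₃ (dQ : UDec Q) (bφ : UBdd φ) (de : UDec e) (dg₁ : UDec g₁) (dg₂ : UDec g₂)
    (dG : UDec G) : UDec fun z => quadRem₃ (Q z) (φ z) (e z) (g₁ z) (g₂ z) (G z) z.2 := by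
  unfold quadRem₃
  fun_prop

end

namespace Family

variable {ι : Type*} {P C : ℝ} {ν ε δ : ι → ℝ} {f : ι → ℝ → ℝ} {Q φ y e g₁ g₂ G : ι × ℝ → ℝ}

/-- Besides A, the integrand involves B and J, so the perturbative description is first extended to
them: J = -2φ + εj, and B - J is of order ε up to a multiple of Q'. -/
theorem abs_quadratic_defect_le (h : Family 1 P ν ε δ f Q φ y e g₁ g₂ G C) {W W' : ι × ℝ → ℝ}
    {c : ℝ} (hW : Solvability f Q φ W W' c) {N : ℕ∞} (hN : 1 ≤ N) (hf : ∀ i, ContDiff ℝ N (f i))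
    {A A' J B B' : ι × ℝ → ℝ} {a b b₂ : ι → ℝ}
    (S : ∀ i, FirstSol N (f i) (fun x => Q (i, x)) (fun x => φ (i, x)) (fun x => A (i, x))
      (fun x => A' (i, x)) (fun x => J (i, x)) (fun x => B (i, x)) (fun x => B' (i, x)) (a i) (b i))
    (hb : ∀ i, HasInt (fun x =>
        1 / 2 * (iteratedDeriv 2 (f i) (Q (i, x)) * (1 + A (i, x)) ^ 2 - 2) * (1 + A (i, x))
        + a i * (-(3 / 2) * A (i, x) ^ 2 + 3 * A' (i, x) ^ 2)
        + a i ^ 2 * (4 * A (i, x) * (Q (i, x) - f i (Q (i, x))) - 5 / 2 * (A (i, x) * Q (i, x)))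
        + a i ^ 3 * (-(1 / 2) * (Q (i, x) * (Q (i, x) - f i (Q (i, x)))) - Q (i, x) ^ 2)
        + (-4 * A (i, x) - 3 * a i * Q (i, x) - a i * (A (i, x) * Q (i, x)) + a i ^ 2 * Q (i, x) ^ 2
          - 3 * A (i, x) ^ 2
          + B (i, x) * (3 * A' (i, x) + deriv (f i) (Q (i, x)) * J (i, x))))
      (2 * (b₂ i - b i) + b i ^ 3)) :
    ∃ K : ℝ, ∀ i, |b₂ i + 1 / 6 * b i ^ 3 - coeff2 P * ε i * ∫ x, y (i, x) * Q (i, x) ^ 2|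
      ≤ K * (|ε i| * (|ε i| + |ν i| + |δ i|)) := by
  obtain ⟨w, w', α, dw, dw', bα, eA, eA', ea, ew, hw, hw'⟩ := h.exists_first_order hW hN S
  have dQ := h.dec_Q
  have bφ := h.bdd_φ
  have dy := h.dec_y
  have de := h.dec_e
  have dg₁ := h.dec_g₁
  have dg₂ := h.dec_g₂
  have dG := h.dec_G
  have bν := h.ν_bdd
  have bε := h.ε_bdd
  have bδ := h.δ_bdd
  have hP := h.four_le
  have dF := h.dec_f
  have dp := h.dec_f'
  have ow' : ∀ i x, w' (i, -x) = -w' (i, x) := fun i => odd_of_hasDerivAt_even (hw i) (ew i)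
  set r := 1 / (P + 1) with hr
  have n1 : P + 1 ≠ 0 := by linarith
  have n2 : P - 2 ≠ 0 := by linarith
  have n3 : 2 * P + 1 ≠ 0 := by linarith
  have n4 : P - 1 ≠ 0 := by linarith
  have hr1 : r * (P + 1) = 1 := by rw [hr]; field_simp
  -- t₀, t₁, t₂ are solved from the balances of y, yQ and yQ³; the balance of yQ² then gives
  -- `coeff2`.
  set t₀ := -(P * (P - 1) / (2 * (P - 2))) with ht₀
  set t₁ := (t₀ * (2 / 3 * P - 1) - (P - 2 * P ^ 2 + 32 / 3 * r - 16 / 3)) / (P - 1) with ht₁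
  set t₂ := (-(8 / 9) * P * r - 112 / 27 * P - 32 / 27 * P ^ 2 - 88 / 9 * r + 152 / 9)
    * 3 / (2 * P + 1) with ht₂
  have h₀ : 1 / 2 * P * (P - 1) + t₀ * (P - 2) = 0 := by
    rw [ht₀]; field_simp; ring
  have h₁ : P - 2 * P ^ 2 + 32 / 3 * r - 16 / 3 + t₁ * (P - 1) - t₀ * (2 / 3 * P - 1) = 0 := by
    rw [ht₁]; field_simp; ring
  have h₃ : -(8 / 9) * P * r - 112 / 27 * P - 32 / 27 * P ^ 2 - 88 / 9 * r + 152 / 9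
      - t₂ * (2 / 3 * P + 1 / 3) = 0 := by
    rw [ht₂]; field_simp; ring
  have h₂ : 16 / 3 * P + 8 / 3 * P ^ 2 + 16 * r - 178 / 9 + t₂ * P - t₁ * (2 / 3 * P - 1 / 3)
      = 2 * coeff2 P := by
    have n5 : P ^ 2 - 1 ≠ 0 := by nlinarith
    rw [ht₂, ht₁, ht₀, hr, coeff2, show P ^ 2 - 1 = (P - 1) * (P + 1) by ring]
    field_simp; ring
  -- the normalized first integral `j` and the source `ρ`
  set j : ι × ℝ → ℝ := fun z => (J z + 2 * φ z) / ε z.1 with hj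
  set j' : ι × ℝ → ℝ := fun z => w z + par α z * Q z
    + 2 * (y z * Q z + par δ z * e z - 2 * (r * (y z * Q z) + par δ z * G z)) with hj'
  have dj' : UDec j' := by fun_prop
  have hjd : ∀ i x, HasDerivAt (fun x => j (i, x)) (j' (i, x)) x := fun i x => by
    refine ((((S i).hasDerivAt_J x).fun_add ((h.hasDerivAt_φ i x).const_mul 2)).div_const
      (ε i)).congr_deriv ?_
    have e3 := h.φ_sq (i, x)
    have e4 := eA (i, x)
    simp only [par] at e3 e4
    rw [div_eq_iff (h.ε_ne i), e4, ea i]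
    simp only [hj', par]
    linear_combination 2 * e3
  have oj : ∀ i x, j (i, -x) = -j (i, x) := fun i x => by
    simp only [hj, (S i).odd_J x, h.odd_φ i x]; ring
  have bj : UBdd j := UBdd.of_hasDerivAt_odd dj' hjd oj
  have eJ : ∀ z, J z = -2 * φ z + ε z.1 * j z := fun z => by
    have := h.ε_ne z.1
    simp only [hj]; field_simp; ring
  have sj : ∀ i, HasInt (fun x => j' (i, x)) (2 * ((b i + 2) / ε i)) := fun i => by
    refine HasInt.of_deriv_odd (oj i) (dj'.dec i) ?_ (hjd i)
    simpa using ((S i).tendsto_J.add ((h.profile i).tendsto_φ.const_mul 2)).div_const (ε i)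
  obtain ⟨Kβ, hKβ⟩ := dj'.exists_integral_le
  set p : ι × ℝ → ℝ := fun z => deriv (f z.1) (Q z) with hp
  have ep : ∀ i x, p (i, -x) = p (i, x) := fun i x => by simp only [hp, h.even_Q]
  -- The equations of B and J give ℒ(B - J) = 3A' + f'(Q)J, whose parts of order zero in ε cancel; ρ
  -- is this source divided by ε.
  set ρ : ι × ℝ → ℝ := fun z => 3 * w' z - 2 * φ z * (P * (y z * Q z) + par δ z * g₁ z) + p z * j z
    with hρ
  have dρ : UDec ρ := by fun_prop
  have eρ : ∀ z, 3 * A' z + p z * J z = ε z.1 * ρ z := fun z => by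
    have e2 := h.deriv_eq z
    have e5 := eA' z
    have e6 := eJ z
    simp only [par] at e2 e5 e6
    rw [e5, e6]
    simp only [hρ, hp, par, e2]
    ring
  have oρ : ∀ i x, ρ (i, -x) = -1 * ρ (i, x) := fun i x => by
    simp only [hρ, par, ep, ow', oj, h.odd_φ, h.even_y, h.even_Q, h.even_g₁]; ring
  have hv : ∀ i x, HasDerivAt (fun x => (B (i, x) - J (i, x)) / ε i)
      ((B' (i, x) - (A (i, x) + a i * Q (i, x))) / ε i) x := fun i x =>
    (((S i).hasDerivAt_B x).fun_sub ((S i).hasDerivAt_J x)).div_const (ε i)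
  have hv' : ∀ i x, HasDerivAt (fun x => (B' (i, x) - (A (i, x) + a i * Q (i, x))) / ε i)
      ((1 - deriv (f i) (Q (i, x))) * ((B (i, x) - J (i, x)) / ε i) - ρ (i, x)) x := fun i x => by
    refine ((((S i).hasDerivAt_B' x).fun_sub (((S i).hasDerivAt_A x).fun_add
      ((h.hasDerivAt_Q i x).const_mul (a i)))).div_const (ε i)).congr_deriv ?_
    have e1 := eρ (i, x)
    have := h.ε_ne i
    simp only [hp] at e1
    field_simp
    linear_combination -e1
  have dv : ∀ i, Dec fun x => (B (i, x) - J (i, x)) / ε i := fun i => by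
    have d1 := (S i).loc_B.dec (by simp)
    have d2 := ((S i).loc_J (h.profile i) (hf i) hN).dec (by simp)
    convert (d1.sub d2).mul_bdd (Bdd.const (ε i)⁻¹) using 2
    ring
  have dv' : ∀ i, Dec fun x => (B' (i, x) - (A (i, x) + a i * Q (i, x))) / ε i := fun i => by
    have d1 := ((S i).loc_B' (h.profile i) (hf i)).dec (by simpa using hN)
    exact (d1.sub ((S i).dec_A.add (Dec.bdd_mul (Bdd.const (a i)) (dQ.dec i)))).mul_bdd
      (Bdd.const (ε i)⁻¹)
  have sρ : ∀ i, HasInt (fun x => φ (i, x) * Q (i, x) * ρ (i, x)) 0 := fun i =>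
    (h.profile i).hasInt_Q'_mul (dv i).bdd (dv' i).bdd (dρ.dec i).bdd (hv i) (hv' i)
  obtain ⟨u, u', du, du', -, -, hu, hu'⟩ := UDec.exists_solution (σ := -1) h.profile dρ oρ
    (Or.inr ⟨rfl, fun i => (sρ i).2⟩)
  -- Comparison with the uniformly bounded solution u of ℒu = ρ. No bound on k is needed: it enters
  -- the integrand only through φQρ, whose integral is zero.
  have hk : ∀ i, ∃ k : ℝ, ∀ x, B (i, x) = J (i, x) + ε i * (u (i, x) + k * (φ (i, x) * Q (i, x))) :=
    fun i => by
    obtain ⟨k, hk, -⟩ := (h.profile i).exists_eq_mul_of_homogeneous ((dv i).sub (du.dec i))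
      ((dv' i).sub (du'.dec i)) (fun x => (hv i x).fun_sub (hu i x))
      (fun x => ((hv' i x).fun_sub (hu' i x)).congr_deriv (by ring))
    refine ⟨-k, fun x => ?_⟩
    have e1 := hk x
    have := h.ε_ne i
    field_simp at e1
    linear_combination e1
  choose k eB using hk
  set R₁ : ι × ℝ → ℝ := fun z => quadRem₁ P r t₀ t₁ t₂ (par ε z) (par ν z) (par δ z) (par α z) (Q z)
    (φ z) (y z) (e z) (g₁ z) (g₂ z) (G z) (w z) (w' z) (j z) + (j z + u z) * ρ z with hR₁
  set R₂ : ι × ℝ → ℝ := fun z => quadRem₂ P r t₀ t₁ t₂ (par ν z) (par δ z) (par α z) (Q z)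
    (φ z) (y z) (e z) (g₁ z) (g₂ z) (G z) (w z) z.2 with hR₂
  set R₃ : ι × ℝ → ℝ := fun z => quadRem₃ (Q z) (φ z) (e z) (g₁ z) (g₂ z) (G z) z.2 with hR₃
  have dR₁ : UDec R₁ :=
    (udec_quadRem₁ bε bν bδ bα dQ bφ dy de.bdd dg₁ dg₂.bdd dG.bdd dw dw' bj).add
      (UDec.bdd_mul (bj.add du.bdd) dρ)
  have dR₂ : UDec R₂ := udec_quadRem₂ bν bδ bα dQ bφ dy.bdd de.bdd dg₁.bdd dg₂.bdd dG.bdd dw.bdd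
  have dR₃ : UDec R₃ := udec_quadRem₃ dQ bφ de dg₁ dg₂ dG
  set β : ι → ℝ := fun i => (b i + 2) / ε i with hβ
  have eb : ∀ i, b i = -2 + ε i * β i := fun i => by
    have := h.ε_ne i
    simp only [hβ]; field_simp; ring
  -- With b = -2 + εβ one has 2(b₂ - b) + b³ = 2(b₂ + b³/6) - 4/3 + 6εβ - 4(εβ)² + (2/3)(εβ)³. The
  -- constant and the linear term are cancelled by ∫ φ' = 2 and ∫ j' = 2β, and the higher powers are
  -- O(ε²).
  suffices H : ∀ i, HasInt (fun x => ε i * (2 * coeff2 P * (y (i, x) * Q (i, x) ^ 2) + ε i * R₁ (i, x)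
      + ν i * R₂ (i, x) + δ i * R₃ (i, x))) (2 * (b₂ i + 1 / 6 * b i ^ 3
        - 2 * (ε i * β i) ^ 2 + 1 / 3 * (ε i * β i) ^ 3)) by
    obtain ⟨K, hK0, hK⟩ := abs_le_of_hasInt (Y := fun z => y z * Q z ^ 2) dR₁ dR₂ dR₃
      (by fun_prop) H
    obtain ⟨E, hE⟩ := bε.exists_par
    have hβ : ∀ i, |β i| ≤ |Kβ| := fun i => by
      have e1 := (sj i).2
      have e2 := hKβ i
      rw [e1, abs_mul, abs_two] at e2
      have := abs_nonneg (β i)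
      exact (by linarith : |β i| ≤ Kβ).trans (le_abs_self _)
    refine ⟨K + (2 * |Kβ| ^ 2 + 1 / 3 * (|E| * |Kβ| ^ 3)), fun i => ?_⟩
    have e1 : b₂ i + 1 / 6 * b i ^ 3 - coeff2 P * ε i * ∫ x, y (i, x) * Q (i, x) ^ 2
        = (b₂ i + 1 / 6 * b i ^ 3 - 2 * (ε i * β i) ^ 2 + 1 / 3 * (ε i * β i) ^ 3
          - coeff2 P * ε i * ∫ x, y (i, x) * Q (i, x) ^ 2)
        + ε i ^ 2 * (2 * β i ^ 2 - 1 / 3 * (ε i * β i ^ 3)) := by ring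
    rw [e1, add_mul]
    refine (abs_add_le _ _).trans (add_le_add (hK i) ?_)
    have e2 : |2 * β i ^ 2 - 1 / 3 * (ε i * β i ^ 3)| ≤ 2 * |Kβ| ^ 2 + 1 / 3 * (|E| * |Kβ| ^ 3) := by
      refine (abs_sub _ _).trans ?_
      rw [abs_mul, abs_mul, abs_mul, abs_pow, abs_pow, abs_two, abs_of_pos (by norm_num : (0 : ℝ) < 1 / 3)]
      have := hβ i
      have := (hE i).trans (le_abs_self _)
      gcongr
    rw [abs_mul, abs_pow, mul_comm]
    refine mul_le_mul e2 ?_ (by positivity) (by positivity)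
    rw [sq]
    refine mul_le_mul_of_nonneg_left ?_ (abs_nonneg _)
    linarith [abs_nonneg (ν i), abs_nonneg (δ i)]
  intro i
  -- The product xφQ is localized as a whole, which must be seen before boundedness is assembled.
  have dK : UBdd fun z : ι × ℝ => -5 + 4 * Q z + 2 / 3 * (z.2 * (φ z * Q z)) := by
    have dm : UDec fun z : ι × ℝ => φ z * Q z := by fun_prop
    have key : ∀ m : ι × ℝ → ℝ, UDec m → UBdd fun z : ι × ℝ => -5 + 4 * Q z + 2 / 3 * m z :=
      fun m hm => by fun_prop
    exact key _ dm.id_mul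
  have dK' : UBdd fun z : ι × ℝ => -(10 / 3) * (φ z * Q z) - 2 / 3 * (z.2 * (Q z - f z.1 (Q z))) := by
    have key : ∀ m : ι × ℝ → ℝ, UDec m → UBdd fun z : ι × ℝ =>
      -(10 / 3) * (φ z * Q z) - 2 / 3 * m z := fun m hm => by fun_prop
    exact key _ (dQ.sub dF).id_mul
  have dLK : UBdd fun z : ι × ℝ => -5 + 5 * p z + 4 * (f z.1 (Q z) - p z * Q z)
      + 4 / 3 * (Q z - f z.1 (Q z)) := by
    have key : ∀ F : ι × ℝ → ℝ, UDec F → UBdd fun z : ι × ℝ => -5 + 5 * p z + 4 * (F z - p z * Q z)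
      + 4 / 3 * (Q z - F z) := fun F hF => by fun_prop
    exact key _ dF
  have hK : ∀ x, HasDerivAt (fun x => -5 + 4 * Q (i, x) + 2 / 3 * (x * (φ (i, x) * Q (i, x))))
      (-(10 / 3) * (φ (i, x) * Q (i, x)) - 2 / 3 * (x * (Q (i, x) - f i (Q (i, x))))) x := fun x => by
    refine ((((h.hasDerivAt_Q i x).const_mul 4).const_add (-5)).fun_sub (((hasDerivAt_id x).fun_mul
      ((h.profile i).hasDerivAt_Q' x)).const_mul (2 / 3))).congr_of_eventuallyEq
      (Eventually.of_forall fun t => ?_) |>.congr_deriv ?_ <;> simp only [id] <;> ring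
  have hK' : ∀ x, HasDerivAt
      (fun x => -(10 / 3) * (φ (i, x) * Q (i, x)) - 2 / 3 * (x * (Q (i, x) - f i (Q (i, x)))))
      ((1 - deriv (f i) (Q (i, x))) * (-5 + 4 * Q (i, x) + 2 / 3 * (x * (φ (i, x) * Q (i, x))))
        - (-5 + 5 * p (i, x) + 4 * (f i (Q (i, x)) - p (i, x) * Q (i, x))
          + 4 / 3 * (Q (i, x) - f i (Q (i, x))))) x := fun x => by
    refine ((((h.profile i).hasDerivAt_Q' x).const_mul (10 / 3)).fun_sub (((hasDerivAt_id x).fun_mul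
      ((h.profile i).hasDerivAt_Q'' x)).const_mul (2 / 3))).congr_of_eventuallyEq
      (Eventually.of_forall fun t => ?_) |>.congr_deriv ?_ <;> simp only [id, hp] <;> ring
  set s : ι × ℝ → ℝ := fun z => P * (y z * Q z) + par δ z * g₁ z
      + 4 / 3 * (y z * Q z ^ 2 + par δ z * (e z * Q z))
      + 4 / 3 * (y z * Q z ^ 2 + par δ z * (e z * Q z) - (P * (y z * Q z) + par δ z * g₁ z) * Q z)
      + par ν z * (4 * (r * (y z * Q z) + par δ z * G z) * Q z ^ 2
        + 2 * Q z * (y z * Q z ^ 2 + par δ z * (e z * Q z))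
        - (P * (y z * Q z) + par δ z * g₁ z) * Q z ^ 2)
      - par α z * (3 * Q z - 2 * f z.1 (Q z)) with hs
  have ds : UDec s := by
    have key : ∀ F : ι × ℝ → ℝ, UDec F → UDec fun z => P * (y z * Q z) + par δ z * g₁ z
      + 4 / 3 * (y z * Q z ^ 2 + par δ z * (e z * Q z))
      + 4 / 3 * (y z * Q z ^ 2 + par δ z * (e z * Q z) - (P * (y z * Q z) + par δ z * g₁ z) * Q z)
      + par ν z * (4 * (r * (y z * Q z) + par δ z * G z) * Q z ^ 2
        + 2 * Q z * (y z * Q z ^ 2 + par δ z * (e z * Q z))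
        - (P * (y z * Q z) + par δ z * g₁ z) * Q z ^ 2)
      - par α z * (3 * Q z - 2 * F z) := fun F hF => by fun_prop
    exact key _ dF
  have s1 := hasInt_wronskian (dw.dec i) (dw'.dec i) (dK.bdd i) (dK'.bdd i) (ds.dec i) (dLK.bdd i)
    (hw i) hK (fun x => (hw' i x).congr_deriv (by simp only [hs, par]; ring)) hK'
  have s2 := h.hasInt_φ_mul
    (q := fun z => -(8 / 9 + 3 * par ν z) * Q z + (28 / 27 + 10 / 3 * par ν z) * Q z ^ 2
      + (2 * par ν z ^ 2 - 14 / 3 * par ν z) * Q z ^ 3 - 16 / 3 * par ν z ^ 2 * Q z ^ 4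
      - par ν z ^ 3 * Q z ^ 5)
    (d := fun z => -(8 / 9 + 3 * par ν z) * Q z + 2 * (28 / 27 + 10 / 3 * par ν z) * Q z ^ 2
      + 3 * (2 * par ν z ^ 2 - 14 / 3 * par ν z) * Q z ^ 3 - 64 / 3 * par ν z ^ 2 * Q z ^ 4
      - 5 * par ν z ^ 3 * Q z ^ 5) (by fun_prop) (by fun_prop)
    (fun i x => by
      have hQ := h.hasDerivAt_Q i x
      refine (((((hQ.const_mul (-(8 / 9 + 3 * ν i))).fun_add
        ((hQ.fun_pow 2).const_mul (28 / 27 + 10 / 3 * ν i))).fun_add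
        ((hQ.fun_pow 3).const_mul (2 * ν i ^ 2 - 14 / 3 * ν i))).fun_sub
        ((hQ.fun_pow 4).const_mul (16 / 3 * ν i ^ 2))).fun_sub
        ((hQ.fun_pow 5).const_mul (ν i ^ 3))).congr_deriv ?_
      simp only [par]; push_cast; ring) i
  have s3 := h.hasInt_φ_mul (q := fun z => -9 * Q z + 62 / 9 * Q z ^ 2)
    (d := fun z => -9 * Q z + 124 / 9 * Q z ^ 2) (by fun_prop) (by fun_prop)
    (fun i x => (((h.hasDerivAt_Q i x).const_mul (-9)).fun_add
      (((h.hasDerivAt_Q i x).fun_pow 2).const_mul (62 / 9))).congr_deriv (by push_cast; ring)) i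
  have s4 := h.hasInt_φ_mul (q := fun z => y z * (t₀ + t₁ * Q z + t₂ * Q z ^ 2))
    (d := fun z => y z * ((P - 2) * t₀ + (P - 1) * t₁ * Q z + P * t₂ * Q z ^ 2)) (by fun_prop)
    (by fun_prop) (fun i x => ((h.hasDerivAt_y i x).fun_mul
      ((((h.hasDerivAt_Q i x).const_mul t₁).const_add t₀).fun_add
        (((h.hasDerivAt_Q i x).fun_pow 2).const_mul t₂))).congr_deriv (by push_cast; ring)) i
  have s5 : HasInt (fun x => φ (i, x) ^ 2 - 1 + (Q (i, x) + ν i * Q (i, x) ^ 2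
      + ε i * (y (i, x) * Q (i, x) + δ i * e (i, x)))) (2 * 1) := by
    refine HasInt.of_deriv_odd (h.odd_φ i) ?_ (h.profile i).tendsto_φ
      fun x => (h.hasDerivAt_φ i x).congr_deriv (by ring)
    have d1 : UDec fun z => Q z + par ν z * Q z ^ 2 + par ε z * (y z * Q z + par δ z * e z) := by
      fun_prop
    exact (h.profile i).dec_θ.add (d1.dec i)
  have dx : UDec fun z => -(2 / 3) * par α z * (3 / 2 * Q z ^ 2 - Q z ^ 2 * (1 - φ z ^ 2))
      + 2 / 3 * (y z * Q z ^ 2) + 2 / 3 * (8 / 3 - 4 / 3 * P) * r * (y z * Q z ^ 3) := by fun_prop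
  have dx' : UDec fun z => -(2 / 3) * par α z * (-3 * (φ z * Q z ^ 2) + 2 * (φ z * Q z * f z.1 (Q z)))
      - 2 / 3 * P * (φ z * (y z * Q z ^ 2))
      - 2 / 3 * (8 / 3 - 4 / 3 * P) * r * (P + 1) * (φ z * (y z * Q z ^ 3)) := by
    have key : ∀ F : ι × ℝ → ℝ, UDec F → UDec fun z =>
      -(2 / 3) * par α z * (-3 * (φ z * Q z ^ 2) + 2 * (φ z * Q z * F z))
      - 2 / 3 * P * (φ z * (y z * Q z ^ 2))
      - 2 / 3 * (8 / 3 - 4 / 3 * P) * r * (P + 1) * (φ z * (y z * Q z ^ 3)) := fun F hF => by fun_prop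
    exact key _ dF
  -- Trades the x-weighted terms created by the part xQ' of K for unweighted ones.
  have s6 := HasInt.of_deriv (dx.id_mul.dec i) ((dx.add dx'.id_mul).dec i) fun x => by
    have hQ := h.hasDerivAt_Q i x
    have hy := h.hasDerivAt_y i x
    have hq := hQ.fun_pow 2
    refine ((hasDerivAt_id x).fun_mul (((((hq.const_mul (3 / 2)).fun_sub (hq.fun_mul
      (((h.hasDerivAt_φ i x).fun_pow 2).const_sub 1))).const_mul (-(2 / 3) * α i)).fun_add
      ((hy.fun_mul hq).const_mul (2 / 3))).fun_add ((hy.fun_mul (hQ.fun_pow 3)).const_mul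
      (2 / 3 * (8 / 3 - 4 / 3 * P) * r)))).congr_deriv ?_
    have e1 := h.f_eq (i, x)
    simp only [par] at e1
    simp only [id, par, e1]
    push_cast
    ring
  have dc : UDec fun z => 6 * (φ z * w z) - (4 * Q z + 3 * par ν z * Q z ^ 2) * j z
      - 4 * (φ z * (4 / 3 * Q z + 2 * par ν z * Q z ^ 2) * w z) := by fun_prop
  have dc' : UDec fun z => 6 * ((φ z ^ 2 - 1 + (Q z + par ν z * Q z ^ 2
        + par ε z * (y z * Q z + par δ z * e z))) * w z + φ z * w' z)
      + φ z * (4 * Q z + 6 * par ν z * Q z ^ 2) * j z - (4 * Q z + 3 * par ν z * Q z ^ 2) * j' z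
      - 4 * (((φ z ^ 2 - 1 + (Q z + par ν z * Q z ^ 2 + par ε z * (y z * Q z + par δ z * e z)))
          * (4 / 3 * Q z + 2 * par ν z * Q z ^ 2)
          - φ z ^ 2 * (4 / 3 * Q z + 4 * par ν z * Q z ^ 2)) * w z
        + φ z * (4 / 3 * Q z + 2 * par ν z * Q z ^ 2) * w' z) := by fun_prop
  -- Removes the first order terms in w' and in j, leaving only w and j', which is explicit.
  have s7 := HasInt.of_deriv (dc.dec i) (dc'.dec i) fun x => by
    have hQ := h.hasDerivAt_Q i x
    have hφ := h.hasDerivAt_φ i x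
    have hq := hQ.fun_pow 2
    refine ((((hφ.fun_mul (hw i x)).const_mul 6).fun_sub (((hQ.const_mul 4).fun_add
      (hq.const_mul (3 * ν i))).fun_mul (hjd i x))).fun_sub (((hφ.fun_mul
      ((hQ.const_mul (4 / 3)).fun_add (hq.const_mul (2 * ν i)))).fun_mul (hw i x)).const_mul
      4)).congr_deriv ?_
    simp only [par]
    push_cast
    ring
  refine (((((((((((hb i).add ((S i).orth.const_mul (16 / 9))).add (s5.const_mul (2 / 3))).sub
    ((sj i).const_mul (3 * ε i))).sub s2).add (s7.const_mul (ε i))).add (s1.const_mul (ε i))).add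
    (s6.const_mul (ε i))).sub (s3.const_mul (ε i * α i))).sub (s4.const_mul (ε i))).sub
    ((sρ i).const_mul (ε i ^ 2 * k i))).congr (fun x => ?_) ?_
  · have e1 := h.f_eq (i, x)
    have e2 := h.deriv_eq (i, x)
    have e3 := h.φ_sq (i, x)
    have e4 := h.deriv2_eq (i, x)
    have e5 := eA (i, x)
    have e6 := eA' (i, x)
    have e7 := ea i
    have e8 := eB i x
    have e9 := eJ (i, x)
    simp only [par] at e1 e2 e3 e4 e5 e6
    have key := quadratic_identity (P := P) (r := r) (c := coeff2 P) (t₀ := t₀) (t₁ := t₁) (t₂ := t₂)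
      (ε := ε i) (ν := ν i) (δ := δ i) (α := α i) (Q := Q (i, x)) (φ := φ (i, x)) (y := y (i, x))
      (e := e (i, x)) (g₁ := g₁ (i, x)) (g₂ := g₂ (i, x)) (G := G (i, x)) (w := w (i, x))
      (w' := w' (i, x)) (j := j (i, x)) (u := u (i, x)) (k := k i) (x := x)
      (by rw [e3]; ring) hr1 h₀ h₁ h₂ h₃
    have eρ' : ρ (i, x) = 3 * w' (i, x) - 2 * φ (i, x) * (P * (y (i, x) * Q (i, x)) + δ i * g₁ (i, x))
        + (2 * Q (i, x) + 3 * ν i * Q (i, x) ^ 2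
          + ε i * (P * (y (i, x) * Q (i, x)) + δ i * g₁ (i, x))) * j (i, x) := by
      simp only [hρ, hp, par, e2]; ring
    simp only [hR₁, hR₂, hR₃, par, hs, hj', hp, eρ'] at key ⊢
    rw [e8, e9, e1, e2, e4, e5, e6, e7]
    clear_value R₁ R₂ R₃
    generalize quadRem₁ _ _ _ _ _ _ _ _ _ _ _ _ _ _ _ _ _ _ _ = X₁ at key ⊢
    generalize quadRem₂ _ _ _ _ _ _ _ _ _ _ _ _ _ _ _ _ _ = X₂ at key ⊢
    generalize quadRem₃ _ _ _ _ _ _ _ = X₃ at key ⊢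
    linear_combination -key
  · rw [eb i]
    simp only [hβ]
    have := h.ε_ne i
    field_simp
    ring

end Family

end GKdV

/-! ### Moments of the soliton and comparison with the explicit ones -/

namespace GKdV

section Moments

variable {Q φ R T : ℝ → ℝ} {α β : ℝ} {d : ℕ}

/-- The derivative of φQ^(k+1), with φ' and φ² replaced by their leading powers of Q plus errors: a
recurrence raising the exponent by d + 1. -/
theorem hasInt_moment (dQ : Dec Q) (bφ : Bdd φ) (dR : Dec R) (dT : Dec T)
    (hQ : ∀ x, HasDerivAt Q (-(φ x * Q x)) x) (hφ : ∀ x, HasDerivAt φ (β * Q x ^ (d + 1) + R x) x)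
    (hsq : ∀ x, φ x ^ 2 = 1 - α * Q x ^ (d + 1) - T x) (k : ℕ) :
    HasInt (fun x => (β + (k + 1) * α) * Q x ^ (k + 1 + (d + 1)) + (R x + (k + 1) * T x) * Q x ^ (k + 1)
      - (k + 1) * Q x ^ (k + 1)) 0 := by
  refine HasInt.of_deriv (T := fun x => φ x * Q x ^ (k + 1)) (by fun_prop) ?_
    fun x => ((hφ x).fun_mul ((hQ x).fun_pow (k + 1))).congr_deriv ?_
  · have key : Dec fun x => (β + (k + 1) * α) * (Q x ^ (k + 1) * Q x ^ (d + 1))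
        + (R x + (k + 1) * T x) * Q x ^ (k + 1) - (k + 1) * Q x ^ (k + 1) := by fun_prop
    simpa only [pow_add Q, pow_add] using key
  · have := hsq x
    rw [pow_add (Q x) (k + 1) (d + 1)]
    push_cast
    rw [pow_succ (Q x) k]
    linear_combination (-(k + 1) * Q x ^ k * Q x) * this

theorem hasInt_moment_zero (dQ : Dec Q) (dR : Dec R) (ho : ∀ x, φ (-x) = -φ x)
    (hl : Tendsto φ atTop (𝓝 1)) (hφ : ∀ x, HasDerivAt φ (β * Q x ^ (d + 1) + R x) x) :
    HasInt (fun x => β * Q x ^ (d + 1) + R x) 2 := by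
  simpa using HasInt.of_deriv_odd ho (by fun_prop) hl hφ

/-- The function arcsin φ increases by π over the line. Its derivative φ'/√(1 - φ²) is close to
(Q²/2)/(Q/√2) = Q/√2, with relative error of order η. -/
theorem abs_integral_sub_le {η : ℝ} (dQ : Dec Q) (hpos : ∀ x, 0 < Q x) (cR : Continuous R)
    (cφ : Continuous φ) (hlt : ∀ x, φ x ^ 2 < 1) (ho : ∀ x, φ (-x) = -φ x) (hl : Tendsto φ atTop (𝓝 1))
    (hφ : ∀ x, HasDerivAt φ (1 / 2 * Q x ^ 2 + R x) x)
    (hsq : ∀ x, φ x ^ 2 = 1 - 1 / 2 * Q x ^ 2 - T x) (hη : η ≤ 1 / 4)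
    (hR : ∀ x, |R x| ≤ η * Q x ^ 2) (hT : ∀ x, |T x| ≤ η * Q x ^ 2) :
    |(∫ x, Q x) - √2 * Real.pi| ≤ √2 * (4 * η) * ∫ x, Q x := by
  set g : ℝ → ℝ := fun x => (1 / 2 * Q x ^ 2 + R x) / √(1 - φ x ^ 2) with hg
  have hs : ∀ x, 0 < √(1 - φ x ^ 2) := fun x => Real.sqrt_pos.2 (by linarith [hlt x])
  have h2 : 0 < √2 := by positivity
  have h22 : √2 ^ 2 = 2 := Real.sq_sqrt (by norm_num)
  have hd : ∀ x, HasDerivAt (fun x => Real.arcsin (φ x)) (g x) x := fun x => by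
    have h1 : |φ x| < 1 := by simpa [sq_lt_one_iff_abs_lt_one] using hlt x
    rw [abs_lt] at h1
    refine ((Real.hasDerivAt_arcsin h1.1.ne' h1.2.ne).comp x (hφ x)).congr_deriv ?_
    simp only [hg]
    ring
  have hgQ : ∀ x, |g x - Q x / √2| ≤ 4 * η * Q x := fun x => by
    have hp := hpos x
    have hsx := hs x
    have hs2 : √(1 - φ x ^ 2) ^ 2 = 1 - φ x ^ 2 := Real.sq_sqrt (by linarith [hlt x])
    set s := √(1 - φ x ^ 2) with hsdef
    have hT' := abs_le.1 (hT x)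
    have hR' := hR x
    have hq2 : 0 < Q x ^ 2 := by positivity
    have e1 : s ^ 2 = 1 / 2 * Q x ^ 2 + T x := by rw [hs2, hsq]; ring
    -- Uses η ≤ 1/4: then 1 - φ² ≥ Q²/2 - Q²/4.
    have hs_low : Q x / 2 ≤ s := by
      refine abs_le_of_sq_le_sq' (by nlinarith) hsx.le |>.2
    have e2 : g x - Q x / √2 = (R x - Q x * T x / (√2 * s + Q x)) / s := by
      have hne : √2 * s + Q x ≠ 0 := by positivity
      simp only [hg, ← hsdef]
      field_simp
      have e1' : 2 * s ^ 2 = Q x ^ 2 + 2 * T x := by linarith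
      linear_combination (Q x ^ 2 * s) * h22 - √2 * Q x * e1'
    have e3 : |Q x * T x / (√2 * s + Q x)| ≤ η * Q x ^ 2 := by
      rw [abs_div, abs_mul, abs_of_pos hp, abs_of_pos (by positivity : 0 < √2 * s + Q x),
        div_le_iff₀ (by positivity), mul_comm (Q x)]
      refine mul_le_mul (hT x) (by nlinarith [mul_pos h2 hsx]) hp.le ((abs_nonneg _).trans (hT x))
    have hη0 : 0 ≤ η * Q x ^ 2 := (abs_nonneg _).trans hR'
    rw [e2, abs_div, abs_of_pos hsx, div_le_iff₀ hsx]
    calc |R x - Q x * T x / (√2 * s + Q x)| ≤ η * Q x ^ 2 + η * Q x ^ 2 :=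
          (abs_sub _ _).trans (add_le_add hR' e3)
      _ = 4 * η * Q x * (Q x / 2) := by ring
      _ ≤ _ := by
        refine mul_le_mul_of_nonneg_left hs_low ?_
        have : 0 ≤ η := by nlinarith
        positivity
  have cg : Continuous g := by
    refine Continuous.div (by have := dQ.continuous; fun_prop) (by fun_prop) fun x => (hs x).ne'
  have dg : Dec g := by
    have : g = fun x => Q x * (g x / Q x) := funext fun x => by
      have := (hpos x).ne'
      field_simp
    rw [this]
    refine dQ.mul_bdd ⟨cg.div dQ.continuous fun x => (hpos x).ne', 4 * η + 1 / √2, fun x => ?_⟩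
    have hp := hpos x
    rw [abs_div, abs_of_pos hp, div_le_iff₀ hp]
    have h3 := hgQ x
    have h4 : |g x| ≤ |g x - Q x / √2| + |Q x / √2| := by simpa using abs_add_le (g x - Q x / √2) (Q x / √2)
    rw [abs_of_pos (by positivity : 0 < Q x / √2)] at h4
    calc |g x| ≤ 4 * η * Q x + Q x / √2 := by linarith
      _ = _ := by ring
  have s1 := HasInt.of_deriv_odd (T := fun x => Real.arcsin (φ x)) (b := Real.pi / 2)
    (fun x => by simp [ho]) dg (by
      have := (Real.continuous_arcsin.tendsto 1).comp hl
      rwa [Real.arcsin_one] at this) hd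
  have s2 := (HasInt.of_dec dQ).sub (s1.const_mul √2)
  have e : (∫ x, Q x) - √2 * Real.pi = ∫ x, (Q x - √2 * g x) := by rw [s2.2]; ring
  rw [e, ← integral_const_mul, ← Real.norm_eq_abs]
  refine norm_integral_le_of_norm_le (dQ.integrable.const_mul _) (ae_of_all _ fun x => ?_)
  have e2 : Q x - √2 * g x = -(√2 * (g x - Q x / √2)) := by field_simp; ring
  rw [Real.norm_eq_abs, e2, abs_neg, abs_mul, abs_of_pos h2, mul_assoc]
  exact mul_le_mul_of_nonneg_left (hgQ x) h2.le

end Moments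

section

/-- The soliton of `Q'' + Q² = Q`. -/
noncomputable def quadSoliton (x : ℝ) : ℝ := 3 / (2 * Real.cosh (x / 2) ^ 2)

/-- The soliton of `Q'' + Q³ = Q`. -/
noncomputable def cubicSoliton (x : ℝ) : ℝ := √2 / Real.cosh x

theorem exp_abs_le_two_mul_cosh (x : ℝ) : Real.exp |x| ≤ 2 * Real.cosh x := by
  rw [Real.cosh_eq]
  rcases abs_cases x with ⟨h, -⟩ | ⟨h, -⟩ <;> rw [h] <;> linarith [Real.exp_pos x, Real.exp_pos (-x)]

theorem hasDerivAt_quadSoliton (x : ℝ) :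
    HasDerivAt quadSoliton (-(Real.tanh (x / 2) * quadSoliton x)) x := by
  have hc := Real.cosh_pos (x / 2)
  have h1 : HasDerivAt (fun x : ℝ => 2 * Real.cosh (x / 2) ^ 2)
      (2 * (2 * Real.cosh (x / 2) * (Real.sinh (x / 2) * (1 / 2)))) x := by
    refine ((((Real.hasDerivAt_cosh (x / 2)).comp x ((hasDerivAt_id x).div_const 2)).fun_pow
      2).const_mul 2).congr_deriv ?_
    simp
  refine ((hasDerivAt_const x (3 : ℝ)).fun_div h1 (by positivity)).congr_deriv ?_
  rw [quadSoliton, Real.tanh_eq_sinh_div_cosh]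
  field_simp
  ring

theorem hasDerivAt_cubicSoliton (x : ℝ) :
    HasDerivAt cubicSoliton (-(Real.tanh x * cubicSoliton x)) x := by
  have hc := Real.cosh_pos x
  refine ((hasDerivAt_const x √2).fun_div (Real.hasDerivAt_cosh x) hc.ne').congr_deriv ?_
  rw [cubicSoliton, Real.tanh_eq_sinh_div_cosh]
  field_simp
  ring

theorem tanh_sq_quadSoliton (x : ℝ) : Real.tanh (x / 2) ^ 2 = 1 - 2 / 3 * quadSoliton x := by
  have hc := Real.cosh_pos (x / 2)
  have := Real.cosh_sq_sub_sinh_sq (x / 2)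
  rw [quadSoliton, Real.tanh_eq_sinh_div_cosh]
  field_simp
  linarith

theorem tanh_sq_cubicSoliton (x : ℝ) : Real.tanh x ^ 2 = 1 - 1 / 2 * cubicSoliton x ^ 2 := by
  have hc := Real.cosh_pos x
  have := Real.cosh_sq_sub_sinh_sq x
  have h2 : √2 ^ 2 = 2 := Real.sq_sqrt (by norm_num)
  rw [cubicSoliton, Real.tanh_eq_sinh_div_cosh, div_pow, div_pow, h2]
  field_simp
  linarith

theorem quadSoliton_pos (x : ℝ) : 0 < quadSoliton x := by
  have hc := Real.cosh_pos (x / 2)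
  rw [quadSoliton]; positivity

theorem cubicSoliton_pos (x : ℝ) : 0 < cubicSoliton x := by
  have hc := Real.cosh_pos x
  rw [cubicSoliton]; positivity

theorem dec_quadSoliton : Dec quadSoliton := by
  refine ⟨continuous_of_hasDerivAt hasDerivAt_quadSoliton, 6, 0, fun x => ?_⟩
  rw [abs_of_pos (quadSoliton_pos x), pow_zero, one_mul, quadSoliton, Real.exp_neg]
  have hc := Real.cosh_pos (x / 2)
  have h1 := exp_abs_le_two_mul_cosh (x / 2)
  have e : Real.exp |x| = Real.exp |x / 2| ^ 2 := by
    rw [← Real.exp_nat_mul, abs_div, abs_two]; congr 1; push_cast; ring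
  rw [e, ← div_eq_mul_inv, div_le_div_iff₀ (by positivity) (by positivity)]
  have := pow_le_pow_left₀ (Real.exp_pos _).le h1 2
  linarith

theorem dec_cubicSoliton : Dec cubicSoliton := by
  refine ⟨continuous_of_hasDerivAt hasDerivAt_cubicSoliton, 2 * √2, 0, fun x => ?_⟩
  rw [abs_of_pos (cubicSoliton_pos x), pow_zero, one_mul, cubicSoliton, Real.exp_neg]
  have hc := Real.cosh_pos x
  have h1 := exp_abs_le_two_mul_cosh x
  have h2 : 0 < √2 := by positivity
  rw [← div_eq_mul_inv, div_le_div_iff₀ (by positivity) (by positivity)]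
  have := mul_le_mul_of_nonneg_left h1 h2.le
  linarith

theorem bdd_tanh : Bdd Real.tanh :=
  ⟨continuous_of_hasDerivAt hasDerivAt_tanh, 1, fun x => (Real.abs_tanh_lt_one x).le⟩

theorem tendsto_tanh : Tendsto Real.tanh atTop (𝓝 1) := by
  have h1 : ∀ x, Real.tanh x = 1 - Real.exp (-x) * (cubicSoliton x * (1 / √2)) := fun x => by
    have hc := Real.cosh_pos x
    have h2 : 0 < √2 := by positivity
    have := Real.cosh_sub_sinh x
    rw [cubicSoliton, Real.tanh_eq_sinh_div_cosh, ← this]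
    field_simp
    ring
  rw [funext h1]
  have h2 := (Real.tendsto_exp_neg_atTop_nhds_zero.mul (dec_cubicSoliton.tendsto_atTop.mul_const
    (1 / √2))).const_sub 1
  simpa using h2

end
section Families

variable {ι : Type*} {Q φ R₁ R₂ T₁ T₂ : ι × ℝ → ℝ} {ε ν : ι → ℝ} {α β M M' : ℝ} {d : ℕ}

/-- `hM` says that the reference moments obey the recurrence without error terms, so closeness of
one moment passes to the next. -/
theorem exists_moment_succ (dQ : UDec Q) (bφ : UBdd φ) (dR₁ : UDec R₁) (dR₂ : UDec R₂) (dT₁ : UDec T₁)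
    (dT₂ : UDec T₂) (hQ : ∀ i x, HasDerivAt (fun x => Q (i, x)) (-(φ (i, x) * Q (i, x))) x)
    (hφ : ∀ i x, HasDerivAt (fun x => φ (i, x))
      (β * Q (i, x) ^ (d + 1) + (ε i * R₁ (i, x) + ν i * R₂ (i, x))) x)
    (hsq : ∀ i x, φ (i, x) ^ 2 = 1 - α * Q (i, x) ^ (d + 1) - (ε i * T₁ (i, x) + ν i * T₂ (i, x)))
    {k : ℕ} (hc : 0 < β + (k + 1) * α) (hM : (β + (k + 1) * α) * M' = (k + 1) * M)
    (H : ∃ K : ℝ, ∀ i, |(∫ x, Q (i, x) ^ (k + 1)) - M| ≤ K * (|ε i| + |ν i|)) :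
    ∃ K : ℝ, ∀ i, |(∫ x, Q (i, x) ^ (k + 1 + (d + 1))) - M'| ≤ K * (|ε i| + |ν i|) := by
  obtain ⟨K, hK⟩ := H
  have d1 : UDec fun z => (R₁ z + (k + 1) * T₁ z) * Q z ^ (k + 1) := by fun_prop
  have d2 : UDec fun z => (R₂ z + (k + 1) * T₂ z) * Q z ^ (k + 1) := by fun_prop
  obtain ⟨K₁, hK₁⟩ := d1.exists_integral_le
  obtain ⟨K₂, hK₂⟩ := d2.exists_integral_le
  set c := β + (k + 1) * α with hcdef
  refine ⟨((k + 1) * K + (|K₁| + |K₂|)) / c, fun i => ?_⟩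
  have s0 := hasInt_moment (dQ.dec i) (bφ.bdd i)
    ((Dec.bdd_mul (Bdd.const (ε i)) (dR₁.dec i)).add (Dec.bdd_mul (Bdd.const (ν i)) (dR₂.dec i)))
    ((Dec.bdd_mul (Bdd.const (ε i)) (dT₁.dec i)).add (Dec.bdd_mul (Bdd.const (ν i)) (dT₂.dec i)))
    (hQ i) (hφ i) (hsq i) k
  have s1 := HasInt.of_dec (((dQ.pow_succ (k + 1 + d))).dec i)
  have s2 := HasInt.of_dec ((dQ.pow_succ k).dec i)
  have s3 := HasInt.of_dec (d1.dec i)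
  have s4 := HasInt.of_dec (d2.dec i)
  have e := s0.unique ((((s1.const_mul c).add ((s3.const_mul (ε i)).add (s4.const_mul (ν i)))).sub
    (s2.const_mul (k + 1))).congr (fun x => by ring) rfl)
  have h1 := hK i
  have h3 := mul_le_mul_of_nonneg_left ((hK₁ i).trans (le_abs_self _)) (abs_nonneg (ε i))
  have h4 := mul_le_mul_of_nonneg_left ((hK₂ i).trans (le_abs_self _)) (abs_nonneg (ν i))
  rw [← abs_mul] at h3 h4
  rw [show k + 1 + (d + 1) = k + 1 + d + 1 by ring]
  set I' := ∫ x, Q (i, x) ^ (k + 1 + d + 1)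
  set I := ∫ x, Q (i, x) ^ (k + 1)
  set I₁ := ∫ x, (R₁ (i, x) + (k + 1) * T₁ (i, x)) * Q (i, x) ^ (k + 1)
  set I₂ := ∫ x, (R₂ (i, x) + (k + 1) * T₂ (i, x)) * Q (i, x) ^ (k + 1)
  have e2 : I' - M' = ((k + 1) * (I - M) - (ε i * I₁ + ν i * I₂)) / c := by
    rw [eq_div_iff hc.ne']
    linarith
  rw [e2, abs_div, abs_of_pos hc, div_mul_eq_mul_div]
  refine div_le_div_of_nonneg_right ((abs_sub _ _).trans ?_) hc.le
  rw [abs_mul, abs_of_pos (by positivity : (0 : ℝ) < k + 1), add_mul ((k + 1) * K), mul_assoc]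
  refine add_le_add (by gcongr) ((abs_add_le _ _).trans ?_)
  have := mul_nonneg (abs_nonneg (ε i)) (abs_nonneg K₂)
  have := mul_nonneg (abs_nonneg (ν i)) (abs_nonneg K₁)
  linarith

theorem exists_moment_zero (dQ : UDec Q) (dR₁ : UDec R₁) (dR₂ : UDec R₂)
    (ho : ∀ i x, φ (i, -x) = -φ (i, x)) (hl : ∀ i, Tendsto (fun x => φ (i, x)) atTop (𝓝 1))
    (hφ : ∀ i x, HasDerivAt (fun x => φ (i, x))
      (β * Q (i, x) ^ (d + 1) + (ε i * R₁ (i, x) + ν i * R₂ (i, x))) x) (hβ : 0 < β) (hM : β * M = 2) :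
    ∃ K : ℝ, ∀ i, |(∫ x, Q (i, x) ^ (d + 1)) - M| ≤ K * (|ε i| + |ν i|) := by
  obtain ⟨K₁, hK₁⟩ := dR₁.exists_integral_le
  obtain ⟨K₂, hK₂⟩ := dR₂.exists_integral_le
  refine ⟨(|K₁| + |K₂|) / β, fun i => ?_⟩
  have s0 := hasInt_moment_zero (dQ.dec i)
    ((Dec.bdd_mul (Bdd.const (ε i)) (dR₁.dec i)).add (Dec.bdd_mul (Bdd.const (ν i)) (dR₂.dec i)))
    (ho i) (hl i) (hφ i)
  have e := s0.unique (((HasInt.of_dec ((dQ.pow_succ d).dec i)).const_mul β).add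
    (((HasInt.of_dec (dR₁.dec i)).const_mul (ε i)).add ((HasInt.of_dec (dR₂.dec i)).const_mul (ν i))))
  have h3 := mul_le_mul_of_nonneg_left ((hK₁ i).trans (le_abs_self _)) (abs_nonneg (ε i))
  have h4 := mul_le_mul_of_nonneg_left ((hK₂ i).trans (le_abs_self _)) (abs_nonneg (ν i))
  rw [← abs_mul] at h3 h4
  set I := ∫ x, Q (i, x) ^ (d + 1)
  set I₁ := ∫ x, R₁ (i, x)
  set I₂ := ∫ x, R₂ (i, x)
  have e2 : I - M = -(ε i * I₁ + ν i * I₂) / β := by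
    rw [eq_div_iff hβ.ne']
    linarith
  rw [e2, abs_div, abs_of_pos hβ, div_mul_eq_mul_div, abs_neg]
  refine div_le_div_of_nonneg_right ((abs_add_le _ _).trans ?_) hβ.le
  have := mul_nonneg (abs_nonneg (ε i)) (abs_nonneg K₂)
  have := mul_nonneg (abs_nonneg (ν i)) (abs_nonneg K₁)
  linarith

end Families

theorem tendsto_tanh_half : Tendsto (fun x => Real.tanh (x / 2)) atTop (𝓝 1) :=
  tendsto_tanh.comp (tendsto_id.atTop_div_const two_pos)

theorem hasDerivAt_tanh_half (x : ℝ) :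
    HasDerivAt (fun x => Real.tanh (x / 2)) (1 / 3 * quadSoliton x ^ (0 + 1) + 0) x := by
  refine ((hasDerivAt_tanh (x / 2)).comp x ((hasDerivAt_id x).div_const 2)).congr_deriv ?_
  rw [tanh_sq_quadSoliton]
  ring

theorem hasDerivAt_tanh_cubic (x : ℝ) :
    HasDerivAt Real.tanh (1 / 2 * cubicSoliton x ^ (1 + 1) + 0) x := by
  refine (hasDerivAt_tanh x).congr_deriv ?_
  rw [tanh_sq_cubicSoliton]
  ring

theorem dec_zero : Dec fun _ => 0 := ⟨continuous_const, 0, 0, fun x => by simp⟩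

theorem quadSoliton_moment (k : ℕ) : (1 / 3 + ((k : ℝ) + 1) * (2 / 3))
    * ∫ x, quadSoliton x ^ (k + 1 + (0 + 1)) = (k + 1) * ∫ x, quadSoliton x ^ (k + 1) := by
  have dQ := dec_quadSoliton
  have b : Bdd fun x => Real.tanh (x / 2) :=
    ⟨bdd_tanh.continuous.comp (continuous_id.div_const 2), 1, fun x => (Real.abs_tanh_lt_one _).le⟩
  have s0 := hasInt_moment (d := 0) dQ b dec_zero dec_zero hasDerivAt_quadSoliton hasDerivAt_tanh_half
    (fun x => by rw [tanh_sq_quadSoliton, sub_zero, zero_add, pow_one]) k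
  have e := s0.unique ((((HasInt.of_dec (dQ.pow_succ (k + 1))).const_mul
    (1 / 3 + ((k : ℝ) + 1) * (2 / 3))).sub ((HasInt.of_dec (dQ.pow_succ k)).const_mul (k + 1))).congr
      (fun x => by ring) rfl)
  exact (sub_eq_zero.1 e.symm)

theorem quadSoliton_moment_zero : 1 / 3 * ∫ x, quadSoliton x ^ (0 + 1) = 2 := by
  have s0 := hasInt_moment_zero (d := 0) dec_quadSoliton dec_zero
    (fun x => by rw [neg_div, Real.tanh_neg]) tendsto_tanh_half hasDerivAt_tanh_half
  exact (s0.unique (((HasInt.of_dec (dec_quadSoliton.pow_succ 0)).const_mul (1 / 3)).congr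
    (fun x => by ring) rfl)).symm

theorem cubicSoliton_moment (k : ℕ) : (1 / 2 + ((k : ℝ) + 1) * (1 / 2))
    * ∫ x, cubicSoliton x ^ (k + 1 + (1 + 1)) = (k + 1) * ∫ x, cubicSoliton x ^ (k + 1) := by
  have dQ := dec_cubicSoliton
  have s0 := hasInt_moment (d := 1) dQ bdd_tanh dec_zero dec_zero hasDerivAt_cubicSoliton
    hasDerivAt_tanh_cubic (fun x => by rw [tanh_sq_cubicSoliton, sub_zero]) k
  have e := s0.unique ((((HasInt.of_dec (dQ.pow_succ (k + 2))).const_mul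
    (1 / 2 + ((k : ℝ) + 1) * (1 / 2))).sub ((HasInt.of_dec (dQ.pow_succ k)).const_mul (k + 1))).congr
      (fun x => by ring) rfl)
  exact (sub_eq_zero.1 e.symm)

theorem cubicSoliton_moment_zero : 1 / 2 * ∫ x, cubicSoliton x ^ (1 + 1) = 2 := by
  have s0 := hasInt_moment_zero (d := 1) dec_cubicSoliton dec_zero
    (fun x => Real.tanh_neg x) tendsto_tanh hasDerivAt_tanh_cubic
  exact (s0.unique (((HasInt.of_dec (dec_cubicSoliton.pow_succ 1)).const_mul (1 / 2)).congr
    (fun x => by ring) rfl)).symm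

/-- The arcsine estimate without error terms, η = 0. -/
theorem integral_cubicSoliton : ∫ x, cubicSoliton x = √2 * Real.pi := by
  have h := abs_integral_sub_le (Q := cubicSoliton) (φ := Real.tanh) (R := fun _ => 0) (T := fun _ => 0)
    (η := 0) dec_cubicSoliton cubicSoliton_pos continuous_const bdd_tanh.continuous
    Real.tanh_sq_lt_one Real.tanh_neg tendsto_tanh (fun x => hasDerivAt_tanh_cubic x)
    (fun x => by rw [tanh_sq_cubicSoliton, sub_zero]) (by norm_num) (by simp) (by simp)
  rw [mul_zero, mul_zero, zero_mul] at h
  exact sub_eq_zero.1 (abs_eq_zero.1 (le_antisymm h (abs_nonneg _)))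

namespace Family

variable {ι : Type*} {P C : ℝ} {ν ε δ : ι → ℝ} {f : ι → ℝ → ℝ} {Q φ y e g₁ g₂ G : ι × ℝ → ℝ}

/-- Perturbed and explicit moments satisfy the same recurrence up to O(|ε| + |ν|) and start from ∫
φ' = 2; the functions themselves are never compared. -/
theorem exists_moment_quadratic (h : Family 1 P ν ε δ f Q φ y e g₁ g₂ G C) (k : ℕ) :
    ∃ K : ℝ, ∀ i, |(∫ x, Q (i, x) ^ (k + 1)) - ∫ x, quadSoliton x ^ (k + 1)| ≤ K * (|ε i| + |ν i|) := by
  have dQ := h.dec_Q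
  have bφ := h.bdd_φ
  have dy := h.dec_y
  have de := h.dec_e
  have dG := h.dec_G
  have bδ := h.δ_bdd
  have dR₁ : UDec fun z => y z * Q z + par δ z * e z - 2 * (1 / (P + 1) * (y z * Q z) + par δ z * G z) := by
    fun_prop
  have dR₂ : UDec fun z => 1 / 2 * Q z ^ 2 := by fun_prop
  have dT₁ : UDec fun z => 2 * (1 / (P + 1) * (y z * Q z) + par δ z * G z) := by fun_prop
  have hφ : ∀ i x, HasDerivAt (fun x => φ (i, x)) (1 / 3 * Q (i, x) ^ (0 + 1)
      + (ε i * (y (i, x) * Q (i, x) + δ i * e (i, x)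
        - 2 * (1 / (P + 1) * (y (i, x) * Q (i, x)) + δ i * G (i, x)))
        + ν i * (1 / 2 * Q (i, x) ^ 2))) x := fun i x => by
    refine (h.hasDerivAt_φ i x).congr_deriv ?_
    have := h.φ_sq (i, x)
    simp only [par] at this
    rw [this]
    ring
  induction k with
  | zero =>
    exact exists_moment_zero dQ dR₁ dR₂ h.odd_φ (fun i => (h.profile i).tendsto_φ) hφ (by norm_num)
      quadSoliton_moment_zero
  | succ k ih =>
    refine exists_moment_succ dQ bφ dR₁ dR₂ dT₁ dR₂ h.hasDerivAt_Q hφ (fun i x => ?_) (by positivity)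
      (quadSoliton_moment k) ih
    have := h.φ_sq (i, x)
    simp only [par] at this ⊢
    rw [this]
    ring

/-- The recurrence has step two, so two starting values are needed: ∫ Q² from ∫ φ' = 2, and ∫ Q from
the arcsine estimate. The latter divides by √(1 - φ²), of size Q, which is why the errors must be
bounded by multiples of Q². -/
theorem exists_moment_cubic (h : Family 0 P (fun _ => 1) ε δ f Q φ y e g₁ g₂ G C) {M : ℝ}
    (hy : ∀ z, |y z| ≤ M * Q z) (he : ∀ z, |e z| ≤ M * Q z ^ 2) (hG : ∀ z, |G z| ≤ M * Q z ^ 2) (k : ℕ) :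
    ∃ K : ℝ, ∀ i, |(∫ x, Q (i, x) ^ (k + 1)) - ∫ x, cubicSoliton x ^ (k + 1)| ≤ K * |ε i| := by
  have dQ := h.dec_Q
  have bφ := h.bdd_φ
  have dy := h.dec_y
  have de := h.dec_e
  have dG := h.dec_G
  have bδ := h.δ_bdd
  have hP := h.four_le
  set E : ι × ℝ → ℝ := fun z =>
    y z * Q z + par δ z * e z - 4 * (1 / (P + 1) * (y z * Q z) + par δ z * G z) with hE
  set H : ι × ℝ → ℝ := fun z => 2 * (1 / (P + 1) * (y z * Q z) + par δ z * G z) with hH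
  have dE : UDec E := by fun_prop
  have dH : UDec H := by fun_prop
  have hsq : ∀ i x, φ (i, x) ^ 2 = 1 - 1 / 2 * Q (i, x) ^ (1 + 1) - ε i * H (i, x) := fun i x => by
    have := h.φ_sq (i, x)
    simp only [par] at this
    simp only [hH, par]
    rw [this]
    ring
  have hφ : ∀ i x, HasDerivAt (fun x => φ (i, x))
      (1 / 2 * Q (i, x) ^ (1 + 1) + ε i * (E (i, x) + H (i, x))) x := fun i x => by
    refine (h.hasDerivAt_φ i x).congr_deriv ?_
    rw [hsq]
    simp only [hE, hH, par]
    ring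
  obtain ⟨D, hD⟩ := bδ.exists_par
  obtain ⟨K₀, hK₀⟩ := dQ.exists_integral_le
  set L := 3 * (|M| * (1 + |D|)) with hL
  have hQ0 : ∀ z, 0 < Q z := fun z => (h.profile z.1).pos z.2
  have hb : ∀ z, |y z * Q z| ≤ |M| * Q z ^ 2 ∧ |par δ z * e z| ≤ |D| * |M| * Q z ^ 2 ∧
      |1 / (P + 1) * (y z * Q z) + par δ z * G z| ≤ |M| * (1 + |D|) * Q z ^ 2 := fun z => by
    have hp := hQ0 z
    have hδ : |par δ z| ≤ |D| := (hD z.1).trans (le_abs_self _)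
    have hM := le_abs_self M
    have h1 : |y z * Q z| ≤ |M| * Q z ^ 2 := by
      rw [abs_mul, abs_of_pos hp, sq, ← mul_assoc]
      exact mul_le_mul_of_nonneg_right ((hy z).trans (by gcongr)) hp.le
    have h2 : ∀ u : ℝ, |u| ≤ M * Q z ^ 2 → |par δ z * u| ≤ |D| * |M| * Q z ^ 2 := fun u hu => by
      rw [abs_mul, mul_assoc]
      exact mul_le_mul hδ (hu.trans (by gcongr)) (abs_nonneg _) (abs_nonneg _)
    refine ⟨h1, h2 _ (he z), (abs_add_le _ _).trans ?_⟩
    have h3 : |1 / (P + 1) * (y z * Q z)| ≤ |M| * Q z ^ 2 := by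
      rw [abs_mul]
      refine (mul_le_of_le_one_left (abs_nonneg _) ?_).trans h1
      rw [abs_of_pos (by positivity), div_le_one (by linarith)]
      linarith
    linarith [h2 _ (hG z)]
  have hR : ∀ z, |E z + H z| ≤ L * Q z ^ 2 := fun z => by
    obtain ⟨h1, h2, h3⟩ := hb z
    have e1 : E z + H z = (y z * Q z + par δ z * e z)
        - 2 * (1 / (P + 1) * (y z * Q z) + par δ z * G z) := by simp only [hE, hH]; ring
    rw [e1]
    refine (abs_sub _ _).trans ?_
    rw [abs_mul, abs_two]
    have := abs_add_le (y z * Q z) (par δ z * e z)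
    simp only [hL]
    linarith
  have hT : ∀ z, |H z| ≤ L * Q z ^ 2 := fun z => by
    obtain ⟨-, -, h3⟩ := hb z
    simp only [hH, hL]
    rw [abs_mul, abs_two]
    have : 0 ≤ |M| * (1 + |D|) * Q z ^ 2 := by positivity
    linarith
  have hL0 : 0 ≤ L := by positivity
  have h2π : 0 ≤ √2 * Real.pi := by positivity
  have hφ' : ∀ i x, HasDerivAt (fun x => φ (i, x)) (1 / 2 * Q (i, x) ^ (1 + 1)
      + (ε i * (E (i, x) + H (i, x)) + (fun _ => 0) i * H (i, x))) x := fun i x =>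
    (hφ i x).congr_deriv (by ring)
  induction k using Nat.twoStepInduction with
  | zero =>
    refine ⟨√2 * (4 * L) * |K₀| + (|K₀| + √2 * Real.pi) * (4 * L), fun i => ?_⟩
    have hI : (∫ x, Q (i, x)) ≤ |K₀| := (le_abs_self _).trans ((hK₀ i).trans (le_abs_self _))
    have hI0 : 0 ≤ ∫ x, Q (i, x) := integral_nonneg fun x => (hQ0 (i, x)).le
    simp only [zero_add, pow_one, integral_cubicSoliton]
    rw [add_mul]
    -- The arcsine estimate requires small ε; otherwise |ε| is bounded below and a crude bound is
    -- already of the form K|ε|.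
    rcases le_or_gt (L * |ε i|) (1 / 4) with hη | hη
    · have key := abs_integral_sub_le (Q := fun x => Q (i, x)) (φ := fun x => φ (i, x))
        (R := fun x => ε i * (E (i, x) + H (i, x))) (T := fun x => ε i * H (i, x)) (η := L * |ε i|)
        (dQ.dec i) (fun x => hQ0 (i, x)) (continuous_const.mul ((dE.add dH).1 i)) (bφ.1 i)
        (h.profile i).φ_sq_lt (h.odd_φ i) (h.profile i).tendsto_φ (hφ i) (hsq i) hη
        (fun x => by
          rw [abs_mul, mul_comm L, mul_assoc]
          exact mul_le_mul_of_nonneg_left (hR (i, x)) (abs_nonneg _))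
        (fun x => by
          rw [abs_mul, mul_comm L, mul_assoc]
          exact mul_le_mul_of_nonneg_left (hT (i, x)) (abs_nonneg _))
      refine key.trans ((mul_le_mul_of_nonneg_left hI (by positivity)).trans ?_)
      have : 0 ≤ (|K₀| + √2 * Real.pi) * (4 * L) * |ε i| := by positivity
      linarith
    · have h1 : |(∫ x, Q (i, x)) - √2 * Real.pi| ≤ |K₀| + √2 * Real.pi := by
        rw [abs_le]; constructor <;> linarith [abs_nonneg K₀]
      have h2 : |K₀| + √2 * Real.pi ≤ (|K₀| + √2 * Real.pi) * (4 * (L * |ε i|)) :=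
        le_mul_of_one_le_right (by positivity) (by linarith)
      have : 0 ≤ √2 * (4 * L) * |K₀| * |ε i| := by positivity
      linarith
  | one =>
    obtain ⟨K, hK⟩ := exists_moment_zero (ε := ε) (ν := fun _ => 0) dQ (dE.add dH) dH h.odd_φ
      (fun i => (h.profile i).tendsto_φ) hφ' (by norm_num) cubicSoliton_moment_zero
    exact ⟨K, fun i => by simpa using hK i⟩
  | more k ih _ =>
    obtain ⟨K, hK⟩ := exists_moment_succ (ε := ε) (ν := fun _ => 0) dQ bφ (dE.add dH) dH dH dH
      h.hasDerivAt_Q hφ' (fun i x => by rw [hsq]; ring) (by positivity) (cubicSoliton_moment k)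
      (ih.imp fun K hK i => by simpa using hK i)
    exact ⟨K, fun i => by simpa using hK i⟩

end Family

end GKdV

/-! ### Taylor bounds for the remainder and profiles of perturbed powers -/

namespace GKdV

/-- If k were the lowest order of a nonzero derivative at 0, Taylor's formula would make f
comparable to s^k, against f = o(s^p) with k ≤ p. -/
theorem iteratedDeriv_eq_zero_of_tendsto {f : ℝ → ℝ} {p : ℕ} (hf : ContDiff ℝ p f)
    (h : Tendsto (fun s => f s / |s| ^ p) (𝓝[≠] 0) (𝓝 0)) (k : ℕ) (hk : k ≤ p) :
    iteratedDeriv k f 0 = 0 := by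
  have h1 : f =o[𝓝[≠] 0] fun s : ℝ => s ^ p := by
    refine isLittleO_abs_right.1 ?_
    refine (isLittleO_iff_tendsto' ?_).2 (by simpa only [abs_pow] using h)
    filter_upwards [self_mem_nhdsWithin] with s hs h0
    exact absurd h0 (abs_ne_zero.2 (pow_ne_zero _ hs))
  induction k using Nat.strong_induction_on with
  | _ k ih =>
    have h2 : f =o[𝓝[≠] 0] fun s : ℝ => s ^ k :=
      h1.trans_isBigO (by
        refine IsBigO.of_bound 1 ?_
        have : ∀ᶠ s : ℝ in 𝓝[≠] 0, |s| < 1 :=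
          eventually_nhdsWithin_of_eventually_nhds (by
            have := Metric.ball_mem_nhds (0 : ℝ) one_pos
            filter_upwards [this] with s hs using by simpa using hs)
        filter_upwards [this] with s hs
        rw [one_mul, norm_pow, norm_pow]
        exact pow_le_pow_of_le_one (abs_nonneg _) hs.le hk)
    have h3 := (taylor_isLittleO (x₀ := 0) (n := k) convex_univ (Set.mem_univ _)
      (hf.of_le (by exact_mod_cast hk)).contDiffOn).mono (nhdsWithin_mono 0 (Set.subset_univ {0}ᶜ))
    have h4 : ∀ s, taylorWithinEval f k Set.univ 0 s = (k.factorial : ℝ)⁻¹ * iteratedDeriv k f 0 * s ^ k := by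
      intro s
      rw [taylor_within_apply, Finset.sum_range_succ, Finset.sum_eq_zero]
      · simp only [sub_zero, iteratedDerivWithin_univ, smul_eq_mul, zero_add]; ring
      · intro j hj
        rw [iteratedDerivWithin_univ, ih j (Finset.mem_range.1 hj)
          ((Finset.mem_range.1 hj).le.trans hk), smul_zero]
    simp only [h4, sub_zero] at h3
    have h5 := h2.sub h3
    simp only [sub_sub_cancel] at h5
    by_contra hne
    have hc : (k.factorial : ℝ)⁻¹ * iteratedDeriv k f 0 ≠ 0 :=
      mul_ne_zero (inv_ne_zero (by positivity)) hne
    refine isLittleO_irrefl ?_ ((isLittleO_const_mul_left_iff hc).1 h5)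
    refine Eventually.frequently ?_
    filter_upwards [self_mem_nhdsWithin] with s hs
    exact pow_ne_zero _ hs

/-- Descends from order p + 1 by the mean value inequality, each step gaining a factor |s| because
the derivative vanishes at 0. -/
theorem abs_iteratedDeriv_le {f : ℝ → ℝ} {p : ℕ} {M R : ℝ} (hf : ContDiff ℝ (p + 1 : ℕ) f)
    (h0 : ∀ k ≤ p, iteratedDeriv k f 0 = 0)
    (hM : ∀ s, |s| ≤ R → |iteratedDeriv (p + 1) f s| ≤ M) (j : ℕ) (hj : j ≤ p + 1) (s : ℝ) (hs : |s| ≤ R) :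
    |iteratedDeriv (p + 1 - j) f s| ≤ M * |s| ^ j := by
  have hM0 : 0 ≤ M := (abs_nonneg _).trans (hM s hs)
  induction j generalizing s with
  | zero => simpa using hM s hs
  | succ j ih =>
    have e : p + 1 - j = (p + 1 - (j + 1)) + 1 := by omega
    have h1 : ∀ t ∈ Metric.closedBall (0 : ℝ) |s|,
        ‖deriv (iteratedDeriv (p + 1 - (j + 1)) f) t‖ ≤ M * |s| ^ j := fun t ht => by
      have ht' : |t| ≤ |s| := by simpa using ht
      rw [← iteratedDeriv_succ, ← e]
      exact (ih (by omega) t (ht'.trans hs)).trans (by gcongr)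
    have h2 := Convex.norm_image_sub_le_of_norm_deriv_le (x := 0) (y := s) (fun t _ =>
      (hf.differentiable_iteratedDeriv _ (by exact_mod_cast (by omega : p + 1 - (j + 1) < p + 1))) t)
      h1 (convex_closedBall _ _) (by simp) (by simp)
    rw [h0 _ (by omega), sub_zero, sub_zero] at h2
    rw [pow_succ, ← mul_assoc]
    exact h2

theorem UDec.of_le {ι : Type*} {g Q : ι × ℝ → ℝ} (hQ : UDec Q) (hc : ∀ i, Continuous fun x => g (i, x))
    {K : ℝ} (h : ∀ z, |g z| ≤ K * |Q z|) : UDec g := by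
  obtain ⟨-, L, n, hL⟩ := hQ
  refine ⟨hc, |K| * L, n, fun z => (h z).trans ?_⟩
  rw [mul_assoc]
  exact mul_le_mul (le_abs_self _) (hL z) (abs_nonneg _) (abs_nonneg _)

section Construction

variable {f r : ℝ → ℝ} {κ ν ε δ M : ℝ} {n : ℕ}

theorem abs_integral_pow_le (h0 : ∀ q ∈ Set.Icc (0 : ℝ) 2, |r q| ≤ M * q ^ 5)
    {q : ℝ} (hq : q ∈ Set.Icc (0 : ℝ) 2) : |∫ u in (0)..q, r u| ≤ M * q ^ 6 := by
  have h1 := intervalIntegral.norm_integral_le_of_norm_le_const (a := 0) (b := q) (f := r)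
    (C := M * q ^ 5) fun u hu => by
      rw [Set.uIoc_of_le hq.1] at hu
      have hM : 0 ≤ M := by
        have := (abs_nonneg _).trans (h0 2 ⟨by norm_num, le_rfl⟩)
        linarith
      refine (h0 u ⟨hu.1.le, hu.2.trans hq.2⟩).trans ?_
      exact mul_le_mul_of_nonneg_left (pow_le_pow_left₀ hu.1.le hu.2 5) hM
  rw [sub_zero, abs_of_nonneg hq.1] at h1
  calc _ ≤ M * q ^ 5 * q := h1
    _ = _ := by ring

theorem hasDerivAt_of_perturbation (hf : ∀ u, f u = κ * u ^ 2 + ν * u ^ 3 + ε * (u ^ (n + 4) + δ * r u))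
    (hr : ContDiff ℝ 3 r) (q : ℝ) : HasDerivAt f (2 * κ * q + 3 * ν * q ^ 2
      + ε * ((n + 4) * q ^ (n + 3) + δ * deriv r q)) q := by
  have hid := hasDerivAt_id q
  have hrd : HasDerivAt r (deriv r q) q := (hr.differentiable (by norm_num) q).hasDerivAt
  rw [funext hf]
  refine ((((hid.fun_pow 2).const_mul κ).fun_add ((hid.fun_pow 3).const_mul ν)).fun_add
    (((hid.fun_pow (n + 4)).fun_add (hrd.const_mul δ)).const_mul ε)).congr_deriv ?_
  simp only [id]
  push_cast
  ring

theorem iteratedDeriv_two_of_perturbation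
    (hf : ∀ u, f u = κ * u ^ 2 + ν * u ^ 3 + ε * (u ^ (n + 4) + δ * r u)) (hr : ContDiff ℝ 3 r) (q : ℝ) :
    iteratedDeriv 2 f q = 2 * κ + 6 * ν * q
      + ε * ((n + 4) * (n + 3) * q ^ (n + 2) + δ * iteratedDeriv 2 r q) := by
  have hid := hasDerivAt_id q
  have hrd : HasDerivAt (deriv r) (iteratedDeriv 2 r q) q := by
    rw [iteratedDeriv_succ, iteratedDeriv_one]
    exact (((contDiff_succ_iff_deriv (n := 2)).1 (by exact_mod_cast hr)).2.2.differentiable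
      (by norm_num) q).hasDerivAt
  rw [iteratedDeriv_succ, iteratedDeriv_one, funext fun q => (hasDerivAt_of_perturbation hf hr q).deriv]
  refine (((hid.const_mul (2 * κ)).fun_add ((hid.fun_pow 2).const_mul (3 * ν))).fun_add
    ((((hid.fun_pow (n + 3)).const_mul ((n : ℝ) + 4)).fun_add
      (hrd.const_mul δ)).const_mul ε)).deriv.trans ?_
  simp only [id]
  push_cast
  ring

/-- The unperturbed solitons have heights 3/2 and √2, so [0, 2] contains the range of Q with room to
spare. On it f(q)/q, s(q) and f'(q) are within a small multiple of w of their unperturbed values,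
and C = 8 satisfies all requirements of `exists_profile` for both nonlinearities at once. -/
theorem exists_profile_of_perturbation (hf : ∀ u, f u = κ * u ^ 2 + ν * u ^ 3 + ε * (u ^ (n + 4) + δ * r u))
    (hr : ContDiff ℝ 3 r) (h0 : ∀ q ∈ Set.Icc (0 : ℝ) 2, |r q| ≤ M * q ^ 5)
    (h1 : ∀ q ∈ Set.Icc (0 : ℝ) 2, |deriv r q| ≤ M * q ^ 4) (hδ : |δ| ≤ 1)
    (hκ : κ = 1 ∧ |ν| ≤ 1 / 1000 ∨ κ = 0 ∧ ν = 1)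
    (hε : |ε| * ((n + 4) * 2 ^ n + M) ≤ 1 / 1000) :
    ∃ Q φ : ℝ → ℝ, Profile f Q φ (8 * Real.exp 8) ∧ (∀ x, Q x < 2) ∧
      ∀ x, φ x ^ 2 = 1 - (2 / 3 * κ * Q x + 1 / 2 * ν * Q x ^ 2
        + 2 * ε * (1 / ((n : ℝ) + 4 + 1) * (Q x ^ (n + 2) * Q x)
          + δ * ((∫ u in (0)..Q x, r u) / Q x ^ 2))) := by
  -- This is 2q^(-2) times the primitive of f vanishing at 0.
  set s : ℝ → ℝ := fun q => 2 / 3 * κ * q + 1 / 2 * ν * q ^ 2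
        + 2 * ε * (1 / ((n : ℝ) + 4 + 1) * (q ^ (n + 2) * q)
          + δ * ((∫ u in (0)..q, r u) / q ^ 2)) with hs
  have hM : 0 ≤ M := by
    have := (abs_nonneg _).trans (h0 2 ⟨by norm_num, le_rfl⟩)
    linarith
  have hd : ∀ q, 0 < q → HasDerivAt s (2 * (f q / q - s q) / q) q := fun q hq => by
    have hR := intervalIntegral.integral_hasDerivAt_right (hr.continuous.intervalIntegrable 0 q)
      (hr.continuous.stronglyMeasurableAtFilter _ _) hr.continuous.continuousAt
    have hid := hasDerivAt_id q
    refine (((hid.const_mul (2 / 3 * κ)).fun_add ((hid.fun_pow 2).const_mul (1 / 2 * ν))).fun_add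
      (((((hid.fun_pow (n + 2)).fun_mul hid).const_mul (1 / ((n : ℝ) + 4 + 1))).fun_add
      ((hR.fun_div (hid.fun_pow 2) (by simpa using hq.ne')).const_mul δ)).const_mul
        (2 * ε))).congr_deriv ?_
    simp only [hs, hf, id]
    have hn : (n : ℝ) + 4 + 1 ≠ 0 := by positivity
    push_cast
    field_simp
    ring
  have hε0 := abs_nonneg ε
  have hn4 : (4 : ℝ) ≤ (n : ℝ) + 4 := by have : (0 : ℝ) ≤ n := n.cast_nonneg; linarith
  have h2n : (1 : ℝ) ≤ 2 ^ n := one_le_pow₀ (by norm_num)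
  have hpow : ∀ q ∈ Set.Icc (0 : ℝ) 2, |q ^ (n + 3)| ≤ 2 * 2 ^ n * q ^ 2 := fun q hq => by
    rw [abs_of_nonneg (pow_nonneg hq.1 _), show n + 3 = n + 1 + 2 by ring, pow_add,
      show (2 : ℝ) * 2 ^ n = 2 ^ (n + 1) by ring]
    exact mul_le_mul_of_nonneg_right (pow_le_pow_left₀ hq.1 hq.2 (n + 1)) (sq_nonneg q)
  have hq4 : ∀ q ∈ Set.Icc (0 : ℝ) 2, M * q ^ 4 ≤ 4 * M * q ^ 2 := fun q hq => by
    have h2 : q ^ 2 ≤ 4 := by nlinarith [hq.1, hq.2]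
    have h3 := mul_le_mul_of_nonneg_left (mul_le_mul_of_nonneg_right h2 (sq_nonneg q)) hM
    calc M * q ^ 4 = M * (q ^ 2 * q ^ 2) := by ring
      _ ≤ _ := h3
      _ = _ := by ring
  have hδu : ∀ u B : ℝ, |u| ≤ B → |δ * u| ≤ B := fun u B hu => by
    rw [abs_mul]; exact (mul_le_of_le_one_left (abs_nonneg _) hδ).trans hu
  have hεu : ∀ q u : ℝ, |u| ≤ ((n + 4) * (2 * 2 ^ n) + 4 * M) * q ^ 2 → |ε * u| ≤ 4 / 1000 * q ^ 2 :=
    fun q u hu => by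
    rw [abs_mul]
    refine (mul_le_mul_of_nonneg_left hu hε0).trans ?_
    rw [← mul_assoc]
    refine mul_le_mul_of_nonneg_right ?_ (sq_nonneg q)
    have : 0 ≤ |ε| * ((n + 4) * 2 ^ n) := by positivity
    linarith
  have hsum : ∀ q ∈ Set.Icc (0 : ℝ) 2, ∀ c u v : ℝ, 0 ≤ c → c ≤ n + 4 → |u| ≤ |q ^ (n + 3)| →
      |v| ≤ M * q ^ 4 → |ε * (c * u + δ * v)| ≤ 4 / 1000 * q ^ 2 := fun q hq c u v hc hc' hu hv => by
    refine hεu q _ ((abs_add_le _ _).trans ?_)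
    rw [add_mul]
    refine add_le_add ?_ ((hδu _ _ hv).trans (hq4 q hq))
    rw [abs_mul, abs_of_nonneg hc, mul_assoc]
    exact mul_le_mul hc' (hu.trans (hpow q hq)) (abs_nonneg _) (by linarith)
  have hνq : ∀ q ∈ Set.Icc (0 : ℝ) 2, κ = 1 → |ν * q ^ 2| ≤ 2 / 1000 * q := fun q hq h1 => by
    rcases hκ with ⟨-, hν⟩ | ⟨h2, -⟩
    · rw [abs_mul, abs_of_nonneg (sq_nonneg q)]
      have := mul_le_mul_of_nonneg_right hν (sq_nonneg q)
      nlinarith [hq.1, hq.2]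
    · exact absurd (h1.symm.trans h2) one_ne_zero
  have hf' : ∀ q, deriv f q = 2 * κ * q + 3 * ν * q ^ 2 + ε * ((n + 4) * q ^ (n + 3) + δ * deriv r q) :=
    fun q => (hasDerivAt_of_perturbation hf hr q).deriv
  -- A common normal form: w = q, σ = 2/3, τ = 2 in the quadratic case and w = q², σ = 1/2, τ = 3 in
  -- the cubic one. The condition on w(2) ensures s(2) > 1, so that s reaches the value 1 before q =
  -- 2.
  obtain ⟨w, σ, τ, hw, hσ, hτ, key⟩ : ∃ (w : ℝ → ℝ) (σ τ : ℝ), (2 ≤ w 2 ∧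
      ∀ q ∈ Set.Ioc (0 : ℝ) 2, 0 < w q ∧ w q ≤ 2 * q) ∧ (1 / 2 ≤ σ ∧ σ ≤ 2 / 3 ∧ 1 < σ * w 2 - 2 / 100 * w 2) ∧
      (2 ≤ τ ∧ τ ≤ 3) ∧ ∀ q ∈ Set.Ioc (0 : ℝ) 2, |s q - σ * w q| ≤ 2 / 100 * w q ∧
        |f q / q - w q| ≤ 2 / 100 * w q ∧ |deriv f q - τ * w q| ≤ 2 / 100 * w q := by
    have b1 : ∀ q ∈ Set.Ioc (0 : ℝ) 2, |ε * (1 / ((n : ℝ) + 4 + 1) * (q ^ (n + 2) * q)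
        + δ * ((∫ u in (0)..q, r u) / q ^ 2))| ≤ 4 / 1000 * q ^ 2 := fun q hq => by
      have hq' : q ∈ Set.Icc (0 : ℝ) 2 := ⟨hq.1.le, hq.2⟩
      refine hsum q hq' _ _ _ (by positivity) ?_ (by rw [← pow_succ]) ?_
      · rw [div_le_iff₀ (by positivity)]; nlinarith
      · have := abs_integral_pow_le h0 hq'
        have hq0 := hq.1
        rw [abs_div, abs_of_pos (by positivity : 0 < q ^ 2), div_le_iff₀ (by positivity)]
        linarith
    have b2 : ∀ q ∈ Set.Ioc (0 : ℝ) 2, |ε * (1 * q ^ (n + 3) + δ * (r q / q))| ≤ 4 / 1000 * q ^ 2 :=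
      fun q hq => by
      have hq' : q ∈ Set.Icc (0 : ℝ) 2 := ⟨hq.1.le, hq.2⟩
      refine hsum q hq' _ _ _ zero_le_one (by linarith) le_rfl ?_
      have := h0 q hq'
      rw [abs_div, abs_of_pos hq.1, div_le_iff₀ hq.1]
      linarith
    have b3 : ∀ q ∈ Set.Ioc (0 : ℝ) 2, |ε * ((n + 4) * q ^ (n + 3) + δ * deriv r q)| ≤ 4 / 1000 * q ^ 2 :=
      fun q hq => by
      have hq' : q ∈ Set.Icc (0 : ℝ) 2 := ⟨hq.1.le, hq.2⟩
      exact hsum q hq' _ _ _ (by linarith) le_rfl le_rfl (h1 q hq')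
    have hfq : ∀ q ∈ Set.Ioc (0 : ℝ) 2, f q / q = κ * q + ν * q ^ 2
        + ε * (1 * q ^ (n + 3) + δ * (r q / q)) := fun q hq => by
      have := hq.1.ne'
      rw [hf]
      field_simp
      ring
    rcases hκ with ⟨hκ1, -⟩ | ⟨hκ0, hν1⟩
    · refine ⟨fun q => q, 2 / 3, 2, ⟨le_rfl, fun q hq => ⟨hq.1, by linarith [hq.1]⟩⟩, by norm_num,
        by norm_num, fun q hq => ?_⟩
      have c0 := abs_le.1 (hνq q ⟨hq.1.le, hq.2⟩ hκ1)
      have c1 := abs_le.1 (b1 q hq)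
      have c2 := abs_le.1 (b2 q hq)
      have c3 := abs_le.1 (b3 q hq)
      have c4 : q ^ 2 ≤ 2 * q := by nlinarith [hq.1, hq.2]
      rw [hfq q hq, hf' q]
      simp only [hs, hκ1]
      refine ⟨abs_le.2 ⟨?_, ?_⟩, abs_le.2 ⟨?_, ?_⟩, abs_le.2 ⟨?_, ?_⟩⟩ <;> linarith
    · refine ⟨fun q => q ^ 2, 1 / 2, 3, ⟨by norm_num, fun q hq => ⟨by have := hq.1; positivity,
        by nlinarith [hq.1, hq.2]⟩⟩, by norm_num, by norm_num, fun q hq => ?_⟩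
      have c1 := abs_le.1 (b1 q hq)
      have c2 := abs_le.1 (b2 q hq)
      have c3 := abs_le.1 (b3 q hq)
      have c4 := sq_nonneg q
      rw [hfq q hq, hf' q]
      simp only [hs, hκ0, hν1]
      refine ⟨abs_le.2 ⟨?_, ?_⟩, abs_le.2 ⟨?_, ?_⟩, abs_le.2 ⟨?_, ?_⟩⟩ <;> linarith
  have hall : ∀ q ∈ Set.Ioo (0 : ℝ) 2, s q ≤ 8 * (f q / q - s q) ∧ f q / q - s q ≤ 8 * s q ∧
      0 < f q / q - s q ∧ s q ≤ 8 * q ∧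
      |deriv f q - s q - 3 * (f q / q - s q)| ≤ 8 * (f q / q - s q) ∧ |f q| ≤ 8 * q ^ 2 ∧
      |deriv f q| ≤ 8 * q := fun q hq => by
    have hq' : q ∈ Set.Ioc (0 : ℝ) 2 := ⟨hq.1, hq.2.le⟩
    obtain ⟨k1, k2, k3⟩ := key q hq'
    obtain ⟨w0, w1⟩ := hw.2 q hq'
    rw [abs_le] at k1 k2 k3
    have m1 : 1 / 2 * w q ≤ σ * w q := mul_le_mul_of_nonneg_right hσ.1 w0.le
    have m2 : σ * w q ≤ 2 / 3 * w q := mul_le_mul_of_nonneg_right hσ.2.1 w0.le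
    have m3 : 2 * w q ≤ τ * w q := mul_le_mul_of_nonneg_right hτ.1 w0.le
    have m4 : τ * w q ≤ 3 * w q := mul_le_mul_of_nonneg_right hτ.2 w0.le
    refine ⟨by linarith, by linarith, by linarith, by linarith, abs_le.2 ⟨by linarith, by linarith⟩, ?_,
      abs_le.2 ⟨by linarith, by linarith⟩⟩
    have e : f q = f q / q * q := by have := hq.1.ne'; field_simp
    rw [e, abs_mul, abs_of_pos hq.1, sq, ← mul_assoc]
    exact mul_le_mul_of_nonneg_right (abs_le.2 ⟨by linarith, by linarith⟩) hq.1.le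
  refine exists_profile (s := s) (q₁ := 2) (C := 8) (by norm_num) two_pos (by norm_num) ?_ ?_ ?_ ?_
    (fun q hq => hd q hq.1) (fun q hq => (hall q hq).1) (fun q hq => (hall q hq).2.1)
    (fun q hq => (hall q hq).2.2.1) (fun q hq => (hall q hq).2.2.2.1)
    (fun q hq => (hall q hq).2.2.2.2.1) (fun q hq => (hall q hq).2.2.2.2.2.1)
    (fun q hq => (hall q hq).2.2.2.2.2.2)
  · rw [funext hf]; fun_prop
  · intro q hq
    rcases hq.1.eq_or_lt with rfl | hq0
    · have hs00 : s 0 = 0 := by simp [hs]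
      rw [ContinuousWithinAt, hs00]
      -- At q = 0 division by q² returns the default value 0, which is also the limit, since |s(q)|
      -- ≤ 4q.
      refine squeeze_zero_norm' (a := fun q => 4 * q) ?_ ?_
      · filter_upwards [self_mem_nhdsWithin] with q hq
        rcases hq.1.eq_or_lt with rfl | hq0
        · simp [hs00]
        · obtain ⟨k1, -, -⟩ := key q ⟨hq0, hq.2⟩
          obtain ⟨w0, w1⟩ := hw.2 q ⟨hq0, hq.2⟩
          rw [abs_le] at k1
          have m1 : 1 / 2 * w q ≤ σ * w q := mul_le_mul_of_nonneg_right hσ.1 w0.le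
          have m2 : σ * w q ≤ 2 / 3 * w q := mul_le_mul_of_nonneg_right hσ.2.1 w0.le
          exact abs_le.2 ⟨by linarith, by linarith⟩
      · have : Tendsto (fun q : ℝ => 4 * q) (𝓝 0) (𝓝 (4 * 0)) := (continuous_const_mul 4).tendsto 0
        rw [mul_zero] at this
        exact this.mono_left nhdsWithin_le_nhds
    · exact (hd q hq0).continuousAt.continuousWithinAt
  · simp [hs]
  · have := (abs_le.1 (key 2 ⟨two_pos, le_rfl⟩).1).1
    linarith [hσ.2.2]

end Construction

end GKdV

/-! ### Families of solitons on a punctured interval of parameters -/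

namespace GKdV

theorem exists_family {ι : Type*} {f r : ι → ℝ → ℝ} {κ M : ℝ} {ν ε δ : ι → ℝ} {n : ℕ}
    (hf : ∀ i u, f i u = κ * u ^ 2 + ν i * u ^ 3 + ε i * (u ^ (n + 4) + δ i * r i u))
    (hr : ∀ i, ContDiff ℝ 3 (r i)) (hM : 0 ≤ M)
    (h0 : ∀ i, ∀ q ∈ Set.Icc (0 : ℝ) 2, |r i q| ≤ M * q ^ 5)
    (h1 : ∀ i, ∀ q ∈ Set.Icc (0 : ℝ) 2, |deriv (r i) q| ≤ M * q ^ 4)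
    (h2 : ∀ i, ∀ q ∈ Set.Icc (0 : ℝ) 2, |iteratedDeriv 2 (r i) q| ≤ M * q ^ 3)
    (hδ : ∀ i, |δ i| ≤ 1) (hκ : κ = 1 ∧ (∀ i, |ν i| ≤ 1 / 1000) ∨ κ = 0 ∧ ∀ i, ν i = 1)
    (hε : ∀ i, |ε i| * ((n + 4) * 2 ^ n + M) ≤ 1 / 1000) (hε0 : ∀ i, ε i ≠ 0) :
    ∃ (Q φ y e g₁ g₂ G : ι × ℝ → ℝ),
      Family κ ((n : ℝ) + 4) ν ε δ f Q φ y e g₁ g₂ G (8 * Real.exp 8) ∧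
      (∀ z, y z * Q z ^ 2 = Q z ^ (n + 4)) ∧
      ∃ L : ℝ, ∀ z, |y z| ≤ L * Q z ∧ |e z| ≤ L * Q z ^ 2 ∧ |G z| ≤ L * Q z ^ 2 := by
  have key := fun i => exists_profile_of_perturbation (hf i) (hr i) (h0 i) (h1 i) (hδ i)
    (hκ.imp (And.imp_right fun h => h i) (And.imp_right fun h => h i)) (hε i)
  choose Q φ hp hlt hsq using key
  have hpos : ∀ i x, 0 < Q i x := fun i => (hp i).pos
  have hI : ∀ i x, Q i x ∈ Set.Icc (0 : ℝ) 2 := fun i x => ⟨(hpos i x).le, (hlt i x).le⟩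
  have cQ : ∀ i, Continuous (Q i) := fun i => (hp i).continuous_Q
  have hne : ∀ i x, Q i x ≠ 0 := fun i x => (hpos i x).ne'
  have dQ : UDec fun z : ι × ℝ => Q z.1 z.2 :=
    ⟨cQ, 8 * Real.exp 8, 0, fun z => by
      simpa [abs_of_pos (hpos z.1 z.2)] using (hp z.1).le_exp z.2⟩
  have cr : ∀ i, Continuous (r i) := fun i => (hr i).continuous
  have cr1 : ∀ i, Continuous (deriv (r i)) := fun i => (hr i).continuous_deriv (by norm_num)
  have cr2 : ∀ i, Continuous (iteratedDeriv 2 (r i)) := fun i =>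
    (hr i).continuous_iteratedDeriv 2 (by norm_num)
  have cR : ∀ i, Continuous fun q => ∫ u in (0)..q, r i u := fun i =>
    continuous_of_hasDerivAt fun x => hasDerivAt_integral (cr i) x
  have pw : ∀ i x (k : ℕ), M * Q i x ^ (k + 1) ≤ 2 ^ k * M * Q i x := fun i x k => by
    have := pow_le_pow_left₀ (hI i x).1 (hI i x).2 k
    rw [pow_succ, ← mul_assoc, mul_comm (2 ^ k : ℝ)]
    exact mul_le_mul_of_nonneg_right (mul_le_mul_of_nonneg_left this hM) (hI i x).1
  have pw2 : ∀ i x, M * Q i x ^ 4 ≤ 4 * M * Q i x ^ 2 := fun i x => by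
    have := pow_le_pow_left₀ (hI i x).1 (hI i x).2 2
    have := mul_le_mul_of_nonneg_right (mul_le_mul_of_nonneg_left this hM) (sq_nonneg (Q i x))
    calc M * Q i x ^ 4 = M * Q i x ^ 2 * Q i x ^ 2 := by ring
      _ ≤ _ := this
      _ = _ := by ring
  have be : ∀ i x, |r i (Q i x) / Q i x| ≤ M * Q i x ^ 4 := fun i x => by
    rw [abs_div, abs_of_pos (hpos i x), div_le_iff₀ (hpos i x)]
    exact (h0 i _ (hI i x)).trans_eq (by ring)
  have bG : ∀ i x, |(∫ u in (0)..Q i x, r i u) / Q i x ^ 2| ≤ M * Q i x ^ 4 := fun i x => by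
    have := hpos i x
    rw [abs_div, abs_of_pos (by positivity : 0 < Q i x ^ 2), div_le_iff₀ (by positivity)]
    exact (abs_integral_pow_le (h0 i) (hI i x)).trans_eq (by ring)
  have ev : ∀ i x, Q i (-x) = Q i x := fun i => (hp i).even
  refine ⟨fun z => Q z.1 z.2, fun z => φ z.1 z.2, fun z => Q z.1 z.2 ^ (n + 2),
    fun z => r z.1 (Q z.1 z.2) / Q z.1 z.2, fun z => deriv (r z.1) (Q z.1 z.2),
    fun z => iteratedDeriv 2 (r z.1) (Q z.1 z.2),
    fun z => (∫ u in (0)..Q z.1 z.2, r z.1 u) / Q z.1 z.2 ^ 2, ?_, fun z => by ring, ?_⟩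
  · exact
    { profile := hp
      four_le := by have : (0 : ℝ) ≤ n := n.cast_nonneg; linarith
      ν_bdd := by
        rcases hκ with ⟨-, h⟩ | ⟨-, h⟩
        · exact UBdd.of_par h
        · exact UBdd.of_par (K := 1) fun i => by rw [h i, abs_one]
      ε_bdd := UBdd.of_par (K := 1 / 1000) fun i => by
        refine le_trans (le_mul_of_one_le_right (abs_nonneg _) ?_) (hε i)
        have h3 : (1 : ℝ) ≤ 2 ^ n := one_le_pow₀ (by norm_num)
        have h4 : (0 : ℝ) ≤ n := n.cast_nonneg
        nlinarith
      δ_bdd := UBdd.of_par hδ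
      ε_ne := hε0
      dec_y := dQ.pow_succ (n + 1)
      dec_e := dQ.of_le (fun i => ((cr i).comp (cQ i)).div (cQ i) (hne i)) (K := 2 ^ 3 * M) fun z => by
        rw [abs_of_pos (hpos z.1 z.2)]
        exact (be z.1 z.2).trans (pw z.1 z.2 3)
      dec_g₁ := dQ.of_le (fun i => (cr1 i).comp (cQ i)) (K := 2 ^ 3 * M) fun z => by
        rw [abs_of_pos (hpos z.1 z.2)]
        exact (h1 z.1 _ (hI z.1 z.2)).trans (pw z.1 z.2 3)
      dec_g₂ := dQ.of_le (fun i => (cr2 i).comp (cQ i)) (K := 2 ^ 2 * M) fun z => by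
        rw [abs_of_pos (hpos z.1 z.2)]
        exact (h2 z.1 _ (hI z.1 z.2)).trans (pw z.1 z.2 2)
      dec_G := dQ.of_le (fun i => ((cR i).comp (cQ i)).div ((cQ i).pow 2)
          fun x => pow_ne_zero 2 (hne i x)) (K := 2 ^ 3 * M) fun z => by
        rw [abs_of_pos (hpos z.1 z.2)]
        exact (bG z.1 z.2).trans (pw z.1 z.2 3)
      even_y := fun i x => by simp only [ev]
      even_e := fun i x => by simp only [ev]
      even_g₁ := fun i x => by simp only [ev]
      even_G := fun i x => by simp only [ev]
      f_eq := fun z => by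
        have := hne z.1 z.2
        simp only [par]
        rw [hf]
        field_simp
        ring
      deriv_eq := fun z => by
        rw [(hasDerivAt_of_perturbation (hf z.1) (hr z.1) _).deriv]
        simp only [par]
        ring
      deriv2_eq := fun z => by
        rw [iteratedDeriv_two_of_perturbation (hf z.1) (hr z.1)]
        simp only [par]
        ring
      φ_sq := fun z => hsq z.1 z.2
      hasDerivAt_y := fun i x => by
        refine (((hp i).hasDerivAt_Q x).fun_pow (n + 2)).congr_deriv ?_
        push_cast
        ring }
  -- Stronger than uniform localization: these bounds by powers of Q are what the first cubic moment
  -- requires.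
  · refine ⟨2 ^ (n + 1) + 4 * M, fun z => ⟨?_, ?_, ?_⟩⟩
    · have h3 := pow_le_pow_left₀ (hI z.1 z.2).1 (hI z.1 z.2).2 (n + 1)
      rw [abs_of_pos (pow_pos (hpos z.1 z.2) _), pow_succ _ (n + 1)]
      exact mul_le_mul_of_nonneg_right (by linarith) (hI z.1 z.2).1
    · refine ((be z.1 z.2).trans (pw2 z.1 z.2)).trans ?_
      exact mul_le_mul_of_nonneg_right (by linarith [pow_pos (two_pos (α := ℝ)) (n + 1)]) (sq_nonneg _)
    · refine ((bG z.1 z.2).trans (pw2 z.1 z.2)).trans ?_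
      exact mul_le_mul_of_nonneg_right (by linarith [pow_pos (two_pos (α := ℝ)) (n + 1)]) (sq_nonneg _)

section Comap

variable {ι ι' : Type*} {κ P C : ℝ} {ν ε δ : ι → ℝ} {f : ι → ℝ → ℝ} {Q φ y e g₁ g₂ G : ι × ℝ → ℝ}

theorem UBdd.comap {g : ι × ℝ → ℝ} (h : UBdd g) (s : ι' → ι) : UBdd fun z : ι' × ℝ => g (s z.1, z.2) :=
  ⟨fun i => h.1 (s i), h.2.imp fun _ hK z => hK (s z.1, z.2)⟩

theorem UDec.comap {g : ι × ℝ → ℝ} (h : UDec g) (s : ι' → ι) : UDec fun z : ι' × ℝ => g (s z.1, z.2) := by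
  obtain ⟨hc, K, n, hK⟩ := h
  exact ⟨fun i => hc (s i), K, n, fun z => hK (s z.1, z.2)⟩

/-- Allows the parameter interval to be shrunk after the family is built: the smallness needed for
solvability depends on constants of the family itself. -/
theorem Family.comap (h : Family κ P ν ε δ f Q φ y e g₁ g₂ G C) (s : ι' → ι) :
    Family κ P (fun i => ν (s i)) (fun i => ε (s i)) (fun i => δ (s i)) (fun i => f (s i))
      (fun z => Q (s z.1, z.2)) (fun z => φ (s z.1, z.2)) (fun z => y (s z.1, z.2))
      (fun z => e (s z.1, z.2)) (fun z => g₁ (s z.1, z.2)) (fun z => g₂ (s z.1, z.2))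
      (fun z => G (s z.1, z.2)) C where
  profile i := h.profile (s i)
  four_le := h.four_le
  ν_bdd := h.ν_bdd.comap s
  ε_bdd := h.ε_bdd.comap s
  δ_bdd := h.δ_bdd.comap s
  ε_ne i := h.ε_ne (s i)
  dec_y := h.dec_y.comap s
  dec_e := h.dec_e.comap s
  dec_g₁ := h.dec_g₁.comap s
  dec_g₂ := h.dec_g₂.comap s
  dec_G := h.dec_G.comap s
  even_y i := h.even_y (s i)
  even_e i := h.even_e (s i)
  even_g₁ i := h.even_g₁ (s i)
  even_G i := h.even_G (s i)
  f_eq z := h.f_eq (s z.1, z.2)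
  deriv_eq z := h.deriv_eq (s z.1, z.2)
  deriv2_eq z := h.deriv2_eq (s z.1, z.2)
  φ_sq z := h.φ_sq (s z.1, z.2)
  hasDerivAt_y i := h.hasDerivAt_y (s i)

theorem Family.exists_solvability_comap (h : Family κ P ν ε δ f Q φ y e g₁ g₂ G C)
    (hκ : κ = 0 ∨ κ = 1) (hC : 1 ≤ C) : ∃ η : ℝ, 0 < η ∧ ∀ {ι' : Type} (s : ι' → ι),
      (∀ i, |ε (s i)| + |κ * ν (s i)| ≤ η) → ∃ W W' : ι' × ℝ → ℝ,
        Solvability (fun i => f (s i)) (fun z => Q (s z.1, z.2)) (fun z => φ (s z.1, z.2)) W W'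
          (1 / 8 * (1 / C ^ 2)) := by
  obtain ⟨W, W', K, dW, dW', eW, hW, hW', hI⟩ := h.exists_solvability hκ
  have hc : 0 < 1 / 8 * (1 / C ^ 2) := by positivity
  refine ⟨1 / 8 * (1 / C ^ 2) / (|K| + 1), by positivity, fun s hs =>
    ⟨fun z => W (s z.1, z.2), fun z => W' (s z.1, z.2), hc, dW.comap s, dW'.comap s, fun i => eW (s i),
      fun i => hW (s i), fun i => hW' (s i), fun i => le_trans ?_ (hI (s i))⟩⟩
  have h1 := hs i
  rw [le_div_iff₀ (by positivity)] at h1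
  have h2 : K * (|ε (s i)| + |κ * ν (s i)|) ≤ |K| * (|ε (s i)| + |κ * ν (s i)|) :=
    mul_le_mul_of_nonneg_right (le_abs_self K) (by positivity)
  have h3 : 0 ≤ |ε (s i)| + |κ * ν (s i)| := by positivity
  linarith

end Comap

theorem eventually_punctured_iff {p : ℝ → Prop} :
    (∀ᶠ ε in 𝓝[≠] (0 : ℝ), p ε) ↔ ∃ ρ : ℝ, 0 < ρ ∧ ∀ ε, 0 < |ε| → |ε| < ρ → p ε := by
  rw [eventually_nhdsWithin_iff, Metric.eventually_nhds_iff]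
  simp only [dist_zero_right, Real.norm_eq_abs, abs_pos, Set.mem_compl_iff, Set.mem_singleton_iff, gt_iff_lt]
  exact ⟨fun ⟨ρ, h1, h2⟩ => ⟨ρ, h1, fun ε h3 h4 => h2 h4 h3⟩, fun ⟨ρ, h1, h2⟩ => ⟨ρ, h1, fun ε h3 h4 => h2 ε h4 h3⟩⟩

/-- A punctured interval of parameters. -/
abbrev Punctured (ρ : ℝ) := {ε : ℝ // 0 < |ε| ∧ |ε| < ρ}

/-- The interval is shrunk twice: until the profiles exist with the universal constant, and again
until the solvability constant of the resulting family is bounded below. -/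
theorem exists_solvable_family {f r : ℝ → ℝ → ℝ} {κ M : ℝ} {ν δ : ℝ → ℝ} {n : ℕ}
    (hf : ∀ ε, ε ≠ 0 → ∀ u, f ε u = κ * u ^ 2 + ν ε * u ^ 3 + ε * (u ^ (n + 4) + δ ε * r ε u))
    (hr : ∀ ε, ContDiff ℝ 3 (r ε)) (hM : 0 ≤ M)
    (h0 : ∀ ε, ∀ q ∈ Set.Icc (0 : ℝ) 2, |r ε q| ≤ M * q ^ 5)
    (h1 : ∀ ε, ∀ q ∈ Set.Icc (0 : ℝ) 2, |deriv (r ε) q| ≤ M * q ^ 4)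
    (h2 : ∀ ε, ∀ q ∈ Set.Icc (0 : ℝ) 2, |iteratedDeriv 2 (r ε) q| ≤ M * q ^ 3)
    (hδ : Tendsto δ (𝓝[≠] 0) (𝓝 0))
    (hκ : κ = 1 ∧ Tendsto ν (𝓝[≠] 0) (𝓝 0) ∨ κ = 0 ∧ ∀ ε, ν ε = 1) :
    ∃ ρ : ℝ, 0 < ρ ∧ ∃ (Q φ y e g₁ g₂ G W W' : Punctured ρ × ℝ → ℝ) (C c L : ℝ),
      Family κ ((n : ℝ) + 4) (fun i : Punctured ρ => ν i) (fun i => i) (fun i => δ i)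
        (fun i => f i) Q φ y e g₁ g₂ G C ∧ Solvability (fun i : Punctured ρ => f i) Q φ W W' c ∧
      (∀ z, y z * Q z ^ 2 = Q z ^ (n + 4)) ∧
      ∀ z, |y z| ≤ L * Q z ∧ |e z| ≤ L * Q z ^ 2 ∧ |G z| ≤ L * Q z ^ 2 := by
  have hid : Tendsto (fun ε : ℝ => ε) (𝓝[≠] 0) (𝓝 0) := tendsto_id.mono_left nhdsWithin_le_nhds
  have habs : ∀ {g : ℝ → ℝ}, Tendsto g (𝓝[≠] 0) (𝓝 0) → ∀ η, 0 < η → ∀ᶠ ε in 𝓝[≠] (0 : ℝ), |g ε| ≤ η :=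
    fun hg η hη => by
      have := hg.abs
      rw [abs_zero] at this
      exact this.eventually_le_const hη
  have hB : 0 < (n + 4) * 2 ^ n + M := by positivity
  obtain ⟨ρ₁, hρ₁, hs⟩ := eventually_punctured_iff.1 ((habs hδ 1 one_pos).and
    ((habs hid (1 / 1000 / ((n + 4) * 2 ^ n + M)) (by positivity)).and
      (show ∀ᶠ ε in 𝓝[≠] (0 : ℝ), κ = 1 → |ν ε| ≤ 1 / 1000 from by
        rcases hκ with ⟨-, h⟩ | ⟨h, -⟩
        · exact (habs h _ (by norm_num)).mono fun _ h _ => h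
        · exact Eventually.of_forall fun _ h' => absurd (h.symm.trans h') zero_ne_one)))
  obtain ⟨Q, φ, y, e, g₁, g₂, G, hF, hy, L, hL⟩ := exists_family (ι := Punctured ρ₁)
    (f := fun i => f i) (r := fun i => r i) (κ := κ) (M := M) (ν := fun i => ν i) (ε := fun i => i)
    (δ := fun i => δ i) (n := n) (fun i => hf i (abs_pos.1 i.2.1)) (fun i => hr i) hM (fun i => h0 i)
    (fun i => h1 i) (fun i => h2 i) (fun i => (hs i i.2.1 i.2.2).1)
    (hκ.imp (fun h => ⟨h.1, fun i => (hs i i.2.1 i.2.2).2.2 h.1⟩) fun h => ⟨h.1, fun i => h.2 i⟩)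
    (fun i => (le_div_iff₀ hB).1 (hs i i.2.1 i.2.2).2.1) (fun i => abs_pos.1 i.2.1)
  obtain ⟨η, hη, hW⟩ := hF.exists_solvability_comap (hκ.symm.imp And.left And.left) (by
    have := Real.add_one_le_exp (8 : ℝ)
    linarith)
  have hκν : Tendsto (fun ε => κ * ν ε) (𝓝[≠] 0) (𝓝 0) := by
    rcases hκ with ⟨-, h⟩ | ⟨h, -⟩
    · simpa using h.const_mul κ
    · simp [h]
  obtain ⟨ρ₂, hρ₂, hs'⟩ := eventually_punctured_iff.1
    ((habs hid (η / 2) (by positivity)).and (habs hκν (η / 2) (by positivity)))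
  -- Inclusion of the smaller punctured interval into the one on which the family was constructed.
  set s : Punctured (min ρ₁ ρ₂) → Punctured ρ₁ := fun i =>
    ⟨i, i.2.1, i.2.2.trans_le (min_le_left _ _)⟩
  obtain ⟨W, W', hW⟩ := hW s fun i => by
    have := hs' i i.2.1 (i.2.2.trans_le (min_le_right _ _))
    simp only [s]
    linarith [this.1, this.2]
  exact ⟨min ρ₁ ρ₂, lt_min hρ₁ hρ₂, _, _, _, _, _, _, _, W, W', _, _, L, hF.comap s, hW,
    fun z => hy (s z.1, z.2), fun z => hL (s z.1, z.2)⟩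

end GKdV

/-! ### Assembly of the expansion and nonvanishing -/

namespace GKdV

theorem exists_remainder_bound {n : ℕ} {N : ℕ∞} (hN : ((n + 4 + 1 : ℕ) : ℕ∞) ≤ N) {r : ℝ → ℝ → ℝ}
    (hr : ∀ ε, ContDiff ℝ N (r ε))
    (h0 : ∀ ε, Tendsto (fun s : ℝ => r ε s / |s| ^ (n + 4)) (𝓝[≠] 0) (𝓝 0))
    (hu : ∀ R : ℝ, ∃ M : ℝ, ∀ ε s : ℝ, |s| ≤ R → |iteratedDeriv (n + 4 + 1) (r ε) s| ≤ M) :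
    ∃ M : ℝ, 0 ≤ M ∧ ∀ ε, ∀ q ∈ Set.Icc (0 : ℝ) 2, |r ε q| ≤ M * q ^ 5 ∧ |deriv (r ε) q| ≤ M * q ^ 4 ∧
      |iteratedDeriv 2 (r ε) q| ≤ M * q ^ 3 := by
  obtain ⟨M, hM⟩ := hu 2
  have hM0 : 0 ≤ M := (abs_nonneg _).trans (hM 0 0 (by simp))
  -- The Taylor bounds are M q^(n+k) with k = 5, 4, 3; on [0, 2] the excess power q^n is at most
  -- 2^n.
  refine ⟨M * 2 ^ n, by positivity, fun ε q hq => ?_⟩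
  have hs : |q| ≤ 2 := by rw [abs_of_nonneg hq.1]; exact hq.2
  have hc : ContDiff ℝ (n + 4 + 1 : ℕ) (r ε) := (hr ε).of_le (WithTop.coe_le_coe.2 hN)
  have key := abs_iteratedDeriv_le hc (iteratedDeriv_eq_zero_of_tendsto
    (hc.of_le (by exact_mod_cast Nat.le_succ _)) (h0 ε)) (hM ε)
  have hpow : ∀ k : ℕ, M * |q| ^ (n + k) ≤ M * 2 ^ n * q ^ k := fun k => by
    rw [abs_of_nonneg hq.1, pow_add, mul_assoc]
    gcongr
    · exact pow_nonneg hq.1 k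
    · exact hq.1
    · exact hq.2
  refine ⟨?_, ?_, ?_⟩
  · simpa using (key (n + 5) (by omega) q hs).trans (hpow 5)
  · have := (key (n + 4) (by omega) q hs).trans (hpow 4)
    rwa [show n + 4 + 1 - (n + 4) = 1 by omega, iteratedDeriv_one] at this
  · have := (key (n + 3) (by omega) q hs).trans (hpow 3)
    rwa [show n + 4 + 1 - (n + 3) = 2 by omega] at this

/-- The factor of the remainder of the nonlinearity relative to `ε`. -/
noncomputable def relSize (s ε : ℝ) : ℝ := ε / |ε| * |ε| ^ s

theorem mul_relSize {s ε : ℝ} (hε : ε ≠ 0) : ε * relSize s ε = |ε| ^ (1 + s) := by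
  have h := abs_pos.2 hε
  rw [relSize, Real.rpow_add h, Real.rpow_one]
  field_simp
  rw [sq_abs]

theorem tendsto_abs_rpow {s : ℝ} (hs : 0 < s) : Tendsto (fun ε : ℝ => |ε| ^ s) (𝓝[≠] 0) (𝓝 0) := by
  have h : Tendsto (fun ε : ℝ => |ε| ^ s) (𝓝 0) (𝓝 (|0| ^ s)) :=
    ((Real.continuousAt_rpow_const _ _ (Or.inr hs.le)).tendsto).comp (continuous_abs.tendsto 0)
  rw [abs_zero, Real.zero_rpow hs.ne'] at h
  exact h.mono_left nhdsWithin_le_nhds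

theorem tendsto_relSize {s : ℝ} (hs : 0 < s) : Tendsto (relSize s) (𝓝[≠] 0) (𝓝 0) := by
  refine squeeze_zero_norm (fun ε => ?_) (tendsto_abs_rpow hs)
  rw [relSize, norm_mul, norm_div, Real.norm_eq_abs, Real.norm_eq_abs, abs_abs, Real.norm_eq_abs,
    abs_of_nonneg (Real.rpow_nonneg (abs_nonneg ε) s)]
  exact mul_le_of_le_one_left (Real.rpow_nonneg (abs_nonneg ε) s) (div_self_le_one _)

theorem tendsto_sum_abs {u v : ℝ → ℝ} (K L : ℝ) (hu : Tendsto u (𝓝[≠] 0) (𝓝 0))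
    (hv : Tendsto v (𝓝[≠] 0) (𝓝 0)) :
    Tendsto (fun ε : ℝ => K * (|ε| + |u ε| + |v ε|) + L * (|ε| + |u ε|)) (𝓝[≠] 0) (𝓝 0) := by
  have hid : Tendsto (fun ε : ℝ => ε) (𝓝[≠] 0) (𝓝 0) := tendsto_id.mono_left nhdsWithin_le_nhds
  simpa using (((hid.abs.add hu.abs).add hv.abs).const_mul K).add ((hid.abs.add hu.abs).const_mul L)

theorem abs_sub_le_of_defect {d c I I₀ ε K K' A B : ℝ} (h1 : |d - c * ε * I| ≤ K * (|ε| * A))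
    (h2 : |I - I₀| ≤ K' * B) : |d - c * I₀ * ε| ≤ (K * A + |c| * K' * B) * |ε| := by
  have e : d - c * I₀ * ε = (d - c * ε * I) + c * ε * (I - I₀) := by ring
  rw [e]
  refine (abs_add_le _ _).trans ?_
  rw [abs_mul, abs_mul]
  have := mul_le_mul_of_nonneg_left h2 (mul_nonneg (abs_nonneg c) (abs_nonneg ε))
  linarith

theorem Profile.exists_firstSol_of_solvable {f Q φ : ℝ → ℝ} {C : ℝ} {N : ℕ∞} (h : Profile f Q φ C)
    (hf : ContDiff ℝ N f) (hN : 3 ≤ N) (hW : Solvable N f Q φ) :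
    ∃ (A A' J B B' : ℝ → ℝ) (a b : ℝ), FirstSol N f Q φ A A' J B B' a b := by
  obtain ⟨V, V', h1, h2, h3, h4, h5, h6⟩ := hW
  exact h.exists_firstSol hf hN h1 h2 h3 h4 h5 h6

theorem exists_quadratic_defect {n : ℕ} {N : ℕ∞} (hN : ((n + 4 + 1 : ℕ) : ℕ∞) ≤ N) (μ : ℝ)
    {f₁ : ℝ → ℝ → ℝ} (hf₁ : ∀ ε, ContDiff ℝ N (f₁ ε))
    (h0 : ∀ ε, Tendsto (fun s : ℝ => f₁ ε s / |s| ^ (n + 4)) (𝓝[≠] 0) (𝓝 0))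
    (hu : ∀ R : ℝ, ∃ M : ℝ, ∀ ε s : ℝ, |s| ≤ R → |iteratedDeriv (n + 4 + 1) (f₁ ε) s| ≤ M) :
    ∃ ρ : ℝ, 0 < ρ ∧ ∃ ω : ℝ → ℝ, Tendsto ω (𝓝[≠] 0) (𝓝 0) ∧ ∀ ε, 0 < |ε| → |ε| < ρ →
      ∃ (Q A₁ B₁ A₂ B₂ : ℝ → ℝ) (a₁ b₁ a₂ b₂ : ℝ),
        (IsSoliton (nonlin2 (n + 4) μ f₁ ε) Q ∧
          IsFirstOrder N (nonlin2 (n + 4) μ f₁ ε) Q A₁ B₁ a₁ b₁ ∧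
          SolvesOmega (nonlin2 (n + 4) μ f₁ ε) Q (sourceF2 (nonlin2 (n + 4) μ f₁ ε) Q A₁ B₁ a₁)
            (sourceG2 (nonlin2 (n + 4) μ f₁ ε) Q A₁ B₁ a₁) A₂ B₂ a₂ ∧
          HasLimitForm N Q A₂ B₂ (-(1 / 2) * b₁ ^ 2) b₂ ∧ HasIP N A₂ B₂) ∧
        |b₂ + 1 / 6 * b₁ ^ 3 - c2 (n + 4) * ε| ≤ ω ε * |ε| := by
  obtain ⟨M, hM, hb⟩ := exists_remainder_bound hN hf₁ h0 hu
  have hN3 : (3 : ℕ∞) ≤ N := le_trans (by exact_mod_cast (by omega : 3 ≤ n + 4 + 1)) hN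
  have hN1 : (1 : ℕ∞) ≤ N := le_trans (by norm_num) hN3
  have hr : ∀ ε, ContDiff ℝ 3 (f₁ ε) := fun ε => (hf₁ ε).of_le (WithTop.coe_le_coe.2 hN3)
  set s : ℝ := 1 / (((n + 4 : ℕ) : ℝ) - 2) with hs
  have hs0 : 0 < s := by
    have : (0 : ℝ) ≤ n := n.cast_nonneg
    rw [hs]; push_cast; exact one_div_pos.2 (by linarith)
  set ν : ℝ → ℝ := fun ε => μ * |ε| ^ s with hν
  have tν : Tendsto ν (𝓝[≠] 0) (𝓝 0) := by simpa using (tendsto_abs_rpow hs0).const_mul μ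
  have hf : ∀ ε, ε ≠ 0 → ∀ u, nonlin2 (n + 4) μ f₁ ε u = 1 * u ^ 2 + ν ε * u ^ 3
      + ε * (u ^ (n + 4) + relSize s ε * f₁ ε u) := fun ε hε u => by
    rw [nonlin2, ← hs, ← mul_relSize hε]; ring
  have hfN : ∀ ε, ContDiff ℝ N (nonlin2 (n + 4) μ f₁ ε) := fun ε => by
    have := hf₁ ε
    unfold nonlin2
    fun_prop
  obtain ⟨ρ, hρ, Q, φ, y, e, g₁, g₂, G, W, W', C, c, L, hF, hW, hy, hL⟩ := exists_solvable_family hf hr hM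
    (fun ε q hq => (hb ε q hq).1) (fun ε q hq => (hb ε q hq).2.1) (fun ε q hq => (hb ε q hq).2.2)
    (tendsto_relSize hs0) (Or.inl ⟨rfl, tν⟩)
  have hsolv := hW.solvable hF.profile fun i => hfN i
  choose A A' J B B' a b S using fun i =>
    (hF.profile i).exists_firstSol_of_solvable (hfN i) hN3 (hsolv i)
  choose A₂ B₂ a₂ b₂ h1 h2 h3 h4 using fun i =>
    (hF.profile i).exists_second2 (hfN i) hN3 (hsolv i) (S i) (by
      -- The bound M q³ at q = 0 shows that the remainder does not contribute to f''(0), which is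
      -- therefore 2.
      have h := (hb i 0 (by simp)).2.2
      rw [zero_pow (by norm_num), mul_zero] at h
      rw [iteratedDeriv_two_of_perturbation (hf i (abs_pos.1 i.2.1)) (hr i),
        abs_eq_zero.1 (le_antisymm h (abs_nonneg _))]
      simp)
  obtain ⟨K, hK⟩ := hF.abs_quadratic_defect_le hW hN1 (fun i => hfN i) (A := fun z => A z.1 z.2)
    (A' := fun z => A' z.1 z.2) (J := fun z => J z.1 z.2) (B := fun z => B z.1 z.2)
    (B' := fun z => B' z.1 z.2) S h4
  obtain ⟨K', hK'⟩ := hF.exists_moment_quadratic (n + 3)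
  refine ⟨ρ, hρ, _, tendsto_sum_abs K (|coeff2 (n + 4)| * K') tν (tendsto_relSize hs0), fun ε hε hερ => ?_⟩
  set i : Punctured ρ := ⟨ε, hε, hερ⟩
  refine ⟨fun x => Q (i, x), A i, B i, A₂ i, B₂ i, a i, b i, a₂ i, b₂ i,
    ⟨(hF.profile i).isSoliton, (S i).isFirstOrder (hF.profile i), h1 i, h2 i, h3 i⟩, ?_⟩
  have hI := hK i
  simp only [hy] at hI
  have hc : c2 (n + 4) = coeff2 (n + 4) * ∫ x, quadSoliton x ^ (n + 3 + 1) := by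
    rw [c2, coeff2]
    push_cast
    rfl
  rw [hc]
  exact abs_sub_le_of_defect hI (hK' i)

theorem exists_cubic_defect {n : ℕ} {N : ℕ∞} (hN : ((n + 4 + 1 : ℕ) : ℕ∞) ≤ N)
    {f₁ : ℝ → ℝ → ℝ} (hf₁ : ∀ ε, ContDiff ℝ N (f₁ ε))
    (h0 : ∀ ε, Tendsto (fun s : ℝ => f₁ ε s / |s| ^ (n + 4)) (𝓝[≠] 0) (𝓝 0))
    (hu : ∀ R : ℝ, ∃ M : ℝ, ∀ ε s : ℝ, |s| ≤ R → |iteratedDeriv (n + 4 + 1) (f₁ ε) s| ≤ M) :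
    ∃ ρ : ℝ, 0 < ρ ∧ ∃ ω : ℝ → ℝ, Tendsto ω (𝓝[≠] 0) (𝓝 0) ∧ ∀ ε, 0 < |ε| → |ε| < ρ →
      ∃ (Q A₁ B₁ A₂ B₂ : ℝ → ℝ) (a₁ b₁ a₂ b₂ : ℝ),
        (IsSoliton (nonlin3 (n + 4) f₁ ε) Q ∧
          IsFirstOrder N (nonlin3 (n + 4) f₁ ε) Q A₁ B₁ a₁ b₁ ∧
          SolvesOmega (nonlin3 (n + 4) f₁ ε) Q (sourceF3 (nonlin3 (n + 4) f₁ ε) Q A₁ a₁)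
            (sourceG3 (nonlin3 (n + 4) f₁ ε) Q A₁ B₁ a₁) A₂ B₂ a₂ ∧
          HasLimitForm N Q A₂ B₂ 0 b₂ ∧ HasIP N A₂ B₂) ∧
        |b₂ - c3 (n + 4) * ε| ≤ ω ε * |ε| := by
  obtain ⟨M, hM, hb⟩ := exists_remainder_bound hN hf₁ h0 hu
  have hN3 : (3 : ℕ∞) ≤ N := le_trans (by exact_mod_cast (by omega : 3 ≤ n + 4 + 1)) hN
  have hN1 : (1 : ℕ∞) ≤ N := le_trans (by norm_num) hN3
  have hr : ∀ ε, ContDiff ℝ 3 (f₁ ε) := fun ε => (hf₁ ε).of_le (WithTop.coe_le_coe.2 hN3)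
  set s : ℝ := 1 / (((n + 4 : ℕ) : ℝ) - 3) with hs
  have hs0 : 0 < s := by
    have : (0 : ℝ) ≤ n := n.cast_nonneg
    rw [hs]; push_cast; exact one_div_pos.2 (by linarith)
  have hf : ∀ ε, ε ≠ 0 → ∀ u, nonlin3 (n + 4) f₁ ε u = 0 * u ^ 2 + (fun _ => 1) ε * u ^ 3
      + ε * (u ^ (n + 4) + relSize s ε * f₁ ε u) := fun ε hε u => by
    rw [nonlin3, ← hs, ← mul_relSize hε]; ring
  have hfN : ∀ ε, ContDiff ℝ N (nonlin3 (n + 4) f₁ ε) := fun ε => by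
    have := hf₁ ε
    unfold nonlin3
    fun_prop
  obtain ⟨ρ, hρ, Q, φ, y, e, g₁, g₂, G, W, W', C, c, L, hF, hW, hy, hL⟩ := exists_solvable_family hf hr hM
    (fun ε q hq => (hb ε q hq).1) (fun ε q hq => (hb ε q hq).2.1) (fun ε q hq => (hb ε q hq).2.2)
    (tendsto_relSize hs0) (Or.inr ⟨rfl, fun _ => rfl⟩)
  have hsolv := hW.solvable hF.profile fun i => hfN i
  choose A A' J B B' a b S using fun i =>
    (hF.profile i).exists_firstSol_of_solvable (hfN i) hN3 (hsolv i)
  choose A₂ B₂ a₂ b₂ h1 h2 h3 h4 using fun i =>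
    (hF.profile i).exists_second3 (hfN i) hN3 (hsolv i) (S i) (by
      -- As above: the remainder and the cubic term leave f''(0) = 0.
      have h := (hb i 0 (by simp)).2.2
      rw [zero_pow (by norm_num), mul_zero] at h
      rw [iteratedDeriv_two_of_perturbation (hf i (abs_pos.1 i.2.1)) (hr i),
        abs_eq_zero.1 (le_antisymm h (abs_nonneg _))]
      simp)
  obtain ⟨K, hK⟩ := hF.abs_cubic_defect_le hW hN1 (A := fun z => A z.1 z.2)
    (A' := fun z => A' z.1 z.2) (J := fun z => J z.1 z.2) (B := fun z => B z.1 z.2)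
    (B' := fun z => B' z.1 z.2) S h4
  obtain ⟨K', hK'⟩ := hF.exists_moment_cubic (fun z => (hL z).1) (fun z => (hL z).2.1)
    (fun z => (hL z).2.2) (n + 3)
  refine ⟨ρ, hρ, _, tendsto_sum_abs (u := fun _ => 0) K (|coeff3 (n + 4)| * K') tendsto_const_nhds
    (tendsto_relSize hs0), fun ε hε hερ => ?_⟩
  set i : Punctured ρ := ⟨ε, hε, hερ⟩
  refine ⟨fun x => Q (i, x), A i, B i, A₂ i, B₂ i, a i, b i, a₂ i, b₂ i,
    ⟨(hF.profile i).isSoliton, (S i).isFirstOrder (hF.profile i), h1 i, h2 i, h3 i⟩, ?_⟩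
  have hI := hK i
  simp only [hy] at hI
  have hc : c3 (n + 4) = coeff3 (n + 4) * ∫ x, cubicSoliton x ^ (n + 3 + 1) := by
    rw [c3, coeff3]
    push_cast
    rfl
  rw [hc]
  simpa using abs_sub_le_of_defect hI (hK' i)

theorem Dec.integral_pow_pos {Q : ℝ → ℝ} (dQ : Dec Q) (hQ : ∀ x, 0 < Q x) (k : ℕ) :
    0 < ∫ x, Q x ^ (k + 1) :=
  integral_pos_of_integrable_nonneg_nonzero (x := 0) (dQ.pow_succ k).continuous (dQ.pow_succ k).integrable
    (fun x => (pow_pos (hQ x) _).le) (pow_pos (hQ 0) _).ne'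

theorem c2_ne_zero (n : ℕ) : c2 (n + 4) ≠ 0 := by
  have hn : (0 : ℝ) ≤ n := n.cast_nonneg
  refine mul_ne_zero (neg_ne_zero.2 (div_pos ?_ ?_).ne')
    (dec_quadSoliton.integral_pow_pos quadSoliton_pos (n + 3)).ne' <;> push_cast
  -- Written in n = p - 4, all coefficients of the polynomial are positive.
  · have h : 24 - 23 * ((n : ℝ) + 4) + 3 * ((n : ℝ) + 4) ^ 2 + 2 * ((n : ℝ) + 4) ^ 3
        = 2 * (n : ℝ) ^ 3 + 27 * n ^ 2 + 97 * n + 108 := by ring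
    rw [h]
    exact mul_pos (mul_pos (by linarith) (by linarith)) (by positivity)
  · exact mul_pos (mul_pos (by norm_num) (by nlinarith)) (by linarith)

theorem c3_ne_zero (n : ℕ) : c3 (n + 4) ≠ 0 := by
  have hn : (0 : ℝ) ≤ n := n.cast_nonneg
  refine mul_ne_zero (neg_ne_zero.2 (div_pos ?_ ?_).ne')
    (dec_cubicSoliton.integral_pow_pos cubicSoliton_pos (n + 3)).ne' <;> push_cast
  · exact mul_pos (mul_pos (by linarith) (by linarith)) (by nlinarith)
  · exact mul_pos (mul_pos (by norm_num) (by linarith)) (by linarith)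

/-- Where ω < |c| the error cannot compensate the linear term cε, so d does not vanish; ω → 0 gives
the expansion. -/
theorem defect_of_bound {c ρ : ℝ} {d ω : ℝ → ℝ} (hc : c ≠ 0) (hρ : 0 < ρ)
    (hω : Tendsto ω (𝓝[≠] 0) (𝓝 0))
    (hd : ∀ ε, 0 < |ε| → |ε| < ρ → |d ε - c * ε| ≤ ω ε * |ε|) :
    (∃ ρ' : ℝ, 0 < ρ' ∧ ρ' ≤ ρ ∧ ∀ ε, 0 < |ε| → |ε| < ρ' → d ε ≠ 0) ∧
      (fun ε => d ε - c * ε) =o[𝓝[≠] 0] fun ε => ε := by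
  have hd' := eventually_punctured_iff.2 ⟨ρ, hρ, hd⟩
  refine ⟨?_, isLittleO_iff.2 fun η hη => ?_⟩
  · obtain ⟨ρ₁, h1, h2⟩ := eventually_punctured_iff.1 (hω.eventually_lt_const (abs_pos.2 hc))
    refine ⟨min ρ ρ₁, lt_min hρ h1, min_le_left _ _, fun ε hε hε' h0 => ?_⟩
    have h3 := hd ε hε (hε'.trans_le (min_le_left _ _))
    have h4 := h2 ε hε (hε'.trans_le (min_le_right _ _))
    rw [h0, zero_sub, abs_neg, abs_mul] at h3
    exact absurd (le_of_mul_le_mul_right h3 hε) (not_le.2 h4)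
  · filter_upwards [hd', hω.eventually_le_const hη] with ε h1 h2
    exact h1.trans (mul_le_mul_of_nonneg_right h2 (abs_nonneg ε))

end GKdV

theorem mainTheorem3 (p : ℕ) (hp : 4 ≤ p) (N : ℕ∞) (hN : ((p + 1 : ℕ) : ℕ∞) ≤ N)
    (μ : ℝ) (f₁ : ℝ → ℝ → ℝ)
    (hf₁ : ∀ ε, ContDiff ℝ N (f₁ ε))
    (hf₁_zero : ∀ ε, Tendsto (fun s : ℝ => f₁ ε s / |s| ^ p) (𝓝[≠] 0) (𝓝 0))
    (hf₁_unif : ∀ R : ℝ, ∃ M : ℝ, ∀ ε s : ℝ, |s| ≤ R →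
      |iteratedDeriv (p + 1) (f₁ ε) s| ≤ M) :
    -- the case `m = 2`
    ((∃ ε₀ : ℝ, 0 < ε₀ ∧ ∃ (Q A₁ B₁ A₂ B₂ : ℝ → ℝ → ℝ) (a₁ b₁ a₂ b₂ d : ℝ → ℝ),
        (∀ ε : ℝ, 0 < |ε| → |ε| < ε₀ →
          GKdV.IsSoliton (GKdV.nonlin2 p μ f₁ ε) (Q ε) ∧
          GKdV.IsFirstOrder N (GKdV.nonlin2 p μ f₁ ε) (Q ε) (A₁ ε) (B₁ ε) (a₁ ε) (b₁ ε) ∧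
          GKdV.SolvesOmega (GKdV.nonlin2 p μ f₁ ε) (Q ε)
            (GKdV.sourceF2 (GKdV.nonlin2 p μ f₁ ε) (Q ε) (A₁ ε) (B₁ ε) (a₁ ε))
            (GKdV.sourceG2 (GKdV.nonlin2 p μ f₁ ε) (Q ε) (A₁ ε) (B₁ ε) (a₁ ε))
            (A₂ ε) (B₂ ε) (a₂ ε) ∧
          GKdV.HasLimitForm N (Q ε) (A₂ ε) (B₂ ε) (-(1 / 2) * b₁ ε ^ 2) (b₂ ε) ∧
          GKdV.HasIP N (A₂ ε) (B₂ ε) ∧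
          d ε = b₂ ε + 1 / 6 * b₁ ε ^ 3 ∧ d ε ≠ 0) ∧
        (fun ε => d ε - GKdV.c2 p * ε) =o[𝓝[≠] 0] (fun ε => ε)) ∧
      GKdV.c2 p ≠ 0) ∧
    -- the case `m = 3`
    ((∃ ε₀ : ℝ, 0 < ε₀ ∧ ∃ (Q A₁ B₁ A₂ B₂ : ℝ → ℝ → ℝ) (a₁ b₁ a₂ b₂ d : ℝ → ℝ),
        (∀ ε : ℝ, 0 < |ε| → |ε| < ε₀ →
          GKdV.IsSoliton (GKdV.nonlin3 p f₁ ε) (Q ε) ∧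
          GKdV.IsFirstOrder N (GKdV.nonlin3 p f₁ ε) (Q ε) (A₁ ε) (B₁ ε) (a₁ ε) (b₁ ε) ∧
          GKdV.SolvesOmega (GKdV.nonlin3 p f₁ ε) (Q ε)
            (GKdV.sourceF3 (GKdV.nonlin3 p f₁ ε) (Q ε) (A₁ ε) (a₁ ε))
            (GKdV.sourceG3 (GKdV.nonlin3 p f₁ ε) (Q ε) (A₁ ε) (B₁ ε) (a₁ ε))
            (A₂ ε) (B₂ ε) (a₂ ε) ∧
          GKdV.HasLimitForm N (Q ε) (A₂ ε) (B₂ ε) 0 (b₂ ε) ∧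
          GKdV.HasIP N (A₂ ε) (B₂ ε) ∧
          d ε = b₂ ε ∧ d ε ≠ 0) ∧
        (fun ε => d ε - GKdV.c3 p * ε) =o[𝓝[≠] 0] (fun ε => ε)) ∧
      GKdV.c3 p ≠ 0) := by
  obtain ⟨n, rfl⟩ : ∃ n, p = n + 4 := ⟨p - 4, by omega⟩
  refine ⟨⟨?_, GKdV.c2_ne_zero n⟩, ?_, GKdV.c3_ne_zero n⟩
  · obtain ⟨ρ, hρ, ω, hω, h⟩ := GKdV.exists_quadratic_defect hN μ hf₁ hf₁_zero hf₁_unif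
    -- Outside the punctured interval all objects are set to 0, so that choice gives functions of
    -- every real ε.
    have h' : ∀ ε : ℝ, ∃ (Q A₁ B₁ A₂ B₂ : ℝ → ℝ) (a₁ b₁ a₂ b₂ : ℝ), 0 < |ε| → |ε| < ρ → _ := fun ε => by
      by_cases hε : 0 < |ε| ∧ |ε| < ρ
      · obtain ⟨Q, A₁, B₁, A₂, B₂, a₁, b₁, a₂, b₂, h⟩ := h ε hε.1 hε.2
        exact ⟨Q, A₁, B₁, A₂, B₂, a₁, b₁, a₂, b₂, fun _ _ => h⟩
      · exact ⟨0, 0, 0, 0, 0, 0, 0, 0, 0, fun h1 h2 => absurd ⟨h1, h2⟩ hε⟩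
    choose Q A₁ B₁ A₂ B₂ a₁ b₁ a₂ b₂ h using h'
    obtain ⟨⟨ρ', h1, h2, h3⟩, h4⟩ := GKdV.defect_of_bound (GKdV.c2_ne_zero n) hρ hω
      fun ε hε hε' => (h ε hε hε').2
    refine ⟨ρ', h1, Q, A₁, B₁, A₂, B₂, a₁, b₁, a₂, b₂, fun ε => b₂ ε + 1 / 6 * b₁ ε ^ 3,
      fun ε hε hε' => ?_, h4⟩
    obtain ⟨⟨k1, k2, k3, k4, k5⟩, -⟩ := h ε hε (hε'.trans_le h2)
    exact ⟨k1, k2, k3, k4, k5, rfl, h3 ε hε hε'⟩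
  · obtain ⟨ρ, hρ, ω, hω, h⟩ := GKdV.exists_cubic_defect hN hf₁ hf₁_zero hf₁_unif
    have h' : ∀ ε : ℝ, ∃ (Q A₁ B₁ A₂ B₂ : ℝ → ℝ) (a₁ b₁ a₂ b₂ : ℝ), 0 < |ε| → |ε| < ρ → _ := fun ε => by
      by_cases hε : 0 < |ε| ∧ |ε| < ρ
      · obtain ⟨Q, A₁, B₁, A₂, B₂, a₁, b₁, a₂, b₂, h⟩ := h ε hε.1 hε.2
        exact ⟨Q, A₁, B₁, A₂, B₂, a₁, b₁, a₂, b₂, fun _ _ => h⟩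
      · exact ⟨0, 0, 0, 0, 0, 0, 0, 0, 0, fun h1 h2 => absurd ⟨h1, h2⟩ hε⟩
    choose Q A₁ B₁ A₂ B₂ a₁ b₁ a₂ b₂ h using h'
    obtain ⟨⟨ρ', h1, h2, h3⟩, h4⟩ := GKdV.defect_of_bound (GKdV.c3_ne_zero n) hρ hω
      fun ε hε hε' => (h ε hε hε').2
    refine ⟨ρ', h1, Q, A₁, B₁, A₂, B₂, a₁, b₁, a₂, b₂, b₂, fun ε hε hε' => ?_, h4⟩
    obtain ⟨⟨k1, k2, k3, k4, k5⟩, -⟩ := h ε hε (hε'.trans_le h2)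
    exact ⟨k1, k2, k3, k4, k5, rfl, h3 ε hε hε'⟩
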